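/- Let $p$ be a prime, $\Sigma=\operatorname{Spec}\mathbb Z_p$ with the canonical divided powers $\gamma$ on $(p)$. **(A)** For a scheme $U$ let $\mathcal O^{\mathrm{cris}}(U)=\Gamma(\mathrm{CRIS}(U/\Sigma),\mathcal O_{U/\Sigma})$ be the ring of global sections of the crystalline structure sheaf $(V,T,\delta)\mapsto\Gamma(T,\mathcal O_T)$ on the big crystalline site of $U$, whose objects are the PD thickenings $(V,T,\delta)$ compatible with $\gamma$, where $V$ is a $U$-scheme and $p$ is locally nilpotent on $T$. For a scheme $X$ on which $p$ is locally nilpotent let $\mathcal O_X^{\mathrm{cris}}$ be the resulting presheaf of rings on $X$-schemes, and let $\mathcal I_X^{\mathrm{cris}}$ be the kernel of the homomorphism $\mathcal O_X^{\mathrm{cris}}\to\mathcal O_X$ given by the value at $(U,U,0)$. Equip the category of $X$-schemes with the $\mathrm{pr}$-topology, whose coverings are the surjective families of morphisms that Zariski locally have the form $\operatorname{Spec}R'\to\operatorname{Spec}R$ with $R'=\varinjlim(R=B_0\to B_1\to\cdots)$, $B_{n+1}\cong B_n[(T_i)_{i\in I_n}]/(T_i^p-a_i)_{i\in I_n}$.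 There is a unique ring endomorphism $\sigma$ of $\mathcal O_X^{\mathrm{cris}}$ that becomes $\phi_W^*$ on $\mathcal O^{\mathrm{cris}}(W)$ after restriction along any $X$-morphism $W\to U$ with $p\mathcal O_W=0$, where $\phi_W$ is the absolute Frobenius. There is a unique system, functorial in $X$, of $\sigma$-linear maps $$\sigma_1:\mathcal I_X^{\mathrm{cris}}\to\mathcal O_X^{\mathrm{cris}}\quad\text{with}\quad p\sigma_1=\sigma .$$ With it $(\mathcal O_X^{\mathrm{cris}},\mathcal I_X^{\mathrm{cris}},\mathcal O_X,\sigma,\sigma_1)$ is a frame in the topos of $\mathrm{pr}$-sheaves: $\mathcal O_X^{\mathrm{cris}}$ and $\mathcal O_X$ are sheaves of rings $\mathcal A$ with $\mathcal A\cong\varprojlim_r\mathcal A/p^r$, $\mathcal O_X^{\mathrm{cris}}\to\mathcal O_X$ is surjective as a map of sheaves, and $\sigma$ induces the Frobenius on $\mathcal O_X^{\mathrm{cris}}/p$. If $p\mathcal O_X=0$, then $\sigma_1(p)=1$. **(B)** Consider triples $(A\to R,\sigma)$ where $A$ is a $p$-adically complete and separated $\mathbb Z_p$-flat ring, $R=A/I$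 is a quotient in which $p$ is nilpotent, and $\sigma:A\to A$ is a ring homomorphism with $\sigma(a)\equiv a^p\bmod p$. Let $D$ be the $p$-adic completion of the PD envelope of $A\to R$ relative to $(\mathbb Z_p,(p),\gamma)$, let $\bar I=\ker(D\to R)$, and let $\sigma:D\to D$ be the induced extension of $\sigma$. There is a unique system, functorial in $(A\to R,\sigma)$, of $\sigma$-linear maps $\sigma_1:\bar I\to D$ with $p\sigma_1=\sigma$. With it $(D,\bar I,R,\sigma,\sigma_1)$ is a frame, functorially in $(A\to R,\sigma)$: $D$ and $R=D/\bar I$ are $p$-adically complete and separated and $\sigma$ induces the Frobenius on $D/p$. -/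

import Mathlib

open CategoryTheory AlgebraicGeometry Opposite

universe u v w

namespace DivDieud

section Crystalline

/-- The Frobenius endomorphism of a commutative ring in which `p = 0` (possibly the zero ring). -/
def frobHom (p : ℕ) [hp : Fact p.Prime] (B : Type u) [CommRing B] (h : (p : B) = 0) : B →+* B where
  toFun x := x ^ p
  map_one' := one_pow p
  map_mul' x y := mul_pow x y p
  map_zero' := zero_pow hp.out.ne_zero
  map_add' x y := by
    obtain ⟨r, hr⟩ := exists_add_pow_prime_eq hp.out x y
    rw [hr, h, zero_mul, zero_mul, zero_mul, add_zero]

theorem natCast_section_eq_zero {X : Scheme.{u}} {p : ℕ} (h : (p : Γ(X, ⊤)) = 0) (U : X.Opens) :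
    (p : Γ(X, U)) = 0 := by
  have := congrArg (X.presheaf.map (homOfLE (le_top : U ≤ ⊤)).op).hom h
  simpa using this

/-- The absolute Frobenius morphism. -/
noncomputable def absFrob (p : ℕ) [Fact p.Prime] (X : Scheme.{u}) (h : (p : Γ(X, ⊤)) = 0) :
    X ⟶ X where
  base := 𝟙 _
  c := { app := fun U => CommRingCat.ofHom (frobHom p Γ(X, U.unop) (natCast_section_eq_zero h _))
         naturality := by
          intro U V f
          ext x
          exact (map_pow (X.presheaf.map f).hom x p).symm }
  prop x := by
    refine ⟨fun a ha => ?_⟩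
    obtain ⟨U, hxU, s, rfl⟩ := X.presheaf.exists_germ_eq a
    rw [PresheafedSpace.stalkMap_germ_apply] at ha
    have key : (X.presheaf.germ U x hxU).hom (s ^ p) = ((X.presheaf.germ U x hxU).hom s) ^ p :=
      map_pow _ _ _
    have ha' : IsUnit (((X.presheaf.germ U x hxU).hom s) ^ p) := key ▸ ha
    exact (isUnit_pow_iff (Fact.out : p.Prime).ne_zero).1 ha'



/-- `p` is locally nilpotent on `X`. -/
def PLocNilp (p : ℕ) (X : Scheme.{u}) : Prop :=
  ∀ x : X, ∃ U : X.Opens, x ∈ U ∧ IsNilpotent (p : Γ(X, U))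

theorem PLocNilp.of_hom {p : ℕ} {X Y : Scheme.{u}} (f : X ⟶ Y) (h : PLocNilp p Y) :
    PLocNilp p X := by
  intro x
  obtain ⟨U, hU, n, hn⟩ := h (f x)
  refine ⟨f ⁻¹ᵁ U, hU, n, ?_⟩
  have := congrArg (f.app U).hom hn
  simpa using this

/-- A divided power thickening `(V, T, δ)`, compatible with `(Spec ℤ_p, (p), γ)`: a closed immersion
`i : V ⟶ T` into a scheme on which `p` is locally nilpotent, with divided powers on its sheaf of
ideals, given on affine opens and compatible with restriction. The last condition says that `δ`
agrees with `γ_n(p a) = (p ^ n / n!) a ^ n` on `I ∩ p 𝒪_T`; writing `n! = p ^ v * m` with `m` prime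
to `p`, it is multiplied by the integer `m`, which is invertible on `T`. -/
structure PDThickening (p : ℕ) where
  V : Scheme.{u}
  T : Scheme.{u}
  i : V ⟶ T
  isClosedImmersion : IsClosedImmersion i
  pLocNilp : PLocNilp p T
  δ : ∀ W : T.affineOpens, DividedPowers (RingHom.ker (i.app W).hom)
  δ_restrict : ∀ (W W' : T.affineOpens) (h : (W' : T.Opens) ≤ W),
    (δ W).IsDPMorphism (δ W') (T.presheaf.map (homOfLE h).op).hom
  δ_compat : ∀ (W : T.affineOpens) (n : ℕ) (a : Γ(T, W)),
    (p : Γ(T, W)) * a ∈ RingHom.ker (i.app W).hom →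
      ((n.factorial / p ^ padicValNat p n.factorial : ℕ) : Γ(T, W)) * (δ W).dpow n (p * a) =
        (p : Γ(T, W)) ^ (n - padicValNat p n.factorial) * a ^ n

/-- An object of the big crystalline site `CRIS(U/Σ)`, where `Σ = Spec ℤ_p`. -/
structure CrisObj (p : ℕ) (U : Scheme.{u}) extends PDThickening.{u} p where
  str : V ⟶ U

/-- A morphism of the big crystalline site `CRIS(U/Σ)`. -/
structure CrisHom {p : ℕ} {U : Scheme.{u}} (c' c : CrisObj p U) where
  gV : c'.V ⟶ c.V
  gT : c'.T ⟶ c.T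
  comm : c'.i ≫ gT = gV ≫ c.i
  comm_str : gV ≫ c.str = c'.str
  isDP : ∀ (W : c.T.affineOpens) (W' : c'.T.affineOpens) (h : (W' : c'.T.Opens) ≤ gT ⁻¹ᵁ W),
    (c.δ W).IsDPMorphism (c'.δ W') (gT.appLE W W' h).hom

/-- The ring `𝒪^cris(U) = Γ(CRIS(U/Σ), 𝒪_{U/Σ})` of global sections of the crystalline structure
sheaf `(V, T, δ) ↦ Γ(T, 𝒪_T)`. -/
def ocris (p : ℕ) (U : Scheme.{u}) : Subring (∀ c : CrisObj p U, Γ(c.T, ⊤)) where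
  carrier := {s | ∀ (c' c : CrisObj p U) (g : CrisHom c' c), g.gT.appTop.hom (s c) = s c'}
  mul_mem' ha hb c' c g := by simp only [Pi.mul_apply, map_mul, ha c' c g, hb c' c g]
  one_mem' _ _ g := by simp only [Pi.one_apply, map_one]
  add_mem' ha hb c' c g := by simp only [Pi.add_apply, map_add, ha c' c g, hb c' c g]
  zero_mem' _ _ g := by simp only [Pi.zero_apply, map_zero]
  neg_mem' ha c' c g := by simp only [Pi.neg_apply, map_neg, ha c' c g]

/-- An object over `U'` seen as an object over `U`. -/
def CrisObj.comp {p : ℕ} {U' U : Scheme.{u}} (c : CrisObj p U') (f : U' ⟶ U) : CrisObj p U where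
  toPDThickening := c.toPDThickening
  str := c.str ≫ f

def CrisHom.comp {p : ℕ} {U' U : Scheme.{u}} {c' c : CrisObj p U'} (g : CrisHom c' c)
    (f : U' ⟶ U) : CrisHom (c'.comp f) (c.comp f) where
  gV := g.gV
  gT := g.gT
  comm := g.comm
  comm_str := (Category.assoc _ _ _).symm.trans (congrArg (· ≫ f) g.comm_str)
  isDP := g.isDP

/-- The restriction `f^* : 𝒪^cris(U) → 𝒪^cris(U')` along `f : U' ⟶ U`. -/
def ocrisMap (p : ℕ) {U' U : Scheme.{u}} (f : U' ⟶ U) : ocris p U →+* ocris p U' where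
  toFun s := ⟨fun c => s.1 (c.comp f), fun _ _ g => s.2 _ _ (g.comp f)⟩
  map_one' := rfl
  map_mul' _ _ := rfl
  map_zero' := rfl
  map_add' _ _ := rfl

theorem ocris_congr {p : ℕ} {U : Scheme.{u}} (s : ocris p U) (t : PDThickening.{u} p)
    {f g : t.V ⟶ U} (h : f = g) : s.1 ⟨t, f⟩ = s.1 ⟨t, g⟩ := by
  subst h; rfl

/-- The presheaf of rings `𝒪_X^cris` on the category of `X`-schemes. -/
def ocrisSheaf (p : ℕ) (X : Scheme.{u}) : (Over X)ᵒᵖ ⥤ CommRingCat.{u + 1} where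
  obj U := CommRingCat.of (ocris p U.unop.left)
  map f := CommRingCat.ofHom (ocrisMap p f.unop.left)
  map_id U := by
    ext s c
    exact ocris_congr s c.toPDThickening (Category.comp_id c.str)
  map_comp f g := by
    ext s c
    exact ocris_congr s c.toPDThickening (Category.assoc c.str g.unop.left f.unop.left).symm

/-- The divided powers on an ideal that is zero. -/
noncomputable def dpOfEqBot {A : Type u} [CommRing A] {I : Ideal A} (h : I = ⊥) :
    DividedPowers I := h ▸ dividedPowersBot A

theorem dpOfEqBot_zero {A : Type u} [CommRing A] {I : Ideal A} (h : I = ⊥) (n : ℕ) :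
    (dpOfEqBot h).dpow n 0 = if n = 0 then 1 else 0 := by
  subst h
  classical
  simp [dpOfEqBot, dividedPowersBot_dpow_eq]

theorem dpOfEqBot_isDP {A B : Type u} [CommRing A] [CommRing B] {I : Ideal A} {J : Ideal B}
    (hI : I = ⊥) (hJ : J = ⊥) (f : A →+* B) :
    (dpOfEqBot hI).IsDPMorphism (dpOfEqBot hJ) f := by
  refine ⟨by rw [hI, Ideal.map_bot]; exact bot_le, fun {n} a ha => ?_⟩
  have ha : a = 0 := by simpa [hI] using ha
  subst ha
  rw [map_zero, dpOfEqBot_zero, dpOfEqBot_zero]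
  split_ifs <;> simp

theorem ker_id_app (U : Scheme.{u}) (W : U.Opens) :
    RingHom.ker (Scheme.Hom.app (𝟙 U) W).hom = ⊥ := by
  rw [← RingHom.injective_iff_ker_eq_bot]
  simp only [Scheme.Hom.id_app]
  exact fun _ _ h => h

/-- The trivial thickening `(U, U, 0)` as an object of `CRIS(U/Σ)`. -/
noncomputable def CrisObj.triv {p : ℕ} [hp : Fact p.Prime] {U : Scheme.{u}} (h : PLocNilp p U) :
    CrisObj p U where
  V := U
  T := U
  i := 𝟙 U
  isClosedImmersion := inferInstance
  pLocNilp := h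
  δ W := dpOfEqBot (ker_id_app U W)
  δ_restrict W W' h := dpOfEqBot_isDP _ _ _
  δ_compat W n a ha := by
    have ha : (p : Γ(U, W)) * a = 0 := by
      rw [ker_id_app] at ha; simpa using ha
    rw [ha, dpOfEqBot_zero]
    split_ifs with hn
    · subst hn; simp
    · have hlt := padicValNat_factorial_lt_of_ne_zero p hn
      obtain ⟨k, hk⟩ := Nat.exists_eq_add_of_lt hlt
      obtain ⟨m, rfl⟩ := Nat.exists_eq_succ_of_ne_zero hn
      rw [show m.succ - padicValNat p m.succ.factorial = k + 1 by omega, pow_succ, pow_succ,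
        mul_zero, show (p : Γ(U, W)) ^ k * p * (a ^ m * a) = p ^ k * a ^ m * (p * a) by ring, ha,
        mul_zero]
  str := 𝟙 U

/-- The homomorphism `𝒪^cris(U) → 𝒪(U)`, given by the value at `(U, U, 0)`. -/
noncomputable def ocrisToO {p : ℕ} [Fact p.Prime] {U : Scheme.{u}} (h : PLocNilp p U) :
    ocris p U →+* Γ(U, ⊤) where
  toFun s := s.1 (CrisObj.triv h)
  map_one' := rfl
  map_mul' _ _ := rfl
  map_zero' := rfl
  map_add' _ _ := rfl

/-- The structure presheaf `𝒪_X` on the category of `X`-schemes (in a larger universe). -/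
def oSheaf (X : Scheme.{u}) : (Over X)ᵒᵖ ⥤ CommRingCat.{u + 1} where
  obj U := CommRingCat.of (ULift.{u + 1} Γ(U.unop.left, ⊤))
  map f := CommRingCat.ofHom
    (ULift.ringEquiv.symm.toRingHom.comp (f.unop.left.appTop.hom.comp ULift.ringEquiv.toRingHom))
  map_id U := by ext; simp
  map_comp f g := by ext; simp; rfl

/-- The homomorphism `𝒪_X^cris → 𝒪_X`. -/
noncomputable def ocrisToOSheaf (p : ℕ) [Fact p.Prime] {X : Scheme.{u}} (hX : PLocNilp p X) :
    ocrisSheaf p X ⟶ oSheaf X where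
  app U := CommRingCat.ofHom
    (ULift.ringEquiv.symm.toRingHom.comp (ocrisToO (hX.of_hom U.unop.hom)))
  naturality U V f := by
    ext s
    refine congrArg ULift.up ?_
    let g : CrisHom ((CrisObj.triv (hX.of_hom V.unop.hom)).comp f.unop.left)
        (CrisObj.triv (hX.of_hom U.unop.hom)) :=
      { gV := f.unop.left
        gT := f.unop.left
        comm := (Category.id_comp _).trans (Category.comp_id _).symm
        comm_str := (Category.comp_id _).trans (Category.id_comp _).symm
        isDP := fun W W' _ =>
          dpOfEqBot_isDP (ker_id_app U.unop.left W.1) (ker_id_app V.unop.left W'.1) _ }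
    exact (s.2 _ _ g).symm


/-- `f : A ⟶ B` is a simultaneous extraction of `p`-th roots: `B ≅ A[(a_i ^ (1/p))_{i ∈ ι}]` as an
`A`-algebra, where `A[(a_i ^ (1/p))] = A[(T_i)] / (T_i ^ p - a_i)`. -/
def rootExtraction (p : ℕ) : MorphismProperty CommRingCat.{u} := fun A B f =>
  ∃ (ι : Type u) (a : ι → A)
    (e : (MvPolynomial ι A ⧸ Ideal.span (Set.range fun i : ι =>
      (MvPolynomial.X i ^ p - MvPolynomial.C (a i) : MvPolynomial ι A))) ≃+* B),
    ∀ r : A, e (Ideal.Quotient.mk _ (MvPolynomial.C r)) = f.hom r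

/-- A `p`-root extension is the colimit of a sequence of simultaneous extractions of `p`-th
roots. -/
def rootExtension (p : ℕ) : MorphismProperty CommRingCat.{u} :=
  (rootExtraction p).transfiniteCompositionsOfShape ℕ

/-- A `pr`-morphism is a morphism that is a `p`-root extension Zariski locally. -/
def prMorphism (p : ℕ) : MorphismProperty Scheme.{u} := fun X' X f =>
  ∀ y : X', ∃ (U' : X'.affineOpens) (U : X.affineOpens) (h : (U' : X'.Opens) ≤ f ⁻¹ᵁ U),
    y ∈ (U' : X'.Opens) ∧ rootExtension p (f.appLE U U' h)

/-- The `pr`-topology on the category of `X`-schemes: coverings are the jointly surjective families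
of `pr`-morphisms. -/
def prTopology (p : ℕ) (X : Scheme.{u}) : GrothendieckTopology (Over X) :=
  (Scheme.grothendieckTopology (prMorphism p)).over X

section SheafFrames

variable {C : Type v} [Category.{u} C]

/-- The presheaf quotient `A / p ^ r`. -/
def pQuot (p r : ℕ) (A : Cᵒᵖ ⥤ CommRingCat.{w}) : Cᵒᵖ ⥤ CommRingCat.{w} where
  obj U := CommRingCat.of (A.obj U ⧸ Ideal.span {(p : A.obj U) ^ r})
  map {U V} f := CommRingCat.ofHom (Ideal.quotientMap _ (A.map f).hom (by
    rw [Ideal.span_singleton_le_iff_mem, Ideal.mem_comap, map_pow, map_natCast]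
    exact Ideal.mem_span_singleton_self _))
  map_id U := by ext x; simp
  map_comp f g := by ext x; simp

/-- The projection `A ⟶ A / p ^ r`. -/
def pQuotMk (p r : ℕ) (A : Cᵒᵖ ⥤ CommRingCat.{w}) : A ⟶ pQuot p r A where
  app U := CommRingCat.ofHom (Ideal.Quotient.mk _)

/-- The projection `A / p ^ (r + 1) ⟶ A / p ^ r`. -/
def pQuotStep (p r : ℕ) (A : Cᵒᵖ ⥤ CommRingCat.{w}) : pQuot p (r + 1) A ⟶ pQuot p r A where
  app U := CommRingCat.ofHom (Ideal.Quotient.factor (by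
    rw [Ideal.span_singleton_le_span_singleton]; exact pow_dvd_pow _ (Nat.le_succ r)))
  naturality U V f := by
    ext x; obtain ⟨x, rfl⟩ := Ideal.Quotient.mk_surjective x; rfl

variable (J : GrothendieckTopology C) [HasWeakSheafify J CommRingCat.{w}]

/-- The homomorphism from `A` to the sheaf quotient `A / p ^ r`. -/
noncomputable def toPQuotSheaf (p r : ℕ) (A : Cᵒᵖ ⥤ CommRingCat.{w}) :
    A ⟶ sheafify J (pQuot p r A) :=
  pQuotMk p r A ≫ toSheafify J (pQuot p r A)

/-- `A` is a `p`-adic sheaf of rings: it is a sheaf and `A → lim_r A / p ^ r` is an isomorphism,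
where `A / p ^ r` is the sheaf quotient. -/
structure IsPAdicSheaf (p : ℕ) (A : Cᵒᵖ ⥤ CommRingCat.{w}) : Prop where
  isSheaf : Presheaf.IsSheaf J A
  separated : ∀ (U : Cᵒᵖ) (a : A.obj U),
    (∀ r, ((toPQuotSheaf J p r A).app U).hom a = 0) → a = 0
  complete : ∀ (U : Cᵒᵖ) (s : ∀ r, (sheafify J (pQuot p r A)).obj U),
    (∀ r, ((sheafifyMap J (pQuotStep p r A)).app U).hom (s (r + 1)) = s r) →
      ∃ a : A.obj U, ∀ r, ((toPQuotSheaf J p r A).app U).hom a = s r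

/-- `(A, I, R, σ, σ₁)` is a frame in the topos of sheaves for `J`, where `I` is the kernel
of `π : A ⟶ R`. -/
structure IsSheafFrame (p : ℕ) {A R : Cᵒᵖ ⥤ CommRingCat.{w}} (π : A ⟶ R) (σ : A ⟶ A)
    (σ₁ : ∀ U : Cᵒᵖ, RingHom.ker (π.app U).hom →ₛₗ[(σ.app U).hom] A.obj U) : Prop where
  pAdic_A : IsPAdicSheaf J p A
  pAdic_R : IsPAdicSheaf J p R
  surjective : Presheaf.IsLocallySurjective J π
  frobenius : ∀ (U : Cᵒᵖ) (a : A.obj U),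
    ((toPQuotSheaf J p 1 A).app U).hom ((σ.app U).hom a) =
      ((toPQuotSheaf J p 1 A).app U).hom a ^ p
  natural : ∀ ⦃U V : Cᵒᵖ⦄ (f : U ⟶ V) (x : RingHom.ker (π.app U).hom)
    (y : RingHom.ker (π.app V).hom), (y : A.obj V) = (A.map f).hom x →
      σ₁ V y = (A.map f).hom (σ₁ U x)
  p_mul : ∀ (U : Cᵒᵖ) (x : RingHom.ker (π.app U).hom), (p : A.obj U) * σ₁ U x = (σ.app U).hom x

end SheafFrames


/-- `σ` is the Frobenius lift of `𝒪_X^cris`: on every `X`-scheme `U` it is compatible, after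
restriction along any morphism `f : W ⟶ U` from a scheme `W` with `p 𝒪_W = 0`, with
`φ_W^* : 𝒪^cris(W) → 𝒪^cris(W)`, where `φ_W` is the absolute Frobenius of `W`. -/
def IsCrisFrobenius (p : ℕ) [Fact p.Prime] (X : Scheme.{u})
    (σ : ocrisSheaf p X ⟶ ocrisSheaf p X) : Prop :=
  ∀ (U : Over X) (W : Scheme.{u}) (hW : (p : Γ(W, ⊤)) = 0) (f : W ⟶ U.left) (s : ocris p U.left),
    ocrisMap p f ((σ.app (op U)).hom s) = ocrisMap p (absFrob p W hW) (ocrisMap p f s)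

/-- A family, for all schemes `X` on which `p` is locally nilpotent and all `X`-schemes `U`, of
`σ`-linear maps `ℐ_X^cris(U) → 𝒪_X^cris(U)`. -/
abbrev SigmaOneFamily (p : ℕ) [Fact p.Prime]
    (σ : ∀ X : Scheme.{u}, PLocNilp p X → (ocrisSheaf p X ⟶ ocrisSheaf p X)) : Type (u + 1) :=
  ∀ (X : Scheme.{u}) (hX : PLocNilp p X) (U : (Over X)ᵒᵖ),
    RingHom.ker ((ocrisToOSheaf p hX).app U).hom →ₛₗ[((σ X hX).app U).hom] (ocrisSheaf p X).obj U

/-- The family `σ₁` consists of maps of sheaves `ℐ_X^cris → 𝒪_X^cris` on `X`-schemes with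
`p σ₁ = σ`, and it is functorial in `X`. -/
structure IsFunctorialSigmaOne (p : ℕ) [Fact p.Prime]
    (σ : ∀ X : Scheme.{u}, PLocNilp p X → (ocrisSheaf p X ⟶ ocrisSheaf p X))
    (σ₁ : SigmaOneFamily p σ) : Prop where
  natural : ∀ (X : Scheme.{u}) (hX : PLocNilp p X) ⦃U V : (Over X)ᵒᵖ⦄ (f : U ⟶ V)
    (x : RingHom.ker ((ocrisToOSheaf p hX).app U).hom)
    (y : RingHom.ker ((ocrisToOSheaf p hX).app V).hom),
      (y : (ocrisSheaf p X).obj V) = ((ocrisSheaf p X).map f).hom x →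
        σ₁ X hX V y = ((ocrisSheaf p X).map f).hom (σ₁ X hX U x)
  p_mul : ∀ (X : Scheme.{u}) (hX : PLocNilp p X) (U : (Over X)ᵒᵖ)
    (x : RingHom.ker ((ocrisToOSheaf p hX).app U).hom),
      (p : (ocrisSheaf p X).obj U) * σ₁ X hX U x = ((σ X hX).app U).hom x
  functorial : ∀ (X' X : Scheme.{u}) (hX' : PLocNilp p X') (hX : PLocNilp p X) (f : X' ⟶ X)
    (U : Over X') (x : RingHom.ker ((ocrisToOSheaf p hX').app (op U)).hom),
      σ₁ X' hX' (op U) x = σ₁ X hX (op ((Over.map f).obj U)) ⟨x.1, x.2⟩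

end Crystalline

theorem exists_mk_eq (p : ℕ) {A : Type v} [CommRing A] {I : Ideal A} (x : ↥(I ⊔ Ideal.span {(p : A)})) :
    ∃ b : A ⧸ I, Ideal.Quotient.mk I x = p * b := by
  obtain ⟨i, hi, c, hc, hx⟩ := Submodule.mem_sup.1 x.2
  obtain ⟨b, rfl⟩ := Ideal.mem_span_singleton.1 hc
  refine ⟨Ideal.Quotient.mk I b, ?_⟩
  rw [← hx, map_add, Ideal.Quotient.eq_zero_iff_mem.2 hi, zero_add, map_mul, map_natCast]

section Envelope

variable (p : ℕ) [Fact p.Prime]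

/-- The element `p ^ n / n!` of `ℤ_p`. -/
noncomputable def gammaP (n : ℕ) : ℤ_[p] := (PadicInt.dividedPowers p).dpow n p

theorem gammaP_coe (n : ℕ) : ((gammaP p n : ℤ_[p]) : ℚ_[p]) = (p : ℚ_[p]) ^ n / n.factorial := by
  rw [gammaP, PadicInt.coe_dpow_eq, dif_pos (Ideal.mem_span_singleton_self _)]
  simp [div_eq_inv_mul]

theorem gammaP_zero : gammaP p 0 = 1 := by
  apply PadicInt.ext; rw [gammaP_coe]; simp

theorem gammaP_one : gammaP p 1 = p := by
  apply PadicInt.ext; rw [gammaP_coe]; simp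

theorem gammaP_dvd {n : ℕ} (hn : n ≠ 0) : (p : ℤ_[p]) ∣ gammaP p n :=
  Ideal.mem_span_singleton.1
    ((PadicInt.dividedPowers p).dpow_mem hn (Ideal.mem_span_singleton_self _))

theorem gammaP_mul (m n : ℕ) :
    gammaP p m * gammaP p n = (m + n).choose m * gammaP p (m + n) :=
  (PadicInt.dividedPowers p).mul_dpow (Ideal.mem_span_singleton_self _)

/-- A triple `(A → R, σ)`: `A` is `p`-adically complete and separated and `ℤ_p`-flat, `R = A / I`
with `p` nilpotent in `R`, and `σ` is a Frobenius lift on `A`. (Ring homomorphisms between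
`p`-adically complete rings are automatically `ℤ_p`-linear.) -/
structure FrobPresentation where
  A : Type v
  [commRing : CommRing A]
  [algebra : Algebra ℤ_[p] A]
  I : Ideal A
  σ : A →ₐ[ℤ_[p]] A
  isAdicComplete : IsAdicComplete (Ideal.span {(p : A)}) A
  flat : Module.Flat ℤ_[p] A
  nilpotent : IsNilpotent (p : A ⧸ I)
  frobenius : ∀ a, σ a - a ^ p ∈ Ideal.span {(p : A)}

attribute [instance] FrobPresentation.commRing FrobPresentation.algebra

/-- A homomorphism `(A → R, σ) → (A' → R', σ')`. -/
structure FrobPresentation.Hom (P P' : FrobPresentation.{v} p) where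
  α : P.A →ₐ[ℤ_[p]] P'.A
  map_I : P.I ≤ P'.I.comap α
  map_σ : ∀ a, α (P.σ a) = P'.σ (α a)

section
variable {A : Type v} [CommRing A] [Algebra ℤ_[p] A]

/-- The ideal of relations `x^{[1]} = x` for `x ∈ J` and `p^{[n]} = p ^ n / n!` in `Γ_A(J)`,
where `J = I + p A`. -/
noncomputable def pdRel (I : Ideal A) : Ideal (DividedPowerAlgebra A ↥(I ⊔ Ideal.span {(p : A)})) :=
  Ideal.span
    ({y | ∃ x : ↥(I ⊔ Ideal.span {(p : A)}),
        y = DividedPowerAlgebra.dp A 1 x - algebraMap A _ (x : A)} ∪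
      {y | ∃ (n : ℕ) (x : ↥(I ⊔ Ideal.span {(p : A)})), (x : A) = p ∧
        y = DividedPowerAlgebra.dp A n x - algebraMap A _ (algebraMap ℤ_[p] A (gammaP p n))})

/-- The divided power envelope `D_γ(A → A / I)` relative to `(ℤ_p, p ℤ_p, γ)`. As a ring it is the
quotient of the polynomial algebra over `A` in variables `x^{[n]}` for `x ∈ J = I + p A` and
`n ≥ 0` by the axioms of divided powers, `x^{[1]} = x`, and `p^{[n]} = p ^ n / n!`. -/
def PDEnv (I : Ideal A) : Type v :=
  DividedPowerAlgebra A ↥(I ⊔ Ideal.span {(p : A)}) ⧸ pdRel p I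

noncomputable instance (I : Ideal A) : CommRing (PDEnv p I) :=
  inferInstanceAs (CommRing (_ ⧸ pdRel p I))

noncomputable instance (I : Ideal A) : Algebra A (PDEnv p I) :=
  inferInstanceAs (Algebra A (_ ⧸ pdRel p I))

variable {p} in
/-- The element `x^{[n]}` of `D_γ(A → A / I)`, for `x ∈ I + p A`. -/
noncomputable def PDEnv.dp {I : Ideal A} (n : ℕ) (x : ↥(I ⊔ Ideal.span {(p : A)})) : PDEnv p I :=
  Ideal.Quotient.mk (pdRel p I) (DividedPowerAlgebra.dp A n x)

/-- Homomorphisms out of `D_γ(A → A / I)` are given by images of the `x^{[n]}` that satisfy the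
relations. -/
noncomputable def PDEnv.lift {I : Ideal A} {B : Type w} [CommRing B] (φ : A →+* B)
    (f : ℕ → ↥(I ⊔ Ideal.span {(p : A)}) → B)
    (f_zero : ∀ x, f 0 x = 1)
    (f_smul : ∀ (n : ℕ) (a : A) x, f n (a • x) = φ a ^ n * f n x)
    (f_mul : ∀ (m n : ℕ) x, f m x * f n x = (m + n).choose m * f (m + n) x)
    (f_add : ∀ (n : ℕ) x y,
      f n (x + y) = (Finset.HasAntidiagonal.antidiagonal n).sum fun k => f k.1 x * f k.2 y)
    (f_one : ∀ x : ↥(I ⊔ Ideal.span {(p : A)}), f 1 x = φ (x : A))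
    (f_p : ∀ (n : ℕ) (x : ↥(I ⊔ Ideal.span {(p : A)})), (x : A) = p → f n x = φ (algebraMap ℤ_[p] A (gammaP p n))) :
    PDEnv p I →+* B :=
  letI := φ.toAlgebra
  Ideal.Quotient.lift (pdRel p I)
    (DividedPowerAlgebra.lift' (R := A) (A := B) (f := fun k => f k.1 k.2) f_zero
      (fun n r m => by
        rw [f_smul, Algebra.smul_def, map_pow]; rfl)
      (fun n q m => by rw [f_mul, nsmul_eq_mul])
      (fun n u v => f_add n u v)).toRingHom
    (by
      intro a ha
      rw [← RingHom.mem_ker]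
      revert a
      change pdRel p I ≤ _
      rw [pdRel, Ideal.span_le]
      rintro y (⟨x, rfl⟩ | ⟨n, x, hx, rfl⟩)
      · rw [SetLike.mem_coe, RingHom.mem_ker, map_sub, sub_eq_zero]
        refine (DividedPowerAlgebra.lift'_apply_dp _ _ _ _ 1 x).trans ((f_one x).trans ?_)
        exact (AlgHom.commutes _ _).symm
      · rw [SetLike.mem_coe, RingHom.mem_ker, map_sub, sub_eq_zero]
        refine (DividedPowerAlgebra.lift'_apply_dp _ _ _ _ n x).trans ((f_p n x hx).trans ?_)
        exact (AlgHom.commutes _ _).symm)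

theorem PDEnv.dp_zero {I : Ideal A} (x : ↥(I ⊔ Ideal.span {(p : A)})) :
    PDEnv.dp 0 x = 1 := by
  rw [PDEnv.dp, DividedPowerAlgebra.dp_zero]; rfl

theorem PDEnv.dp_smul {I : Ideal A} (n : ℕ) (a : A) (x : ↥(I ⊔ Ideal.span {(p : A)})) :
    PDEnv.dp n (a • x) = algebraMap A (PDEnv p I) a ^ n * PDEnv.dp n x := by
  rw [PDEnv.dp, DividedPowerAlgebra.dp_smul, Algebra.smul_def, map_mul, map_pow, map_pow]; rfl

theorem PDEnv.dp_mul {I : Ideal A} (m n : ℕ) (x : ↥(I ⊔ Ideal.span {(p : A)})) :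
    PDEnv.dp m x * PDEnv.dp n x = ((m + n).choose m : PDEnv p I) * PDEnv.dp (m + n) x := by
  simp only [PDEnv.dp]
  erw [← map_mul, DividedPowerAlgebra.dp_mul, nsmul_eq_mul, map_mul, map_natCast]
  rfl

theorem PDEnv.dp_add {I : Ideal A} (n : ℕ) (x y : ↥(I ⊔ Ideal.span {(p : A)})) :
    PDEnv.dp n (x + y) =
      (Finset.HasAntidiagonal.antidiagonal n).sum fun k => PDEnv.dp k.1 x * PDEnv.dp k.2 y := by
  simp only [PDEnv.dp]
  rw [DividedPowerAlgebra.dp_add]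
  exact map_sum (Ideal.Quotient.mk (pdRel p I)) _ _

theorem PDEnv.dp_one {I : Ideal A} (x : ↥(I ⊔ Ideal.span {(p : A)})) :
    PDEnv.dp 1 x = algebraMap A (PDEnv p I) x :=
  Ideal.Quotient.eq.2 (Ideal.subset_span (Or.inl ⟨x, rfl⟩))

theorem PDEnv.dp_p {I : Ideal A} (n : ℕ) (x : ↥(I ⊔ Ideal.span {(p : A)})) (hx : (x : A) = p) :
    PDEnv.dp n x = algebraMap A (PDEnv p I) (algebraMap ℤ_[p] A (gammaP p n)) :=
  Ideal.Quotient.eq.2 (Ideal.subset_span (Or.inr ⟨n, x, hx, rfl⟩))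

end

section
variable {A A' : Type v} [CommRing A] [Algebra ℤ_[p] A] [CommRing A'] [Algebra ℤ_[p] A']

variable {p} in
/-- The homomorphism `D_γ(A → A / I) → D_γ(A' → A' / I')` induced by `α : A → A'` that maps
`I + p A` into `I' + p A'`; it sends `x^{[n]}` to `α(x)^{[n]}`. -/
noncomputable def PDEnv.map {I : Ideal A} {I' : Ideal A'} (α : A →ₐ[ℤ_[p]] A')
    (h : I ⊔ Ideal.span {(p : A)} ≤ (I' ⊔ Ideal.span {(p : A')}).comap α) :
    PDEnv p I →+* PDEnv p I' :=
  PDEnv.lift p ((algebraMap A' (PDEnv p I')).comp α.toRingHom)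
    (fun n x => PDEnv.dp n ⟨α x, h x.2⟩)
    (fun x => PDEnv.dp_zero p _)
    (fun n a x => by
      rw [show (⟨α ↑(a • x), h (a • x).2⟩ : ↥(I' ⊔ Ideal.span {(p : A')})) =
        α a • ⟨α x, h x.2⟩ from Subtype.ext (map_mul α a x), PDEnv.dp_smul]
      rfl)
    (fun m n x => PDEnv.dp_mul p m n _)
    (fun n x y => by
      rw [show (⟨α ↑(x + y), h (x + y).2⟩ : ↥(I' ⊔ Ideal.span {(p : A')})) =
        ⟨α x, h x.2⟩ + ⟨α y, h y.2⟩ from Subtype.ext (map_add α (x : A) y), PDEnv.dp_add])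
    (fun x => PDEnv.dp_one p _)
    (fun n x hx => by
      rw [PDEnv.dp_p p n _ (show α x = p by rw [hx, map_natCast])]
      exact congrArg _ (AlgHom.commutes α _).symm)

/-- For `x ∈ I + p A` with image `p b` in `R = A / I`, the element `(p ^ n / n!) b ^ n` of `R`. -/
noncomputable def dpMod (I : Ideal A) (n : ℕ) (x : ↥(I ⊔ Ideal.span {(p : A)})) : A ⧸ I :=
  algebraMap ℤ_[p] (A ⧸ I) (gammaP p n) * (exists_mk_eq p x).choose ^ n

theorem dpMod_eq {I : Ideal A} (n : ℕ) (x : ↥(I ⊔ Ideal.span {(p : A)})) (b : A ⧸ I)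
    (hb : Ideal.Quotient.mk I x = p * b) :
    dpMod p I n x = algebraMap ℤ_[p] (A ⧸ I) (gammaP p n) * b ^ n := by
  have hc := (exists_mk_eq p x).choose_spec
  rw [dpMod]
  generalize (exists_mk_eq p x).choose = c at hc
  by_cases hn : n = 0
  · subst hn; simp
  obtain ⟨d, hd⟩ := gammaP_dvd p hn
  obtain ⟨m, rfl⟩ := Nat.exists_eq_succ_of_ne_zero hn
  obtain ⟨e, he⟩ := sub_dvd_pow_sub_pow c b (m + 1)
  rw [hd, map_mul, map_natCast, ← sub_eq_zero, ← mul_sub, he]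
  have : (p : A ⧸ I) * (c - b) = 0 := by rw [mul_sub, ← hc, ← hb, sub_self]
  linear_combination (algebraMap ℤ_[p] (A ⧸ I) d) * e * this

/-- The homomorphism `D_γ(A → R) → R = A / I`; it sends `x^{[n]}` to `0` for `x ∈ I`
and `n ≥ 1`. -/
noncomputable def PDEnv.toQuot (I : Ideal A) : PDEnv p I →+* A ⧸ I :=
  PDEnv.lift p (Ideal.Quotient.mk I) (dpMod p I)
    (fun x => by rw [dpMod, gammaP_zero]; simp)
    (fun n a x => by
      obtain ⟨b, hb⟩ := exists_mk_eq p x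
      rw [dpMod_eq p n x b hb, dpMod_eq p n (a • x) (Ideal.Quotient.mk I a * b) (by
        rw [Submodule.coe_smul, smul_eq_mul, map_mul, hb]; ring)]
      ring)
    (fun m n x => by
      simp only [dpMod]
      rw [mul_mul_mul_comm, ← map_mul, gammaP_mul, ← pow_add, map_mul, map_natCast, mul_assoc])
    (fun n x y => by
      obtain ⟨b, hb⟩ := exists_mk_eq p x
      obtain ⟨c, hc⟩ := exists_mk_eq p y
      rw [dpMod_eq p n (x + y) (b + c) (by rw [Submodule.coe_add, map_add, hb, hc]; ring),
        (Commute.all b c).add_pow', Finset.mul_sum]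
      refine Finset.sum_congr rfl fun k hk => ?_
      rw [dpMod_eq p k.1 x b hb, dpMod_eq p k.2 y c hc, mul_mul_mul_comm, ← map_mul, gammaP_mul,
        Finset.HasAntidiagonal.mem_antidiagonal.1 hk, map_mul, map_natCast, nsmul_eq_mul]
      ring)
    (fun x => by
      obtain ⟨b, hb⟩ := exists_mk_eq p x
      rw [dpMod_eq p 1 x b hb, gammaP_one, map_natCast, pow_one, hb])
    (fun n x hx => by
      rw [dpMod_eq p n x 1 (by rw [hx, map_natCast, mul_one]), one_pow, mul_one]
      rfl)

end

/-- The `p`-adic completion of a ring. -/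
abbrev PCompl (D : Type v) [CommRing D] : Type v := AdicCompletion (Ideal.span {(p : D)}) D

theorem span_p_pow_le_comap (p : ℕ) {D : Type v} {D' : Type w} [CommRing D] [CommRing D']
    (f : D →+* D') (n : ℕ) :
    Ideal.span {(p : D)} ^ n ≤ (Ideal.span {(p : D')} ^ n).comap f := by
  rw [← Ideal.map_le_iff_le_comap, Ideal.map_pow, Ideal.map_span, Set.image_singleton,
    map_natCast]

/-- The homomorphism of `p`-adic completions induced by a ring homomorphism. -/
noncomputable def pComplMap {D : Type v} {D' : Type w} [CommRing D] [CommRing D'] (f : D →+* D') :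
    PCompl p D →+* PCompl p D' :=
  AdicCompletion.liftRingHom _
    (fun n => (Ideal.quotientMap (Ideal.span {(p : D')} ^ n) f (span_p_pow_le_comap p f n)).comp
      (AdicCompletion.evalₐ (Ideal.span {(p : D)}) n).toRingHom)
    (by
      intro m n hle
      ext x
      obtain ⟨y, rfl⟩ := AdicCompletion.mk_surjective (Ideal.span {(p : D)}) D x
      have h := congrArg (Ideal.quotientMap (Ideal.span {(p : D')} ^ m) f
        (span_p_pow_le_comap p f m)) (AdicCompletion.Ideal.mk_eq_mk (Ideal.span {(p : D)}) hle y)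
      change Ideal.Quotient.factorPow _ hle (Ideal.quotientMap _ f (span_p_pow_le_comap p f n)
        (AdicCompletion.evalₐ _ n (AdicCompletion.mk _ _ y))) =
          Ideal.quotientMap _ f (span_p_pow_le_comap p f m)
            (AdicCompletion.evalₐ _ m (AdicCompletion.mk _ _ y))
      rw [AdicCompletion.evalₐ_mk, AdicCompletion.evalₐ_mk]
      exact h)

/-- The homomorphism from the `p`-adic completion of `D` to a ring in which `p` is nilpotent
induced by a homomorphism from `D`. -/
noncomputable def pComplLift {D : Type v} {R : Type w} [CommRing D] [CommRing R] (f : D →+* R)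
    (h : IsNilpotent (p : R)) : PCompl p D →+* R :=
  (Ideal.Quotient.lift (Ideal.span {(p : D)} ^ h.choose) f (fun a ha => by
      rw [Ideal.span_singleton_pow] at ha
      obtain ⟨b, rfl⟩ := Ideal.mem_span_singleton.1 ha
      rw [map_mul, map_pow, map_natCast, h.choose_spec, zero_mul])).comp
    (AdicCompletion.evalₐ (Ideal.span {(p : D)}) h.choose).toRingHom


variable {p}

namespace FrobPresentation

/-- `σ` maps `I + p A` into itself. -/
theorem σ_le (P : FrobPresentation.{v} p) :
    P.I ⊔ Ideal.span {(p : P.A)} ≤ (P.I ⊔ Ideal.span {(p : P.A)}).comap P.σ := by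
  intro a ha
  rw [Ideal.mem_comap, show P.σ a = (P.σ a - a ^ p) + a ^ p by ring]
  exact add_mem (Ideal.mem_sup_right (P.frobenius a))
    (Ideal.pow_mem_of_mem _ ha p (Fact.out : p.Prime).pos)

/-- The ring `D = D_γ(A → R)^∧`. -/
abbrev D (P : FrobPresentation.{v} p) : Type v := PCompl p (PDEnv p P.I)

/-- The extension of `σ` to `D`. -/
noncomputable def σD (P : FrobPresentation.{v} p) : P.D →+* P.D :=
  pComplMap p (PDEnv.map P.σ P.σ_le)

/-- The homomorphism `D → R = A / I`. Its kernel is the ideal `Ī`. -/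
noncomputable def toR (P : FrobPresentation.{v} p) : P.D →+* P.A ⧸ P.I :=
  pComplLift p (PDEnv.toQuot p P.I) P.nilpotent

theorem Hom.map_le {P P' : FrobPresentation.{v} p} (f : Hom p P P') :
    P.I ⊔ Ideal.span {(p : P.A)} ≤ (P'.I ⊔ Ideal.span {(p : P'.A)}).comap f.α := by
  refine sup_le (f.map_I.trans (Ideal.comap_mono le_sup_left)) ?_
  rw [Ideal.span_singleton_le_iff_mem, Ideal.mem_comap, map_natCast]
  exact Ideal.mem_sup_right (Ideal.mem_span_singleton_self _)

/-- The homomorphism `D → D'` induced by a homomorphism `(A → R, σ) → (A' → R', σ')`. -/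
noncomputable def Hom.mapD {P P' : FrobPresentation.{v} p} (f : Hom p P P') : P.D →+* P'.D :=
  pComplMap p (PDEnv.map f.α f.map_le)

/-- The homomorphism `R → R'` induced by a homomorphism `(A → R, σ) → (A' → R', σ')`. -/
def Hom.mapR {P P' : FrobPresentation.{v} p} (f : Hom p P P') : P.A ⧸ P.I →+* P'.A ⧸ P'.I :=
  Ideal.quotientMap P'.I f.α.toRingHom f.map_I

end FrobPresentation

variable (p) in
/-- `(A, I, R, σ, σ₁)` is a frame, where `I` is the kernel of `π : A → R`. -/
structure IsFrame {A : Type v} {R : Type w} [CommRing A] [CommRing R] (π : A →+* R) (σ : A →+* A)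
    (σ₁ : RingHom.ker π →ₛₗ[σ] A) : Prop where
  pAdic_A : IsAdicComplete (Ideal.span {(p : A)}) A
  pAdic_R : IsAdicComplete (Ideal.span {(p : R)}) R
  surjective : Function.Surjective π
  frobenius : ∀ a, σ a - a ^ p ∈ Ideal.span {(p : A)}
  p_mul : ∀ x : RingHom.ker π, (p : A) * σ₁ x = σ x

/-- `f : A → A'` is a homomorphism of frames that induces `g : R → R'`. -/
structure IsFrameHom {A A' : Type v} {R R' : Type w} [CommRing A] [CommRing R] [CommRing A']
    [CommRing R'] {π : A →+* R} {π' : A' →+* R'} {σ : A →+* A} {σ' : A' →+* A'}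
    (σ₁ : RingHom.ker π →ₛₗ[σ] A) (σ₁' : RingHom.ker π' →ₛₗ[σ'] A') (f : A →+* A') (g : R →+* R') :
    Prop where
  comm_π : ∀ a, π' (f a) = g (π a)
  comm_σ : ∀ a, f (σ a) = σ' (f a)
  comm_σ₁ : ∀ (x : RingHom.ker π) (y : RingHom.ker π'), (y : A') = f x → f (σ₁ x) = σ₁' y

variable (p) in
/-- A family, for all `(A → R, σ)`, of `σ`-linear maps `Ī → D`. -/
abbrev SigmaOneFamilyD : Type (v + 1) :=
  ∀ P : FrobPresentation.{v} p, RingHom.ker P.toR →ₛₗ[P.σD] P.D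

/-- The maps `σ₁ : Ī → D` satisfy `p σ₁ = σ` and are functorial in `(A → R, σ)`. -/
structure IsFunctorialSigmaOneD (σ₁ : SigmaOneFamilyD.{v} p) : Prop where
  p_mul : ∀ (P : FrobPresentation.{v} p) (x : RingHom.ker P.toR), (p : P.D) * σ₁ P x = P.σD x
  functorial : ∀ (P P' : FrobPresentation.{v} p) (f : FrobPresentation.Hom p P P')
    (x : RingHom.ker P.toR) (y : RingHom.ker P'.toR), (y : P'.D) = f.mapD x →
      f.mapD (σ₁ P x) = σ₁ P' y

end Envelope
end DivDieud

open DivDieud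

/-!
The divided Frobenius `σ₁` is a canonical division of `σ` by `p`. It exists because, for `x` in a
divided power ideal and a lift of Frobenius `σ(x) = x ^ p + p δ(x)`, the element `(p - 1)! x^{[p]} +
δ(x)` multiplied by `p` gives `σ(x)`; it is unique because the kernel is generated by elements that
come by functoriality from objects without `p`-torsion.

*Existence.* A lift of Frobenius on `B` together with `δ` amounts to a section of `W₂(B) → B`. If `J
⊆ B` is a divided power ideal, then the preimage of `J` in `W₂(B)` has divided powers
(`W2.dividedPowers`), and both ghost components `x₀` and `x₀ ^ p + p x₁` of `(x₀, x₁) ∈ W₂(B)`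
preserve divided powers if `J` contains `p` and is compatible with the divided powers of `p`
(`W2.isDPMorphism_fst`, `W2.isDPMorphism_ghostHom`). For a frame presentation `A → R`, the
homomorphism `A → W₂(A)` given by `σ` thus extends to the divided power envelope
(`FrobPresentation.wittEnv`). For `𝒪^cris`, the morphism `Spec C/p → Spec W₂(B)` is again a
divided power thickening for each divided power thickening `Spec C → Spec B` (`PDDatum.witt`), since
divided powers always extend to the ideal generated by `p` (`exists_dividedPowers_sup_p`). The value
of a section of `𝒪^cris` at this thickening is an element of `W₂(B)`, whose components give the
section itself and its `δ`; so `σ` and `σ₁` are defined without any choice (`famSigma`, `famDiv`),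
and functoriality is automatic.

Divided powers are constructed by dividing by factorials in torsion-free rings and passing to
quotients: every divided power algebra over `ℤ_p` is the quotient of a torsion-free one
(`exists_torsionFreeCover`), and a quotient inherits divided powers if the divided powers of the
elements of the kernel are again in the kernel (`exists_dividedPowers_of_surjective`). This also
gives the divided powers on the envelope (`PDEnv.exists_dividedPowers`) and on flat extensions
(`exists_dividedPowers_flat`).

*The sheaf properties.* A section of `𝒪^cris` over `U` is a compatible family of elements of `B`,
for all affine divided power thickenings `Spec C → Spec B` with a morphism `Spec C → U`
(`toFam_injective`, `toFam_surjective`). The adjunction of `p`-th roots to `C` lifts to a flat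
extension of `B`, to which the divided powers extend; hence a `pr`-covering of `U` induces a flat
covering of each such thickening, and families glue by flat descent (`isSheaf_famPre`). Locally in
the `pr`-topology, all elements have `p`-th roots (`mem_prTopology_of_roots`). A ring `R` with this
property is a quotient of the monoid algebra over `ℤ_p` of a monoid `M` with unique `p`-th roots.
Because homomorphisms from `M` to `C` lift uniquely to `B`, the ring of sections over `R` is the
`p`-completed divided power envelope of this presentation (`PerfectChart.toFam_surjective`). This
implies that `𝒪^cris → 𝒪` is surjective and that sections that vanish on the thickenings with `p ^ r
= 0` are locally divisible by `p ^ r`, which gives the completeness (`isPAdicSheaf_of_iso_famOver`).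
The sheaf `𝒪` is treated in the same way, as the sheaf of families on the thickenings with `B = C`.

*Uniqueness.* The envelope of an ideal that is generated, up to `p`, by an element `y` that is
regular modulo `p` is torsion-free (`PDEnv.natTorsionFree_of_regular`), and there `σ₁` is determined
by `p σ₁ = σ`. For a frame presentation `A → R` with kernel `I`, an element `i ∈ I` is the image of
`y` under a homomorphism from the completed free `δ`-ring on `y` with the ideal `(y, p ^ N)`; the
elements `i^{[k]}` and `p ^ N` generate the kernel of `D → R`
(`FrobPresentation.eq_of_isFunctorialSigmaOneD`). For `𝒪^cris`, it suffices to consider rings of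
characteristic `p` in which all elements have `p`-th roots (`ocris_ext_of_hasRoots`), with the same
description of the kernel. An element `i` of the kernel of `ℤ_p[M] → R` that is not divisible by `p`
comes from the monoid algebra of a free monoid with `p`-power roots, which modulo `p` is a domain,
so that the tautological lift of `i` is regular modulo `p`
(`PerfectChart.exists_torsionFree_chart`).

The endomorphism `σ` of `𝒪^cris` is unique because the value of a section on a thickening `Spec C →
Spec B` is equal to its value on `Spec C/p → Spec B` (`IsCrisFrobenius.unique`).
-/


set_option linter.unusedSectionVars false

namespace DivDieud

/-! ### Divided powers on torsion-free rings -/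

/-- The additive group of `B` is torsion-free. -/
def NatTorsionFree (B : Type*) [CommRing B] : Prop :=
  ∀ n : ℕ, n ≠ 0 → ∀ x : B, (n : B) * x = 0 → x = 0

theorem NatTorsionFree.cancel {B : Type*} [CommRing B] (h : NatTorsionFree B) {n : ℕ} (hn : n ≠ 0)
    {x y : B} (hxy : (n : B) * x = n * y) : x = y :=
  sub_eq_zero.1 (h n hn _ (by rw [mul_sub, hxy, sub_self]))

theorem NatTorsionFree.of_injective {B B' : Type*} [CommRing B] [CommRing B']
    (h : NatTorsionFree B') (f : B →+* B') (hf : Function.Injective f) : NatTorsionFree B :=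
  fun n hn x hx => (injective_iff_map_eq_zero f).1 hf x
    (h n hn _ (by rw [← map_natCast f, ← map_mul, hx, map_zero]))

theorem factorial_mul_sum_antidiagonal {B : Type*} [CommRing B] {x y : B} {g g' : ℕ → B}
    (hg : ∀ n, (n.factorial : B) * g n = x ^ n) (hg' : ∀ n, (n.factorial : B) * g' n = y ^ n)
    (n : ℕ) :
    (n.factorial : B) * ∑ k ∈ Finset.HasAntidiagonal.antidiagonal n, g k.1 * g' k.2 = (x + y) ^ n := by
  rw [(Commute.all x y).add_pow', Finset.mul_sum]
  refine Finset.sum_congr rfl fun k hk => ?_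
  rw [← Finset.HasAntidiagonal.mem_antidiagonal.1 hk, ← hg, ← hg', nsmul_eq_mul,
    ← Nat.add_choose_mul_factorial_mul_factorial k.1 k.2, Nat.choose_symm_add]
  push_cast; ring

/-- In a torsion-free ring an ideal has divided powers as soon as it contains `s ^ n / n!` for all
elements `s` of a generating set. -/
theorem NatTorsionFree.exists_dividedPowers {B : Type*} [CommRing B] (tf : NatTorsionFree B)
    {J : Ideal B} {S : Set B} (hJ : J = Ideal.span S)
    (h : ∀ s ∈ S, ∀ n ≠ 0, ∃ y ∈ J, (n.factorial : B) * y = s ^ n) :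
    Nonempty (DividedPowers J) := by
  classical
  have key : ∀ x ∈ J, ∃ g : ℕ → B, g 0 = 1 ∧ (∀ n ≠ 0, g n ∈ J) ∧
      ∀ n, (n.factorial : B) * g n = x ^ n := by
    intro x hx
    rw [hJ] at hx
    induction hx using Submodule.span_induction with
    | mem s hs =>
      choose! g hg hg' using h s hs
      refine ⟨fun n => if n = 0 then 1 else g n, if_pos rfl, fun n hn => ?_, fun n => ?_⟩
      · simpa [hn] using hg n hn
      · by_cases hn : n = 0
        · simp [hn]
        · simpa [hn] using hg' n hn
    | zero =>
      refine ⟨fun n => if n = 0 then 1 else 0, if_pos rfl, fun n hn => by simp [hn], fun n => ?_⟩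
      by_cases hn : n = 0 <;> simp [hn]
    | add x y _ _ hx hy =>
      obtain ⟨g, h0, h1, h2⟩ := hx
      obtain ⟨g', h0', h1', h2'⟩ := hy
      refine ⟨fun n => ∑ k ∈ Finset.HasAntidiagonal.antidiagonal n, g k.1 * g' k.2, by simp [h0, h0'],
        fun n hn => ?_, factorial_mul_sum_antidiagonal h2 h2'⟩
      refine Ideal.sum_mem _ fun k hk => ?_
      by_cases hk1 : k.1 = 0
      · refine Ideal.mul_mem_left _ _ (h1' _ ?_)
        have := Finset.HasAntidiagonal.mem_antidiagonal.1 hk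
        omega
      · exact Ideal.mul_mem_right _ _ (h1 _ hk1)
    | smul a x _ hx =>
      obtain ⟨g, h0, h1, h2⟩ := hx
      refine ⟨fun n => a ^ n * g n, by simp [h0], fun n hn => Ideal.mul_mem_left _ _ (h1 n hn),
        fun n => ?_⟩
      rw [smul_eq_mul, mul_pow, ← h2]; ring
  choose! g h0 h1 h2 using key
  -- The element `x ^ n / n!` is unique, so each axiom may be checked after multiplication by
  -- factorials.
  have uniq : ∀ {n : ℕ} {a b : B}, (n.factorial : B) * a = n.factorial * b → a = b :=
    fun {n a b} => tf.cancel n.factorial_ne_zero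
  refine ⟨{ dpow := fun n x => if x ∈ J then g x n else 0
            dpow_null := fun hx => if_neg hx
            dpow_zero := fun {x} hx => by rw [if_pos hx, h0 x hx]
            dpow_one := fun {x} hx => by
              have := h2 x hx 1
              rw [if_pos hx]; simpa using this
            dpow_mem := fun {n x} hn hx => by rw [if_pos hx]; exact h1 x hx n hn
            dpow_add := fun {n x y} hx hy => ?_
            dpow_mul := fun {n a x} hx => ?_
            mul_dpow := fun {m n x} hx => ?_
            dpow_comp := fun {m n x} hn hx => ?_ }⟩
  · simp only [if_pos (J.add_mem hx hy), if_pos hx, if_pos hy]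
    refine uniq (n := n) ?_
    rw [factorial_mul_sum_antidiagonal (h2 x hx) (h2 y hy), h2 _ (J.add_mem hx hy)]
  · simp only [if_pos hx, if_pos (J.mul_mem_left a hx)]
    refine uniq (n := n) ?_
    rw [h2 _ (J.mul_mem_left a hx), mul_left_comm, h2 x hx, mul_pow]
  · simp only [if_pos hx]
    refine uniq (n := m + n) ?_
    rw [mul_left_comm ((m + n).factorial : B) ((m + n).choose m : B), h2 x hx,
      ← Nat.add_choose_mul_factorial_mul_factorial m n, pow_add, ← h2 x hx, ← h2 x hx,
      Nat.choose_symm_add]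
    push_cast; ring
  · simp only [if_pos hx, if_pos (h1 x hx n hn)]
    refine uniq (n := m) (tf.cancel (pow_ne_zero m n.factorial_ne_zero) ?_)
    have e := h2 (g x n) (h1 x hx n hn) m
    have e' := h2 x hx (m * n)
    rw [← Nat.uniformBell_mul_eq m hn] at e'
    rw [e]
    push_cast at e' ⊢
    rw [← mul_pow, h2 x hx, ← pow_mul, mul_comm n m, ← e']
    ring

/-- Divided powers descend along a surjection `F` if their images depend only on `F`. -/
theorem exists_dividedPowers_of_surjective {Γ B : Type*} [CommRing Γ] [CommRing B] (F : Γ →+* B)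
    (hF : Function.Surjective F) {J : Ideal Γ} (hJ : DividedPowers J)
    (h : ∀ z ∈ J, F z = 0 → ∀ n ≠ 0, F (hJ.dpow n z) = 0) {J' : Ideal B} (hJ' : J' = J.map F) :
    ∃ hB : DividedPowers J', hJ.IsDPMorphism hB F := by
  have hs : hJ.IsSubDPIdeal (RingHom.ker F ⊓ J) :=
    { isSubideal := inf_le_right
      dpow_mem := fun n hn z hz => ⟨h z hz.2 hz.1 n hn, hJ.dpow_mem hn hz.2⟩ }
  exact ⟨_, DividedPowers.Quotient.OfSurjective.isDPMorphism hJ hF hJ' hs⟩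

/-! ### The divided powers of `p` -/

section Compat
variable (p : ℕ) [hp : Fact p.Prime]

theorem factorial_mul_gammaP (n : ℕ) : (n.factorial : ℤ_[p]) * gammaP p n = (p : ℤ_[p]) ^ n :=
  (PadicInt.dividedPowers p).factorial_mul_dpow_eq_pow (Ideal.mem_span_singleton_self _)

theorem padicInt_isUnit_natCast {m : ℕ} (hm : ¬ p ∣ m) : IsUnit (m : ℤ_[p]) := by
  rw [PadicInt.isUnit_iff]
  have := (PadicInt.norm_int_lt_one_iff_dvd (p := p) m).not.2 (by exact_mod_cast hm)
  exact le_antisymm (PadicInt.norm_le_one _) (by rw [Int.cast_natCast] at this; exact not_lt.1 this)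

theorem primeToP_factorial_mul_gammaP (n : ℕ) :
    ((n.factorial / p ^ padicValNat p n.factorial : ℕ) : ℤ_[p]) * gammaP p n =
      (p : ℤ_[p]) ^ (n - padicValNat p n.factorial) := by
  have hv : padicValNat p n.factorial ≤ n := by
    rcases eq_or_ne n 0 with rfl | hn
    · simp
    · exact (padicValNat_factorial_lt_of_ne_zero p hn).le
  have hpz : (p : ℤ_[p]) ^ padicValNat p n.factorial ≠ 0 :=
    pow_ne_zero _ (Nat.cast_ne_zero.2 hp.out.ne_zero)
  apply mul_left_cancel₀ hpz
  rw [← pow_add, Nat.add_sub_cancel' hv, ← factorial_mul_gammaP p n, ← mul_assoc]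
  congr 1
  rw [← Nat.cast_pow, ← Nat.cast_mul, Nat.mul_div_cancel' pow_padicValNat_dvd]

theorem padicInt_isUnit_primeToP_factorial (n : ℕ) :
    IsUnit ((n.factorial / p ^ padicValNat p n.factorial : ℕ) : ℤ_[p]) := by
  refine padicInt_isUnit_natCast p fun h => ?_
  have h1 : p ^ (padicValNat p n.factorial + 1) ∣ n.factorial := by
    rw [pow_succ]
    obtain ⟨c, hc⟩ := h
    exact ⟨c, by rw [mul_assoc, ← hc, Nat.mul_div_cancel' pow_padicValNat_dvd]⟩
  exact pow_succ_padicValNat_not_dvd n.factorial_ne_zero h1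

variable {p}

/-- The divided powers on `J` agree with those of `ℤ_p` on `J ∩ p B`, where `ι : ℤ_p → B`. -/
def GammaCompat {B : Type*} [CommRing B] (ι : ℤ_[p] →+* B) {J : Ideal B} (hJ : DividedPowers J) :
    Prop :=
  ∀ (n : ℕ) (a : B), (p : B) * a ∈ J → hJ.dpow n (p * a) = ι (gammaP p n) * a ^ n

theorem gammaCompat_iff {B : Type*} [CommRing B] (ι : ℤ_[p] →+* B) {J : Ideal B}
    (hJ : DividedPowers J) : GammaCompat ι hJ ↔ ∀ (n : ℕ) (a : B), (p : B) * a ∈ J →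
      ((n.factorial / p ^ padicValNat p n.factorial : ℕ) : B) * hJ.dpow n (p * a) =
        (p : B) ^ (n - padicValNat p n.factorial) * a ^ n := by
  have h1 : ∀ n, ((n.factorial / p ^ padicValNat p n.factorial : ℕ) : B) * ι (gammaP p n) =
      (p : B) ^ (n - padicValNat p n.factorial) := fun n => by
    rw [← map_natCast ι, ← map_mul, primeToP_factorial_mul_gammaP, map_pow, map_natCast]
  refine forall₃_congr fun n a _ => ?_
  have hu : IsUnit ((n.factorial / p ^ padicValNat p n.factorial : ℕ) : B) := by
    rw [← map_natCast ι]; exact (padicInt_isUnit_primeToP_factorial p n).map ι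
  rw [← h1, mul_assoc]
  exact hu.mul_right_inj.symm

theorem GammaCompat.of_torsionFree {B : Type*} [CommRing B] (tf : NatTorsionFree B)
    (ι : ℤ_[p] →+* B) {J : Ideal B} (hJ : DividedPowers J) : GammaCompat ι hJ := fun n a ha => by
  refine tf.cancel n.factorial_ne_zero ?_
  have h := congrArg ι (factorial_mul_gammaP p n)
  rw [map_mul, map_natCast, map_pow, map_natCast] at h
  rw [hJ.factorial_mul_dpow_eq_pow ha, ← mul_assoc, h, mul_pow]

theorem natTorsionFree_of_p {B : Type*} [CommRing B] (ι : ℤ_[p] →+* B)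
    (h : ∀ x : B, (p : B) * x = 0 → x = 0) : NatTorsionFree B := by
  intro n hn x hx
  obtain ⟨k, m, hm, rfl⟩ := Nat.exists_eq_pow_mul_and_not_dvd hn p hp.out.ne_one
  have hu : IsUnit (m : B) := by rw [← map_natCast ι]; exact (padicInt_isUnit_natCast p hm).map ι
  push_cast at hx
  have hx' : (m : B) * ((p : B) ^ k * x) = 0 := by rw [← hx]; ring
  rw [hu.mul_right_eq_zero] at hx'
  clear hx hn
  induction k with
  | zero => simpa using hx'
  | succ k ih => exact ih (h _ (by rw [← hx', pow_succ]; ring))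

/-- There is a ring homomorphism from `ℤ_p` to every ring in which `p` is nilpotent. -/
theorem exists_padicInt_ringHom {B : Type*} [CommRing B] (h : IsNilpotent (p : B)) :
    Nonempty (ℤ_[p] →+* B) := by
  obtain ⟨n, hn⟩ := h
  have : ringChar B ∣ p ^ n := (ringChar.spec B _).1 (by exact_mod_cast hn)
  exact ⟨(ZMod.castHom this B).comp (PadicInt.toZModPow n)⟩

theorem padicInt_ringHom_ext {B : Type*} [CommRing B] (h : IsNilpotent (p : B))
    (f g : ℤ_[p] →+* B) : f = g := by
  obtain ⟨n, hn⟩ := h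
  ext x
  have hx := PadicInt.appr_spec n x
  obtain ⟨y, hy⟩ := Ideal.mem_span_singleton.1 hx
  have hx' : x = x.appr n + p ^ n * y := by rw [← hy]; ring
  rw [hx']
  simp [hn]

/-- The element `p ^ (n - 1) / n!` of `ℤ_p`, for `n ≥ 1`. -/
noncomputable def gammaDiv (p : ℕ) [Fact p.Prime] (n : ℕ) : ℤ_[p] :=
  if hn : n = 0 then 0 else (gammaP_dvd p hn).choose

theorem p_mul_gammaDiv {n : ℕ} (hn : n ≠ 0) : (p : ℤ_[p]) * gammaDiv p n = gammaP p n := by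
  rw [gammaDiv, dif_neg hn]; exact (gammaP_dvd p hn).choose_spec.symm

theorem p_mul_gammaDiv_mem {B : Type*} [CommRing B] (ι : ℤ_[p] →+* B) {n : ℕ} (hn : n ≠ 0) :
    ι (gammaP p n) = p * ι (gammaDiv p n) := by
  rw [← p_mul_gammaDiv hn, map_mul, map_natCast]

end Compat

/-! ### Divided power algebras of free modules -/

section FreeDP
variable {A : Type u} [CommRing A] (τ : Type u)

theorem NatTorsionFree.of_charZero_domain {B : Type*} [CommRing B] [IsDomain B] [CharZero B] :
    NatTorsionFree B := fun _ hn _ hx =>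
  (mul_eq_zero.1 hx).resolve_left (Nat.cast_ne_zero.2 hn)

/-- A torsion-free ring embeds into a `ℚ`-algebra. -/
theorem NatTorsionFree.exists_rat_algebra (tf : NatTorsionFree A) :
    ∃ (K : Type u) (_ : CommRing K) (_ : Algebra ℚ K) (f : A →+* K), Function.Injective f := by
  have : Module.IsTorsionFree ℤ A := by
    refine Module.isTorsionFree_iff_smul_eq_zero.2 fun n x h => ?_
    by_contra! hc
    have h' : ((n.natAbs : ℕ) : A) * x = 0 := by
      rcases Int.natAbs_eq n with e | e
      · rw [e] at h; simpa using h
      · rw [e] at h; simpa using h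
    exact hc.2 (tf _ (Int.natAbs_ne_zero.2 hc.1) _ h')
  exact ⟨TensorProduct ℤ ℚ A, inferInstance, inferInstance,
    (Algebra.TensorProduct.includeRight (R := ℤ) (A := ℚ) (B := A)).toRingHom,
    Algebra.TensorProduct.includeRight_injective (FaithfulSMul.algebraMap_injective ℤ ℚ)⟩

/-- The monomials `∏ x_i^{[m_i]}` in the divided power algebra of a free module. -/
noncomputable def dpMonomial (m : τ →₀ ℕ) : DividedPowerAlgebra A (τ →₀ A) :=
  m.prod fun i k => DividedPowerAlgebra.dp A k (Finsupp.single i (1 : A))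

variable {τ} in
/-- In the polynomial ring over a `ℚ`-algebra that contains `A`, the monomials become the usual
monomials up to invertible factors. -/
theorem dpMonomial_linearIndependent (tf : NatTorsionFree A) :
    LinearIndependent A (dpMonomial (A := A) τ) := by
  classical
  obtain ⟨K, _, _, f, hf⟩ := tf.exists_rat_algebra
  let _ : Algebra A K := f.toAlgebra
  let hI := DividedPowers.RatAlgebra.dividedPowers (⊤ : Ideal (MvPolynomial τ K))
  let g : (τ →₀ A) →ₗ[A] MvPolynomial τ K :=
    Finsupp.linearCombination A (fun i => (MvPolynomial.X i : MvPolynomial τ K))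
  let Φ := DividedPowerAlgebra.lift hI g (fun _ => Submodule.mem_top)
  have hdp : ∀ (i : τ) (k : ℕ), Φ (DividedPowerAlgebra.dp A k (Finsupp.single i (1 : A))) =
      MvPolynomial.C (algebraMap ℚ K (k.factorial : ℚ)⁻¹) * MvPolynomial.X i ^ k := by
    intro i k
    have h1 : (k.factorial : MvPolynomial τ K) *
        Φ (DividedPowerAlgebra.dp A k (Finsupp.single i (1 : A))) = MvPolynomial.X i ^ k := by
      rw [DividedPowerAlgebra.lift_apply_dp, hI.factorial_mul_dpow_eq_pow Submodule.mem_top]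
      simp [g]
    rw [← h1, ← mul_assoc, ← map_natCast (MvPolynomial.C (σ := τ) (R := K)), ← map_mul,
      ← map_natCast (algebraMap ℚ K), ← map_mul,
      inv_mul_cancel₀ (Nat.cast_ne_zero.2 k.factorial_ne_zero), map_one, map_one, one_mul]
  have hmon : ∀ m : τ →₀ ℕ, Φ (dpMonomial τ m) = MvPolynomial.monomial m
      (algebraMap ℚ K (m.prod fun _ k => (k.factorial : ℚ)⁻¹)) := by
    intro m
    rw [dpMonomial, Finsupp.prod, map_prod]
    simp only [hdp, Finset.prod_mul_distrib]
    rw [MvPolynomial.monomial_eq, Finsupp.prod, Finsupp.prod, map_prod, map_prod]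
  rw [linearIndependent_iff]
  intro l hl
  ext m
  have h0 := congrArg (fun z => MvPolynomial.coeff m (Φ z)) hl
  simp only [Finsupp.linearCombination_apply, Finsupp.sum, map_sum, map_smul, hmon, map_zero,
    MvPolynomial.coeff_sum, MvPolynomial.coeff_smul, MvPolynomial.coeff_zero] at h0
  simp only [MvPolynomial.coeff_monomial, smul_ite, smul_zero, Finset.sum_ite_eq'] at h0
  by_cases hm : m ∈ l.support
  · rw [if_pos hm, Algebra.smul_def] at h0
    have hne : (m.prod fun _ k => (k.factorial : ℚ)⁻¹) ≠ 0 :=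
      Finset.prod_ne_zero_iff.2 fun i _ => inv_ne_zero (Nat.cast_ne_zero.2 (m i).factorial_ne_zero)
    have hu : IsUnit (algebraMap ℚ K (m.prod fun _ k => (k.factorial : ℚ)⁻¹)) :=
      (IsUnit.mk0 _ hne).map _
    rw [hu.mul_left_eq_zero] at h0
    exact (injective_iff_map_eq_zero f).1 hf _ h0
  · simpa using hm

/-- The basis of the divided power algebra of a free module that consists of the monomials. -/
noncomputable def dpBasis (tf : NatTorsionFree A) :
    Module.Basis (τ →₀ ℕ) A (DividedPowerAlgebra A (τ →₀ A)) :=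
  Module.Basis.mk (dpMonomial_linearIndependent tf) (by
    refine (DividedPowerAlgebra.submodule_span_prod_dp_eq_top (R := A)
      (v := fun i : τ => Finsupp.single i (1 : A)) ?_).ge
    rw [eq_top_iff]
    intro x _
    induction x using Finsupp.induction_linear with
    | zero => exact zero_mem _
    | add x y hx hy => exact add_mem (hx trivial) (hy trivial)
    | single i a =>
      rw [show Finsupp.single i a = a • Finsupp.single i (1 : A) by simp]
      exact Submodule.smul_mem _ _ (Submodule.subset_span ⟨i, rfl⟩))

theorem NatTorsionFree.of_basis {B : Type*} [CommRing B] [Algebra A B] (tf : NatTorsionFree A)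
    {κ : Type*} (b : Module.Basis κ A B) : NatTorsionFree B := by
  intro n hn x hx
  refine b.repr.injective ?_
  ext i
  rw [map_zero, Finsupp.zero_apply]
  refine tf n hn _ ?_
  have h := congrArg (fun z => b.repr z i) hx
  rw [← nsmul_eq_mul] at h ⊢
  simpa only [map_nsmul, map_zero, Finsupp.smul_apply, Finsupp.zero_apply] using h

/-- The ideal generated by the divided powers in a divided power algebra. -/
noncomputable def dpIdeal (A : Type u) [CommRing A] (M : Type u) [AddCommGroup M] [Module A M] :
    Ideal (DividedPowerAlgebra A M) :=
  Ideal.span {z | ∃ (n : ℕ) (c : M), n ≠ 0 ∧ z = DividedPowerAlgebra.dp A n c}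

theorem dp_mem_dpIdeal (A : Type u) [CommRing A] {M : Type u} [AddCommGroup M] [Module A M] {n : ℕ} (hn : n ≠ 0) (c : M) :
    DividedPowerAlgebra.dp A n c ∈ dpIdeal A M :=
  Ideal.subset_span (s := {z | ∃ (n : ℕ) (c : M), n ≠ 0 ∧ z = DividedPowerAlgebra.dp A n c})
    ⟨n, c, hn, rfl⟩

theorem factorial_mul_uniformBell_mul_dp {M : Type u} [AddCommGroup M] [Module A M]
    (tf : NatTorsionFree (DividedPowerAlgebra A M)) {m n : ℕ} (hn : n ≠ 0) (c : M) :
    (m.factorial : DividedPowerAlgebra A M) *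
      (m.uniformBell n * DividedPowerAlgebra.dp A (m * n) c) =
        DividedPowerAlgebra.dp A n c ^ m := by
  refine tf.cancel (pow_ne_zero m n.factorial_ne_zero) ?_
  have h1 : ∀ k, (k.factorial : DividedPowerAlgebra A M) * DividedPowerAlgebra.dp A k c =
      DividedPowerAlgebra.dp A 1 c ^ k := fun k => by
    exact DividedPowerAlgebra.natFactorial_mul_dp_eq k c
  have h2 := h1 (m * n)
  rw [← Nat.uniformBell_mul_eq m hn] at h2
  push_cast at h2 ⊢
  rw [← mul_pow, h1 n, ← pow_mul, mul_comm n m, ← h2]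
  ring

theorem exists_dividedPowers_dpIdeal {M : Type u} [AddCommGroup M] [Module A M]
    (tf : NatTorsionFree (DividedPowerAlgebra A M)) : Nonempty (DividedPowers (dpIdeal A M)) := by
  refine tf.exists_dividedPowers rfl ?_
  rintro _ ⟨n, c, hn, rfl⟩ m hm
  exact ⟨_, Ideal.mul_mem_left _ _ (dp_mem_dpIdeal A (Nat.mul_ne_zero hm hn) c),
    factorial_mul_uniformBell_mul_dp tf hn c⟩

end FreeDP

/-! ### Torsion-free covers -/

section Cover
variable {p : ℕ} [hp : Fact p.Prime]

/-- A presentation of a divided power ring `(B, J)` over `ℤ_p` as a quotient of a torsion-free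
divided power ring. -/
structure TorsionFreeCover {B : Type u} [CommRing B] (ι : ℤ_[p] →+* B) {J : Ideal B}
    (hJ : DividedPowers J) where
  Γ : Type u
  [ring : CommRing Γ]
  torsionFree : NatTorsionFree Γ
  ι' : ℤ_[p] →+* Γ
  I : Ideal Γ
  hI : DividedPowers I
  F : Γ →+* B
  F_ι : F.comp ι' = ι
  surjective : Function.Surjective F
  map_I : I.map F = J
  isDP : hI.IsDPMorphism hJ F

attribute [instance] TorsionFreeCover.ring

theorem mvPolynomial_natTorsionFree {A : Type*} [CommRing A] (tf : NatTorsionFree A) (σ : Type*) :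
    NatTorsionFree (MvPolynomial σ A) := by
  intro n hn x hx
  ext m
  refine tf n hn _ ?_
  rw [← MvPolynomial.coeff_C_mul, map_natCast, hx, MvPolynomial.coeff_zero]

/-- The divided power algebra of the free module on `J` over a polynomial ring over `ℤ_p` that maps
onto `B`. It is torsion-free because it is free over the polynomial ring. -/
theorem exists_torsionFreeCover {B : Type u} [CommRing B] (ι : ℤ_[p] →+* B) {J : Ideal B}
    (hJ : DividedPowers J) : Nonempty (TorsionFreeCover ι hJ) := by
  let A := MvPolynomial B ℤ_[p]
  have tfA : NatTorsionFree A :=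
    mvPolynomial_natTorsionFree NatTorsionFree.of_charZero_domain _
  let π : A →+* B := MvPolynomial.eval₂Hom ι id
  let _ : Algebra A B := π.toAlgebra
  let g : (J →₀ A) →ₗ[A] B := Finsupp.linearCombination A (fun x : J => (x : B))
  have hg : ∀ c, g c ∈ J := fun c => by
    rw [show g c = c.sum fun x a => a • (x : B) from Finsupp.linearCombination_apply _ _]
    exact J.sum_mem fun x _ => J.mul_mem_left _ x.2
  let Φ := DividedPowerAlgebra.lift hJ g hg
  have tf : NatTorsionFree (DividedPowerAlgebra A (J →₀ A)) := tfA.of_basis (dpBasis _ tfA)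
  obtain ⟨hI⟩ := exists_dividedPowers_dpIdeal tf
  have hI1 : ∀ (n : ℕ) (c : J →₀ A), hI.dpow n (DividedPowerAlgebra.dp A 1 c) =
      DividedPowerAlgebra.dp A n c := fun n c => by
    refine tf.cancel n.factorial_ne_zero ?_
    rw [hI.factorial_mul_dpow_eq_pow (dp_mem_dpIdeal A one_ne_zero c),
      ← DividedPowerAlgebra.natFactorial_mul_dp_eq]
  have hle : (dpIdeal A (J →₀ A)).map Φ.toRingHom ≤ J := by
    rw [dpIdeal, Ideal.map_span, Ideal.span_le]
    rintro _ ⟨_, ⟨n, c, hn, rfl⟩, rfl⟩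
    have : Φ (DividedPowerAlgebra.dp A n c) = hJ.dpow n (g c) :=
      DividedPowerAlgebra.lift_apply_dp _ _ n c
    change Φ _ ∈ J
    rw [this]
    exact hJ.dpow_mem hn (hg c)
  refine ⟨{ Γ := DividedPowerAlgebra A (J →₀ A)
            torsionFree := tf
            ι' := (algebraMap A _).comp MvPolynomial.C
            I := dpIdeal A _
            hI := hI
            F := Φ.toRingHom
            F_ι := ?_
            surjective := ?_
            map_I := ?_
            isDP := ?_ }⟩
  · ext x
    exact (AlgHom.commutes Φ _).trans (MvPolynomial.eval₂Hom_C _ _ _)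
  · intro b
    exact ⟨algebraMap A _ (MvPolynomial.X b),
      (AlgHom.commutes Φ _).trans (MvPolynomial.eval₂Hom_X' _ _ _)⟩
  · refine le_antisymm hle fun x hx => ?_
    have : Φ.toRingHom (DividedPowerAlgebra.dp A 1 (Finsupp.single ⟨x, hx⟩ 1)) = x := by
      refine (DividedPowerAlgebra.lift_apply_dp hJ hg 1 _).trans ?_
      rw [hJ.dpow_one (hg _)]
      simp [g]
    rw [← this]
    exact Ideal.mem_map_of_mem _ (dp_mem_dpIdeal A one_ne_zero _)
  · refine DividedPowers.IsDPMorphism.on_span hI hJ rfl ?_ ?_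
    · intro s hs
      exact hle (Ideal.mem_map_of_mem _ (Ideal.subset_span hs))
    · rintro m _ ⟨n, c, hn, rfl⟩
      have e1 : hI.dpow m (DividedPowerAlgebra.dp A n c) =
          m.uniformBell n * DividedPowerAlgebra.dp A (m * n) c := by
        rw [← hI1 n, hI.dpow_comp hn (dp_mem_dpIdeal A one_ne_zero c), hI1]
      have e2 : ∀ n, Φ.toRingHom (DividedPowerAlgebra.dp A n c) = hJ.dpow n (g c) :=
        fun n => DividedPowerAlgebra.lift_apply_dp hJ hg n c
      rw [e1, map_mul, map_natCast, e2, e2, hJ.dpow_comp hn (hg c)]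

end Cover

/-! ### Extension of divided powers to the ideal generated by `p` -/

section SupP
variable {p : ℕ} [hp : Fact p.Prime] {B : Type u} [CommRing B] (ι : ℤ_[p] →+* B)

theorem NatTorsionFree.dpow_eq {B : Type*} [CommRing B] (tf : NatTorsionFree B) {I I' : Ideal B}
    (hI : DividedPowers I) (hI' : DividedPowers I') {x : B} (hx : x ∈ I) (hx' : x ∈ I') (n : ℕ) :
    hI.dpow n x = hI'.dpow n x :=
  tf.cancel n.factorial_ne_zero
    (by rw [hI.factorial_mul_dpow_eq_pow hx, hI'.factorial_mul_dpow_eq_pow hx'])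

theorem sum_gammaP (x y : B) (n : ℕ) :
    ∑ k ∈ Finset.HasAntidiagonal.antidiagonal n,
      (ι (gammaP p k.1) * x ^ k.1) * (ι (gammaP p k.2) * y ^ k.2) =
        ι (gammaP p n) * (x + y) ^ n := by
  rw [(Commute.all x y).add_pow', Finset.mul_sum]
  refine Finset.sum_congr rfl fun k hk => ?_
  rw [mul_mul_mul_comm, ← map_mul, gammaP_mul, Finset.HasAntidiagonal.mem_antidiagonal.1 hk,
    map_mul, map_natCast, nsmul_eq_mul]
  ring

/-- The divided powers on `J` extend to `J + p B`. -/
theorem exists_dividedPowers_sup_p {J : Ideal B} (hJ : DividedPowers J) (hc : GammaCompat ι hJ) :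
    ∃ h : DividedPowers (J ⊔ Ideal.span {(p : B)}),
      hJ.IsDPMorphism h (RingHom.id B) ∧ GammaCompat ι h := by
  obtain ⟨c⟩ := exists_torsionFreeCover ι hJ
  have hιF : ∀ x, c.F (c.ι' x) = ι x := fun x => congrArg (fun g : ℤ_[p] →+* B => g x) c.F_ι
  obtain ⟨hI'⟩ : Nonempty (DividedPowers (c.I ⊔ Ideal.span {(p : c.Γ)})) := by
    refine c.torsionFree.exists_dividedPowers (S := c.I ∪ {(p : c.Γ)}) ?_ ?_
    · rw [Ideal.span_union, Ideal.span_eq]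
    · rintro s (hs | rfl) n hn
      · exact ⟨c.hI.dpow n s, Ideal.mem_sup_left (c.hI.dpow_mem hn hs),
          c.hI.factorial_mul_dpow_eq_pow hs⟩
      · refine ⟨c.ι' (gammaP p n), Ideal.mem_sup_right ?_, ?_⟩
        · rw [p_mul_gammaDiv_mem c.ι' hn]
          exact Ideal.mul_mem_right _ _ (Ideal.mem_span_singleton_self _)
        · rw [← map_natCast c.ι', ← map_mul, factorial_mul_gammaP, map_pow, map_natCast]
  have hcomp := GammaCompat.of_torsionFree c.torsionFree c.ι' hI'
  have hpa : ∀ a : c.Γ, (p : c.Γ) * a ∈ c.I ⊔ Ideal.span {(p : c.Γ)} := fun a =>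
    Ideal.mem_sup_right (Ideal.mul_mem_right _ _ (Ideal.mem_span_singleton_self _))
  have hFI : ∀ i ∈ c.I, ∀ n, c.F (hI'.dpow n i) = hJ.dpow n (c.F i) := fun i hi n => by
    rw [c.torsionFree.dpow_eq hI' c.hI (Ideal.mem_sup_left hi) hi, c.isDP.dpow_comp i hi]
  obtain ⟨h, hF⟩ := exists_dividedPowers_of_surjective c.F c.surjective hI'
    (J' := J ⊔ Ideal.span {(p : B)}) (by
      intro z hz hz0 n hn
      obtain ⟨i, hi, b, hb, rfl⟩ := Submodule.mem_sup.1 hz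
      obtain ⟨a, rfl⟩ := Ideal.mem_span_singleton.1 hb
      rw [hI'.dpow_add (Ideal.mem_sup_left hi) (hpa a), map_sum]
      -- An element `i + p a` of the kernel has `F i = - p F(a)`, and the sum that computes the
      -- image of its `n`-th divided power is `γ_n(p) (-F a + F a) ^ n = 0`.
      have hFi : c.F i = p * (-c.F a) := by
        rw [map_add, map_mul, map_natCast] at hz0
        linear_combination hz0
      have hmem : (p : B) * (-c.F a) ∈ J := by
        rw [← hFi]; exact c.map_I.le (Ideal.mem_map_of_mem _ hi)
      have : ∀ k : ℕ × ℕ, c.F (hI'.dpow k.1 i * hI'.dpow k.2 (p * a)) =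
          (ι (gammaP p k.1) * (-c.F a) ^ k.1) * (ι (gammaP p k.2) * c.F a ^ k.2) := fun k => by
        rw [map_mul, hFI i hi, hFi, hc _ _ hmem, hcomp _ _ (hpa a), map_mul, map_pow, hιF]
      rw [Finset.sum_congr rfl fun k _ => this k, sum_gammaP, neg_add_cancel, zero_pow hn,
        mul_zero])
    (by rw [Ideal.map_sup, c.map_I, Ideal.map_span, Set.image_singleton, map_natCast])
  refine ⟨h, ⟨by rw [Ideal.map_id]; exact le_sup_left, fun {n} a ha => ?_⟩, fun n a ha => ?_⟩
  · obtain ⟨i, hi, rfl⟩ :=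
      (Ideal.mem_map_iff_of_surjective c.F c.surjective).1 (c.map_I.ge ha)
    rw [RingHom.id_apply, hF.dpow_comp i (Ideal.mem_sup_left hi), hFI i hi, RingHom.id_apply]
  · obtain ⟨a, rfl⟩ := c.surjective a
    have e : (p : B) * c.F a = c.F (p * a) := by rw [map_mul, map_natCast]
    rw [e, hF.dpow_comp _ (hpa a), hcomp _ _ (hpa a), map_mul, map_pow,
      hιF]

end SupP

/-! ### Flat extensions of divided powers -/

section Flat
variable {p : ℕ} [hp : Fact p.Prime] {B B' : Type u} [CommRing B] [CommRing B'] [Algebra B B']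
  {J : Ideal B} (hJ : DividedPowers J)

/-- The series `∑ x^{[n]} b ^ n X ^ n`. -/
noncomputable def dpSeries (x : B) (b : B') : PowerSeries B' :=
  PowerSeries.mk fun n => b ^ n * algebraMap B B' (hJ.dpow n x)

theorem dpSeries_add_left {x y : B} (hx : x ∈ J) (hy : y ∈ J) (b : B') :
    dpSeries hJ (x + y) b = dpSeries hJ x b * dpSeries hJ y b := by
  ext n
  rw [PowerSeries.coeff_mul, dpSeries, PowerSeries.coeff_mk, hJ.dpow_add hx hy, map_sum,
    Finset.mul_sum]
  refine Finset.sum_congr rfl fun k hk => ?_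
  rw [dpSeries, dpSeries, PowerSeries.coeff_mk, PowerSeries.coeff_mk,
    ← Finset.HasAntidiagonal.mem_antidiagonal.1 hk, map_mul, pow_add]
  ring

theorem dpSeries_add_right {x : B} (hx : x ∈ J) (b b' : B') :
    dpSeries hJ x (b + b') = dpSeries hJ x b * dpSeries hJ x b' := by
  ext n
  rw [PowerSeries.coeff_mul, dpSeries, PowerSeries.coeff_mk, (Commute.all b b').add_pow',
    Finset.sum_mul]
  refine Finset.sum_congr rfl fun k hk => ?_
  have h := congrArg (algebraMap B B') (hJ.mul_dpow (m := k.1) (n := k.2) hx)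
  rw [map_mul, map_mul, map_natCast, Finset.HasAntidiagonal.mem_antidiagonal.1 hk] at h
  rw [dpSeries, dpSeries, PowerSeries.coeff_mk, PowerSeries.coeff_mk, mul_mul_mul_comm, h,
    nsmul_eq_mul]
  ring

theorem dpSeries_smul {x : B} (hx : x ∈ J) (r : B) (b : B') :
    dpSeries hJ (r * x) b = dpSeries hJ x (r • b) := by
  ext n
  rw [dpSeries, dpSeries, PowerSeries.coeff_mk, PowerSeries.coeff_mk, hJ.dpow_mul hx, map_mul,
    map_pow, Algebra.smul_def]
  ring

theorem dpSeries_zero_left (b : B') : dpSeries hJ 0 b = 1 := by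
  ext n
  rw [dpSeries, PowerSeries.coeff_mk, PowerSeries.coeff_one]
  split_ifs with hn
  · rw [hn, hJ.dpow_zero J.zero_mem]; simp
  · rw [hJ.dpow_eval_zero hn]; simp

theorem dpSeries_zero_right {x : B} (hx : x ∈ J) : dpSeries hJ x (0 : B') = 1 := by
  ext n
  rw [dpSeries, PowerSeries.coeff_mk, PowerSeries.coeff_one]
  split_ifs with hn
  · rw [hn, hJ.dpow_zero hx]; simp
  · simp [hn]

/-- The homomorphism `J ⊗ B' → B'[[X]]`, from sums to products, that sends `x ⊗ b` to
`∑ x^{[n]} b ^ n X ^ n`. -/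
noncomputable def dpSeriesHom : TensorProduct B J B' →+ Additive (PowerSeries B') :=
  TensorProduct.liftAddHom
    { toFun := fun x =>
        { toFun := fun b => Additive.ofMul (dpSeries hJ (x : B) b)
          map_zero' := congrArg Additive.ofMul (dpSeries_zero_right hJ x.2)
          map_add' := fun b b' => congrArg Additive.ofMul (dpSeries_add_right hJ x.2 b b') }
      map_zero' := by
        exact AddMonoidHom.ext fun b => congrArg Additive.ofMul (dpSeries_zero_left hJ b)
      map_add' := fun x y => by
        exact AddMonoidHom.ext fun b =>
          congrArg Additive.ofMul (dpSeries_add_left hJ x.2 y.2 b) }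
    (fun r x b => congrArg Additive.ofMul (dpSeries_smul hJ x.2 r b))

theorem dpSeriesHom_tmul (x : J) (b : B') :
    (dpSeriesHom hJ (TensorProduct.tmul B x b)).toMul = dpSeries hJ (x : B) b := rfl

theorem dpSeriesHom_lTensor (a : B') (t : TensorProduct B J B') (n : ℕ) :
    PowerSeries.coeff n (dpSeriesHom hJ ((LinearMap.mulLeft B a).lTensor J t)).toMul =
      a ^ n * PowerSeries.coeff n (dpSeriesHom hJ t).toMul := by
  have : (dpSeriesHom hJ ((LinearMap.mulLeft B a).lTensor J t)).toMul =
      PowerSeries.rescale a (dpSeriesHom hJ t).toMul := by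
    induction t with
    | zero => simp
    | add x y hx hy => simp only [map_add, toMul_add, hx, hy, map_mul]
    | tmul x b =>
      rw [LinearMap.lTensor_tmul, dpSeriesHom_tmul, dpSeriesHom_tmul, LinearMap.mulLeft_apply]
      ext m
      rw [PowerSeries.coeff_rescale, dpSeries, dpSeries, PowerSeries.coeff_mk, PowerSeries.coeff_mk]
      ring
  rw [this, PowerSeries.coeff_rescale]

/-- Divided powers extend along flat ring homomorphisms. -/
theorem exists_dividedPowers_flat [Module.Flat B B'] (ι : ℤ_[p] →+* B) :
    ∃ h : DividedPowers (J.map (algebraMap B B')), hJ.IsDPMorphism h (algebraMap B B') := by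
  obtain ⟨c⟩ := exists_torsionFreeCover ι hJ
  -- A polynomial ring over a torsion-free cover of `B` maps onto `B'`. Its divided powers descend
  -- to `J B'` because the coefficients of the divided power series depend only on the element of `J
  -- ⊗ B'`, and `J ⊗ B' → B'` is injective.
  let G : MvPolynomial B' c.Γ →+* B' := MvPolynomial.eval₂Hom ((algebraMap B B').comp c.F) id
  have hGC : ∀ x, G (MvPolynomial.C x) = algebraMap B B' (c.F x) :=
    fun x => MvPolynomial.eval₂Hom_C _ _ _
  have hG : Function.Surjective G := fun b =>
    ⟨MvPolynomial.X b, MvPolynomial.eval₂Hom_X' _ _ _⟩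
  have tf := mvPolynomial_natTorsionFree c.torsionFree B'
  obtain ⟨hI⟩ : Nonempty (DividedPowers (c.I.map (MvPolynomial.C (σ := B')))) := by
    refine tf.exists_dividedPowers rfl ?_
    rintro _ ⟨i, hi, rfl⟩ n hn
    refine ⟨MvPolynomial.C (c.hI.dpow n i), Ideal.mem_map_of_mem _ (c.hI.dpow_mem hn hi), ?_⟩
    rw [← map_natCast MvPolynomial.C, ← map_mul, c.hI.factorial_mul_dpow_eq_pow hi, map_pow]
  have hIC : ∀ i ∈ c.I, ∀ n, hI.dpow n (MvPolynomial.C i) = MvPolynomial.C (c.hI.dpow n i) := by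
    intro i hi n
    refine tf.cancel n.factorial_ne_zero ?_
    rw [hI.factorial_mul_dpow_eq_pow (Ideal.mem_map_of_mem _ hi),
      ← map_natCast MvPolynomial.C, ← map_mul, c.hI.factorial_mul_dpow_eq_pow hi, map_pow]
  let μ : TensorProduct B J B' →ₗ[B] B' :=
    TensorProduct.lift ((LinearMap.lsmul B B').comp J.subtype)
  have hμ : Function.Injective μ := by
    have h := Module.Flat.rTensor_preserves_injective_linearMap (M := B') J.subtype
      J.subtype_injective
    have e : μ = (TensorProduct.lid B B').toLinearMap ∘ₗ J.subtype.rTensor B' :=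
      TensorProduct.ext' fun x b => by simp [μ]
    rw [e]
    exact (TensorProduct.lid B B').injective.comp h
  have key : ∀ z ∈ c.I.map (MvPolynomial.C (σ := B')), ∃ t : TensorProduct B J B',
      μ t = G z ∧ ∀ n, PowerSeries.coeff n (dpSeriesHom hJ t).toMul = G (hI.dpow n z) := by
    intro z hz
    induction hz using Submodule.span_induction with
    | mem z hz =>
      obtain ⟨i, hi, rfl⟩ := hz
      have hFi : c.F i ∈ J := c.map_I.le (Ideal.mem_map_of_mem _ hi)
      refine ⟨TensorProduct.tmul B ⟨c.F i, hFi⟩ 1, ?_, fun n => ?_⟩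
      · rw [hGC]
        simp [μ, Algebra.smul_def]
      · rw [dpSeriesHom_tmul, dpSeries, PowerSeries.coeff_mk, one_pow, one_mul, hIC i hi, hGC,
          c.isDP.dpow_comp i hi]
    | zero =>
      refine ⟨0, by simp, fun n => ?_⟩
      rw [map_zero, toMul_zero, PowerSeries.coeff_one]
      split_ifs with hn
      · rw [hn, hI.dpow_zero (zero_mem _), map_one]
      · rw [hI.dpow_eval_zero hn, map_zero]
    | add x y hx hy hx' hy' =>
      obtain ⟨t, ht, ht'⟩ := hx'
      obtain ⟨s, hs, hs'⟩ := hy'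
      refine ⟨t + s, by rw [map_add, map_add, ht, hs], fun n => ?_⟩
      rw [map_add, toMul_add, PowerSeries.coeff_mul, hI.dpow_add hx hy, map_sum]
      exact Finset.sum_congr rfl fun k _ => by rw [ht', hs', map_mul]
    | smul a x hx hx' =>
      obtain ⟨t, ht, ht'⟩ := hx'
      refine ⟨(LinearMap.mulLeft B (G a)).lTensor J t, ?_, fun n => ?_⟩
      · rw [smul_eq_mul, map_mul, ← ht]
        clear ht ht'
        induction t with
        | zero => simp
        | add x y hx hy => rw [map_add, map_add, hx, hy, map_add, mul_add]
        | tmul x b => simp [μ]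
      · rw [dpSeriesHom_lTensor, ht', smul_eq_mul, hI.dpow_mul hx, map_mul, map_pow]
  obtain ⟨h, hh⟩ := exists_dividedPowers_of_surjective G hG hI
    (J' := J.map (algebraMap B B')) (by
      intro z hz hz0 n hn
      obtain ⟨t, ht, ht'⟩ := key z hz
      rw [hz0] at ht
      rw [← ht', (injective_iff_map_eq_zero μ).1 hμ t ht, map_zero, toMul_zero,
        PowerSeries.coeff_one, if_neg hn])
    (by
      rw [Ideal.map_map, show G.comp MvPolynomial.C = (algebraMap B B').comp c.F from
        RingHom.ext hGC, ← Ideal.map_map, c.map_I])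
  refine ⟨h, le_rfl, fun {n} a ha => ?_⟩
  have h0 : ∀ a ∈ J, h.dpow n (algebraMap B B' a) = algebraMap B B' (hJ.dpow n a) := by
    intro a ha
    obtain ⟨i, hi, rfl⟩ :=
      (Ideal.mem_map_iff_of_surjective c.F c.surjective).1 (c.map_I.ge ha)
    rw [← hGC, hh.dpow_comp _ (Ideal.mem_map_of_mem _ hi), hIC i hi, hGC, c.isDP.dpow_comp i hi]
  exact h0 a ha

/-- By the equational criterion of flatness, an element `a` with `p a ∈ J B'` is a linear
combination of elements `x` of `B` with `p x ∈ J`. -/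
theorem gammaCompat_of_flat [Module.Flat B B'] (ι : ℤ_[p] →+* B) (hc : GammaCompat ι hJ)
    (h : DividedPowers (J.map (algebraMap B B'))) (hh : hJ.IsDPMorphism h (algebraMap B B')) :
    GammaCompat ((algebraMap B B').comp ι) h := by
  intro n a ha
  let P : B' → Prop := fun a => (p : B') * a ∈ J.map (algebraMap B B') ∧
    ∀ n, h.dpow n (p * a) = ((algebraMap B B').comp ι) (gammaP p n) * a ^ n
  have hP0 : P 0 := by
    refine ⟨by simp, fun n => ?_⟩
    rcases eq_or_ne n 0 with rfl | hn
    · simp [gammaP_zero, h.dpow_zero (zero_mem _)]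
    · rw [mul_zero, h.dpow_eval_zero hn, zero_pow hn, mul_zero]
  have hPadd : ∀ x y, P x → P y → P (x + y) := fun x y hx hy => by
    refine ⟨by rw [mul_add]; exact add_mem hx.1 hy.1, fun n => ?_⟩
    rw [mul_add, h.dpow_add hx.1 hy.1, ← sum_gammaP]
    exact Finset.sum_congr rfl fun k _ => by rw [hx.2, hy.2]
  have hPmul : ∀ (x : B) (y : B'), (p : B) * x ∈ J → P (x • y) := fun x y hx => by
    have e : (p : B') * (x • y) = y * algebraMap B B' (p * x) := by
      rw [Algebra.smul_def, map_mul, map_natCast]; ring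
    refine ⟨by rw [e]; exact Ideal.mul_mem_left _ _ (Ideal.mem_map_of_mem _ hx), fun n => ?_⟩
    rw [e, h.dpow_mul (Ideal.mem_map_of_mem _ hx), hh.dpow_comp _ hx, hc _ _ hx, map_mul, map_pow,
      RingHom.comp_apply, Algebra.smul_def]
    ring
  suffices hPa : P a from hPa.2 n
  obtain ⟨k, j, b, hjb⟩ : ∃ (k : ℕ) (j : Fin k → J) (b : Fin k → B'),
      (p : B') * a = ∑ i, (j i : B) • b i := by
    have ha' := ha
    rw [Ideal.map, Ideal.span, Submodule.mem_span_set'] at ha'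
    obtain ⟨k, b, s, hs⟩ := ha'
    choose j hj hj' using fun i => (s i).2
    refine ⟨k, fun i => ⟨j i, hj i⟩, b, ?_⟩
    rw [← hs]
    exact Finset.sum_congr rfl fun i _ => by
      show b i * _ = j i • b i
      rw [Algebra.smul_def, hj', mul_comm]
  have hrel : ∑ i : Option (Fin k), (Option.elim i (p : B) (fun i => (j i : B))) •
      (Option.elim i a (fun i => - b i) : B') = 0 := by
    rw [Fintype.sum_option]
    simp only [Option.elim_none, Option.elim_some, smul_neg, Finset.sum_neg_distrib]
    rw [← hjb, Algebra.smul_def, map_natCast, add_neg_cancel]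
  obtain ⟨κ, c, y, h1, h2⟩ := Module.Flat.isTrivialRelation_of_sum_smul_eq_zero (R := B) (M := B') hrel
  have ha2 := h1 none
  simp only [Option.elim_none] at ha2
  rw [ha2]
  refine Finset.sum_induction _ P hPadd hP0 fun l _ => hPmul _ _ ?_
  have h3 := h2 l
  rw [Fintype.sum_option] at h3
  simp only [Option.elim_none, Option.elim_some] at h3
  rw [eq_neg_of_add_eq_zero_left h3]
  exact J.neg_mem (J.sum_mem fun i _ => J.mul_mem_right _ (j i).2)

end Flat

/-! ### Witt vectors of length two -/

section WittTwo

theorem exists_add_pow_eq_powDefect (p : ℕ) [hp : Fact p.Prime] {B : Type*} [CommRing B] (x y : B) :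
    (x + y) ^ p = x ^ p + y ^ p +
      p * ∑ i ∈ Finset.Ico 1 p, ((p.choose i / p : ℕ) : B) * x ^ i * y ^ (p - i) := by
  have hp1 := hp.out.one_lt
  rw [add_pow, Finset.sum_range_succ, Finset.range_eq_Ico,
    Finset.sum_eq_sum_Ico_succ_bot hp.out.pos, Finset.mul_sum]
  have : ∀ i ∈ Finset.Ico 1 p, (p : B) * (((p.choose i / p : ℕ) : B) * x ^ i * y ^ (p - i)) =
      x ^ i * y ^ (p - i) * (p.choose i : B) := fun i hi => by
    rw [Finset.mem_Ico] at hi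
    have h : p * (p.choose i / p) = p.choose i :=
      Nat.mul_div_cancel' (hp.out.dvd_choose_self (by omega) hi.2)
    have h' : (p : B) * ((p.choose i / p : ℕ) : B) = (p.choose i : B) := by
      rw [← Nat.cast_mul, h]
    rw [← h']; ring
  rw [Finset.sum_congr rfl this]
  simp
  ring

/-- The polynomial `((x + y) ^ p - x ^ p - y ^ p) / p`. -/
def powDefect (p : ℕ) {B : Type*} [CommRing B] (x y : B) : B :=
  ∑ i ∈ Finset.Ico 1 p, ((p.choose i / p : ℕ) : B) * x ^ i * y ^ (p - i)

theorem add_pow_eq_powDefect (p : ℕ) [Fact p.Prime] {B : Type*} [CommRing B] (x y : B) :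
    (x + y) ^ p = x ^ p + y ^ p + p * powDefect p x y :=
  exists_add_pow_eq_powDefect p x y

theorem map_powDefect (p : ℕ) {B B' : Type*} [CommRing B] [CommRing B'] (f : B →+* B') (x y : B) :
    f (powDefect p x y) = powDefect p (f x) (f y) := by
  simp [powDefect, map_sum]

theorem powDefect_zero_right (p : ℕ) {B : Type*} [CommRing B] (x : B) : powDefect p x 0 = 0 := by
  refine Finset.sum_eq_zero fun i hi => ?_
  rw [Finset.mem_Ico] at hi
  rw [zero_pow (by omega), mul_zero]

theorem powDefect_zero_left (p : ℕ) {B : Type*} [CommRing B] (x : B) : powDefect p 0 x = 0 := by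
  refine Finset.sum_eq_zero fun i hi => ?_
  rw [Finset.mem_Ico] at hi
  rw [zero_pow (by omega), mul_zero, zero_mul]

/-- The ring `W₂(B)` of `p`-typical Witt vectors of length two. -/
@[ext]
structure W2 (p : ℕ) (B : Type u) where
  c0 : B
  c1 : B

namespace W2
variable {p : ℕ} {B : Type u} {B' : Type v} [CommRing B] [CommRing B']

instance : Zero (W2 p B) := ⟨⟨0, 0⟩⟩
instance : One (W2 p B) := ⟨⟨1, 0⟩⟩
instance : Add (W2 p B) := ⟨fun x y => ⟨x.c0 + y.c0, x.c1 + y.c1 - powDefect p x.c0 y.c0⟩⟩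
instance : Mul (W2 p B) :=
  ⟨fun x y => ⟨x.c0 * y.c0, x.c0 ^ p * y.c1 + x.c1 * y.c0 ^ p + p * (x.c1 * y.c1)⟩⟩
instance : Neg (W2 p B) := ⟨fun x => ⟨-x.c0, -x.c1 + powDefect p (-x.c0) x.c0⟩⟩

@[simp] theorem zero_c0 : (0 : W2 p B).c0 = 0 := rfl
@[simp] theorem zero_c1 : (0 : W2 p B).c1 = 0 := rfl
@[simp] theorem one_c0 : (1 : W2 p B).c0 = 1 := rfl
@[simp] theorem one_c1 : (1 : W2 p B).c1 = 0 := rfl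
@[simp] theorem add_c0 (x y : W2 p B) : (x + y).c0 = x.c0 + y.c0 := rfl
theorem add_c1 (x y : W2 p B) : (x + y).c1 = x.c1 + y.c1 - powDefect p x.c0 y.c0 := rfl
@[simp] theorem mul_c0 (x y : W2 p B) : (x * y).c0 = x.c0 * y.c0 := rfl
theorem mul_c1 (x y : W2 p B) :
    (x * y).c1 = x.c0 ^ p * y.c1 + x.c1 * y.c0 ^ p + p * (x.c1 * y.c1) := rfl
@[simp] theorem neg_c0 (x : W2 p B) : (-x).c0 = -x.c0 := rfl
theorem neg_c1 (x : W2 p B) : (-x).c1 = -x.c1 + powDefect p (-x.c0) x.c0 := rfl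

/-- The second ghost component. -/
def ghost (x : W2 p B) : B := x.c0 ^ p + p * x.c1

theorem ext_ghost [hp : Fact p.Prime] (tf : NatTorsionFree B) {x y : W2 p B} (h0 : x.c0 = y.c0)
    (h1 : x.ghost = y.ghost) : x = y := by
  refine W2.ext h0 (tf.cancel hp.out.ne_zero ?_)
  rw [ghost, ghost, h0] at h1
  exact add_left_cancel h1

theorem ghost_add [Fact p.Prime] (x y : W2 p B) : (x + y).ghost = x.ghost + y.ghost := by
  simp only [ghost, add_c0, add_c1, add_pow_eq_powDefect]; ring

theorem ghost_mul (x y : W2 p B) : (x * y).ghost = x.ghost * y.ghost := by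
  simp only [ghost, mul_c0, mul_c1]; ring

theorem ghost_zero [hp : Fact p.Prime] : (0 : W2 p B).ghost = 0 := by
  simp [ghost, hp.out.ne_zero]

theorem ghost_one : (1 : W2 p B).ghost = 1 := by simp [ghost]

/-- The map `W₂(B) → W₂(B')` induced by a ring homomorphism, as a function. -/
def mapFun (f : B →+* B') (x : W2 p B) : W2 p B' := ⟨f x.c0, f x.c1⟩

theorem mapFun_add (f : B →+* B') (x y : W2 p B) :
    mapFun f (x + y) = mapFun f x + mapFun f y := by
  ext <;> simp [mapFun, add_c1, map_powDefect]

theorem mapFun_mul (f : B →+* B') (x y : W2 p B) :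
    mapFun f (x * y) = mapFun f x * mapFun f y := by
  ext <;> simp [mapFun, mul_c1]

theorem mapFun_surjective (f : B →+* B') (hf : Function.Surjective f) :
    Function.Surjective (mapFun (p := p) f) := fun x => by
  obtain ⟨a, ha⟩ := hf x.c0
  obtain ⟨b, hb⟩ := hf x.c1
  exact ⟨⟨a, b⟩, W2.ext ha hb⟩

theorem exists_cover (B : Type u) [CommRing B] :
    NatTorsionFree (MvPolynomial B ℤ) ∧ ∃ f : MvPolynomial B ℤ →+* B, Function.Surjective f :=
  ⟨mvPolynomial_natTorsionFree NatTorsionFree.of_charZero_domain _,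
    MvPolynomial.eval₂Hom (Int.castRingHom B) id,
    fun b => ⟨MvPolynomial.X b, MvPolynomial.eval₂Hom_X' _ _ _⟩⟩

instance [hp : Fact p.Prime] : CommRing (W2 p B) :=
  -- The identities hold in the torsion-free case by comparison of ghost components, and they
  -- are preserved under quotients.
  CommRing.ofMinimalAxioms
    (fun x y z => by
      obtain ⟨tf, f, hf⟩ := exists_cover B
      obtain ⟨x, rfl⟩ := mapFun_surjective f hf x
      obtain ⟨y, rfl⟩ := mapFun_surjective f hf y
      obtain ⟨z, rfl⟩ := mapFun_surjective f hf z
      simp only [← mapFun_add]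
      congr 1
      exact ext_ghost tf (add_assoc _ _ _) (by simp only [ghost_add]; ring))
    (fun x => by ext <;> simp [add_c1, powDefect_zero_left])
    (fun x => by ext <;> simp [add_c1, neg_c1])
    (fun x y z => by ext <;> simp [mul_c1] <;> ring)
    (fun x y => by ext <;> simp [mul_c1] <;> ring)
    (fun x => by ext <;> simp [mul_c1])
    (fun x y z => by
      obtain ⟨tf, f, hf⟩ := exists_cover B
      obtain ⟨x, rfl⟩ := mapFun_surjective f hf x
      obtain ⟨y, rfl⟩ := mapFun_surjective f hf y
      obtain ⟨z, rfl⟩ := mapFun_surjective f hf z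
      simp only [← mapFun_add, ← mapFun_mul]
      congr 1
      exact ext_ghost tf (mul_add _ _ _) (by simp only [ghost_add, ghost_mul]; ring))

variable [hp : Fact p.Prime]

/-- The projection `W₂(B) → B` to the first component. -/
def fst (p : ℕ) [Fact p.Prime] (B : Type u) [CommRing B] : W2 p B →+* B where
  toFun := c0
  map_one' := rfl
  map_mul' _ _ := rfl
  map_zero' := rfl
  map_add' _ _ := rfl

@[simp] theorem fst_apply (x : W2 p B) : fst p B x = x.c0 := rfl

/-- The second ghost component `(x₀, x₁) ↦ x₀ ^ p + p x₁` as a ring homomorphism. -/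
def ghostHom (p : ℕ) [Fact p.Prime] (B : Type u) [CommRing B] : W2 p B →+* B where
  toFun := ghost
  map_one' := ghost_one
  map_mul' := ghost_mul
  map_zero' := ghost_zero
  map_add' := ghost_add

theorem ghostHom_apply (x : W2 p B) : ghostHom p B x = x.c0 ^ p + p * x.c1 := rfl

/-- The homomorphism `W₂(B) → W₂(B')` induced by a ring homomorphism. -/
def map (f : B →+* B') : W2 p B →+* W2 p B' where
  toFun := mapFun f
  map_one' := by ext <;> simp [mapFun]
  map_mul' := mapFun_mul f
  map_zero' := by ext <;> simp [mapFun]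
  map_add' := mapFun_add f

@[simp] theorem map_c0 (f : B →+* B') (x : W2 p B) : (map f x).c0 = f x.c0 := rfl
@[simp] theorem map_c1 (f : B →+* B') (x : W2 p B) : (map f x).c1 = f x.c1 := rfl

theorem ext_ghostHom (tf : NatTorsionFree B) {x y : W2 p B} (h0 : fst p B x = fst p B y)
    (h1 : ghostHom p B x = ghostHom p B y) : x = y := ext_ghost tf h0 h1

theorem natTorsionFree (tf : NatTorsionFree B) : NatTorsionFree (W2 p B) := fun n hn x hx => by
  have h0 := congrArg (fst p B) hx
  have h1 := congrArg (ghostHom p B) hx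
  rw [map_mul, map_natCast, map_zero] at h0 h1
  exact ext_ghost tf (tf n hn _ h0) ((tf n hn _ h1).trans ghost_zero.symm)

/-- The Teichmüller element `[x]`. -/
def teich (p : ℕ) {B : Type u} [CommRing B] (x : B) : W2 p B := ⟨x, 0⟩

/-- The Verschiebung. -/
def V (p : ℕ) {B : Type u} [CommRing B] (x : B) : W2 p B := ⟨0, x⟩


theorem eq_teich_add_V (x : W2 p B) : x = teich p x.c0 + V p x.c1 := by
  ext <;> simp [teich, V, add_c1, powDefect_zero_right]

theorem teich_pow (x : B) (n : ℕ) : teich p x ^ n = teich p (x ^ n) := by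
  induction n with
  | zero => ext <;> simp [teich]
  | succ n ih => rw [pow_succ, ih]; ext <;> simp [teich, mul_c1, pow_succ]

theorem natCast_p : (p : W2 p B) = ⟨p, 1 - p ^ (p - 1)⟩ := by
  have h : (p : W2 p ℤ) = ⟨p, 1 - p ^ (p - 1)⟩ := by
    refine ext_ghost NatTorsionFree.of_charZero_domain (map_natCast (fst p ℤ) p) ?_
    refine (map_natCast (ghostHom p ℤ) p).trans ?_
    have : (p : ℤ) ^ p = p * p ^ (p - 1) := by
      rw [← pow_succ', Nat.sub_add_cancel hp.out.one_le]
    rw [ghost, this]; ring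
  have := congrArg (map (Int.castRingHom B)) h
  rw [map_natCast] at this
  rw [this]
  ext <;> simp

theorem p_mul_V (y : B) : (p : W2 p B) * V p y = V p (p * y) := by
  have : (p : B) ^ p = p ^ (p - 1) * p := by
    rw [← pow_succ, Nat.sub_add_cancel hp.out.one_le]
  rw [natCast_p]
  ext
  · simp [V]
  · simp [V, mul_c1, hp.out.ne_zero, this]; ring

theorem isNilpotent_p (h : IsNilpotent (p : B)) : IsNilpotent (p : W2 p B) := by
  obtain ⟨n, hn⟩ := h
  have h0 : ((p : W2 p B) ^ n).c0 = 0 := by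
    have := map_pow (fst p B) (p : W2 p B) n
    rw [map_natCast, hn] at this
    exact this
  have h1 : ∀ k (y : B), (p : W2 p B) ^ k * V p y = V p ((p : B) ^ k * y) := by
    intro k y
    induction k with
    | zero => simp
    | succ k ih => rw [pow_succ', mul_assoc, ih, p_mul_V, pow_succ', mul_assoc]
  have h2 : (p : W2 p B) ^ n = V p ((p : W2 p B) ^ n).c1 := by
    ext
    · exact h0
    · rfl
  refine ⟨n + n, ?_⟩
  rw [pow_add]
  nth_rewrite 2 [h2]
  rw [h1, hn, zero_mul]
  rfl

/-- The homomorphism `A → W₂(A)` with ghost components `id` and `σ`, for a Frobenius lift `σ` on a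
torsion-free ring. -/
noncomputable def ofFrobeniusLift (tf : NatTorsionFree B) (σ : B →+* B)
    (h : ∀ a, ∃ b, σ a = a ^ p + p * b) : B →+* W2 p B where
  toFun a := ⟨a, (h a).choose⟩
  map_one' := ext_ghost tf rfl ((h 1).choose_spec.symm.trans ((map_one σ).trans ghost_one.symm))
  map_mul' a b := ext_ghost tf rfl (by
    rw [ghost_mul]
    exact (h (a * b)).choose_spec.symm.trans ((map_mul σ a b).trans
      (congrArg₂ _ (h a).choose_spec (h b).choose_spec)))
  map_zero' := ext_ghost tf rfl ((h 0).choose_spec.symm.trans ((map_zero σ).trans ghost_zero.symm))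
  map_add' a b := ext_ghost tf rfl (by
    rw [ghost_add]
    exact (h (a + b)).choose_spec.symm.trans ((map_add σ a b).trans
      (congrArg₂ _ (h a).choose_spec (h b).choose_spec)))

theorem ghostHom_ofFrobeniusLift (tf : NatTorsionFree B) (σ : B →+* B)
    (h : ∀ a, ∃ b, σ a = a ^ p + p * b) (a : B) :
    ghostHom p B (ofFrobeniusLift tf σ h a) = σ a := (h a).choose_spec.symm

theorem padicInt_frobenius (a : ℤ_[p]) : ∃ b, RingHom.id ℤ_[p] a = a ^ p + p * b := by
  have : a - a ^ p ∈ RingHom.ker (PadicInt.toZMod (p := p)) := by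
    rw [RingHom.mem_ker, map_sub, map_pow, ZMod.pow_card, sub_self]
  rw [PadicInt.ker_toZMod, PadicInt.maximalIdeal_eq_span_p, Ideal.mem_span_singleton] at this
  obtain ⟨b, hb⟩ := this
  exact ⟨b, by rw [RingHom.id_apply, ← hb]; ring⟩

/-- The `ℤ_p`-algebra structure of `W₂(B)` for a `ℤ_p`-algebra `B`. -/
noncomputable def padicInt (ι : ℤ_[p] →+* B) : ℤ_[p] →+* W2 p B :=
  (map ι).comp (ofFrobeniusLift NatTorsionFree.of_charZero_domain (RingHom.id _) padicInt_frobenius)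

/-! ### Divided powers on Witt vectors -/

/-- The ideal of `W₂(B)` of all `(x₀, x₁)` with `x₀ ∈ J`. -/
def ideal (p : ℕ) [Fact p.Prime] (J : Ideal B) : Ideal (W2 p B) := J.comap (fst p B)

theorem mem_ideal {J : Ideal B} {x : W2 p B} : x ∈ ideal p J ↔ x.c0 ∈ J := Iff.rfl

theorem ideal_eq_span (J : Ideal B) :
    ideal p J = Ideal.span (teich p '' J ∪ Set.range (V p)) := by
  refine le_antisymm (fun x hx => ?_) (Ideal.span_le.2 ?_)
  · rw [eq_teich_add_V x]
    exact add_mem (Ideal.subset_span (Or.inl ⟨_, hx, rfl⟩)) (Ideal.subset_span (Or.inr ⟨_, rfl⟩))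
  · rintro _ (⟨x, hx, rfl⟩ | ⟨y, rfl⟩)
    · exact hx
    · exact J.zero_mem

/-- The integer `((p n)! / n! - (p n)! / n! ^ p) / p`. -/
def teichCoeff (p n : ℕ) : ℤ :=
  (n * ((p * n - 1).factorial / n.factorial) : ℕ) - ((p - 1).factorial * Nat.uniformBell p n : ℕ)

theorem factorial_mul_teichCoeff {n : ℕ} (hn : n ≠ 0) :
    (n.factorial : ℤ) * (p.factorial * Nat.uniformBell p n + p * teichCoeff p n) =
      (p * n).factorial := by
  have h1 : (p : ℤ) * (p - 1).factorial = p.factorial := by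
    exact_mod_cast Nat.mul_factorial_pred hp.out.ne_zero
  have hd : n.factorial ∣ (p * n - 1).factorial := Nat.factorial_dvd_factorial (by
    have := Nat.mul_le_mul_right n hp.out.two_le
    omega)
  have h2 : (n.factorial : ℤ) * ((p * n - 1).factorial / n.factorial : ℕ) =
      (p * n - 1).factorial := by
    exact_mod_cast Nat.mul_div_cancel' hd
  have h3 : (p * n : ℤ) * (p * n - 1).factorial = (p * n).factorial := by
    exact_mod_cast Nat.mul_factorial_pred (Nat.mul_ne_zero hp.out.ne_zero hn)
  rw [teichCoeff, ← h1, ← h3, ← h2]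
  push_cast
  ring


theorem dpow_pow {J : Ideal B} (hJ : DividedPowers J) {x : B} (hx : x ∈ J) {n : ℕ} (hn : n ≠ 0) :
    hJ.dpow n x ^ p = ((p.factorial * Nat.uniformBell p n : ℕ) : B) * hJ.dpow (p * n) x := by
  rw [← hJ.factorial_mul_dpow_eq_pow (hJ.dpow_mem hn hx), hJ.dpow_comp hn hx]
  push_cast; ring

/-- The `n`-th divided power of `[x]`. -/
def dpowTeich {J : Ideal B} (hJ : DividedPowers J) (n : ℕ) (x : B) : W2 p B :=
  ⟨hJ.dpow n x, teichCoeff p n * hJ.dpow (p * n) x⟩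

theorem ghostHom_dpowTeich {J : Ideal B} (hJ : DividedPowers J) {x : B} (hx : x ∈ J) {n : ℕ}
    (hn : n ≠ 0) : ghostHom p B (dpowTeich hJ n x) =
      ((p.factorial * Nat.uniformBell p n + p * teichCoeff p n : ℤ) : B) * hJ.dpow (p * n) x := by
  rw [ghostHom_apply, dpowTeich, dpow_pow hJ hx hn]
  push_cast; ring

theorem factorial_mul_dpowTeich (tf : NatTorsionFree B) {J : Ideal B} (hJ : DividedPowers J) {x : B}
    (hx : x ∈ J) {n : ℕ} (hn : n ≠ 0) :
    (n.factorial : W2 p B) * dpowTeich hJ n x = teich p x ^ n := by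
  refine ext_ghostHom tf ?_ ?_
  · rw [map_mul, map_natCast, map_pow]
    exact hJ.factorial_mul_dpow_eq_pow hx
  · rw [map_mul, map_natCast, ghostHom_dpowTeich hJ hx hn, teich_pow, ← mul_assoc]
    have := congrArg (Int.cast (R := B)) (factorial_mul_teichCoeff (p := p) hn)
    rw [Int.cast_mul, Int.cast_natCast, Int.cast_natCast] at this
    rw [this, hJ.factorial_mul_dpow_eq_pow hx]
    simp [ghostHom_apply, teich, mul_comm p n, pow_mul]

theorem factorial_mul_V (tf : NatTorsionFree B) (ι : ℤ_[p] →+* B) (y : B) {n : ℕ} (hn : n ≠ 0) :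
    (n.factorial : W2 p B) * V p (ι (gammaDiv p n) * y ^ n) = V p y ^ n := by
  refine ext_ghostHom tf ?_ ?_
  · rw [map_mul, map_natCast, map_pow]
    simp [V, hn]
  · have h := congrArg ι (factorial_mul_gammaP p n)
    rw [map_mul, map_natCast, map_pow, map_natCast, p_mul_gammaDiv_mem ι hn] at h
    rw [map_mul, map_natCast, map_pow, ghostHom_apply, ghostHom_apply]
    simp only [V, zero_pow hp.out.ne_zero, zero_add]
    rw [mul_pow, ← h]; ring

/-- If `B` is torsion-free, so is `W₂(B)`, and it suffices to divide the powers of the elements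
`[x]` and `V(y)`, which generate the ideal, by factorials. -/
theorem exists_dividedPowers_of_torsionFree (tf : NatTorsionFree B) (ι : ℤ_[p] →+* B) {J : Ideal B}
    (hJ : DividedPowers J) : ∃ h : DividedPowers (ideal p J),
      (∀ x ∈ J, ∀ n ≠ 0, h.dpow n (teich p x) = dpowTeich hJ n x) ∧
        ∀ y, ∀ n ≠ 0, h.dpow n (V p y) = V p (ι (gammaDiv p n) * y ^ n) := by
  obtain ⟨h⟩ := (natTorsionFree tf).exists_dividedPowers (ideal_eq_span (p := p) J) (by
    rintro _ (⟨x, hx, rfl⟩ | ⟨y, rfl⟩) n hn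
    · exact ⟨_, hJ.dpow_mem hn hx, factorial_mul_dpowTeich tf hJ hx hn⟩
    · exact ⟨_, J.zero_mem, factorial_mul_V tf ι y hn⟩)
  refine ⟨h, fun x hx n hn => ?_, fun y n hn => ?_⟩
  · refine (natTorsionFree tf).cancel n.factorial_ne_zero ?_
    rw [h.factorial_mul_dpow_eq_pow (mem_ideal.2 hx), factorial_mul_dpowTeich tf hJ hx hn]
  · refine (natTorsionFree tf).cancel n.factorial_ne_zero ?_
    rw [h.factorial_mul_dpow_eq_pow (mem_ideal.2 J.zero_mem), factorial_mul_V tf ι y hn]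

/-- The formulas for `[x]^{[n]}` and `V(y)^{[n]}` descend from a torsion-free ring along a cover,
because they are compatible with ring homomorphisms. -/
theorem exists_dividedPowers (ι : ℤ_[p] →+* B) {J : Ideal B} (hJ : DividedPowers J) :
    ∃ h : DividedPowers (ideal p J),
      (∀ x ∈ J, ∀ n ≠ 0, h.dpow n (teich p x) = dpowTeich hJ n x) ∧
        ∀ y, ∀ n ≠ 0, h.dpow n (V p y) = V p (ι (gammaDiv p n) * y ^ n) := by
  obtain ⟨c⟩ := exists_torsionFreeCover ι hJ
  have hιF : ∀ x, c.F (c.ι' x) = ι x := fun x => congrArg (fun g : ℤ_[p] →+* B => g x) c.F_ι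
  obtain ⟨h, h1, h2⟩ := exists_dividedPowers_of_torsionFree c.torsionFree c.ι' c.hI
  have e1 : ∀ x ∈ c.I, ∀ n ≠ 0, map c.F (h.dpow n (teich p x)) = dpowTeich hJ n (c.F x) := by
    intro x hx n hn
    rw [h1 x hx n hn]
    ext <;> simp [dpowTeich, c.isDP.dpow_comp x hx]
  have e2 : ∀ y, ∀ n ≠ 0, map c.F (h.dpow n (V p y)) = V p (ι (gammaDiv p n) * c.F y ^ n) := by
    intro y n hn
    rw [h2 y n hn]
    ext <;> simp [V, hιF]
  obtain ⟨h', hF⟩ := exists_dividedPowers_of_surjective (map c.F)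
    (mapFun_surjective c.F c.surjective) h (J' := ideal p J) (by
      intro z hz hz0 n hn
      have hz0' : c.F z.c0 = 0 := congrArg c0 hz0
      have hz1' : c.F z.c1 = 0 := congrArg c1 hz0
      have hT : teich p z.c0 ∈ ideal p c.I := hz
      have hV : V p z.c1 ∈ ideal p c.I := c.I.zero_mem
      rw [eq_teich_add_V z, h.dpow_add hT hV, map_sum]
      refine Finset.sum_eq_zero fun k hk => ?_
      rw [map_mul]
      by_cases hk1 : k.1 = 0
      · have hk2 : k.2 ≠ 0 := by
          have := Finset.HasAntidiagonal.mem_antidiagonal.1 hk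
          omega
        rw [e2 _ _ hk2, hz1', zero_pow hk2, mul_zero]
        exact mul_zero _
      · rw [e1 z.c0 hz _ hk1, hz0', dpowTeich, hJ.dpow_eval_zero hk1,
          hJ.dpow_eval_zero (Nat.mul_ne_zero hp.out.ne_zero hk1), mul_zero]
        exact zero_mul _)
    (by
      ext x
      rw [Ideal.mem_map_iff_of_surjective _ (mapFun_surjective c.F c.surjective)]
      constructor
      · intro hx
        obtain ⟨a, ha, ha'⟩ :=
          (Ideal.mem_map_iff_of_surjective c.F c.surjective).1 (c.map_I.ge hx)
        obtain ⟨b, hb⟩ := c.surjective x.c1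
        exact ⟨⟨a, b⟩, ha, W2.ext ha' hb⟩
      · rintro ⟨y, hy, rfl⟩
        exact c.map_I.le (Ideal.mem_map_of_mem _ hy))
  refine ⟨h', fun x hx n hn => ?_, fun y n hn => ?_⟩
  · obtain ⟨a, ha, rfl⟩ := (Ideal.mem_map_iff_of_surjective c.F c.surjective).1 (c.map_I.ge hx)
    rw [← e1 a ha n hn, ← hF.dpow_comp _ (mem_ideal.2 ha)]
    congr 1
    ext <;> simp [teich]
  · obtain ⟨b, rfl⟩ := c.surjective y
    rw [← e2 b n hn, ← hF.dpow_comp _ (mem_ideal.2 c.I.zero_mem)]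
    congr 1
    ext <;> simp [V]

/-- The divided powers on the ideal of all `(x₀, x₁)` with `x₀ ∈ J`. They are determined by
the formulas for `[x]^{[n]}` and `V(y)^{[n]}`. -/
noncomputable def dividedPowers (ι : ℤ_[p] →+* B) {J : Ideal B} (hJ : DividedPowers J) :
    DividedPowers (ideal p J) := (exists_dividedPowers ι hJ).choose

theorem dpow_teich (ι : ℤ_[p] →+* B) {J : Ideal B} (hJ : DividedPowers J) {x : B} (hx : x ∈ J)
    {n : ℕ} (hn : n ≠ 0) : (dividedPowers ι hJ).dpow n (teich p x) = dpowTeich hJ n x :=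
  (exists_dividedPowers ι hJ).choose_spec.1 x hx n hn

theorem dpow_V (ι : ℤ_[p] →+* B) {J : Ideal B} (hJ : DividedPowers J) (y : B)
    {n : ℕ} (hn : n ≠ 0) :
    (dividedPowers ι hJ).dpow n (V p y) = V p (ι (gammaDiv p n) * y ^ n) :=
  (exists_dividedPowers ι hJ).choose_spec.2 y n hn

/-- A ring homomorphism from `W₂(B)` preserves divided powers if it does so on the elements `[x]`
and `V(y)`. -/
theorem isDPMorphism_of_generators (ι : ℤ_[p] →+* B) {J : Ideal B} (hJ : DividedPowers J)
    {C : Type*} [CommRing C] {J' : Ideal C} (hJ' : DividedPowers J') (f : W2 p B →+* C)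
    (h1 : ∀ x ∈ J, f (teich p x) ∈ J') (h2 : ∀ y, f (V p y) ∈ J')
    (h1' : ∀ x ∈ J, ∀ n ≠ 0, hJ'.dpow n (f (teich p x)) = f (dpowTeich hJ n x))
    (h2' : ∀ y, ∀ n ≠ 0, hJ'.dpow n (f (V p y)) = f (V p (ι (gammaDiv p n) * y ^ n))) :
    (dividedPowers ι hJ).IsDPMorphism hJ' f := by
  have hS : ∀ s ∈ teich p '' J ∪ Set.range (V p (B := B)), f s ∈ J' := by
    rintro _ (⟨x, hx, rfl⟩ | ⟨y, rfl⟩)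
    exacts [h1 x hx, h2 y]
  refine DividedPowers.IsDPMorphism.on_span _ _ (ideal_eq_span J) hS ?_
  rintro n _ (⟨x, hx, rfl⟩ | ⟨y, rfl⟩)
  · rcases eq_or_ne n 0 with rfl | hn
    · rw [hJ'.dpow_zero (h1 x hx), (dividedPowers ι hJ).dpow_zero (mem_ideal.2 hx), map_one]
    · rw [h1' x hx n hn, dpow_teich ι hJ hx hn]
  · rcases eq_or_ne n 0 with rfl | hn
    · rw [hJ'.dpow_zero (h2 y), (dividedPowers ι hJ).dpow_zero (mem_ideal.2 J.zero_mem), map_one]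
    · rw [h2' y n hn, dpow_V ι hJ y hn]

theorem isDPMorphism_map {ι : ℤ_[p] →+* B} {ι' : ℤ_[p] →+* B'} {J : Ideal B} {J' : Ideal B'}
    {hJ : DividedPowers J} {hJ' : DividedPowers J'} {f : B →+* B'} (hf : hJ.IsDPMorphism hJ' f)
    (hι : f.comp ι = ι') :
    (dividedPowers ι hJ).IsDPMorphism (dividedPowers ι' hJ') (map f) := by
  have hfJ : ∀ x ∈ J, f x ∈ J' := fun x hx => hf.ideal_comp (Ideal.mem_map_of_mem _ hx)
  have e1 : ∀ x, map (p := p) f (teich p x) = teich p (f x) := fun x => by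
    ext <;> simp [teich]
  have e2 : ∀ x, map (p := p) f (V p x) = V p (f x) := fun x => by ext <;> simp [V]
  refine isDPMorphism_of_generators ι hJ _ _ (fun x hx => hfJ x hx)
    (fun y => by rw [e2]; exact J'.zero_mem) (fun x hx n hn => ?_) (fun y n hn => ?_)
  · rw [e1, dpow_teich ι' hJ' (hfJ x hx) hn]
    ext <;> simp [dpowTeich, hf.dpow_comp x hx]
  · rw [e2, e2, dpow_V ι' hJ' _ hn, map_mul, map_pow, ← hι, RingHom.comp_apply]

theorem isDPMorphism_fst (ι : ℤ_[p] →+* B) {J : Ideal B} (hJ : DividedPowers J) :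
    (dividedPowers ι hJ).IsDPMorphism hJ (fst p B) :=
  isDPMorphism_of_generators ι hJ _ _ (fun _ hx => hx) (fun _ => J.zero_mem)
    (fun _ _ _ _ => rfl) (fun _ _ hn => hJ.dpow_eval_zero hn)

/-- On `[x]` the assertion follows from `x ^ p = p! x^{[p]}` and the formula for the divided powers
of `x^{[p]}`, and on `V(y)` from the compatibility with the divided powers of `p`. -/
theorem isDPMorphism_ghostHom {ι : ℤ_[p] →+* B} {J : Ideal B} {hJ : DividedPowers J}
    (hc : GammaCompat ι hJ) (hpJ : (p : B) ∈ J) :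
    (dividedPowers ι hJ).IsDPMorphism hJ (ghostHom p B) := by
  have hx1 : ∀ x : B, ghostHom p B (teich p x) = x ^ p := fun x => by
    simp [ghostHom_apply, teich]
  have hy1 : ∀ y : B, ghostHom p B (V p y) = p * y := fun y => by
    simp [ghostHom_apply, V, hp.out.ne_zero]
  refine isDPMorphism_of_generators ι hJ _ _
    (fun x hx => by rw [hx1]; exact Ideal.pow_mem_of_mem _ hx p hp.out.pos)
    (fun y => by rw [hy1]; exact J.mul_mem_right _ hpJ) (fun x hx n hn => ?_) (fun y n hn => ?_)
  · rw [hx1, ghostHom_dpowTeich hJ hx hn, ← hJ.factorial_mul_dpow_eq_pow hx,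
      hJ.dpow_mul (hJ.dpow_mem hp.out.ne_zero hx), hJ.dpow_comp hp.out.ne_zero hx, ← mul_assoc,
      mul_comm n p]
    congr 1
    have h1 := factorial_mul_teichCoeff (p := p) hn
    have h2 := Nat.uniformBell_mul_eq n hp.out.ne_zero
    have : ((p.factorial : ℤ) * Nat.uniformBell p n + p * teichCoeff p n) =
        p.factorial ^ n * Nat.uniformBell n p := by
      refine mul_left_cancel₀ (Nat.cast_ne_zero.2 n.factorial_ne_zero : (n.factorial : ℤ) ≠ 0) ?_
      rw [h1, mul_comm p n, ← h2]
      push_cast; ring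
    rw [this]; push_cast; ring
  · rw [hy1, hy1, hc _ _ (J.mul_mem_right _ hpJ), p_mul_gammaDiv_mem ι hn, mul_assoc]

theorem isDPMorphism_padicInt {ι : ℤ_[p] →+* B} {J : Ideal B} {hJ : DividedPowers J}
    (hc : GammaCompat ι hJ) (hpJ : (p : B) ∈ J) :
    (PadicInt.dividedPowers p).IsDPMorphism hJ ι := by
  refine ⟨?_, fun {n} a ha => ?_⟩
  · rw [Ideal.map_span, Set.image_singleton, map_natCast, Ideal.span_singleton_le_iff_mem]
    exact hpJ
  · obtain ⟨b, rfl⟩ := Ideal.mem_span_singleton.1 ha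
    rw [map_mul, map_natCast, hc _ _ (J.mul_mem_right _ hpJ), mul_comm (p : ℤ_[p]) b,
      (PadicInt.dividedPowers p).dpow_mul (Ideal.mem_span_singleton_self _), map_mul, map_pow,
      mul_comm]
    rfl

theorem gammaCompat {ι : ℤ_[p] →+* B} {J : Ideal B} {hJ : DividedPowers J}
    (hc : GammaCompat ι hJ) (hpJ : (p : B) ∈ J) :
    GammaCompat (padicInt ι) (dividedPowers ι hJ) := by
  have h1 := isDPMorphism_map (ι := RingHom.id _) (isDPMorphism_padicInt hc hpJ)
    (RingHom.comp_id ι)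
  have hp0 : (p : W2 p ℤ_[p]) ∈ ideal p (Ideal.span {(p : ℤ_[p])}) := by
    rw [mem_ideal, natCast_p]; exact Ideal.mem_span_singleton_self _
  have h2 := GammaCompat.of_torsionFree (natTorsionFree NatTorsionFree.of_charZero_domain)
    (padicInt (RingHom.id ℤ_[p])) (dividedPowers (RingHom.id _) (PadicInt.dividedPowers p))
  intro n a _
  have hp1 : (p : W2 p B) ∈ ideal p J := by rw [mem_ideal, natCast_p]; exact hpJ
  have h3 := h1.dpow_comp (n := n) _ hp0
  have h4 := h2 n 1 (by rw [mul_one]; exact hp0)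
  rw [mul_one, one_pow, mul_one] at h4
  rw [map_natCast, h4] at h3
  rw [mul_comm (p : W2 p B) a, (dividedPowers ι hJ).dpow_mul hp1, h3, mul_comm]
  rfl

end W2
end WittTwo

/-! ### Divided powers on the envelope -/

section EnvelopeDP
variable {p : ℕ} [hp : Fact p.Prime]

namespace PDEnv

section
variable {A : Type v} [CommRing A] [Algebra ℤ_[p] A]

/-- The divided power ideal of the envelope. -/
noncomputable def ideal (I : Ideal A) : Ideal (PDEnv p I) :=
  Ideal.span {z | ∃ (n : ℕ) (x : ↥(I ⊔ Ideal.span {(p : A)})), n ≠ 0 ∧ z = PDEnv.dp n x}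

theorem dp_mem_ideal {I : Ideal A} {n : ℕ} (hn : n ≠ 0) (x : ↥(I ⊔ Ideal.span {(p : A)})) :
    PDEnv.dp n x ∈ ideal I := Ideal.subset_span ⟨n, x, hn, rfl⟩

theorem dp_null {I : Ideal A} {n : ℕ} (hn : n ≠ 0) :
    PDEnv.dp n (0 : ↥(I ⊔ Ideal.span {(p : A)})) = 0 := by
  have := PDEnv.dp_smul p n (0 : A) (0 : ↥(I ⊔ Ideal.span {(p : A)}))
  rwa [zero_smul, map_zero, zero_pow hn, zero_mul] at this

theorem lift_algebraMap {I : Ideal A} {B : Type w} [CommRing B] (φ : A →+* B)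
    (f : ℕ → ↥(I ⊔ Ideal.span {(p : A)}) → B) (h1 h2 h3 h4 h5 h6) (a : A) :
    PDEnv.lift p φ f h1 h2 h3 h4 h5 h6 (algebraMap A (PDEnv p I) a) = φ a := by
  let _ := φ.toAlgebra
  unfold PDEnv.lift
  exact (Ideal.Quotient.lift_mk _ _ _).trans (AlgHom.commutes _ a)

theorem lift_dp {I : Ideal A} {B : Type w} [CommRing B] (φ : A →+* B)
    (f : ℕ → ↥(I ⊔ Ideal.span {(p : A)}) → B) (h1 h2 h3 h4 h5 h6) (n : ℕ)
    (x : ↥(I ⊔ Ideal.span {(p : A)})) :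
    PDEnv.lift p φ f h1 h2 h3 h4 h5 h6 (PDEnv.dp n x) = f n x := by
  let _ := φ.toAlgebra
  exact (Ideal.Quotient.lift_mk _ _ _).trans (DividedPowerAlgebra.lift'_apply_dp _ _ _ _ n x)

@[elab_as_elim]
theorem induction_on {I : Ideal A} {P : PDEnv p I → Prop} (z : PDEnv p I)
    (h1 : ∀ a, P (algebraMap A _ a)) (h2 : ∀ n x, P (PDEnv.dp n x))
    (h3 : ∀ x y, P x → P y → P (x + y)) (h4 : ∀ x y, P x → P y → P (x * y)) : P z := by
  obtain ⟨z, rfl⟩ := Ideal.Quotient.mk_surjective z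
  induction z using DividedPowerAlgebra.induction_on with
  | C a => exact h1 a
  | add f g hf hg => exact h3 _ _ hf hg
  | dp f n m hf => exact h4 _ _ hf (h2 n m)

theorem hom_ext {I : Ideal A} {B : Type w} [CommRing B] {f g : PDEnv p I →+* B}
    (h : ∀ a, f (algebraMap A _ a) = g (algebraMap A _ a))
    (h' : ∀ n x, f (PDEnv.dp n x) = g (PDEnv.dp n x)) : f = g := by
  ext z
  induction z using PDEnv.induction_on with
  | h1 a => exact h a
  | h2 n x => exact h' n x
  | h3 x y hx hy => rw [map_add, map_add, hx, hy]
  | h4 x y hx hy => rw [map_mul, map_mul, hx, hy]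

/-- Every element of the envelope is congruent to an element of `A`. -/
theorem exists_algebraMap_sub_mem {I : Ideal A} (z : PDEnv p I) :
    ∃ a, z - algebraMap A _ a ∈ ideal I := by
  induction z using PDEnv.induction_on with
  | h1 a => exact ⟨a, by simp⟩
  | h2 n x =>
    rcases eq_or_ne n 0 with rfl | hn
    · exact ⟨1, by rw [PDEnv.dp_zero, map_one, sub_self]; exact zero_mem _⟩
    · exact ⟨0, by rw [map_zero, sub_zero]; exact dp_mem_ideal hn x⟩
  | h3 x y hx hy =>
    obtain ⟨a, ha⟩ := hx
    obtain ⟨b, hb⟩ := hy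
    exact ⟨a + b, by rw [map_add, add_sub_add_comm]; exact add_mem ha hb⟩
  | h4 x y hx hy =>
    obtain ⟨a, ha⟩ := hx
    obtain ⟨b, hb⟩ := hy
    refine ⟨a * b, ?_⟩
    rw [map_mul, show x * y - algebraMap A _ a * algebraMap A _ b =
      (x - algebraMap A _ a) * y + algebraMap A _ a * (y - algebraMap A _ b) by ring]
    exact add_mem (Ideal.mul_mem_right _ _ ha) (Ideal.mul_mem_left _ _ hb)

end

/-! ### The envelope as a quotient of a torsion-free divided power algebra -/

namespace Cover

variable {A : Type v} [CommRing A] [Algebra ℤ_[p] A] (I : Ideal A)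

variable (p A) in
/-- A polynomial ring over `ℤ_p` that maps onto `A`. -/
abbrev Poly : Type v := MvPolynomial A ℤ_[p]

variable (p A) in
/-- The projection to `A`. -/
noncomputable def π : Poly p A →ₐ[ℤ_[p]] A := MvPolynomial.aeval id

theorem π_surjective : Function.Surjective (π p A) := fun a =>
  ⟨MvPolynomial.X a, MvPolynomial.aeval_X _ _⟩

variable (p) in
/-- The elements of `I + p A`. -/
abbrev Gen : Type v := ↥(I ⊔ Ideal.span {(p : A)})

variable (p) in
/-- Formal linear combinations of the elements of `I + p A`. -/
abbrev Lin : Type v := Gen p I →₀ Poly p A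

variable (p) in
/-- The torsion-free divided power algebra with one generator for each element of `I + p A`. -/
def Γ : Type v := DividedPowerAlgebra (Poly p A) (Lin p I)

noncomputable instance : CommRing (Γ p I) :=
  inferInstanceAs (CommRing (DividedPowerAlgebra (Poly p A) (Lin p I)))

noncomputable instance : Algebra (Poly p A) (Γ p I) :=
  inferInstanceAs (Algebra (Poly p A) (DividedPowerAlgebra (Poly p A) (Lin p I)))

variable {I} in
/-- The divided powers of a linear form. -/
noncomputable def dpl (n : ℕ) (c : Lin p I) : Γ p I := DividedPowerAlgebra.dp (Poly p A) n c

variable {I} in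
theorem dpl_zero (c : Lin p I) : dpl 0 c = 1 := DividedPowerAlgebra.dp_zero

variable {I} in
theorem dpl_null {n : ℕ} (hn : n ≠ 0) : dpl n (0 : Lin p I) = 0 :=
  DividedPowerAlgebra.dp_null_of_ne_zero hn

variable {I} in
theorem dpl_smul (b : Poly p A) (n : ℕ) (c : Lin p I) :
    dpl n (b • c) = algebraMap (Poly p A) (Γ p I) b ^ n * dpl n c := by
  rw [← map_pow, ← Algebra.smul_def]; exact DividedPowerAlgebra.dp_smul

variable {I} in
theorem dpl_mul (m n : ℕ) (c : Lin p I) :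
    dpl m c * dpl n c = ((m + n).choose m : Γ p I) * dpl (m + n) c := by
  rw [← nsmul_eq_mul]; exact DividedPowerAlgebra.dp_mul

variable {I} in
theorem dpl_add (n : ℕ) (c c' : Lin p I) : dpl n (c + c') =
    ∑ k ∈ Finset.HasAntidiagonal.antidiagonal n, dpl k.1 c * dpl k.2 c' :=
  DividedPowerAlgebra.dp_add

variable {I} in
theorem dpl_one_add (c c' : Lin p I) : dpl 1 (c + c') = dpl 1 c + dpl 1 c' :=
  map_add (DividedPowerAlgebra.embed (Poly p A) (Lin p I)) c c'

variable {I} in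
theorem factorial_mul_dpl (n : ℕ) (c : Lin p I) :
    (n.factorial : Γ p I) * dpl n c = dpl 1 c ^ n :=
  DividedPowerAlgebra.natFactorial_mul_dp_eq n c

variable {I} in
@[elab_as_elim]
theorem Γ_induction {P : Γ p I → Prop} (z : Γ p I) (h1 : ∀ b, P (algebraMap (Poly p A) (Γ p I) b))
    (h2 : ∀ x y, P x → P y → P (x + y)) (h3 : ∀ x n c, P x → P (x * dpl n c)) : P z :=
  DividedPowerAlgebra.induction_on (P := P) z h1 h2 h3

variable {I} in
/-- Homomorphisms out of the cover. -/
noncomputable def Γlift {B : Type w} [CommRing B] (φ : Poly p A →+* B) (f : ℕ → Lin p I → B)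
    (h0 : ∀ c, f 0 c = 1) (h1 : ∀ n b c, f n (b • c) = φ b ^ n * f n c)
    (h2 : ∀ m n c, f m c * f n c = (m + n).choose m * f (m + n) c)
    (h3 : ∀ n c c', f n (c + c') =
      ∑ k ∈ Finset.HasAntidiagonal.antidiagonal n, f k.1 c * f k.2 c') : Γ p I →+* B :=
  letI := φ.toAlgebra
  (DividedPowerAlgebra.lift' (R := Poly p A) (A := B) (M := Lin p I) (f := fun k => f k.1 k.2) h0
    (fun n b c => by rw [h1, Algebra.smul_def, map_pow]; rfl)
    (fun m n c => by rw [h2, nsmul_eq_mul]) h3).toRingHom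

variable {I} in
theorem Γlift_algebraMap {B : Type w} [CommRing B] (φ : Poly p A →+* B) (f : ℕ → Lin p I → B)
    (h0 h1 h2 h3) (b : Poly p A) : Γlift φ f h0 h1 h2 h3 (algebraMap (Poly p A) (Γ p I) b) = φ b := by
  let _ := φ.toAlgebra
  unfold Γlift
  exact AlgHom.commutes (A := DividedPowerAlgebra (Poly p A) (Lin p I)) (B := B) _ b

variable {I} in
theorem Γlift_dpl {B : Type w} [CommRing B] (φ : Poly p A →+* B) (f : ℕ → Lin p I → B)
    (h0 h1 h2 h3) (n : ℕ) (c : Lin p I) : Γlift φ f h0 h1 h2 h3 (dpl n c) = f n c := by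
  let _ := φ.toAlgebra
  exact DividedPowerAlgebra.lift'_apply_dp _ _ _ _ n c

variable (p A) in
theorem tfPoly : NatTorsionFree (Poly p A) :=
  mvPolynomial_natTorsionFree NatTorsionFree.of_charZero_domain _

variable (p) in
theorem tfΓ : NatTorsionFree (Γ p I) :=
  NatTorsionFree.of_basis (B := DividedPowerAlgebra (Poly p A) (Lin p I)) (tfPoly p A)
    (dpBasis (Gen p I) (tfPoly p A))

variable (p) in
/-- The ideal generated by the divided powers of the linear forms. -/
noncomputable def Lp : Ideal (Γ p I) := Ideal.span {z | ∃ (n : ℕ) (c : Lin p I), n ≠ 0 ∧ z = dpl n c}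

variable (p) in
/-- The divided power ideal of the cover. -/
noncomputable def Jp : Ideal (Γ p I) := Lp p I ⊔ Ideal.span {(p : Γ p I)}

variable (p) in
/-- The structure map of the cover. -/
noncomputable def ιΓ : ℤ_[p] →+* Γ p I := (algebraMap (Poly p A) (Γ p I)).comp MvPolynomial.C

theorem exists_dividedPowers_Jp : Nonempty (DividedPowers (Jp p I)) := by
  obtain ⟨h⟩ := exists_dividedPowers_dpIdeal (A := Poly p A) (M := Lin p I) (tfΓ p I)
  have h : DividedPowers (Lp p I) := h
  refine (tfΓ p I).exists_dividedPowers (S := (Lp p I : Set (Γ p I)) ∪ {(p : Γ p I)}) ?_ ?_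
  · rw [Ideal.span_union, Ideal.span_eq]; rfl
  · rintro s (hs | rfl) n hn
    · exact ⟨h.dpow n s, Ideal.mem_sup_left (h.dpow_mem hn hs), h.factorial_mul_dpow_eq_pow hs⟩
    · refine ⟨ιΓ p I (gammaP p n), Ideal.mem_sup_right ?_, ?_⟩
      · rw [p_mul_gammaDiv_mem (ιΓ p I) hn]
        exact Ideal.mul_mem_right _ _ (Ideal.mem_span_singleton_self _)
      · rw [← map_natCast (ιΓ p I), ← map_mul, factorial_mul_gammaP, map_pow, map_natCast]

variable (p) in
/-- The divided powers of the cover. -/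
noncomputable def dpΓ : DividedPowers (Jp p I) := (exists_dividedPowers_Jp I).some

variable {I}

theorem dp_mem {n : ℕ} (hn : n ≠ 0) (c : Lin p I) : dpl n c ∈ Jp p I :=
  Ideal.mem_sup_left (Ideal.subset_span ⟨n, c, hn, rfl⟩)

theorem p_mul_mem (a : Γ p I) : (p : Γ p I) * a ∈ Jp p I :=
  Ideal.mem_sup_right (Ideal.mul_mem_right _ _ (Ideal.mem_span_singleton_self _))

theorem dpow_dp_one (n : ℕ) (c : Lin p I) : (dpΓ p I).dpow n (dpl 1 c) = dpl n c := by
  refine (tfΓ p I).cancel n.factorial_ne_zero ?_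
  rw [(dpΓ p I).factorial_mul_dpow_eq_pow (dp_mem one_ne_zero c), factorial_mul_dpl]

theorem dpow_p_mul (n : ℕ) (a : Γ p I) :
    (dpΓ p I).dpow n (p * a) = ιΓ p I (gammaP p n) * a ^ n :=
  GammaCompat.of_torsionFree (tfΓ p I) (ιΓ p I) (dpΓ p I) n a (p_mul_mem a)

/-- The element `∑ π(c_x) x` of `I + p A`. -/
noncomputable def ρ (c : Lin p I) : Gen p I :=
  c.sum fun x b => π p A b • x

theorem ρ_add (c c' : Lin p I) : ρ (c + c') = ρ c + ρ c' :=
  Finsupp.sum_add_index' (by simp) (by simp [add_smul])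

theorem ρ_smul (b : Poly p A) (c : Lin p I) : ρ (b • c) = π p A b • ρ c := by
  rw [ρ, ρ, Finsupp.sum_smul_index (by simp), Finsupp.smul_sum]
  simp [mul_smul]

theorem ρ_single (x : Gen p I) (b : Poly p A) : ρ (Finsupp.single x b) = π p A b • x :=
  Finsupp.sum_single_index (by simp)

theorem ρ_single_one (x : Gen p I) : ρ (Finsupp.single x (1 : Poly p A)) = x := by
  rw [ρ_single, map_one, one_smul]

variable (I)

variable (p) in
/-- The projection from the cover to the envelope. -/
noncomputable def proj : Γ p I →+* PDEnv p I :=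
  Γlift ((algebraMap A (PDEnv p I)).comp (π p A).toRingHom) (fun n c => PDEnv.dp n (ρ c))
    (fun c => PDEnv.dp_zero p _)
    (fun n b c => by rw [ρ_smul, PDEnv.dp_smul]; rfl)
    (fun m n c => PDEnv.dp_mul p m n _)
    (fun n c c' => by rw [ρ_add, PDEnv.dp_add])

variable {I}

theorem proj_algebraMap (b : Poly p A) :
    proj p I (algebraMap _ (Γ p I) b) = algebraMap A _ (π p A b) := Γlift_algebraMap ..

theorem proj_dp (n : ℕ) (c : Lin p I) : proj p I (dpl n c) = PDEnv.dp n (ρ c) := Γlift_dpl ..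

theorem proj_surjective : Function.Surjective (proj p I) := by
  intro z
  induction z using PDEnv.induction_on with
  | h1 a =>
    obtain ⟨b, rfl⟩ := π_surjective (p := p) a
    exact ⟨_, proj_algebraMap b⟩
  | h2 n x => exact ⟨_, (proj_dp n (Finsupp.single x 1)).trans (by rw [ρ_single_one])⟩
  | h3 x y hx hy =>
    obtain ⟨a, rfl⟩ := hx
    obtain ⟨b, rfl⟩ := hy
    exact ⟨a + b, map_add _ _ _⟩
  | h4 x y hx hy =>
    obtain ⟨a, rfl⟩ := hx
    obtain ⟨b, rfl⟩ := hy
    exact ⟨a * b, map_mul _ _ _⟩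

/-- The linear form `p b + ∑ c_x x` in the cover. -/
noncomputable def ψ (b : Poly p A) (c : Lin p I) : Γ p I :=
  p * algebraMap _ _ b + dpl 1 c

theorem ψ_mem (b : Poly p A) (c : Lin p I) : ψ b c ∈ Jp p I :=
  add_mem (p_mul_mem _) (dp_mem one_ne_zero c)

theorem p_mem : (p : A) ∈ I ⊔ Ideal.span {(p : A)} :=
  Ideal.mem_sup_right (Ideal.mem_span_singleton_self _)

theorem proj_dpow_ψ (n : ℕ) (b : Poly p A) (c : Lin p I) :
    proj p I ((dpΓ p I).dpow n (ψ b c)) = PDEnv.dp n (π p A b • ⟨p, p_mem⟩ + ρ c) := by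
  rw [ψ, (dpΓ p I).dpow_add (p_mul_mem _) (dp_mem one_ne_zero c), PDEnv.dp_add, map_sum]
  refine Finset.sum_congr rfl fun k _ => ?_
  rw [map_mul, dpow_dp_one, proj_dp, dpow_p_mul, PDEnv.dp_smul, PDEnv.dp_p p k.1 (⟨(p : A), p_mem⟩ : Gen p I) rfl,
    map_mul, map_pow, proj_algebraMap, mul_comm (algebraMap A (PDEnv p I) (π p A b) ^ k.1)]
  congr 2
  rw [ιΓ, RingHom.comp_apply, proj_algebraMap]
  exact congrArg (algebraMap A (PDEnv p I)) (AlgHom.commutes (π p A) _)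

variable (I)

variable (p) in
/-- The linear relations in the kernel. -/
def linRel : Submodule (Poly p A) (Γ p I) where
  carrier := {z | ∃ (a : Poly p A) (c : Lin p I), π p A a + (ρ c : A) = 0 ∧
    z = algebraMap _ _ a + dpl 1 c}
  add_mem' := by
    rintro _ _ ⟨a, c, h, rfl⟩ ⟨a', c', h', rfl⟩
    refine ⟨a + a', c + c', ?_, ?_⟩
    · rw [map_add, ρ_add, Submodule.coe_add, add_add_add_comm, h, h', add_zero]
    · rw [map_add, dpl_one_add, add_add_add_comm]
  zero_mem' := ⟨0, 0, by simp [ρ], by rw [dpl_null one_ne_zero, map_zero, add_zero]⟩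
  smul_mem' := by
    rintro b _ ⟨a, c, h, rfl⟩
    refine ⟨b * a, b • c, ?_, ?_⟩
    · rw [map_mul, ρ_smul, Submodule.coe_smul, smul_eq_mul, ← mul_add, h, mul_zero]
    · rw [map_mul, dpl_smul, pow_one, Algebra.smul_def, mul_add]

variable (p) in
/-- The divided powers of linear relations in the divided power ideal. -/
def dpRel : Set (Γ p I) :=
  {z | ∃ (n : ℕ) (b : Poly p A) (c : Lin p I), n ≠ 0 ∧
    π p A b • ⟨p, p_mem⟩ + ρ c = 0 ∧ z = (dpΓ p I).dpow n (ψ b c)}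

variable (p) in
/-- The kernel of the projection. -/
noncomputable def N : Ideal (Γ p I) := Ideal.span (dpRel p I ∪ (linRel p I : Set (Γ p I)))

variable {I}

theorem proj_linRel {z : Γ p I} (hz : z ∈ linRel p I) : proj p I z = 0 := by
  obtain ⟨a, c, h, rfl⟩ := hz
  rw [map_add, proj_algebraMap, proj_dp, PDEnv.dp_one, ← map_add, h, map_zero]

theorem dpow_ψ_mem_N {n : ℕ} (hn : n ≠ 0) {b : Poly p A} {c : Lin p I}
    (h : π p A b • ⟨p, p_mem⟩ + ρ c = 0) : (dpΓ p I).dpow n (ψ b c) ∈ N p I :=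
  Ideal.subset_span (Or.inl ⟨n, b, c, hn, h, rfl⟩)

theorem dpow_add_sub_mem_N {b : Poly p A} {c : Lin p I}
    (h : π p A b • ⟨p, p_mem⟩ + ρ c = 0) (n : ℕ) {y : Γ p I} (hy : y ∈ Jp p I) :
    (dpΓ p I).dpow n (ψ b c + y) - (dpΓ p I).dpow n y ∈ N p I := by
  rw [(dpΓ p I).dpow_add (ψ_mem b c) hy, ← Finset.sum_erase_add _ _
    (Finset.HasAntidiagonal.mem_antidiagonal.2 (zero_add n) : ((0, n) : ℕ × ℕ) ∈ _),
    (dpΓ p I).dpow_zero (ψ_mem b c), one_mul]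
  simp only [add_sub_cancel_right]
  refine Ideal.sum_mem _ fun k hk => Ideal.mul_mem_right _ _ (dpow_ψ_mem_N (fun h0 => ?_) h)
  obtain ⟨h1, h2⟩ := Finset.mem_erase.1 hk
  have := Finset.HasAntidiagonal.mem_antidiagonal.1 h2
  exact h1 (Prod.ext h0 (by simp only; omega))

theorem dp_sub_dp_mem_N {c c' : Lin p I} (h : ρ c = ρ c') (n : ℕ) :
    dpl n c - dpl n c' ∈ N p I := by
  have h1 : π p A 0 • ⟨p, p_mem⟩ + ρ (c - c') = 0 := by
    have : ρ (c - c') + ρ c' = ρ c' := by rw [← ρ_add, sub_add_cancel, h]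
    rw [map_zero, zero_smul, zero_add]
    exact add_eq_right.1 this
  have h2 : ψ 0 (c - c') + dpl 1 c' =
      dpl 1 c := by
    rw [ψ, map_zero, mul_zero, zero_add, ← dpl_one_add, sub_add_cancel]
  have h3 := dpow_add_sub_mem_N h1 n (dp_mem one_ne_zero c')
  rwa [h2, dpow_dp_one, dpow_dp_one] at h3

theorem linRel_le_N {z : Γ p I} (hz : z ∈ linRel p I) : z ∈ N p I :=
  Ideal.subset_span (Or.inr hz)

variable (I)

variable (p) in
/-- The homomorphism from `A` to the quotient of the cover. -/
noncomputable def toΓN : A →+* Γ p I ⧸ N p I :=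
  (Ideal.Quotient.lift (RingHom.ker (π p A).toRingHom)
    ((Ideal.Quotient.mk (N p I)).comp (algebraMap (Poly p A) (Γ p I))) (fun a ha =>
      Ideal.Quotient.eq_zero_iff_mem.2 (linRel_le_N ⟨a, 0,
        by rw [show π p A a = 0 from ha]; simp [ρ], by rw [dpl_null one_ne_zero, add_zero]⟩))).comp
    (RingHom.quotientKerEquivOfSurjective (f := (π p A).toRingHom) π_surjective).symm.toRingHom

variable {I}

theorem toΓN_π (b : Poly p A) :
    toΓN p I (π p A b) = Ideal.Quotient.mk (N p I) (algebraMap _ _ b) := by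
  have : (RingHom.quotientKerEquivOfSurjective (f := (π p A).toRingHom) π_surjective).symm
      (π p A b) = Ideal.Quotient.mk _ b := by
    rw [RingEquiv.symm_apply_eq]; rfl
  simp only [toΓN, RingHom.comp_apply]
  erw [this]
  rfl

/-- The generators of the envelope satisfy its defining relations in the quotient of the cover by
`N`, which gives an inverse of the map from this quotient to the envelope. -/
theorem ker_proj_le : RingHom.ker (proj p I) ≤ N p I := by
  let g : PDEnv p I →+* Γ p I ⧸ N p I :=
    PDEnv.lift p (toΓN p I)
      (fun n x => Ideal.Quotient.mk _ (dpl n (Finsupp.single x 1)))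
      (fun x => by rw [dpl_zero, map_one])
      (fun n a x => by
        obtain ⟨b, rfl⟩ := π_surjective (p := p) a
        rw [toΓN_π, ← map_pow, ← map_mul, ← dpl_smul, Ideal.Quotient.eq]
        exact dp_sub_dp_mem_N (by rw [ρ_smul, ρ_single_one, ρ_single_one]) n)
      (fun m n x => by
        rw [← map_mul, dpl_mul, map_mul, map_natCast])
      (fun n x y => by
        simp only [← map_mul]
        rw [← map_sum, ← dpl_add, Ideal.Quotient.eq]
        exact dp_sub_dp_mem_N (by rw [ρ_add, ρ_single_one, ρ_single_one, ρ_single_one]) n)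
      (fun x => by
        obtain ⟨b, hb⟩ := π_surjective (p := p) (x : A)
        rw [← hb, toΓN_π, Ideal.Quotient.eq]
        refine linRel_le_N ⟨-b, Finsupp.single x 1, ?_, ?_⟩
        · rw [map_neg, hb, ρ_single_one, neg_add_cancel]
        · rw [map_neg]; ring)
      (fun n x hx => by
        have e : algebraMap ℤ_[p] A (gammaP p n) = π p A (algebraMap _ _ (gammaP p n)) :=
          (AlgHom.commutes _ _).symm
        rw [e, toΓN_π, Ideal.Quotient.eq]
        have h1 : π p A (-1) • (⟨p, p_mem⟩ : Gen p I) + ρ (Finsupp.single x 1) = 0 := by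
          rw [ρ_single_one, map_neg, map_one, neg_smul, one_smul]
          exact Subtype.ext (by simp [hx])
        have h2 := dpow_add_sub_mem_N h1 n (p_mul_mem 1)
        have h3 : ψ (-1) (Finsupp.single x 1) + (p : Γ p I) * 1 =
            dpl 1 (Finsupp.single x 1) := by
          rw [ψ, map_neg, map_one]; ring
        rw [h3, dpow_dp_one, dpow_p_mul, one_pow, mul_one] at h2
        exact h2)
  have key : ∀ z, g (proj p I z) = Ideal.Quotient.mk (N p I) z := by
    intro z
    induction z using Γ_induction with
    | h1 a => rw [proj_algebraMap, PDEnv.lift_algebraMap, toΓN_π]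
    | h2 x y hx hy => rw [map_add, map_add, hx, hy, map_add]
    | h3 x n c hx =>
      rw [map_mul, map_mul, hx, proj_dp, PDEnv.lift_dp, map_mul]
      congr 1
      exact Ideal.Quotient.eq.2 (dp_sub_dp_mem_N (ρ_single_one _) n)
  intro z hz
  rw [← Ideal.Quotient.eq_zero_iff_mem, ← key, show proj p I z = 0 from hz, map_zero]

/-- The augmentation of the cover. -/
noncomputable def aug : Γ p I →ₐ[Poly p A] Poly p A :=
  DividedPowerAlgebra.lift (M := Lin p I) (dividedPowersBot (Poly p A)) 0 (fun _ => by simp)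

theorem aug_dp {n : ℕ} (hn : n ≠ 0) (c : Lin p I) :
    aug (dpl n c) = 0 := by
  refine (DividedPowerAlgebra.lift_apply_dp (M := Lin p I) _ _ n c).trans ?_
  exact (dividedPowersBot (Poly p A)).dpow_eval_zero hn

theorem aug_mem {z : Γ p I} (hz : z ∈ Jp p I) : ∃ b : Poly p A, aug z = p * b := by
  have : Jp p I ≤ (Ideal.span {(p : Poly p A)}).comap (aug (p := p) (I := I)).toRingHom := by
    refine sup_le (Ideal.span_le.2 ?_) ?_
    · rintro _ ⟨n, c, hn, rfl⟩
      change aug (dpl n c) ∈ Ideal.span {(p : Poly p A)}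
      rw [aug_dp hn]; exact zero_mem _
    · rw [Ideal.span_singleton_le_iff_mem]
      change aug (p : Γ p I) ∈ Ideal.span {(p : Poly p A)}
      rw [map_natCast]; exact Ideal.mem_span_singleton_self _
  exact Ideal.mem_span_singleton.1 (this hz)

theorem sub_aug_mem (z : Γ p I) : z - algebraMap _ _ (aug z) ∈ Jp p I := by
  induction z using Γ_induction with
  | h1 a => rw [AlgHom.commutes]; simp
  | h2 x y hx hy =>
    rw [map_add, map_add, add_sub_add_comm]; exact add_mem hx hy
  | h3 x n c hx =>
    rcases eq_or_ne n 0 with rfl | hn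
    · rwa [dpl_zero, mul_one]
    · rw [map_mul, aug_dp hn, mul_zero, map_zero, sub_zero]
      exact Ideal.mul_mem_left _ _ (dp_mem hn c)

/-- The kernel of the projection is stable under divided powers. An element of the kernel is the sum
of an element all of whose divided powers are in the kernel and of a linear relation `a + ∑ c_x x`;
if the sum is in the divided power ideal, the augmentation shows that `p` divides `a`, and then the
divided powers of the relation are in the kernel too. -/
theorem proj_dpow_eq_zero {z : Γ p I} (hz : z ∈ Jp p I) (hz0 : proj p I z = 0) {n : ℕ}
    (hn : n ≠ 0) : proj p I ((dpΓ p I).dpow n z) = 0 := by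
  -- The largest divided power ideal contained in the kernel.
  let Q : Ideal (Γ p I) :=
    { carrier := {z | z ∈ Jp p I ∧ ∀ n ≠ 0, proj p I ((dpΓ p I).dpow n z) = 0}
      add_mem' := by
        rintro x y ⟨hx, hx'⟩ ⟨hy, hy'⟩
        refine ⟨add_mem hx hy, fun n hn => ?_⟩
        rw [(dpΓ p I).dpow_add hx hy, map_sum]
        refine Finset.sum_eq_zero fun k hk => ?_
        rw [map_mul]
        by_cases hk1 : k.1 = 0
        · rw [hy' k.2 (by have := Finset.HasAntidiagonal.mem_antidiagonal.1 hk; omega), mul_zero]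
        · rw [hx' k.1 hk1, zero_mul]
      zero_mem' := ⟨zero_mem _, fun n hn => by rw [(dpΓ p I).dpow_eval_zero hn, map_zero]⟩
      smul_mem' := by
        rintro a x ⟨hx, hx'⟩
        refine ⟨Ideal.mul_mem_left _ _ hx, fun n hn => ?_⟩
        rw [smul_eq_mul, (dpΓ p I).dpow_mul hx, map_mul, hx' n hn, mul_zero] }
  have hQ1 : ∀ z ∈ dpRel p I, z ∈ Q := by
    rintro _ ⟨k, b, c, hk, h, rfl⟩
    refine ⟨(dpΓ p I).dpow_mem hk (ψ_mem b c), fun n hn => ?_⟩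
    rw [(dpΓ p I).dpow_comp hk (ψ_mem b c), map_mul, proj_dpow_ψ, h,
      PDEnv.dp_null (Nat.mul_ne_zero hn hk), mul_zero]
  have hQ2 : ∀ z ∈ linRel p I, ∀ j ∈ Jp p I, j * z ∈ Q := by
    intro z hz j hj
    refine ⟨Ideal.mul_mem_right _ _ hj, fun n hn => ?_⟩
    rw [mul_comm, (dpΓ p I).dpow_mul hj, map_mul, map_pow, proj_linRel hz, zero_pow hn, zero_mul]
  -- an element of the kernel is the sum of an element of `Q` and of a linear relation
  have key : ∀ z ∈ N p I, ∃ q ∈ Q, ∃ l ∈ linRel p I, z = q + l := by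
    intro z hz
    induction hz using Submodule.span_induction with
    | mem z hz =>
      rcases hz with hz | hz
      · exact ⟨z, hQ1 z hz, 0, zero_mem _, (add_zero z).symm⟩
      · exact ⟨0, zero_mem _, z, hz, (zero_add z).symm⟩
    | zero => exact ⟨0, zero_mem _, 0, zero_mem _, (add_zero 0).symm⟩
    | add x y _ _ hx hy =>
      obtain ⟨q, hq, l, hl, rfl⟩ := hx
      obtain ⟨q', hq', l', hl', rfl⟩ := hy
      exact ⟨q + q', add_mem hq hq', l + l', add_mem hl hl', add_add_add_comm _ _ _ _⟩
    | smul a x _ hx =>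
      obtain ⟨q, hq, l, hl, rfl⟩ := hx
      refine ⟨a * q + (a - algebraMap _ _ (aug a)) * l,
        add_mem (Q.mul_mem_left _ hq) (hQ2 l hl _ (sub_aug_mem a)), aug a • l,
        Submodule.smul_mem _ _ hl, ?_⟩
      rw [Algebra.smul_def (aug a), smul_eq_mul]; ring
  obtain ⟨q, hq, l, hl, rfl⟩ := key z (ker_proj_le hz0)
  have hl' : l ∈ Jp p I := by simpa using sub_mem hz hq.1
  obtain ⟨a, c, h, rfl⟩ := hl
  obtain ⟨b, hb⟩ := aug_mem hl'
  rw [map_add, AlgHom.commutes, aug_dp one_ne_zero, add_zero] at hb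
  have hb' : a = p * b := hb
  refine (Q.add_mem hq (hQ1 _ ⟨1, b, c, one_ne_zero, ?_, ?_⟩)).2 n hn
  · refine Subtype.ext ?_
    rw [hb', map_mul, map_natCast] at h
    simpa [mul_comm] using h
  · rw [(dpΓ p I).dpow_one (ψ_mem b c), ψ, hb', map_mul, map_natCast]

theorem map_Jp : ideal I = (Jp p I).map (proj p I) := by
  refine le_antisymm (Ideal.span_le.2 ?_) ?_
  · rintro _ ⟨n, x, hn, rfl⟩
    have := proj_dp n (Finsupp.single x (1 : Poly p A))
    rw [ρ_single_one] at this
    rw [← this]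
    exact Ideal.mem_map_of_mem _ (dp_mem hn _)
  · rw [Ideal.map_le_iff_le_comap]
    refine sup_le (Ideal.span_le.2 ?_) ?_
    · rintro _ ⟨n, c, hn, rfl⟩
      change proj p I (dpl n c) ∈ ideal I
      rw [proj_dp]; exact dp_mem_ideal hn _
    · rw [Ideal.span_singleton_le_iff_mem, Ideal.mem_comap, map_natCast]
      have := dp_mem_ideal one_ne_zero (⟨p, p_mem⟩ : Gen p I)
      rwa [PDEnv.dp_one, map_natCast] at this

end Cover

section
variable {A : Type v} [CommRing A] [Algebra ℤ_[p] A]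

theorem exists_dividedPowers (I : Ideal A) :
    ∃ h : DividedPowers (ideal (p := p) I),
      ∀ (n : ℕ) (x : ↥(I ⊔ Ideal.span {(p : A)})), h.dpow n (algebraMap A _ x.1) = PDEnv.dp n x := by
  obtain ⟨h, hh⟩ := exists_dividedPowers_of_surjective (Cover.proj p I) Cover.proj_surjective
    (Cover.dpΓ p I) (J' := ideal (p := p) I)
    (fun z hz hz0 n hn => Cover.proj_dpow_eq_zero hz hz0 hn) Cover.map_Jp
  refine ⟨h, fun n x => ?_⟩
  have := hh.dpow_comp (n := n) _ (Cover.dp_mem one_ne_zero (Finsupp.single x 1))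
  rwa [Cover.proj_dp, Cover.ρ_single_one, PDEnv.dp_one, Cover.dpow_dp_one, Cover.proj_dp,
    Cover.ρ_single_one] at this

/-- The divided powers of the envelope. -/
noncomputable def dividedPowers (I : Ideal A) : DividedPowers (ideal (p := p) I) :=
  (exists_dividedPowers I).choose

theorem dpow_algebraMap {I : Ideal A} (n : ℕ) (x : ↥(I ⊔ Ideal.span {(p : A)})) :
    (dividedPowers I).dpow n (algebraMap A _ x.1) = PDEnv.dp n x :=
  (exists_dividedPowers I).choose_spec n x

theorem algebraMap_mem_ideal {I : Ideal A} (x : ↥(I ⊔ Ideal.span {(p : A)})) :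
    algebraMap A (PDEnv p I) x ∈ ideal I := by
  rw [← PDEnv.dp_one]; exact dp_mem_ideal one_ne_zero x

theorem p_mem_ideal (I : Ideal A) : (p : PDEnv p I) ∈ ideal I := by
  have := algebraMap_mem_ideal (⟨p, Cover.p_mem⟩ : ↥(I ⊔ Ideal.span {(p : A)}))
  rwa [map_natCast] at this

/-- The structure map of the envelope. -/
noncomputable def padicInt (I : Ideal A) : ℤ_[p] →+* PDEnv p I :=
  (algebraMap A (PDEnv p I)).comp (algebraMap ℤ_[p] A)

theorem gammaCompat (I : Ideal A) : GammaCompat (padicInt I) (dividedPowers (p := p) I) := by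
  intro n a _
  have := dpow_algebraMap n (⟨p, Cover.p_mem⟩ : ↥(I ⊔ Ideal.span {(p : A)}))
  rw [PDEnv.dp_p p n _ rfl, map_natCast] at this
  rw [mul_comm (p : PDEnv p I) a, (dividedPowers I).dpow_mul (p_mem_ideal I), this, mul_comm]
  rfl

/-- The universal property of the envelope: existence. -/
noncomputable def liftDP {I : Ideal A} {B : Type w} [CommRing B] (φ : A →+* B) {J : Ideal B}
    (hJ : DividedPowers J) (hφ : ∀ x ∈ I ⊔ Ideal.span {(p : A)}, φ x ∈ J)
    (hc : GammaCompat (φ.comp (algebraMap ℤ_[p] A)) hJ) : PDEnv p I →+* B :=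
  PDEnv.lift p φ (fun n x => hJ.dpow n (φ x))
    (fun x => hJ.dpow_zero (hφ x x.2))
    (fun n a x => by rw [Submodule.coe_smul, smul_eq_mul, map_mul, hJ.dpow_mul (hφ x x.2)])
    (fun m n x => hJ.mul_dpow (hφ x x.2))
    (fun n x y => by rw [Submodule.coe_add, map_add, hJ.dpow_add (hφ x x.2) (hφ y y.2)])
    (fun x => hJ.dpow_one (hφ x x.2))
    (fun n x hx => by
      have h := hφ x x.2
      rw [hx, map_natCast, ← mul_one (p : B)] at h
      rw [hx, map_natCast, ← mul_one (p : B), hc n 1 h, one_pow, mul_one]; rfl)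

theorem liftDP_algebraMap {I : Ideal A} {B : Type w} [CommRing B] (φ : A →+* B) {J : Ideal B}
    (hJ : DividedPowers J) (hφ : ∀ x ∈ I ⊔ Ideal.span {(p : A)}, φ x ∈ J)
    (hc : GammaCompat (φ.comp (algebraMap ℤ_[p] A)) hJ) (a : A) :
    liftDP φ hJ hφ hc (algebraMap A _ a) = φ a := lift_algebraMap ..

theorem liftDP_dp {I : Ideal A} {B : Type w} [CommRing B] (φ : A →+* B) {J : Ideal B}
    (hJ : DividedPowers J) (hφ : ∀ x ∈ I ⊔ Ideal.span {(p : A)}, φ x ∈ J)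
    (hc : GammaCompat (φ.comp (algebraMap ℤ_[p] A)) hJ) (n : ℕ) (x) :
    liftDP φ hJ hφ hc (PDEnv.dp n x) = hJ.dpow n (φ x) := lift_dp ..

theorem ideal_eq_map (I : Ideal A) : ideal (p := p) I = Ideal.span
    {z | ∃ (n : ℕ) (x : ↥(I ⊔ Ideal.span {(p : A)})), n ≠ 0 ∧ z = PDEnv.dp n x} := rfl

/-- Homomorphisms out of the envelope are divided power morphisms if they preserve the elements
`x^{[n]}` with `x ∈ I + p A`. -/
theorem isDPMorphism {I : Ideal A} {B : Type w} [CommRing B] {J : Ideal B}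
    (hJ : DividedPowers J) (f : PDEnv p I →+* B)
    (hf : ∀ x : ↥(I ⊔ Ideal.span {(p : A)}), f (algebraMap A _ x) ∈ J)
    (hf' : ∀ (n : ℕ) (x : ↥(I ⊔ Ideal.span {(p : A)})), f (PDEnv.dp n x) = hJ.dpow n (f (algebraMap A _ x))) :
    (dividedPowers I).IsDPMorphism hJ f := by
  have hS : ∀ z ∈ {z : PDEnv p I | ∃ (n : ℕ) (x : ↥(I ⊔ Ideal.span {(p : A)})), n ≠ 0 ∧ z = PDEnv.dp n x},
      f z ∈ J := by
    rintro _ ⟨n, x, hn, rfl⟩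
    rw [hf']; exact hJ.dpow_mem hn (hf x)
  refine DividedPowers.IsDPMorphism.on_span _ _ (ideal_eq_map I) hS ?_
  rintro m _ ⟨n, x, hn, rfl⟩
  rw [← dpow_algebraMap, (dividedPowers I).dpow_comp hn (algebraMap_mem_ideal x), dpow_algebraMap,
    dpow_algebraMap, hf', hJ.dpow_comp hn (hf x), map_mul, map_natCast, hf']

theorem isDPMorphism_liftDP {I : Ideal A} {B : Type w} [CommRing B] (φ : A →+* B) {J : Ideal B}
    (hJ : DividedPowers J) (hφ : ∀ x ∈ I ⊔ Ideal.span {(p : A)}, φ x ∈ J)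
    (hc : GammaCompat (φ.comp (algebraMap ℤ_[p] A)) hJ) :
    (dividedPowers I).IsDPMorphism hJ (liftDP φ hJ hφ hc) :=
  isDPMorphism hJ _ (fun x => by rw [liftDP_algebraMap]; exact hφ x x.2)
    (fun n x => by rw [liftDP_dp, liftDP_algebraMap])

/-- The universal property of the envelope: uniqueness. -/
theorem hom_ext_of_isDPMorphism {I : Ideal A} {B : Type w} [CommRing B] {J : Ideal B}
    {hJ : DividedPowers J} {f g : PDEnv p I →+* B} (hf : (dividedPowers I).IsDPMorphism hJ f)
    (hg : (dividedPowers I).IsDPMorphism hJ g)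
    (h : ∀ a, f (algebraMap A _ a) = g (algebraMap A _ a)) : f = g :=
  hom_ext h fun n x => by
    rw [← dpow_algebraMap, ← hf.dpow_comp _ (algebraMap_mem_ideal x),
      ← hg.dpow_comp _ (algebraMap_mem_ideal x), h]

theorem ideal_le_comap_toQuot (I : Ideal A) :
    ideal (p := p) I ≤ (Ideal.span {(p : A ⧸ I)}).comap (PDEnv.toQuot p I) := by
  refine Ideal.span_le.2 ?_
  rintro _ ⟨n, x, hn, rfl⟩
  change PDEnv.toQuot p I (PDEnv.dp n x) ∈ Ideal.span {(p : A ⧸ I)}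
  rw [PDEnv.toQuot, lift_dp, dpMod]
  obtain ⟨d, hd⟩ := gammaP_dvd p hn
  rw [hd, map_mul, map_natCast, mul_assoc]
  exact Ideal.mul_mem_right _ _ (Ideal.mem_span_singleton_self _)

theorem mem_ideal_of_toQuot {I : Ideal A} {z : PDEnv p I}
    (hz : PDEnv.toQuot p I z ∈ Ideal.span {(p : A ⧸ I)}) : z ∈ ideal I := by
  obtain ⟨a, ha⟩ := exists_algebraMap_sub_mem z
  have h := sub_mem hz (ideal_le_comap_toQuot I ha)
  rw [← map_sub, sub_sub_cancel, PDEnv.toQuot, lift_algebraMap] at h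
  obtain ⟨b, hb⟩ := Ideal.mem_span_singleton.1 h
  obtain ⟨b, rfl⟩ := Ideal.Quotient.mk_surjective b
  rw [← map_natCast (Ideal.Quotient.mk I), ← map_mul, Ideal.Quotient.eq] at hb
  have ha' : a ∈ I ⊔ Ideal.span {(p : A)} := by
    rw [← sub_add_cancel a (p * b)]
    exact add_mem (Ideal.mem_sup_left hb)
      (Ideal.mem_sup_right (Ideal.mul_mem_right _ _ (Ideal.mem_span_singleton_self _)))
  rw [← sub_add_cancel z (algebraMap A _ a)]
  exact add_mem ha (algebraMap_mem_ideal ⟨a, ha'⟩)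

end
end PDEnv
end EnvelopeDP

/-! ### Envelopes of ideals generated by a regular element -/

section Regular
variable {p : ℕ} [hp : Fact p.Prime] {A : Type v} [CommRing A] [Algebra ℤ_[p] A]

namespace RegularEnv

/-- The divided power algebra in one variable. -/
abbrev Γ₁ (A : Type v) [CommRing A] : Type v := DividedPowerAlgebra A (PUnit.{v + 1} →₀ A)

/-- The divided powers of the variable. -/
noncomputable def S (A : Type v) [CommRing A] (n : ℕ) : Γ₁ A :=
  DividedPowerAlgebra.dp A n (Finsupp.single PUnit.unit 1)

theorem S_one_mul (n : ℕ) : S A 1 * S A n = (n + 1) • S A (n + 1) := by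
  rw [S, S, DividedPowerAlgebra.dp_mul, add_comm 1 n, Nat.choose_one_right]; rfl

/-- The basis of the divided powers of the variable. -/
noncomputable def basis (tf : NatTorsionFree A) : Module.Basis ℕ A (Γ₁ A) :=
  (dpBasis PUnit.{v + 1} tf).reindex
    (Finsupp.equivFunOnFinite.trans (Equiv.funUnique PUnit.{v + 1} ℕ))

theorem basis_apply (tf : NatTorsionFree A) (n : ℕ) : basis tf n = S A n := by
  have h : (Finsupp.equivFunOnFinite.trans (Equiv.funUnique PUnit.{v + 1} ℕ)).symm n =
      Finsupp.single PUnit.unit n := by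
    rw [Equiv.symm_apply_eq]; simp
  have h' : ∀ m, dpBasis PUnit.{v + 1} tf m = dpMonomial PUnit.{v + 1} m :=
    fun m => Module.Basis.mk_apply _ _ m
  rw [basis, Module.Basis.reindex_apply, h, h', dpMonomial,
    Finsupp.prod_single_index (by exact DividedPowerAlgebra.dp_zero)]
  rfl

theorem coord_S_mul (tf : NatTorsionFree A) (u : Γ₁ A) (n : ℕ) :
    (basis tf).repr (S A 1 * u) (n + 1) = (n + 1 : A) * (basis tf).repr u n := by
  have : (basis tf).coord (n + 1) ∘ₗ LinearMap.mulLeft A (S A 1) =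
      ((n + 1 : ℕ) : A) • (basis tf).coord n := by
    refine (basis tf).ext fun m => ?_
    rw [LinearMap.comp_apply, LinearMap.mulLeft_apply, basis_apply, S_one_mul, map_nsmul,
      LinearMap.smul_apply, ← basis_apply tf, ← basis_apply tf, Module.Basis.coord_apply,
      Module.Basis.coord_apply, Module.Basis.repr_self, Module.Basis.repr_self,
      Finsupp.single_apply, Finsupp.single_apply]
    by_cases h : m = n
    · subst h; simp
    · simp [h]
  simpa using congrArg (fun l => l u) this

theorem coord_S_mul_zero (tf : NatTorsionFree A) (u : Γ₁ A) :
    (basis tf).repr (S A 1 * u) 0 = 0 := by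
  have : (basis tf).coord 0 ∘ₗ LinearMap.mulLeft A (S A 1) = 0 := by
    refine (basis tf).ext fun m => ?_
    rw [LinearMap.comp_apply, LinearMap.mulLeft_apply, basis_apply, S_one_mul, map_nsmul,
      ← basis_apply tf, Module.Basis.coord_apply, Module.Basis.repr_self, Finsupp.single_apply]
    simp
  simpa using congrArg (fun l => l u) this

/-- If `y` is regular modulo `p`, then so is `S - y`. -/
theorem exists_eq_p_mul (tf : NatTorsionFree A) {y : A}
    (hy : ∀ a, (∃ b, y * a = p * b) → ∃ b, a = p * b) {u X : Γ₁ A}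
    (h : (S A 1 - algebraMap _ _ y) * u = p * X) : ∃ u', u = p * u' := by
  have h1 : ∀ n, (basis tf).repr (S A 1 * u) n - y * (basis tf).repr u n =
      p * (basis tf).repr X n := fun n => by
    have := congrArg (fun z => (basis tf).repr z n) h
    simp only [sub_mul] at this
    rw [← Algebra.smul_def, ← nsmul_eq_mul, map_sub, map_smul, map_nsmul] at this
    simpa using this
  have h2 : ∀ n, ∃ b, (basis tf).repr u n = p * b := by
    intro n
    induction n with
    | zero =>
      refine hy _ ⟨-(basis tf).repr X 0, ?_⟩
      have := h1 0
      rw [coord_S_mul_zero] at this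
      linear_combination -this
    | succ n ih =>
      obtain ⟨b, hb⟩ := ih
      refine hy _ ⟨(n + 1) * b - (basis tf).repr X (n + 1), ?_⟩
      have := h1 (n + 1)
      rw [coord_S_mul, hb] at this
      linear_combination -this
  choose b hb using h2
  refine ⟨∑ n ∈ ((basis tf).repr u).support, b n • basis tf n, ?_⟩
  conv_lhs => rw [← (basis tf).linearCombination_repr u, Finsupp.linearCombination_apply, Finsupp.sum]
  rw [Finset.mul_sum]
  refine Finset.sum_congr rfl fun n _ => ?_
  rw [hb, mul_smul, ← nsmul_eq_mul, Nat.cast_smul_eq_nsmul]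

/-- The divided power algebra in one variable `S` modulo `S = y`. It is the divided power envelope of
`(y, p)` if `y` is regular modulo `p`. -/
def E (y : A) : Type v := Γ₁ A ⧸ Ideal.span {S A 1 - algebraMap _ (Γ₁ A) y}

noncomputable instance (y : A) : CommRing (E y) :=
  inferInstanceAs (CommRing (Γ₁ A ⧸ Ideal.span {S A 1 - algebraMap _ (Γ₁ A) y}))

noncomputable instance (y : A) : Algebra A (E y) :=
  inferInstanceAs (Algebra A (Γ₁ A ⧸ Ideal.span {S A 1 - algebraMap _ (Γ₁ A) y}))

/-- The projection to `E y`. -/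
noncomputable def mk (y : A) : Γ₁ A →+* E y := Ideal.Quotient.mk _

theorem mk_eq_zero {y : A} {x : Γ₁ A} :
    mk y x = 0 ↔ ∃ u, x = (S A 1 - algebraMap _ (Γ₁ A) y) * u := by
  refine Ideal.Quotient.eq_zero_iff_mem.trans ?_
  rw [Ideal.mem_span_singleton]; rfl

/-- The image of the `n`-th divided power of the variable. -/
noncomputable def s (y : A) (n : ℕ) : E y := mk y (S A n)

theorem s_one (y : A) : s y 1 = algebraMap A (E y) y :=
  Ideal.Quotient.eq.2 (Ideal.mem_span_singleton_self _)

theorem factorial_mul_s (y : A) (n : ℕ) : (n.factorial : E y) * s y n = algebraMap A (E y) y ^ n := by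
  rw [← s_one, s, s, ← map_natCast (mk y), ← map_mul, ← map_pow]
  exact congrArg _ (DividedPowerAlgebra.natFactorial_mul_dp_eq n _)

/-- Regularity of `y` modulo `p` makes `S - y` regular modulo `p`, hence `p` is a non-zero-divisor
modulo `S - y`. -/
theorem natTorsionFree_E (tf : NatTorsionFree A) {y : A}
    (hy : ∀ a, (∃ b, y * a = p * b) → ∃ b, a = p * b) : NatTorsionFree (E y) := by
  refine natTorsionFree_of_p ((algebraMap A (E y)).comp (algebraMap ℤ_[p] A)) fun x hx => ?_
  obtain ⟨x, rfl⟩ := Ideal.Quotient.mk_surjective x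
  change (p : E y) * mk y x = 0 at hx
  rw [← map_natCast (mk y), ← map_mul, mk_eq_zero] at hx
  obtain ⟨u, hu⟩ := hx
  obtain ⟨u', rfl⟩ := exists_eq_p_mul tf hy hu.symm
  refine mk_eq_zero.2 ⟨u', (NatTorsionFree.of_basis tf (basis tf)).cancel hp.out.ne_zero ?_⟩
  rw [hu]; ring

/-- The divided power ideal. -/
noncomputable def J (p : ℕ) (y : A) : Ideal (E y) :=
  Ideal.span ({z | ∃ n, n ≠ 0 ∧ z = s y n} ∪ {(p : E y)})

theorem s_mem {y : A} {n : ℕ} (hn : n ≠ 0) : s y n ∈ J p y :=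
  Ideal.subset_span (Or.inl ⟨n, hn, rfl⟩)

theorem p_mem (y : A) : (p : E y) ∈ J p y := Ideal.subset_span (Or.inr rfl)

/-- The structure map. -/
noncomputable def ιE (y : A) : ℤ_[p] →+* E y := (algebraMap A (E y)).comp (algebraMap ℤ_[p] A)

theorem factorial_mul_uniformBell {y : A} (tf : NatTorsionFree (E y)) (m : ℕ) {n : ℕ} (hn : n ≠ 0) :
    (m.factorial : E y) * (m.uniformBell n * s y (m * n)) = s y n ^ m := by
  refine tf.cancel (pow_ne_zero m n.factorial_ne_zero) ?_
  have h2 := factorial_mul_s y (m * n)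
  rw [← Nat.uniformBell_mul_eq m hn] at h2
  push_cast at h2 ⊢
  rw [← mul_pow, factorial_mul_s, ← pow_mul, mul_comm n m, ← h2]
  ring

theorem exists_dividedPowers {y : A} (tf : NatTorsionFree (E y)) : Nonempty (DividedPowers (J p y)) := by
  refine tf.exists_dividedPowers rfl ?_
  rintro _ (⟨n, hn, rfl⟩ | rfl) m hm
  · exact ⟨_, Ideal.mul_mem_left _ _ (s_mem (Nat.mul_ne_zero hm hn)),
      factorial_mul_uniformBell tf m hn⟩
  · refine ⟨ιE y (gammaP p m), ?_, ?_⟩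
    · rw [p_mul_gammaDiv_mem (ιE y) hm]
      exact Ideal.mul_mem_right _ _ (p_mem y)
    · rw [← map_natCast (ιE (p := p) y), ← map_mul, factorial_mul_gammaP, map_pow, map_natCast]

end RegularEnv

theorem PDEnv.dpow_dp {I : Ideal A} (m : ℕ) {n : ℕ} (hn : n ≠ 0)
    (x : ↥(I ⊔ Ideal.span {(p : A)})) :
    (PDEnv.dividedPowers I).dpow m (PDEnv.dp n x) = m.uniformBell n * PDEnv.dp (m * n) x := by
  rw [← PDEnv.dpow_algebraMap, (PDEnv.dividedPowers I).dpow_comp hn (PDEnv.algebraMap_mem_ideal x),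
    PDEnv.dpow_algebraMap]

open RegularEnv in
/-- If `I + p A` is generated by `p` and an element `y` that is regular modulo `p`, then the
envelope is torsion-free. -/
theorem PDEnv.natTorsionFree_of_regular (tf : NatTorsionFree A) {I : Ideal A} {y : A}
    (hI : I ⊔ Ideal.span {(p : A)} = Ideal.span {y} ⊔ Ideal.span {(p : A)})
    (hy : ∀ a, (∃ b, y * a = p * b) → ∃ b, a = p * b) : NatTorsionFree (PDEnv p I) := by
  have tfE := natTorsionFree_E (p := p) (y := y) tf hy
  obtain ⟨hE⟩ := RegularEnv.exists_dividedPowers (p := p) tfE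
  have hyI : y ∈ I ⊔ Ideal.span {(p : A)} :=
    hI.ge (Ideal.mem_sup_left (Ideal.mem_span_singleton_self y))
  have hJ : ∀ x ∈ I ⊔ Ideal.span {(p : A)}, algebraMap A (E y) x ∈ J p y := by
    rw [hI]
    change _ ≤ (J p y).comap (algebraMap A (E y))
    refine sup_le ?_ ?_
    · rw [Ideal.span_singleton_le_iff_mem, Ideal.mem_comap, ← s_one]
      exact s_mem one_ne_zero
    · rw [Ideal.span_singleton_le_iff_mem, Ideal.mem_comap, map_natCast]
      exact p_mem y
  -- The universal properties give divided power homomorphisms `F` and `G` in both directions, and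
  -- `G ∘ F` is the identity.
  let F : PDEnv p I →+* E y := PDEnv.liftDP (algebraMap A (E y)) hE hJ
    (GammaCompat.of_torsionFree tfE _ hE)
  let g₀ : (PUnit.{v + 1} →₀ A) →ₗ[A] PDEnv p I :=
    Finsupp.linearCombination A (fun _ => algebraMap A (PDEnv p I) y)
  have hg₁ : g₀ (Finsupp.single PUnit.unit 1) = algebraMap A (PDEnv p I) y := by
    simp [g₀]
  have hg₀ : ∀ c, g₀ c ∈ PDEnv.ideal I := fun c => by
    rw [Finsupp.linearCombination_apply]
    refine Submodule.sum_mem _ fun i _ => ?_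
    · simp only [Algebra.smul_def]
      exact Ideal.mul_mem_left _ _ (PDEnv.algebraMap_mem_ideal ⟨y, hyI⟩)
  let G₀ : Γ₁ A →ₐ[A] PDEnv p I := DividedPowerAlgebra.lift (PDEnv.dividedPowers I) g₀ hg₀
  have hG₀ : ∀ n, G₀ (S A n) = PDEnv.dp n ⟨y, hyI⟩ := fun n => by
    rw [S, DividedPowerAlgebra.lift_apply_dp, hg₁]
    exact PDEnv.dpow_algebraMap n ⟨y, hyI⟩
  let G : E y →+* PDEnv p I := Ideal.Quotient.lift _ G₀.toRingHom (by
    intro a ha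
    obtain ⟨c, rfl⟩ := Ideal.mem_span_singleton.1 ha
    change G₀ _ = 0
    rw [map_mul, map_sub, hG₀, AlgHom.commutes, PDEnv.dp_one, sub_self, zero_mul])
  have hGs : ∀ n, G (s y n) = PDEnv.dp n ⟨y, hyI⟩ := hG₀
  have hGa : ∀ a, G (algebraMap A (E y) a) = algebraMap A _ a := fun a => AlgHom.commutes G₀ a
  have hGJ : ∀ z ∈ {z : E y | ∃ n, n ≠ 0 ∧ z = s y n} ∪ {(p : E y)}, G z ∈ PDEnv.ideal I := by
    rintro _ (⟨n, hn, rfl⟩ | rfl)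
    · rw [hGs]; exact PDEnv.dp_mem_ideal hn _
    · rw [map_natCast]; exact PDEnv.p_mem_ideal I
  have hG : hE.IsDPMorphism (PDEnv.dividedPowers I) G := by
    refine DividedPowers.IsDPMorphism.on_span _ _ rfl hGJ ?_
    rintro m _ (⟨n, hn, rfl⟩ | rfl)
    · have h1 : hE.dpow m (s y n) = m.uniformBell n * s y (m * n) := by
        refine tfE.cancel m.factorial_ne_zero ?_
        rw [hE.factorial_mul_dpow_eq_pow (s_mem hn), factorial_mul_uniformBell tfE m hn]
      rw [h1, map_mul, map_natCast, hGs, hGs, PDEnv.dpow_dp m hn]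
    · have h1 := GammaCompat.of_torsionFree tfE (ιE (p := p) y) hE m 1
        (by rw [mul_one]; exact p_mem y)
      have h2 := PDEnv.gammaCompat (p := p) I m 1 (by rw [mul_one]; exact PDEnv.p_mem_ideal I)
      rw [mul_one] at h1 h2
      rw [map_natCast, h1, h2, one_pow, mul_one, one_pow, mul_one]
      exact hGa _
  have hGF : G.comp F = RingHom.id _ := by
    refine PDEnv.hom_ext_of_isDPMorphism (hJ := PDEnv.dividedPowers I)
      (DividedPowers.IsDPMorphism.comp _ hG (PDEnv.isDPMorphism_liftDP ..)) ⟨by rw [Ideal.map_id], fun _ _ => rfl⟩ fun a => ?_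
    rw [RingHom.comp_apply, PDEnv.liftDP_algebraMap, hGa, RingHom.id_apply]
  exact tfE.of_injective F (Function.LeftInverse.injective (g := G)
    fun x => congrArg (fun f : PDEnv p I →+* PDEnv p I => f x) hGF)

end Regular

/-! ### The `p`-adic completion of a ring -/

namespace PCompl
variable {p : ℕ} {D : Type v} [CommRing D] {D' : Type w} [CommRing D']

/-- The canonical homomorphism to the completion. -/
noncomputable def of (p : ℕ) (D : Type v) [CommRing D] : D →+* PCompl p D := algebraMap D _

/-- The element `d` of `D` is congruent to `x` modulo `p ^ n`. -/
def Mod (n : ℕ) (x : PCompl p D) (d : D) : Prop :=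
  AdicCompletion.evalₐ (Ideal.span {(p : D)}) n x = Ideal.Quotient.mk _ d

theorem exists_mod (n : ℕ) (x : PCompl p D) : ∃ d, Mod n x d := by
  obtain ⟨d, hd⟩ := Ideal.Quotient.mk_surjective
    (AdicCompletion.evalₐ (Ideal.span {(p : D)}) n x)
  exact ⟨d, hd.symm⟩

theorem mod_of (n : ℕ) (d : D) : Mod n (of p D d) d := AdicCompletion.evalₐ_of _ n d

theorem mem_span_pow {n : ℕ} {a : D} : a ∈ Ideal.span {(p : D)} ^ n ↔ ∃ t, a = p ^ n * t := by
  rw [Ideal.span_singleton_pow, Ideal.mem_span_singleton]; rfl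

theorem mk_eq_mk {n : ℕ} {a b : D} : Ideal.Quotient.mk (Ideal.span {(p : D)} ^ n) a =
    Ideal.Quotient.mk _ b ↔ ∃ t, a = b + p ^ n * t := by
  rw [Ideal.Quotient.eq, mem_span_pow]
  exact exists_congr fun t => sub_eq_iff_eq_add'

theorem Mod.eq {n : ℕ} {x : PCompl p D} {d d' : D} (h : Mod n x d) (h' : Mod n x d') :
    ∃ t, d = d' + p ^ n * t := mk_eq_mk.1 (h.symm.trans h')

theorem Mod.of_eq {n : ℕ} {x : PCompl p D} {d d' : D} (h : Mod n x d) (t : D)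
    (h' : d' = d + p ^ n * t) : Mod n x d' := Eq.trans h (mk_eq_mk.2 ⟨t, h'⟩).symm

theorem Mod.mono {m n : ℕ} (hmn : m ≤ n) {x : PCompl p D} {d : D} (h : Mod n x d) :
    Mod m x d := by
  obtain ⟨s, rfl⟩ := AdicCompletion.mk_surjective (Ideal.span {(p : D)}) D x
  unfold Mod at h ⊢
  rw [AdicCompletion.evalₐ_mk] at h ⊢
  have h1 := AdicCompletion.Ideal.mk_eq_mk (Ideal.span {(p : D)}) hmn s
  refine h1.symm.trans ?_
  rw [Ideal.Quotient.eq] at h ⊢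
  exact Ideal.pow_le_pow_right hmn h

theorem Mod.add {n : ℕ} {x y : PCompl p D} {d e : D} (h : Mod n x d) (h' : Mod n y e) :
    Mod n (x + y) (d + e) := by
  unfold Mod at *; rw [map_add, map_add, h, h']

theorem Mod.mul {n : ℕ} {x y : PCompl p D} {d e : D} (h : Mod n x d) (h' : Mod n y e) :
    Mod n (x * y) (d * e) := by
  unfold Mod at *; rw [map_mul, map_mul, h, h']

theorem Mod.sub {n : ℕ} {x y : PCompl p D} {d e : D} (h : Mod n x d) (h' : Mod n y e) :
    Mod n (x - y) (d - e) := by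
  unfold Mod at *; rw [map_sub, map_sub, h, h']

theorem Mod.pow {n : ℕ} {x : PCompl p D} {d : D} (h : Mod n x d) (k : ℕ) :
    Mod n (x ^ k) (d ^ k) := by
  unfold Mod at *; rw [map_pow, map_pow, h]

theorem mod_natCast (n k : ℕ) : Mod n (k : PCompl p D) (k : D) := by
  unfold Mod; rw [map_natCast, map_natCast]

theorem ext {x y : PCompl p D} (h : ∀ n, ∃ d, Mod n x d ∧ Mod n y d) : x = y :=
  AdicCompletion.ext_evalₐ fun n => by
    obtain ⟨d, hx, hy⟩ := h n
    exact Eq.trans hx (Eq.symm hy)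

theorem exists_of_seq (d : ℕ → D) (h : ∀ n, ∃ t, d n = d (n + 1) + p ^ n * t) :
    ∃ x : PCompl p D, ∀ n, Mod n x (d n) := by
  refine ⟨AdicCompletion.mk _ D (AdicCompletion.AdicCauchySequence.mk _ _ d fun n => ?_),
    fun n => AdicCompletion.evalₐ_mk _ n _⟩
  obtain ⟨t, ht⟩ := h n
  rw [SModEq.sub_mem, smul_eq_mul, Ideal.mul_top]
  exact mem_span_pow.2 ⟨t, by rw [ht]; ring⟩

theorem fg : (Ideal.span {(p : D)}).FG := ⟨{(p : D)}, by simp⟩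

theorem mod_zero_iff {n : ℕ} {x : PCompl p D} : Mod n x 0 ↔ ∃ y, x = p ^ n * y := by
  constructor
  · intro h
    have h1 : x ∈ (AdicCompletion.eval (Ideal.span {(p : D)}) D n).ker := by
      rw [LinearMap.mem_ker, ← AdicCompletion.factor_evalₐ_eq_eval _ x (by simp), h]
      simp
    rw [← AdicCompletion.pow_smul_top_eq_ker_eval fg, Ideal.span_singleton_pow,
      Submodule.ideal_span_singleton_smul] at h1
    obtain ⟨y, -, hy⟩ := h1
    refine ⟨y, ?_⟩
    rw [← hy]
    change ((p : D) ^ n) • y = _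
    rw [Algebra.smul_def, map_pow, map_natCast]
  · rintro ⟨y, rfl⟩
    obtain ⟨d, hd⟩ := exists_mod n y
    exact (((mod_natCast n p).pow n).mul hd).of_eq (-d) (by ring)

theorem Mod.exists_eq {n : ℕ} {x : PCompl p D} {d : D} (h : Mod n x d) :
    ∃ y, x = of p D d + p ^ n * y := by
  have h1 := h.sub (mod_of n d)
  rw [sub_self] at h1
  obtain ⟨y, hy⟩ := mod_zero_iff.1 h1
  exact ⟨y, by rw [← hy]; ring⟩

theorem Mod.map {n : ℕ} {x : PCompl p D} {d : D} (h : Mod n x d) (f : D →+* D') :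
    Mod n (pComplMap p f x) (f d) := by
  unfold Mod pComplMap
  rw [AdicCompletion.evalₐ_liftRingHom]
  · exact (congrArg (Ideal.quotientMap (Ideal.span {(p : D')} ^ n) f
      (span_p_pow_le_comap p f n)) h).trans rfl
  · intro m n hle
    ext y
    obtain ⟨y, rfl⟩ := AdicCompletion.mk_surjective (Ideal.span {(p : D)}) D y
    have h1 := congrArg (Ideal.quotientMap (Ideal.span {(p : D')} ^ m) f
      (span_p_pow_le_comap p f m)) (AdicCompletion.Ideal.mk_eq_mk (Ideal.span {(p : D)}) hle y)
    change Ideal.Quotient.factorPow _ hle (Ideal.quotientMap _ f (span_p_pow_le_comap p f n)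
      (AdicCompletion.evalₐ _ n (AdicCompletion.mk _ _ y))) =
        Ideal.quotientMap _ f (span_p_pow_le_comap p f m)
          (AdicCompletion.evalₐ _ m (AdicCompletion.mk _ _ y))
    rw [AdicCompletion.evalₐ_mk, AdicCompletion.evalₐ_mk]
    exact h1

theorem pComplMap_of (f : D →+* D') (d : D) : pComplMap p f (of p D d) = of p D' (f d) :=
  ext fun n => ⟨_, (mod_of n d).map f, mod_of n _⟩

theorem Mod.lift {n : ℕ} {x : PCompl p D} {d : D} (hx : Mod n x d) (f : D →+* D')
    (h : IsNilpotent (p : D')) (hn : (p : D') ^ n = 0) : pComplLift p f h x = f d := by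
  obtain ⟨e, he⟩ := exists_mod (max n h.choose) x
  have h1 : pComplLift p f h x = f e := by
    unfold pComplLift
    rw [RingHom.comp_apply]
    change Ideal.Quotient.lift _ f _ (AdicCompletion.evalₐ _ h.choose x) = _
    rw [he.mono (le_max_right _ _)]; rfl
  obtain ⟨t, rfl⟩ := hx.eq (he.mono (le_max_left _ _))
  rw [h1, map_add, map_mul, map_pow, map_natCast, hn, zero_mul, add_zero]

theorem isAdicComplete : IsAdicComplete (Ideal.span {(p : PCompl p D)}) (PCompl p D) := by
  have h := AdicCompletion.isAdicComplete (M := D) (fg (p := p) (D := D))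
  rw [← IsAdicComplete.map_algebraMap_iff (S := PCompl p D)] at h
  rwa [Ideal.map_span, Set.image_singleton, map_natCast] at h

theorem natTorsionFree_p (tf : ∀ x : D, (p : D) * x = 0 → x = 0) (x : PCompl p D)
    (hx : (p : PCompl p D) * x = 0) : x = 0 := by
  refine ext fun n => ?_
  obtain ⟨d, hd⟩ := exists_mod (n + 1) x
  have h1 := (mod_natCast (n + 1) p).mul hd
  rw [hx] at h1
  obtain ⟨t, ht⟩ := h1.eq (d' := 0) (by simpa using mod_natCast (p := p) (D := D) (n + 1) 0)
  have hdt : d = p ^ n * t := sub_eq_zero.1 (tf _ (by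
    rw [mul_sub, ht]; ring))
  exact ⟨0, (hd.mono n.le_succ).of_eq (-t) (by rw [hdt]; ring),
    by simpa using mod_natCast (p := p) (D := D) n 0⟩

/-- Homomorphisms to complete rings extend to the completion. -/
noncomputable def extend {B : Type w} [CommRing B] [IsAdicComplete (Ideal.span {(p : B)}) B]
    (f : D →+* B) : PCompl p D →+* B :=
  (AdicCompletion.ofAlgEquiv (Ideal.span {(p : B)})).symm.toRingHom.comp (pComplMap p f)

theorem extend_of {B : Type w} [CommRing B] [IsAdicComplete (Ideal.span {(p : B)}) B]
    (f : D →+* B) (d : D) : extend (p := p) f (of p D d) = f d := by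
  unfold extend
  rw [RingHom.comp_apply, pComplMap_of]
  exact AdicCompletion.ofAlgEquiv_symm_of _ _

theorem exists_extend_eq {B : Type w} [CommRing B] [IsAdicComplete (Ideal.span {(p : B)}) B]
    (f : D →+* B) {n : ℕ} {x : PCompl p D} {d : D} (h : Mod n x d) :
    ∃ t, extend f x = f d + p ^ n * t := by
  obtain ⟨y, rfl⟩ := h.exists_eq
  exact ⟨extend f y, by rw [map_add, extend_of, map_mul, map_pow, map_natCast]⟩

end PCompl

theorem eq_of_forall_exists_pow_mul {p : ℕ} {B : Type w} [CommRing B]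
    [h : IsAdicComplete (Ideal.span {(p : B)}) B] {x y : B}
    (hxy : ∀ n, ∃ t, x = y + p ^ n * t) : x = y := by
  refine sub_eq_zero.1 (IsHausdorff.haus h.toIsHausdorff _ fun n => ?_)
  obtain ⟨t, ht⟩ := hxy n
  rw [SModEq.zero, smul_eq_mul, Ideal.mul_top]
  exact PCompl.mem_span_pow.2 ⟨t, by rw [ht]; ring⟩

/-! ### Divided Frobenius on Witt vectors -/

namespace W2
variable {p : ℕ} [hp : Fact p.Prime] {B : Type u} [CommRing B]

theorem pred_factorial_mul_dpow_add {J : Ideal B} (hJ : DividedPowers J) {x y : B} (hx : x ∈ J)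
    (hy : y ∈ J) : ((p - 1).factorial : B) * hJ.dpow p (x + y) =
      (p - 1).factorial * hJ.dpow p x + (p - 1).factorial * hJ.dpow p y + powDefect p x y := by
  rw [hJ.dpow_add hx hy, Finset.Nat.sum_antidiagonal_eq_sum_range_succ
    (fun i j => hJ.dpow i x * hJ.dpow j y), Finset.sum_range_succ, Finset.range_eq_Ico,
    Finset.sum_eq_sum_Ico_succ_bot hp.out.pos, Nat.sub_self, Nat.sub_zero, hJ.dpow_zero hx,
    hJ.dpow_zero hy, one_mul, mul_one, mul_add, mul_add, zero_add]
  have : ((p - 1).factorial : B) * ∑ i ∈ Finset.Ico 1 p, hJ.dpow i x * hJ.dpow (p - i) y =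
      powDefect p x y := by
    rw [powDefect, Finset.mul_sum]
    refine Finset.sum_congr rfl fun i hi => ?_
    rw [Finset.mem_Ico] at hi
    have h1 : p.choose i / p * i.factorial * (p - i).factorial = (p - 1).factorial := by
      apply Nat.eq_of_mul_eq_mul_left hp.out.pos
      rw [Nat.mul_factorial_pred hp.out.ne_zero, ← Nat.choose_mul_factorial_mul_factorial hi.2.le]
      conv_rhs => rw [← Nat.mul_div_cancel' (hp.out.dvd_choose_self (by omega) hi.2)]
      ring
    rw [← hJ.factorial_mul_dpow_eq_pow hx, ← hJ.factorial_mul_dpow_eq_pow hy, ← h1]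
    push_cast; ring
  rw [this]; ring

/-- The divided second ghost component of `z ∈ W₂(B)` with first component in `J`. -/
def frobDiv {J : Ideal B} (hJ : DividedPowers J) (z : W2 p B) : B :=
  (p - 1).factorial * hJ.dpow p z.c0 + z.c1

theorem p_mul_frobDiv {J : Ideal B} (hJ : DividedPowers J) {z : W2 p B} (hz : z.c0 ∈ J) :
    (p : B) * frobDiv hJ z = ghostHom p B z := by
  have h : (p : B) * (p - 1).factorial = p.factorial := by
    rw [← Nat.cast_mul, Nat.mul_factorial_pred hp.out.ne_zero]
  rw [frobDiv, mul_add, ← mul_assoc, h, hJ.factorial_mul_dpow_eq_pow hz, ghostHom_apply]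

theorem frobDiv_add {J : Ideal B} (hJ : DividedPowers J) {z w : W2 p B} (hz : z.c0 ∈ J)
    (hw : w.c0 ∈ J) : frobDiv hJ (z + w) = frobDiv hJ z + frobDiv hJ w := by
  rw [frobDiv, add_c0, add_c1, pred_factorial_mul_dpow_add hJ hz hw, frobDiv, frobDiv]; ring

theorem frobDiv_mul {J : Ideal B} (hJ : DividedPowers J) (w : W2 p B) {z : W2 p B}
    (hz : z.c0 ∈ J) : frobDiv hJ (w * z) = ghostHom p B w * frobDiv hJ z := by
  have h : (p : B) * (p - 1).factorial * hJ.dpow p z.c0 = z.c0 ^ p := by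
    rw [← hJ.factorial_mul_dpow_eq_pow hz, ← Nat.cast_mul, Nat.mul_factorial_pred hp.out.ne_zero]
  rw [frobDiv, mul_c0, mul_c1, hJ.dpow_mul hz, ghostHom_apply, frobDiv, ← h]; ring

theorem map_frobDiv {B' : Type v} [CommRing B'] {J : Ideal B} {J' : Ideal B'} {hJ : DividedPowers J}
    {hJ' : DividedPowers J'} {f : B →+* B'} (hf : hJ.IsDPMorphism hJ' f) {z : W2 p B}
    (hz : z.c0 ∈ J) : f (frobDiv hJ z) = frobDiv hJ' (map f z) := by
  rw [frobDiv, frobDiv, map_add, map_mul, map_natCast, ← hf.dpow_comp _ hz]; rfl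

theorem frobDiv_natCast_p {ι : ℤ_[p] →+* B} {J : Ideal B} {hJ : DividedPowers J}
    (hc : GammaCompat ι hJ) (hpJ : (p : B) ∈ J) : frobDiv hJ (p : W2 p B) = 1 := by
  have h1 := hc p 1 (by rwa [mul_one])
  have h2 : ((p - 1).factorial : ℤ_[p]) * gammaP p p = p ^ (p - 1) := by
    have hp0 : (p : ℤ_[p]) ≠ 0 := Nat.cast_ne_zero.2 hp.out.ne_zero
    refine mul_left_cancel₀ hp0 ?_
    rw [← mul_assoc, ← Nat.cast_mul, Nat.mul_factorial_pred hp.out.ne_zero, factorial_mul_gammaP,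
      ← pow_succ', Nat.sub_add_cancel hp.out.one_le]
  have h3 := congrArg ι h2
  rw [map_mul, map_natCast, map_pow, map_natCast] at h3
  rw [mul_one, one_pow, mul_one] at h1
  rw [frobDiv, natCast_p, h1, h3]; ring

end W2

/-! ### The divided Frobenius of a frame presentation -/

namespace PDEnv
variable {p : ℕ} [hp : Fact p.Prime] {A A' : Type v} [CommRing A] [Algebra ℤ_[p] A] [CommRing A']
  [Algebra ℤ_[p] A'] {I : Ideal A} {I' : Ideal A'}

theorem map_algebraMap (α : A →ₐ[ℤ_[p]] A')
    (h : I ⊔ Ideal.span {(p : A)} ≤ (I' ⊔ Ideal.span {(p : A')}).comap α) (a : A) :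
    PDEnv.map α h (algebraMap A (PDEnv p I) a) = algebraMap A' (PDEnv p I') (α a) :=
  lift_algebraMap ..

theorem map_dp (α : A →ₐ[ℤ_[p]] A')
    (h : I ⊔ Ideal.span {(p : A)} ≤ (I' ⊔ Ideal.span {(p : A')}).comap α) (n : ℕ)
    (x : ↥(I ⊔ Ideal.span {(p : A)})) :
    PDEnv.map α h (dp n x) = dp n ⟨α x, h x.2⟩ := lift_dp ..

theorem isDPMorphism_map (α : A →ₐ[ℤ_[p]] A')
    (h : I ⊔ Ideal.span {(p : A)} ≤ (I' ⊔ Ideal.span {(p : A')}).comap α) :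
    (dividedPowers I).IsDPMorphism (dividedPowers I') (PDEnv.map α h) := by
  refine isDPMorphism _ _ (fun x => ?_) (fun n x => ?_)
  · rw [map_algebraMap]; exact algebraMap_mem_ideal ⟨α x, h x.2⟩
  · rw [map_dp, map_algebraMap]; exact (dpow_algebraMap n ⟨α x, h x.2⟩).symm

theorem toQuot_algebraMap (a : A) :
    toQuot p I (algebraMap A _ a) = Ideal.Quotient.mk I a := lift_algebraMap ..

theorem toQuot_dp (n : ℕ) (x : ↥(I ⊔ Ideal.span {(p : A)})) :
    toQuot p I (dp n x) = dpMod p I n x := lift_dp ..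

theorem toQuot_map {α : A →ₐ[ℤ_[p]] A'} (hα : I ≤ I'.comap α)
    (h : I ⊔ Ideal.span {(p : A)} ≤ (I' ⊔ Ideal.span {(p : A')}).comap α) (z : PDEnv p I) :
    toQuot p I' (PDEnv.map α h z) = Ideal.quotientMap I' α.toRingHom hα (toQuot p I z) := by
  change ((toQuot p I').comp (PDEnv.map α h)) z =
    ((Ideal.quotientMap I' α.toRingHom hα).comp (toQuot p I)) z
  refine congrFun (congrArg DFunLike.coe (hom_ext (fun a => ?_) fun n x => ?_)) z
  · simp only [RingHom.comp_apply, map_algebraMap, toQuot_algebraMap]; rfl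
  · simp only [RingHom.comp_apply, map_dp, toQuot_dp]
    obtain ⟨b, hb⟩ := exists_mk_eq p x
    have hb' := congrArg (Ideal.quotientMap I' α.toRingHom hα) hb
    rw [map_mul, map_natCast] at hb'
    rw [dpMod_eq p n x b hb, dpMod_eq p n ⟨α x, h x.2⟩ _
      ((Ideal.quotientMap_mk (H := hα)).symm.trans hb'), map_mul, map_pow]
    congr 1
    change Ideal.Quotient.mk I' _ = Ideal.Quotient.mk I' (α (algebraMap ℤ_[p] A _))
    rw [AlgHom.commutes]

end PDEnv

theorem isDPMorphism_id {B : Type*} [CommRing B] {J : Ideal B} (hJ : DividedPowers J) :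
    hJ.IsDPMorphism hJ (RingHom.id B) := ⟨by rw [Ideal.map_id], fun _ _ => rfl⟩

theorem W2.map_ghostHom {p : ℕ} [hp : Fact p.Prime] {B : Type u} {B' : Type v} [CommRing B]
    [CommRing B'] (f : B →+* B') (x : W2 p B) : f (ghostHom p B x) = ghostHom p B' (map f x) := by
  simp only [ghostHom_apply, map_add, map_pow, map_mul, map_natCast, map_c0, map_c1]

namespace FrobPresentation
variable {p : ℕ} [hp : Fact p.Prime] (P : FrobPresentation.{v} p)

theorem natTorsionFree : NatTorsionFree P.A := by
  have := P.flat
  refine natTorsionFree_of_p (algebraMap ℤ_[p] P.A) fun x hx => ?_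
  have h0 : (p : ℤ_[p]) ≠ 0 := Nat.cast_ne_zero.2 hp.out.ne_zero
  have h1 : (p : ℤ_[p]) • x = 0 := by rw [Algebra.smul_def, map_natCast, hx]
  exact (smul_eq_zero.1 h1).resolve_left h0

theorem exists_frobenius (a : P.A) : ∃ b, P.σ.toRingHom a = a ^ p + p * b := by
  obtain ⟨b, hb⟩ := Ideal.mem_span_singleton.1 (P.frobenius a)
  exact ⟨b, by rw [← hb]; change P.σ a = _; ring⟩

/-- The homomorphism `A → W₂(A)` given by the Frobenius lift. -/
noncomputable def witt : P.A →+* W2 p P.A :=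
  W2.ofFrobeniusLift P.natTorsionFree P.σ.toRingHom P.exists_frobenius

theorem ghostHom_witt (a : P.A) : W2.ghostHom p _ (P.witt a) = P.σ a :=
  W2.ghostHom_ofFrobeniusLift ..

theorem witt_algebraMap : P.witt.comp (algebraMap ℤ_[p] P.A) =
    W2.padicInt (algebraMap ℤ_[p] P.A) := by
  refine RingHom.ext fun a => W2.ext_ghostHom P.natTorsionFree rfl ?_
  rw [RingHom.comp_apply, ghostHom_witt, AlgHom.commutes]
  refine Eq.symm ((W2.map_ghostHom _ _).symm.trans ?_)
  rw [W2.ghostHom_ofFrobeniusLift]; rfl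

/-- The homomorphism `D → W₂(D)` on the divided power envelope that extends `A → W₂(A)`. -/
noncomputable def wittEnv : PDEnv p P.I →+* W2 p (PDEnv p P.I) :=
  PDEnv.liftDP ((W2.map (algebraMap P.A (PDEnv p P.I))).comp P.witt)
    (W2.dividedPowers (PDEnv.padicInt P.I) (PDEnv.dividedPowers P.I))
    (fun x hx => PDEnv.algebraMap_mem_ideal ⟨x, hx⟩)
    (by
      rw [RingHom.comp_assoc, witt_algebraMap]
      exact W2.gammaCompat (PDEnv.gammaCompat P.I) (PDEnv.p_mem_ideal P.I))

theorem wittEnv_algebraMap (a : P.A) : P.wittEnv (algebraMap _ _ a) =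
    W2.map (algebraMap P.A (PDEnv p P.I)) (P.witt a) := PDEnv.liftDP_algebraMap ..

theorem isDPMorphism_wittEnv : (PDEnv.dividedPowers P.I).IsDPMorphism
    (W2.dividedPowers (PDEnv.padicInt P.I) (PDEnv.dividedPowers P.I)) P.wittEnv :=
  PDEnv.isDPMorphism_liftDP ..

theorem wittEnv_c0 (d : PDEnv p P.I) : (P.wittEnv d).c0 = d := by
  have h : (W2.fst p _).comp P.wittEnv = RingHom.id _ :=
    PDEnv.hom_ext_of_isDPMorphism
      (.comp _ (W2.isDPMorphism_fst _ _) P.isDPMorphism_wittEnv)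
      (isDPMorphism_id _) fun a => by
        rw [RingHom.comp_apply, wittEnv_algebraMap]; rfl
  exact congrFun (congrArg DFunLike.coe h) d

theorem ghostHom_wittEnv (d : PDEnv p P.I) :
    W2.ghostHom p _ (P.wittEnv d) = PDEnv.map P.σ P.σ_le d := by
  have h : (W2.ghostHom p _).comp P.wittEnv = PDEnv.map P.σ P.σ_le :=
    PDEnv.hom_ext_of_isDPMorphism
      (.comp _ (W2.isDPMorphism_ghostHom (PDEnv.gammaCompat P.I) (PDEnv.p_mem_ideal P.I))
        P.isDPMorphism_wittEnv)
      (PDEnv.isDPMorphism_map _ _) fun a => by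
        rw [RingHom.comp_apply, wittEnv_algebraMap, PDEnv.map_algebraMap, ← ghostHom_witt]
        exact (W2.map_ghostHom _ _).symm
  exact congrFun (congrArg DFunLike.coe h) d

/-- The map `σ₁` on the divided power envelope. -/
noncomputable def frobDiv (d : PDEnv p P.I) : PDEnv p P.I :=
  W2.frobDiv (PDEnv.dividedPowers P.I) (P.wittEnv d)

variable {P}

theorem frobDiv_add {d e : PDEnv p P.I} (hd : d ∈ PDEnv.ideal (p := p) P.I)
    (he : e ∈ PDEnv.ideal (p := p) P.I) : P.frobDiv (d + e) = P.frobDiv d + P.frobDiv e := by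
  rw [frobDiv, map_add, W2.frobDiv_add]; rfl
  · rwa [wittEnv_c0]
  · rwa [wittEnv_c0]

theorem frobDiv_mul (c : PDEnv p P.I) {d : PDEnv p P.I} (hd : d ∈ PDEnv.ideal (p := p) P.I) :
    P.frobDiv (c * d) = PDEnv.map P.σ P.σ_le c * P.frobDiv d := by
  rw [frobDiv, map_mul, W2.frobDiv_mul, ghostHom_wittEnv]; rfl
  rwa [wittEnv_c0]

theorem p_mul_frobDiv {d : PDEnv p P.I} (hd : d ∈ PDEnv.ideal (p := p) P.I) :
    (p : PDEnv p P.I) * P.frobDiv d = PDEnv.map P.σ P.σ_le d := by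
  rw [frobDiv, W2.p_mul_frobDiv, ghostHom_wittEnv]
  rwa [wittEnv_c0]

theorem frobDiv_natCast_p : P.frobDiv (p : PDEnv p P.I) = 1 := by
  rw [frobDiv, map_natCast]
  exact W2.frobDiv_natCast_p (PDEnv.gammaCompat P.I) (PDEnv.p_mem_ideal P.I)

theorem frobDiv_add_pow {d : PDEnv p P.I} (hd : d ∈ PDEnv.ideal (p := p) P.I) (n : ℕ)
    (t : PDEnv p P.I) : P.frobDiv (d + p ^ (n + 1) * t) =
      P.frobDiv d + p ^ n * PDEnv.map P.σ P.σ_le t := by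
  have h : (p : PDEnv p P.I) ^ (n + 1) * t = p ^ n * t * p := by ring
  rw [h, frobDiv_add hd (Ideal.mul_mem_left _ _ (PDEnv.p_mem_ideal P.I)),
    frobDiv_mul _ (PDEnv.p_mem_ideal P.I), frobDiv_natCast_p, map_mul, map_pow, map_natCast,
    mul_one]

theorem map_wittEnv {P' : FrobPresentation.{v} p} (f : Hom p P P') (d : PDEnv p P.I) :
    W2.map (PDEnv.map f.α f.map_le) (P.wittEnv d) = P'.wittEnv (PDEnv.map f.α f.map_le d) := by
  have h : (W2.map (PDEnv.map f.α f.map_le)).comp P.wittEnv =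
      P'.wittEnv.comp (PDEnv.map f.α f.map_le) := by
    refine PDEnv.hom_ext_of_isDPMorphism
      (.comp _ (W2.isDPMorphism_map (PDEnv.isDPMorphism_map _ _) ?_) P.isDPMorphism_wittEnv)
      (.comp _ P'.isDPMorphism_wittEnv (PDEnv.isDPMorphism_map _ _)) fun a => ?_
    · refine RingHom.ext fun a => ?_
      change PDEnv.map f.α f.map_le (algebraMap P.A (PDEnv p P.I) (algebraMap ℤ_[p] P.A a)) =
        algebraMap P'.A (PDEnv p P'.I) (algebraMap ℤ_[p] P'.A a)
      rw [PDEnv.map_algebraMap, AlgHom.commutes]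
    · rw [RingHom.comp_apply, RingHom.comp_apply, wittEnv_algebraMap, PDEnv.map_algebraMap,
        wittEnv_algebraMap]
      have hw : W2.map f.α.toRingHom (P.witt a) = P'.witt (f.α a) := by
        refine W2.ext_ghostHom P'.natTorsionFree rfl ?_
        rw [ghostHom_witt, ← f.map_σ, ← ghostHom_witt]
        exact (W2.map_ghostHom _ _).symm
      rw [← hw]
      ext <;> exact PDEnv.map_algebraMap ..
  exact congrFun (congrArg DFunLike.coe h) d

theorem map_frobDiv {P' : FrobPresentation.{v} p} (f : Hom p P P') {d : PDEnv p P.I}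
    (hd : d ∈ PDEnv.ideal (p := p) P.I) :
    PDEnv.map f.α f.map_le (P.frobDiv d) = P'.frobDiv (PDEnv.map f.α f.map_le d) := by
  rw [frobDiv, W2.map_frobDiv (PDEnv.isDPMorphism_map _ _) (by rwa [wittEnv_c0]), map_wittEnv]; rfl

theorem toR_eq {n : ℕ} {x : P.D} {d : PDEnv p P.I} (h : PCompl.Mod n x d)
    (hn : (p : P.A ⧸ P.I) ^ n = 0) : P.toR x = PDEnv.toQuot p P.I d := h.lift _ P.nilpotent hn

theorem mem_ideal_of_mod {x : P.D} (hx : x ∈ RingHom.ker P.toR) {n : ℕ} {d : PDEnv p P.I}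
    (hd : PCompl.Mod (n + 1) x d) : d ∈ PDEnv.ideal (p := p) P.I := by
  obtain ⟨N, hN⟩ := P.nilpotent
  obtain ⟨e, he⟩ := PCompl.exists_mod (max (n + 1) N) x
  have h1 := toR_eq he (pow_eq_zero_of_le (le_max_right _ _) hN)
  rw [RingHom.mem_ker.1 hx] at h1
  obtain ⟨t, rfl⟩ := hd.eq (he.mono (le_max_left _ _))
  refine PDEnv.mem_ideal_of_toQuot ?_
  rw [map_add, ← h1, zero_add, map_mul, map_pow, map_natCast, pow_succ', mul_assoc]
  exact Ideal.mul_mem_right _ _ (Ideal.mem_span_singleton_self _)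

/-- If `d` is known modulo `p ^ (n + 1)`, then `σ(d) / p` is known modulo `p ^ n`; hence `σ₁`
extends to the completion. -/
theorem exists_sigma1 (x : RingHom.ker P.toR) : ∃ y : P.D, ∀ n d, PCompl.Mod (n + 1) x.1 d →
    PCompl.Mod n y (P.frobDiv d) := by
  choose d hd using fun n => PCompl.exists_mod (n + 1) x.1
  have hI := fun n => mem_ideal_of_mod x.2 (hd n)
  obtain ⟨y, hy⟩ := PCompl.exists_of_seq (fun n => P.frobDiv (d n)) fun n => by
    obtain ⟨t, ht⟩ := (hd n).eq ((hd (n + 1)).mono (Nat.le_succ _))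
    exact ⟨_, by rw [ht, frobDiv_add_pow (hI (n + 1))]⟩
  refine ⟨y, fun n e he => ?_⟩
  obtain ⟨t, rfl⟩ := he.eq (hd n)
  rw [frobDiv_add_pow (hI n)]
  exact (hy n).of_eq _ rfl

variable (P) in
/-- The map `σ₁ : Ī → D`, as a function. -/
noncomputable def sigma1Fun (x : RingHom.ker P.toR) : P.D := (exists_sigma1 x).choose

theorem mod_sigma1Fun {x : RingHom.ker P.toR} {n : ℕ} {d : PDEnv p P.I}
    (h : PCompl.Mod (n + 1) x.1 d) : PCompl.Mod n (P.sigma1Fun x) (P.frobDiv d) :=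
  (exists_sigma1 x).choose_spec n d h

variable (P) in
/-- The map `σ₁ : Ī → D`. -/
noncomputable def sigma1 : RingHom.ker P.toR →ₛₗ[P.σD] P.D where
  toFun := P.sigma1Fun
  map_add' x y := PCompl.ext fun n => by
    obtain ⟨d, hd⟩ := PCompl.exists_mod (n + 1) x.1
    obtain ⟨e, he⟩ := PCompl.exists_mod (n + 1) y.1
    refine ⟨_, mod_sigma1Fun (hd.add he), ?_⟩
    rw [frobDiv_add (mem_ideal_of_mod x.2 hd) (mem_ideal_of_mod y.2 he)]
    exact (mod_sigma1Fun hd).add (mod_sigma1Fun he)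
  map_smul' c x := PCompl.ext fun n => by
    obtain ⟨d, hd⟩ := PCompl.exists_mod (n + 1) x.1
    obtain ⟨e, he⟩ := PCompl.exists_mod (n + 1) c
    refine ⟨_, mod_sigma1Fun (he.mul hd), ?_⟩
    rw [frobDiv_mul _ (mem_ideal_of_mod x.2 hd)]
    exact ((he.mono n.le_succ).map _).mul (mod_sigma1Fun hd)

theorem isFunctorialSigmaOneD_sigma1 :
    IsFunctorialSigmaOneD (p := p) fun P : FrobPresentation.{v} p => P.sigma1 where
  p_mul P x := PCompl.ext fun n => by
    obtain ⟨d, hd⟩ := PCompl.exists_mod (n + 1) x.1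
    refine ⟨_, (PCompl.mod_natCast n p).mul (mod_sigma1Fun hd), ?_⟩
    rw [p_mul_frobDiv (mem_ideal_of_mod x.2 hd)]
    exact (hd.mono n.le_succ).map _
  functorial P P' f x y hy := PCompl.ext fun n => by
    obtain ⟨d, hd⟩ := PCompl.exists_mod (n + 1) x.1
    have hd' : PCompl.Mod (n + 1) y.1 (PDEnv.map f.α f.map_le d) := by
      rw [hy]; exact hd.map _
    refine ⟨_, (mod_sigma1Fun hd).map _, ?_⟩
    rw [map_frobDiv f (mem_ideal_of_mod x.2 hd)]
    exact mod_sigma1Fun hd'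

theorem isAdicComplete_of_isNilpotent {R : Type*} [CommRing R] (h : IsNilpotent (p : R)) :
    IsAdicComplete (Ideal.span {(p : R)}) R := by
  obtain ⟨N, hN⟩ := h
  have hb : Ideal.span {(p : R)} ^ N = ⊥ := by
    rw [Ideal.span_singleton_pow, hN, Ideal.span_singleton_eq_bot]
  have : IsHausdorff (Ideal.span {(p : R)}) R := ⟨fun x hx => by
    have := hx N
    rwa [hb, Ideal.smul_top_eq_map, Ideal.map_bot, Submodule.restrictScalars_bot, SModEq.bot] at this⟩
  have : IsPrecomplete (Ideal.span {(p : R)}) R := ⟨fun f hf => ⟨f N, fun n => by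
    rcases le_total n N with h | h
    · exact hf h
    · refine SModEq.symm (SModEq.mono ?_ (hf h))
      rw [hb]; simp⟩⟩
  exact ⟨⟩

theorem isFrame (P : FrobPresentation.{v} p) : IsFrame p P.toR P.σD P.sigma1 where
  pAdic_A := PCompl.isAdicComplete
  pAdic_R := isAdicComplete_of_isNilpotent P.nilpotent
  surjective y := by
    obtain ⟨a, rfl⟩ := Ideal.Quotient.mk_surjective y
    obtain ⟨N, hN⟩ := P.nilpotent
    refine ⟨PCompl.of p _ (algebraMap _ _ a), ?_⟩
    rw [toR_eq (PCompl.mod_of N _) hN, PDEnv.toQuot_algebraMap]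
  frobenius a := by
    obtain ⟨d, hd⟩ := PCompl.exists_mod 1 a
    have h : PCompl.Mod 1 (P.σD a - a ^ p) 0 := by
      refine ((hd.map (PDEnv.map P.σ P.σ_le)).sub (hd.pow p)).of_eq (-(P.wittEnv d).c1) ?_
      rw [← ghostHom_wittEnv, W2.ghostHom_apply, wittEnv_c0]; ring
    obtain ⟨y, hy⟩ := PCompl.mod_zero_iff.1 h
    rw [hy, pow_one]
    exact Ideal.mul_mem_right _ _ (Ideal.mem_span_singleton_self _)
  p_mul := isFunctorialSigmaOneD_sigma1.p_mul P

theorem isFrameHom {P P' : FrobPresentation.{v} p} (f : Hom p P P') :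
    IsFrameHom P.sigma1 P'.sigma1 f.mapD f.mapR where
  comm_π x := by
    obtain ⟨N, hN⟩ := P.nilpotent
    obtain ⟨N', hN'⟩ := P'.nilpotent
    obtain ⟨d, hd⟩ := PCompl.exists_mod (max N N') x
    rw [toR_eq hd (pow_eq_zero_of_le (le_max_left _ _) hN),
      toR_eq (x := f.mapD x) (hd.map (PDEnv.map f.α f.map_le)) (pow_eq_zero_of_le (le_max_right _ _) hN')]
    exact PDEnv.toQuot_map f.map_I f.map_le d
  comm_σ x := PCompl.ext fun n => by
    obtain ⟨d, hd⟩ := PCompl.exists_mod n x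
    refine ⟨_, (hd.map _).map _, ?_⟩
    have h : (PDEnv.map f.α f.map_le).comp (PDEnv.map P.σ P.σ_le) =
        (PDEnv.map P'.σ P'.σ_le).comp (PDEnv.map f.α f.map_le) :=
      PDEnv.hom_ext_of_isDPMorphism
        (.comp _ (PDEnv.isDPMorphism_map _ _) (PDEnv.isDPMorphism_map _ _))
        (.comp _ (PDEnv.isDPMorphism_map _ _) (PDEnv.isDPMorphism_map _ _)) fun a => by
          simp only [RingHom.comp_apply, PDEnv.map_algebraMap, f.map_σ]
    have h1 := congrFun (congrArg DFunLike.coe h) d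
    rw [RingHom.comp_apply, RingHom.comp_apply] at h1
    rw [h1]
    exact (hd.map _).map _
  comm_σ₁ := isFunctorialSigmaOneD_sigma1.functorial P P' f

end FrobPresentation

/-! ### Uniqueness of the divided Frobenius of a frame presentation -/

namespace PDEnv
variable {p : ℕ} [hp : Fact p.Prime] {A : Type v} [CommRing A] [Algebra ℤ_[p] A] {I : Ideal A}

/-- The element `i^{[k]}` for `i ∈ I`. -/
noncomputable def dpI (k : ℕ) (i : I) : PDEnv p I := dp k ⟨i.1, Ideal.mem_sup_left i.2⟩

variable (p I) in
/-- The ideal of the envelope generated by all `i^{[k]}` with `i ∈ I` and `k ≥ 1`. -/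
noncomputable def dpSpan : Ideal (PDEnv p I) := Ideal.span {z | ∃ (k : ℕ) (i : I), k ≠ 0 ∧ z = dpI k i}

theorem toQuot_dpI {k : ℕ} (hk : k ≠ 0) (i : I) : toQuot p I (dpI k i) = 0 := by
  rw [dpI, toQuot_dp, dpMod_eq p k _ 0 (by
    rw [mul_zero]; exact Ideal.Quotient.eq_zero_iff_mem.2 i.2), zero_pow hk, mul_zero]

theorem dp_p_mul (n : ℕ) (b : A) (x : ↥(I ⊔ Ideal.span {(p : A)})) (hx : (x : A) = b * p) :
    dp n x = algebraMap A (PDEnv p I) (b ^ n * algebraMap ℤ_[p] A (gammaP p n)) := by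
  have h : x = b • ⟨(p : A), Cover.p_mem⟩ := Subtype.ext hx
  rw [h, dp_smul, dp_p p n _ rfl, map_mul, map_pow]

/-- The divided powers of the multiples of `p` are in the image of `A`; so modulo the ideal of all
`i^{[k]}` the envelope is generated by `A`. -/
theorem exists_sub_mem_dpSpan (z : PDEnv p I) : ∃ a : A, z - algebraMap A _ a ∈ dpSpan p I := by
  induction z using induction_on with
  | h1 a => exact ⟨a, by rw [sub_self]; exact zero_mem _⟩
  | h2 n x =>
    obtain ⟨i, hi, c, hc, hx⟩ := Submodule.mem_sup.1 x.2
    obtain ⟨b, rfl⟩ := Ideal.mem_span_singleton'.1 hc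
    have hx' : x = ⟨i, Ideal.mem_sup_left hi⟩ + ⟨b * p, Ideal.mem_sup_right hc⟩ :=
      Subtype.ext hx.symm
    refine ⟨b ^ n * algebraMap ℤ_[p] A (gammaP p n), ?_⟩
    rw [hx', dp_add, Finset.sum_eq_add_sum_sdiff_singleton_of_mem
      (show ((0 : ℕ), n) ∈ Finset.HasAntidiagonal.antidiagonal n from
        Finset.HasAntidiagonal.mem_antidiagonal.2 (zero_add n))]
    rw [dp_zero, one_mul, dp_p_mul n b _ rfl, add_sub_cancel_left]
    refine sum_mem fun k hk => Ideal.mul_mem_right _ _ (Ideal.subset_span ⟨k.1, ⟨i, hi⟩, ?_, rfl⟩)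
    rintro h0
    rw [Finset.mem_sdiff, Finset.HasAntidiagonal.mem_antidiagonal, Finset.mem_singleton] at hk
    exact hk.2 (Prod.ext h0 (by simpa [h0] using hk.1))
  | h3 y z hy hz =>
    obtain ⟨a, ha⟩ := hy
    obtain ⟨b, hb⟩ := hz
    exact ⟨a + b, by rw [map_add, add_sub_add_comm]; exact add_mem ha hb⟩
  | h4 y z hy hz =>
    obtain ⟨a, ha⟩ := hy
    obtain ⟨b, hb⟩ := hz
    refine ⟨a * b, ?_⟩
    rw [map_mul, show y * z - algebraMap A _ a * algebraMap A _ b =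
      z * (y - algebraMap A _ a) + algebraMap A _ a * (z - algebraMap A _ b) by ring]
    exact add_mem (Ideal.mul_mem_left _ _ ha) (Ideal.mul_mem_left _ _ hb)

theorem dpSpan_le_ker : dpSpan p I ≤ RingHom.ker (toQuot p I) := by
  rw [dpSpan, Ideal.span_le]
  rintro _ ⟨k, i, hk, rfl⟩
  exact toQuot_dpI hk i

theorem ker_toQuot_le : RingHom.ker (toQuot p I) ≤ dpSpan p I := fun z hz => by
  obtain ⟨a, ha⟩ := exists_sub_mem_dpSpan z
  have h := RingHom.mem_ker.1 (dpSpan_le_ker ha)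
  rw [map_sub, RingHom.mem_ker.1 hz, zero_sub, neg_eq_zero, toQuot_algebraMap,
    Ideal.Quotient.eq_zero_iff_mem] at h
  have h1 : algebraMap A (PDEnv p I) a ∈ dpSpan p I :=
    Ideal.subset_span ⟨1, ⟨a, h⟩, one_ne_zero, (dp_one p (⟨a, Ideal.mem_sup_left h⟩ : ↥(I ⊔ Ideal.span {(p : A)}))).symm⟩
  simpa using add_mem ha h1

end PDEnv

section TestRing
variable (p : ℕ) [hp : Fact p.Prime]

/-- The free `δ`-ring over `ℤ_p` in one variable: the polynomial ring in `y, δ(y), δ²(y), …`. -/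
abbrev FreeDelta : Type v := MvPolynomial (ULift.{v} ℕ) ℤ_[p]

namespace FreeDelta

/-- The Frobenius lift of the free `δ`-ring: `y_k ↦ y_k ^ p + p y_{k+1}`. -/
noncomputable def frob : FreeDelta.{v} p →ₐ[ℤ_[p]] FreeDelta.{v} p :=
  MvPolynomial.aeval fun k => MvPolynomial.X k ^ p + (p : FreeDelta p) * MvPolynomial.X ⟨k.down + 1⟩

theorem exists_frob (f : FreeDelta.{v} p) : ∃ b, frob p f = f ^ p + p * b := by
  induction f using MvPolynomial.induction_on with
  | C a =>
    obtain ⟨b, hb⟩ := W2.padicInt_frobenius a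
    refine ⟨MvPolynomial.C b, ?_⟩
    rw [← map_pow, ← map_natCast (MvPolynomial.C : ℤ_[p] →+* FreeDelta p), ← map_mul, ← map_add,
      ← hb]
    exact AlgHom.commutes _ _
  | add f g hf hg =>
    obtain ⟨b, hb⟩ := hf
    obtain ⟨c, hc⟩ := hg
    refine ⟨b + c - powDefect p f g, ?_⟩
    rw [map_add, hb, hc, add_pow_eq_powDefect]; ring
  | mul_X f k hf =>
    obtain ⟨b, hb⟩ := hf
    refine ⟨b * (MvPolynomial.X k ^ p) + f ^ p * MvPolynomial.X ⟨k.down + 1⟩ +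
      (p : FreeDelta.{v} p) * b * MvPolynomial.X ⟨k.down + 1⟩, ?_⟩
    rw [map_mul, hb, frob, MvPolynomial.aeval_X]; ring

theorem natTorsionFree : NatTorsionFree (FreeDelta.{v} p) :=
  mvPolynomial_natTorsionFree NatTorsionFree.of_charZero_domain _

theorem exists_eq_p_mul (f b : FreeDelta.{v} p) (h : MvPolynomial.X ⟨0⟩ * f = (p : FreeDelta.{v} p) * b) :
    ∃ c, f = (p : FreeDelta.{v} p) * c := by
  have hpr : Prime (p : FreeDelta.{v} p) := by
    rw [← map_natCast (MvPolynomial.C : ℤ_[p] →+* FreeDelta p), MvPolynomial.prime_C_iff]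
    exact PadicInt.prime_p
  rcases hpr.dvd_or_dvd ⟨b, h⟩ with ⟨c, hc⟩ | h
  · have := congrArg (MvPolynomial.aeval (fun _ => (1 : ℤ_[p]))) hc
    rw [MvPolynomial.aeval_X, map_mul, map_natCast] at this
    exact absurd (IsUnit.of_mul_eq_one _ this.symm) PadicInt.prime_p.not_isUnit
  · exact h

/-- The ring homomorphism from the free `δ`-ring to a ring with a lift of Frobenius that maps the
generator to `a`. -/
noncomputable def lift {A : Type v} [CommRing A] [Algebra ℤ_[p] A] (δ : A → A) (a : A) :
    FreeDelta.{v} p →ₐ[ℤ_[p]] A := MvPolynomial.aeval fun k => δ^[k.down] a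

theorem lift_frob {A : Type v} [CommRing A] [Algebra ℤ_[p] A] {δ : A → A} {σ : A →ₐ[ℤ_[p]] A}
    (hδ : ∀ a, σ a = a ^ p + p * δ a) (a : A) (f : FreeDelta.{v} p) :
    lift p δ a (frob p f) = σ (lift p δ a f) := by
  have h : (lift p δ a).comp (frob p) = σ.comp (lift p δ a) := by
    refine MvPolynomial.algHom_ext fun k => ?_
    simp only [AlgHom.comp_apply, frob, lift, MvPolynomial.aeval_X, map_add, map_pow, map_mul,
      map_natCast, hδ, Function.iterate_succ_apply']
  exact congrFun (congrArg DFunLike.coe h) f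

end FreeDelta

theorem flat_of_p_mul {B : Type v} [CommRing B] [Algebra ℤ_[p] B]
    (h : ∀ x : B, (p : B) * x = 0 → x = 0) : Module.Flat ℤ_[p] B := by
  have h0 : ∀ (n : ℕ) (x : B), (p : B) ^ n * x = 0 → x = 0 := fun n => by
    induction n with
    | zero => intro x hx; simpa using hx
    | succ n ih => exact fun x hx => ih x (h _ (by rw [← hx]; ring))
  have : Module.IsTorsionFree ℤ_[p] B := by
    refine ⟨fun r hr x y hxy => ?_⟩
    have hr0 : r ≠ 0 := hr.ne_zero
    rw [PadicInt.unitCoeff_spec hr0] at hxy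
    simp only [Algebra.smul_def, map_mul, map_pow, map_natCast, mul_assoc] at hxy
    have hu : IsUnit (algebraMap ℤ_[p] B (PadicInt.unitCoeff hr0 : ℤ_[p])) :=
      (Units.isUnit _).map _
    have h1 := hu.mul_left_cancel hxy
    exact sub_eq_zero.1 (h0 _ _ (by rw [mul_sub, h1, sub_self]))
  infer_instance

namespace FrobPresentation

/-- The completed free `δ`-ring with the ideal generated by the generator and `p ^ N`. -/
noncomputable def test (N : ℕ) : FrobPresentation.{v} p :=
  letI : Algebra ℤ_[p] (PCompl p (FreeDelta.{v} p)) :=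
    ((PCompl.of p (FreeDelta.{v} p)).comp MvPolynomial.C).toAlgebra
  { A := PCompl p (FreeDelta.{v} p)
    I := Ideal.span {PCompl.of p (FreeDelta.{v} p) (MvPolynomial.X ⟨0⟩)} ⊔
      Ideal.span {(p : PCompl p (FreeDelta.{v} p)) ^ N}
    σ := { pComplMap p (FreeDelta.frob p).toRingHom with
      commutes' := fun r => (PCompl.pComplMap_of _ _).trans
        (congrArg _ (AlgHom.commutes (FreeDelta.frob p) r)) }
    isAdicComplete := PCompl.isAdicComplete
    flat := flat_of_p_mul p (PCompl.natTorsionFree_p fun x hx =>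
      FreeDelta.natTorsionFree p p hp.out.ne_zero x hx)
    nilpotent := ⟨N, by
      rw [← map_natCast (Ideal.Quotient.mk _), ← map_pow, Ideal.Quotient.eq_zero_iff_mem]
      exact Ideal.mem_sup_right (Ideal.mem_span_singleton_self _)⟩
    frobenius := fun a => by
      obtain ⟨d, hd⟩ := PCompl.exists_mod 1 a
      obtain ⟨b, hb⟩ := FreeDelta.exists_frob p d
      obtain ⟨y, hy⟩ := PCompl.mod_zero_iff.1
        (((hd.map (FreeDelta.frob p).toRingHom).sub (hd.pow p)).of_eq (d' := 0) (-b) (by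
          change (0 : FreeDelta p) = FreeDelta.frob p d - d ^ p + _
          rw [hb]; ring))
      rw [pow_one] at hy
      exact Ideal.mem_span_singleton'.2 ⟨y, by rw [mul_comm]; exact hy.symm⟩ }

/-- The generator of the test object. -/
noncomputable def testGen (N : ℕ) : (test.{v} p N).I :=
  ⟨PCompl.of p (FreeDelta.{v} p) (MvPolynomial.X ⟨0⟩),
    Ideal.mem_sup_left (Ideal.mem_span_singleton_self _)⟩

/-- The completed envelope of a test object is `p`-torsion free, because the ideal is generated by
`y` and `p ^ N`, and `y` is regular modulo `p`. -/
theorem test_eq_zero {N : ℕ} (hN : N ≠ 0) (x : (test.{v} p N).D) (hx : (p : (test.{v} p N).D) * x = 0) :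
    x = 0 := by
  refine PCompl.natTorsionFree_p (fun x hx => ?_) x hx
  refine PDEnv.natTorsionFree_of_regular (p := p) (test p N).natTorsionFree
    (y := (testGen p N).1) ?_ ?_ p hp.out.ne_zero x hx
  · refine le_antisymm (sup_le (sup_le le_sup_left ((Ideal.span_singleton_le_iff_mem _).2 ?_))
      le_sup_right) (sup_le (le_sup_left.trans le_sup_left) le_sup_right)
    exact Ideal.mem_sup_right (Ideal.pow_mem_of_mem _ (Ideal.mem_span_singleton_self _) _
      (Nat.pos_of_ne_zero hN))
  · rintro a ⟨b, hab⟩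
    change PCompl p (FreeDelta.{v} p) at a b
    obtain ⟨f, hf⟩ := PCompl.exists_mod 1 a
    obtain ⟨g, hg⟩ := PCompl.exists_mod 1 b
    have h1 := (PCompl.mod_of 1 (MvPolynomial.X ⟨0⟩ : FreeDelta.{v} p)).mul hf
    rw [show PCompl.of p (FreeDelta.{v} p) (MvPolynomial.X ⟨0⟩) * a = p * b from hab] at h1
    obtain ⟨t, ht⟩ := h1.eq ((PCompl.mod_natCast 1 p).mul hg)
    obtain ⟨c, rfl⟩ := FreeDelta.exists_eq_p_mul p f (g + t) (by rw [ht]; ring)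
    obtain ⟨y, hy⟩ := PCompl.mod_zero_iff.1 (hf.of_eq (d' := 0) (-c) (by ring))
    exact ⟨y, by rw [hy, pow_one]; rfl⟩

variable {p}

/-- The homomorphism from the test object that maps the generator to `i ∈ I`. -/
noncomputable def testHom (P : FrobPresentation.{v} p) {N : ℕ} (hN : (p : P.A) ^ N ∈ P.I)
    (i : P.I) : Hom p (test.{v} p N) P :=
  letI := P.isAdicComplete
  letI f := FreeDelta.lift p (fun a => (P.exists_frobenius a).choose) i.1
  { α := { PCompl.extend (p := p) f.toRingHom with
      commutes' := fun r => (PCompl.extend_of _ _).trans (AlgHom.commutes f r) }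
    map_I := by
      refine sup_le ((Ideal.span_singleton_le_iff_mem _).2 (Ideal.mem_comap.2 ?_))
        ((Ideal.span_singleton_le_iff_mem _).2 (Ideal.mem_comap.2 ?_))
      · have h : PCompl.extend (p := p) f.toRingHom (PCompl.of p _ (MvPolynomial.X ⟨0⟩)) = i :=
          (PCompl.extend_of _ _).trans (MvPolynomial.aeval_X _ _)
        exact h.symm ▸ i.2
      · have h : PCompl.extend (p := p) f.toRingHom ((p : PCompl p (FreeDelta.{v} p)) ^ N) = p ^ N := by
          rw [map_pow, map_natCast]
        exact h.symm ▸ hN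
    map_σ := fun a => by
      refine eq_of_forall_exists_pow_mul (p := p) fun n => ?_
      obtain ⟨d, hd⟩ := PCompl.exists_mod n a
      obtain ⟨s, hs⟩ := PCompl.exists_extend_eq f.toRingHom hd
      obtain ⟨t, ht⟩ := PCompl.exists_extend_eq f.toRingHom (hd.map (FreeDelta.frob p).toRingHom)
      refine ⟨t - P.σ s, ?_⟩
      have h1 : f (FreeDelta.frob p d) = P.σ (f d) :=
        FreeDelta.lift_frob p (fun a => (P.exists_frobenius a).choose_spec) _ _
      have h2 : P.σ (PCompl.extend (p := p) f.toRingHom a) = P.σ (f d) + p ^ n * P.σ s := by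
        rw [hs, map_add, map_mul, map_pow, map_natCast]; rfl
      refine ht.trans ?_
      refine Eq.trans ?_ (congrArg (· + _) h2.symm)
      refine (congrArg (· + _) h1).trans ?_
      ring }

theorem testHom_testGen (P : FrobPresentation.{v} p) {N : ℕ} (hN : (p : P.A) ^ N ∈ P.I)
    (i : P.I) : (testHom P hN i).α (testGen p N).1 = i := by
  let _ := P.isAdicComplete
  exact (PCompl.extend_of _ _).trans (MvPolynomial.aeval_X _ _)

theorem of_mem_ker (P : FrobPresentation.{v} p) {z : PDEnv p P.I} (hz : PDEnv.toQuot p P.I z = 0) :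
    PCompl.of p _ z ∈ RingHom.ker P.toR := by
  obtain ⟨N, hN⟩ := P.nilpotent
  rw [RingHom.mem_ker, toR_eq (PCompl.mod_of N z) hN, hz]

theorem pow_mem_ker (P : FrobPresentation.{v} p) {N : ℕ} (hN : (p : P.A) ^ N ∈ P.I) :
    (p : P.D) ^ N ∈ RingHom.ker P.toR := by
  rw [RingHom.mem_ker, map_pow, map_natCast]
  rw [← Ideal.Quotient.eq_zero_iff_mem, map_pow, map_natCast] at hN
  exact hN

/-- Two functorial divided Frobenius maps agree on the test objects, which are `p`-torsion free. The
kernel of `D → R` is generated by elements that come from test objects. -/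
theorem eq_of_isFunctorialSigmaOneD {τ τ' : SigmaOneFamilyD.{v} p}
    (h : IsFunctorialSigmaOneD τ) (h' : IsFunctorialSigmaOneD τ') : τ = τ' := by
  have key : ∀ {N : ℕ} (P : FrobPresentation.{v} p) (hN0 : N ≠ 0) (hN : (p : P.A) ^ N ∈ P.I) (i : P.I)
      (x : RingHom.ker (test.{v} p N).toR) (y : RingHom.ker P.toR)
      (_ : y.1 = (testHom P hN i).mapD x.1), τ P y = τ' P y := fun {N} P hN0 hN i x y hxy => by
    rw [← h.functorial _ _ _ x y hxy, ← h'.functorial _ _ _ x y hxy]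
    refine congrArg _ (sub_eq_zero.1 (test_eq_zero p hN0 _ ?_))
    rw [mul_sub, h.p_mul, h'.p_mul, sub_self]
  funext P
  refine LinearMap.ext fun x => ?_
  obtain ⟨N, hN⟩ : ∃ N, (p : P.A) ^ (N + 1) ∈ P.I := by
    obtain ⟨N, hN⟩ := P.nilpotent
    refine ⟨N, ?_⟩
    rw [← Ideal.Quotient.eq_zero_iff_mem, map_pow, map_natCast, pow_succ, hN, zero_mul]
  let K : Ideal P.D := (LinearMap.eqLocus (τ P) (τ' P)).map (RingHom.ker P.toR).subtype
  suffices hx : x.1 ∈ K by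
    obtain ⟨y, hy, hyx⟩ := Submodule.mem_map.1 hx
    rwa [show y = x from Subtype.ext hyx] at hy
  -- As `p` is nilpotent in `R`, the kernel of `D → R` is generated by the elements `i^{[k]}` and a
  -- power of `p`.
  have hpK : (p : P.D) ^ (N + 1) ∈ K := by
    refine Submodule.mem_map.2 ⟨⟨_, P.pow_mem_ker hN⟩, ?_, rfl⟩
    refine key P N.succ_ne_zero hN 0 ⟨(p : (test.{v} p (N + 1)).D) ^ (N + 1), pow_mem_ker _ (Ideal.mem_sup_right
      (Ideal.mem_span_singleton_self _))⟩ _ ?_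
    exact (by rw [map_pow, map_natCast] : (testHom P hN 0).mapD (p ^ (N + 1)) = p ^ (N + 1)).symm
  have hdK : ∀ z ∈ PDEnv.dpSpan p P.I, PCompl.of p _ z ∈ K := by
    change PDEnv.dpSpan p P.I ≤ K.comap (PCompl.of p _)
    rw [PDEnv.dpSpan, Ideal.span_le]
    rintro _ ⟨k, i, hk, rfl⟩
    refine Submodule.mem_map.2 ⟨⟨_, P.of_mem_ker (PDEnv.toQuot_dpI hk i)⟩, ?_, rfl⟩
    refine key P N.succ_ne_zero hN i ⟨PCompl.of p _ (PDEnv.dpI k (testGen p (N + 1))),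
      of_mem_ker _ (PDEnv.toQuot_dpI hk _)⟩ _ ?_
    refine Eq.symm ((PCompl.pComplMap_of _ _).trans (congrArg _ ?_))
    refine (PDEnv.map_dp _ _ _ _).trans (congrArg _ (Subtype.ext (testHom_testGen P hN i)))
  obtain ⟨d, hd⟩ := PCompl.exists_mod (N + 1) x.1
  have hd0 : PDEnv.toQuot p P.I d = 0 := by
    rw [← toR_eq hd]
    · exact x.2
    · rw [← map_natCast (Ideal.Quotient.mk P.I), ← map_pow, Ideal.Quotient.eq_zero_iff_mem]
      exact hN
  obtain ⟨y, hy⟩ := hd.exists_eq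
  rw [hy]
  exact add_mem (hdK d (PDEnv.ker_toQuot_le hd0)) (Ideal.mul_mem_right _ _ hpK)

end FrobPresentation
end TestRing

/-! ### Affine divided power thickenings -/

/-- An affine divided power thickening `Spec C → Spec B`, with `p` nilpotent on `B`, compatible with
the divided powers of `p`. -/
structure PDDatum (p : ℕ) where
  B : CommRingCat.{u}
  C : CommRingCat.{u}
  q : B ⟶ C
  surj : Function.Surjective q.hom
  nilp : IsNilpotent (p : B)
  dp : DividedPowers (RingHom.ker q.hom)
  compat : ∀ (n : ℕ) (a : B), (p : B) * a ∈ RingHom.ker q.hom →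
    ((n.factorial / p ^ padicValNat p n.factorial : ℕ) : B) * dp.dpow n (p * a) =
      (p : B) ^ (n - padicValNat p n.factorial) * a ^ n

/-- A homomorphism of affine divided power thickenings, as a homomorphism of rings. -/
structure PDDatum.Hom {p : ℕ} (d d' : PDDatum.{u} p) where
  φ : d.B ⟶ d'.B
  ψ : d.C ⟶ d'.C
  comm : d.q ≫ ψ = φ ≫ d'.q
  isDP : d.dp.IsDPMorphism d'.dp φ.hom

/-- The ring of compatible families of elements of `B`, for all affine divided power thickenings
`Spec C → Spec B` of `U`-schemes `Spec C` that satisfy the predicate `𝒞`. -/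
def fam {p : ℕ} (𝒞 : PDDatum.{u} p → Prop) (U : Scheme.{u}) :
    Subring (∀ (d : {d : PDDatum.{u} p // 𝒞 d}), (Spec d.1.C ⟶ U) → d.1.B) where
  carrier := {s | ∀ (d d' : {d : PDDatum.{u} p // 𝒞 d}) (g : d.1.Hom d'.1) (f : Spec d.1.C ⟶ U),
    g.φ.hom (s d f) = s d' (Spec.map g.ψ ≫ f)}
  mul_mem' ha hb d d' g f := by simp only [Pi.mul_apply, map_mul, ha d d' g, hb d d' g]
  one_mem' _ _ g f := by simp only [Pi.one_apply, map_one]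
  add_mem' ha hb d d' g f := by simp only [Pi.add_apply, map_add, ha d d' g, hb d d' g]
  zero_mem' _ _ g f := by simp only [Pi.zero_apply, map_zero]
  neg_mem' ha d d' g f := by simp only [Pi.neg_apply, map_neg, ha d d' g]

section
variable {p : ℕ} [hp : Fact p.Prime]

/-- The structure map from `ℤ_p` to a ring in which `p` is nilpotent. -/
noncomputable def padicMap {B : Type*} [CommRing B] (h : IsNilpotent (p : B)) : ℤ_[p] →+* B :=
  (exists_padicInt_ringHom h).some

theorem PDDatum.gammaCompat (d : PDDatum.{u} p) : GammaCompat (padicMap d.nilp) d.dp :=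
  (gammaCompat_iff _ _).2 d.compat

theorem exists_dividedPowers_flat_hom {B B' : CommRingCat.{u}} {J : Ideal B}
    (hJ : DividedPowers J) (ι : ℤ_[p] →+* B) (hc : GammaCompat ι hJ) (f : B ⟶ B')
    (hf : f.hom.Flat) {J' : Ideal B'} (hJ' : J' = J.map f.hom) :
    ∃ h : DividedPowers J', hJ.IsDPMorphism h f.hom ∧ GammaCompat (f.hom.comp ι) h := by
  subst hJ'
  algebraize [f.hom]
  obtain ⟨h, hh⟩ := exists_dividedPowers_flat (B' := B') hJ ι
  exact ⟨h, hh, gammaCompat_of_flat hJ ι hc h hh⟩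

/-- The restriction map `B → Γ(Spec B, W)`. -/
noncomputable def specRes (B : CommRingCat.{u}) (W : (Spec B).Opens) : B ⟶ Γ(Spec B, W) :=
  (Scheme.ΓSpecIso B).inv ≫ (Spec B).presheaf.map (homOfLE le_top).op

theorem specRes_map (B : CommRingCat.{u}) {W W' : (Spec B).Opens} (h : W' ≤ W) :
    specRes B W ≫ (Spec B).presheaf.map (homOfLE h).op = specRes B W' := by
  rw [specRes, Category.assoc, ← Functor.map_comp]; rfl

theorem specRes_appLE {B B' : CommRingCat.{u}} (φ : B ⟶ B') (W : (Spec B).Opens)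
    (W' : (Spec B').Opens) (h : W' ≤ Spec.map φ ⁻¹ᵁ W) :
    specRes B W ≫ (Spec.map φ).appLE W W' h = φ ≫ specRes B' W' := by
  rw [specRes, specRes, Category.assoc, Scheme.Hom.map_appLE, Scheme.ΓSpecIso_inv_naturality_assoc,
    Scheme.Hom.appLE]
  rfl

theorem specRes_flat (B : CommRingCat.{u}) (W : (Spec B).affineOpens) :
    (specRes B W).hom.Flat := by
  have h : (Spec.map (specRes B W)) = W.2.fromSpec := by
    rw [specRes, Spec.map_comp, ← IsAffineOpen.map_fromSpec (isAffineOpen_top (Spec B)) W.2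
      (homOfLE le_top).op, IsAffineOpen.fromSpec_top]
    simp
  rw [← Flat.SpecMap_iff, h]
  have : IsOpenImmersion W.2.fromSpec := W.2.isOpenImmersion_fromSpec
  exact inferInstanceAs (Flat W.2.fromSpec)

theorem ker_app_eq_map {V T : Scheme.{u}} (i : V ⟶ T) [IsClosedImmersion i]
    {W W' : T.affineOpens} (h : (W' : T.Opens) ≤ W) :
    RingHom.ker (i.app W').hom =
      (RingHom.ker (i.app W).hom).map (T.presheaf.map (homOfLE h).op).hom := by
  rw [← Scheme.Hom.ker_apply, ← Scheme.Hom.ker_apply]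
  exact (Scheme.IdealSheafData.map_ideal i.ker (U := W') (V := W) h).symm

theorem ker_SpecMap_app {B C : CommRingCat.{u}} (q : B ⟶ C) (hq : Function.Surjective q.hom)
    (W : (Spec B).affineOpens) :
    RingHom.ker ((Spec.map q).app W).hom = (RingHom.ker q.hom).map (specRes B W).hom := by
  have := IsClosedImmersion.spec_of_surjective q hq
  rw [ker_app_eq_map (Spec.map q) (W := ⟨⊤, isAffineOpen_top _⟩) (le_top), specRes,
    CommRingCat.hom_comp, ← Ideal.map_map]
  congr 1
  ext x
  have e1 : (RingHom.ker q.hom).map (Scheme.ΓSpecIso B).inv.hom =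
      (RingHom.ker q.hom).comap (Scheme.ΓSpecIso B).hom.hom :=
    Ideal.map_comap_of_equiv (Scheme.ΓSpecIso B).commRingCatIsoToRingEquiv.symm
  rw [e1, Ideal.mem_comap, RingHom.mem_ker, RingHom.mem_ker]
  have e2 := congrArg (fun f => f.hom x) (Scheme.ΓSpecIso_naturality q)
  simp only [CommRingCat.hom_comp, RingHom.comp_apply] at e2
  rw [← e2]
  exact (map_eq_zero_iff _ (Scheme.ΓSpecIso C).commRingCatIsoToRingEquiv.injective).symm

namespace PDDatum

theorem exists_δ (d : PDDatum.{u} p) (W : (Spec d.B).affineOpens) :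
    ∃ h : DividedPowers (RingHom.ker ((Spec.map d.q).app W).hom),
      d.dp.IsDPMorphism h (specRes d.B W).hom ∧
        GammaCompat ((specRes d.B W).hom.comp (padicMap d.nilp)) h :=
  exists_dividedPowers_flat_hom d.dp _ d.gammaCompat (specRes d.B W) (specRes_flat _ W)
    (ker_SpecMap_app d.q d.surj W)

theorem pLocNilp_Spec {B : CommRingCat.{u}} (h : IsNilpotent (p : B)) : PLocNilp p (Spec B) :=
  fun x => ⟨⊤, trivial, by
    obtain ⟨n, hn⟩ := h
    refine ⟨n, ?_⟩
    have := congrArg (Scheme.ΓSpecIso B).inv.hom hn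
    simpa using this⟩

/-- The divided power thickening given by an affine divided power thickening. The divided powers on
an affine open subset are obtained from those on `B` by flat base change. -/
noncomputable def thickening (d : PDDatum.{u} p) : PDThickening.{u} p where
  V := Spec d.C
  T := Spec d.B
  i := Spec.map d.q
  isClosedImmersion := IsClosedImmersion.spec_of_surjective d.q d.surj
  pLocNilp := pLocNilp_Spec d.nilp
  δ W := (d.exists_δ W).choose
  δ_restrict W W' h := by
    refine DividedPowers.IsDPMorphism.of_comp _ _ _ (specRes d.B W).hom _ (ker_SpecMap_app d.q d.surj W)
      (d.exists_δ W).choose_spec.1 ?_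
    rw [← CommRingCat.hom_comp, specRes_map]
    exact (d.exists_δ W').choose_spec.1
  δ_compat W := (gammaCompat_iff _ _).1 (d.exists_δ W).choose_spec.2

theorem isDPMorphism_specRes (d : PDDatum.{u} p) (W : (Spec d.B).affineOpens) :
    d.dp.IsDPMorphism (d.thickening.δ W) (specRes d.B W).hom := (d.exists_δ W).choose_spec.1

theorem thickening_isDP (d : PDDatum.{u} p) {B' : CommRingCat.{u}} {J' : Ideal B'}
    {hJ' : DividedPowers J'} (W : (Spec d.B).affineOpens) (g : Γ(Spec d.B, W) ⟶ B')
    (h : d.dp.IsDPMorphism hJ' (specRes d.B W ≫ g).hom) :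
    (d.thickening.δ W).IsDPMorphism hJ' g.hom :=
  DividedPowers.IsDPMorphism.of_comp _ _ _ (specRes d.B W).hom _ (ker_SpecMap_app d.q d.surj W)
    (d.isDPMorphism_specRes W) h

/-- The object of the crystalline site given by an affine divided power thickening. -/
noncomputable def obj (d : PDDatum.{u} p) {U : Scheme.{u}} (f : Spec d.C ⟶ U) : CrisObj p U where
  toPDThickening := d.thickening
  str := f

/-- The morphism of the crystalline site given by a homomorphism of affine thickenings. -/
noncomputable def Hom.toCris {d d' : PDDatum.{u} p} (g : d.Hom d') {U : Scheme.{u}}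
    (f : Spec d.C ⟶ U) : CrisHom (d'.obj (Spec.map g.ψ ≫ f)) (d.obj f) where
  gV := Spec.map g.ψ
  gT := Spec.map g.φ
  comm := by
    change Spec.map d'.q ≫ Spec.map g.φ = Spec.map g.ψ ≫ Spec.map d.q
    rw [← Spec.map_comp, ← Spec.map_comp, g.comm]
  comm_str := rfl
  isDP W W' h := d.thickening_isDP W _ (by
    refine Eq.subst (motive := fun k => d.dp.IsDPMorphism (d'.thickening.δ W') k.hom)
      (specRes_appLE g.φ W.1 W'.1 h).symm ?_
    exact .comp _ (d'.isDPMorphism_specRes W') g.isDP)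

end PDDatum

/-! ### Affine charts of an object of the crystalline site -/

theorem isNilpotent_of_pLocNilp {T : Scheme.{u}} (hT : PLocNilp p T) {W : T.Opens}
    (hW : IsAffineOpen W) : IsNilpotent (p : Γ(T, W)) := by
  have key : ∀ x ∈ W, ∃ V : T.Opens, x ∈ V ∧ ∃ n, (p : Γ(T, V)) ^ n = 0 := fun x _ => hT x
  choose! V hV n hn using key
  obtain ⟨t, ht⟩ := hW.isCompact.elim_finite_subcover (fun x : W => (V x.1 : Set T))
    (fun x => (V x.1).2) (fun x hx => Set.mem_iUnion.2 ⟨⟨x, hx⟩, hV x hx⟩)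
  refine ⟨t.sup fun x => n x.1, ?_⟩
  refine T.sheaf.eq_of_locally_eq' (fun x : t => W ⊓ V x.1.1) W (fun x => homOfLE inf_le_left)
    (fun x hx => ?_) _ _ fun x => ?_
  · obtain ⟨y, hy, hxy⟩ := Set.mem_iUnion₂.1 (ht hx)
    exact TopologicalSpace.Opens.mem_iSup.2 ⟨⟨y, hy⟩, hx, hxy⟩
  · have h1 := congrArg (T.presheaf.map (homOfLE (inf_le_right : W ⊓ V x.1.1 ≤ _)).op).hom
      (hn x.1.1 x.1.2)
    rw [map_pow, map_natCast, map_zero] at h1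
    have h2 : (T.presheaf.map (homOfLE (inf_le_left : W ⊓ V x.1.1 ≤ _)).op).hom
        ((p : Γ(T, W)) ^ t.sup fun x => n x.1) = 0 := by
      rw [map_pow, map_natCast]
      exact pow_eq_zero_of_le (Finset.le_sup (f := fun x : W => n x.1) x.2) h1
    exact h2.trans (map_zero (T.presheaf.map (homOfLE (inf_le_left : W ⊓ V x.1.1 ≤ _)).op).hom).symm

namespace PDThickening
variable (c : PDThickening.{u} p)

theorem isAffineOpen_preimage (W : c.T.affineOpens) : IsAffineOpen (c.i ⁻¹ᵁ W.1) := by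
  have := c.isClosedImmersion
  exact W.2.preimage c.i

/-- The affine thickening given by an affine open subset of `T`. -/
noncomputable def chart (W : c.T.affineOpens) : PDDatum.{u} p where
  B := Γ(c.T, W)
  C := Γ(c.V, c.i ⁻¹ᵁ W)
  q := c.i.app W
  surj := by
    have := c.isClosedImmersion
    exact c.i.app_surjective W.1 W.2
  nilp := isNilpotent_of_pLocNilp c.pLocNilp W.2
  dp := c.δ W
  compat := c.δ_compat W

/-- The inclusion of `V ∩ W` in `V`. -/
noncomputable def chartV (W : c.T.affineOpens) : Spec (c.chart W).C ⟶ c.V :=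
  (c.isAffineOpen_preimage W).fromSpec

end PDThickening
end

section
variable {p : ℕ} [hp : Fact p.Prime]

theorem IsDPMorphism_congr {B B' : CommRingCat.{u}} {J : Ideal B} {J' : Ideal B'}
    {hJ : DividedPowers J} {hJ' : DividedPowers J'} {f g : B ⟶ B'} (h : f = g)
    (hf : hJ.IsDPMorphism hJ' f.hom) : hJ.IsDPMorphism hJ' g.hom := h ▸ hf

/-- On an affine open subset of the source of an open immersion into `T`, the divided powers
are determined by those on a larger affine open subset of `T`. -/
theorem PDThickening.chart_isDP (c : PDThickening.{u} p) {W W'' : c.T.affineOpens}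
    (h : (W'' : c.T.Opens) ≤ W) {B' : CommRingCat.{u}} {J' : Ideal B'} {hJ' : DividedPowers J'}
    (g : Γ(c.T, W'') ⟶ B')
    (hg : (c.δ W).IsDPMorphism hJ' (c.T.presheaf.map (homOfLE h).op ≫ g).hom) :
    (c.δ W'').IsDPMorphism hJ' g.hom := by
  have := c.isClosedImmersion
  exact DividedPowers.IsDPMorphism.of_comp _ _ _ (c.T.presheaf.map (homOfLE h).op).hom _
    (ker_app_eq_map c.i h) (c.δ_restrict _ _ h) hg

section
variable {X : Scheme.{u}} {W : X.Opens} (hW : IsAffineOpen W) (W' : (Spec Γ(X, W)).Opens)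

theorem fromSpec_image_le : hW.fromSpec ''ᵁ W' ≤ W :=
  (Scheme.Hom.image_le_opensRange _ _).trans hW.opensRange_fromSpec.le

theorem le_preimage_fromSpec_image : W' ≤ hW.fromSpec ⁻¹ᵁ (hW.fromSpec ''ᵁ W') := by
  rw [Scheme.Hom.preimage_image_eq]

theorem map_appLE_fromSpec : X.presheaf.map (homOfLE (fromSpec_image_le hW W')).op ≫
    hW.fromSpec.appLE _ W' (le_preimage_fromSpec_image hW W') = specRes _ W' := by
  rw [Scheme.Hom.map_appLE, Scheme.Hom.appLE, hW.fromSpec_app_self, specRes, Category.assoc,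
    ← Functor.map_comp]
  rfl

theorem fromSpec_image_le_of_le {V : X.Opens} (h : W' ≤ hW.fromSpec ⁻¹ᵁ V) :
    hW.fromSpec ''ᵁ W' ≤ V :=
  (hW.fromSpec.image_mono h).trans (Scheme.Hom.image_preimage_le _ _)

theorem appTop_fromSpec : hW.fromSpec.appTop ≫ (Scheme.ΓSpecIso Γ(X, W)).hom =
    X.presheaf.map (homOfLE le_top).op := by
  have h := congrArg Scheme.Hom.appTop hW.fromSpec_toSpecΓ
  rw [Scheme.Hom.comp_appTop, Scheme.toSpecΓ_appTop] at h
  rw [← cancel_epi (Scheme.ΓSpecIso Γ(X, ⊤)).hom, ← Category.assoc, h, Scheme.ΓSpecIso_naturality]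

end

/-- The inclusion of an affine chart in an object of the crystalline site. -/
noncomputable def CrisObj.chartHom {U : Scheme.{u}} (c : CrisObj p U) (W : c.T.affineOpens) :
    CrisHom ((c.chart W).obj (c.chartV W ≫ c.str)) c where
  gV := c.chartV W
  gT := IsAffineOpen.fromSpec (U := W.1) W.2
  comm := by
    have h := IsAffineOpen.SpecMap_appLE_fromSpec c.i W.2 (c.isAffineOpen_preimage W) le_rfl
    rw [Scheme.Hom.appLE_eq_app] at h
    exact h
  comm_str := rfl
  isDP W₁ W' h := by
    have hW : IsAffineOpen W.1 := W.2
    have hW' : IsAffineOpen (X := Spec Γ(c.T, W.1)) W'.1 := W'.2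
    have hW'' : IsAffineOpen (hW.fromSpec ''ᵁ W'.1) := hW'.image_of_isOpenImmersion hW.fromSpec
    refine IsDPMorphism_congr (Scheme.Hom.map_appLE hW.fromSpec
      (le_preimage_fromSpec_image hW W'.1) (homOfLE (fromSpec_image_le_of_le hW W'.1 h)).op) ?_
    exact DividedPowers.IsDPMorphism.comp (hJ := c.δ ⟨_, hW''⟩) _
      (c.chart_isDP (W := W) (W'' := ⟨_, hW''⟩) (fromSpec_image_le hW W'.1) _
        (IsDPMorphism_congr (map_appLE_fromSpec hW W'.1).symm
          ((c.chart W).isDPMorphism_specRes W')))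
      (c.δ_restrict W₁ ⟨_, hW''⟩ (fromSpec_image_le_of_le hW W'.1 h))

/-- The homomorphism of charts given by a morphism of the crystalline site. -/
noncomputable def CrisHom.chart {U : Scheme.{u}} {c' c : CrisObj p U} (g : CrisHom c' c)
    (W : c.T.affineOpens) (W' : c'.T.affineOpens) (h : (W' : c'.T.Opens) ≤ g.gT ⁻¹ᵁ W) :
    (c.chart W).Hom (c'.chart W') where
  φ := g.gT.appLE W W' h
  ψ := g.gV.appLE (c.i ⁻¹ᵁ W) (c'.i ⁻¹ᵁ W') (by
    rw [← Scheme.Hom.comp_preimage, ← g.comm, Scheme.Hom.comp_preimage]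
    exact Scheme.Hom.preimage_mono _ h)
  comm := by
    change c.i.app W ≫ _ = _ ≫ c'.i.app W'
    rw [← Scheme.Hom.appLE_eq_app, ← Scheme.Hom.appLE_eq_app, Scheme.Hom.appLE_comp_appLE,
      Scheme.Hom.appLE_comp_appLE]
    congr 1
    exact g.comm.symm
  isDP := g.isDP W W' h

theorem CrisHom.chart_ψ {U : Scheme.{u}} {c' c : CrisObj p U} (g : CrisHom c' c)
    (W : c.T.affineOpens) (W' : c'.T.affineOpens) (h : (W' : c'.T.Opens) ≤ g.gT ⁻¹ᵁ W) :
    Spec.map (g.chart W W' h).ψ ≫ c.chartV W ≫ c.str = c'.chartV W' ≫ c'.str := by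
  rw [← g.comm_str]
  simp only [← Category.assoc]
  congr 1
  exact IsAffineOpen.SpecMap_appLE_fromSpec g.gV (c.isAffineOpen_preimage W)
    (c'.isAffineOpen_preimage W') _

/-- The identity morphism of an object of the crystalline site. -/
def CrisHom.id {U : Scheme.{u}} (c : CrisObj p U) : CrisHom c c where
  gV := 𝟙 _
  gT := 𝟙 _
  comm := by rw [Category.comp_id, Category.id_comp]
  comm_str := Category.id_comp _
  isDP W W' h := IsDPMorphism_congr (by
    rw [Scheme.Hom.appLE, Scheme.Hom.id_app]; exact (Category.id_comp _).symm)
    (c.δ_restrict W W' h)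

theorem section_ext {T : Scheme.{u}} {U : T.Opens} {x y : Γ(T, U)}
    (h : ∀ t ∈ U, ∃ (W : T.affineOpens) (hW : (W : T.Opens) ≤ U), t ∈ (W : T.Opens) ∧
      (T.presheaf.map (homOfLE hW).op).hom x =
        (T.presheaf.map (homOfLE hW).op).hom y) : x = y := by
  choose W hW htW hxy using h
  exact T.sheaf.eq_of_locally_eq' (fun t : U => (W t.1 t.2 : T.Opens)) U
    (fun t => homOfLE (hW t.1 t.2))
    (fun t ht => TopologicalSpace.Opens.mem_iSup.2 ⟨⟨t, ht⟩, htW t ht⟩) _ _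
    fun t => hxy t.1 t.2

theorem exists_affineOpens_le {T : Scheme.{u}} (U : T.Opens) {t : T} (ht : t ∈ U) :
    ∃ W : T.affineOpens, (W : T.Opens) ≤ U ∧ t ∈ (W : T.Opens) := by
  obtain ⟨_, ⟨V, hV, rfl⟩, hxV, hVU⟩ := T.isBasis_affineOpens.exists_subset_of_mem_open ht U.2
  exact ⟨⟨V, hV⟩, hVU, hxV⟩

theorem presheaf_map_map {T : Scheme.{u}} {U V W : T.Opens} (h : V ≤ U) (h' : W ≤ V) (x : Γ(T, U)) :
    (T.presheaf.map (homOfLE h').op).hom ((T.presheaf.map (homOfLE h).op).hom x) =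
      (T.presheaf.map (homOfLE (h'.trans h)).op).hom x := by
  rw [← RingHom.comp_apply, ← CommRingCat.hom_comp, ← Functor.map_comp]; rfl

theorem exists_section {T : Scheme.{u}} (x : ∀ W : T.affineOpens, Γ(T, W))
    (hx : ∀ (W W' : T.affineOpens) (h : (W' : T.Opens) ≤ W),
      (T.presheaf.map (homOfLE h).op).hom (x W) = x W') :
    ∃ y : Γ(T, ⊤), ∀ W : T.affineOpens, (T.presheaf.map (homOfLE le_top).op).hom y = x W := by
  obtain ⟨y, hy, -⟩ := T.sheaf.existsUnique_gluing' (fun W : T.affineOpens => (W : T.Opens)) ⊤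
    (fun W => homOfLE le_top) (iSup_affineOpens_eq_top T).ge x fun W W' => by
      refine section_ext fun t ht => ?_
      obtain ⟨W₁, h, h'⟩ := exists_affineOpens_le _ ht
      refine ⟨W₁, h, h', ?_⟩
      exact (presheaf_map_map _ _ _).trans ((hx W W₁ (h.trans inf_le_left)).trans
        ((presheaf_map_map _ _ _).trans (hx W' W₁ (h.trans inf_le_right))).symm)
  exact ⟨y, hy⟩

/-! ### Sections of the crystalline structure sheaf as families on affine thickenings -/

/-- The values on affine thickenings of a global section of the crystalline structure sheaf. -/
noncomputable def toFam (𝒞 : PDDatum.{u} p → Prop) (U : Scheme.{u}) : ocris p U →+* fam 𝒞 U where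
  toFun s := ⟨fun d f => (Scheme.ΓSpecIso d.1.B).hom.hom (s.1 (d.1.obj f)), fun d d' g f => by
    refine Eq.trans ?_ (congrArg (Scheme.ΓSpecIso d'.1.B).hom.hom (s.2 _ _ (g.toCris f)))
    exact (congrArg (fun k : Γ(Spec d.1.B, ⊤) ⟶ d'.1.B => k.hom (s.1 (d.1.obj f)))
      (Scheme.ΓSpecIso_naturality g.φ)).symm⟩
  map_one' := Subtype.ext (funext fun _ => funext fun _ => map_one _)
  map_mul' _ _ := Subtype.ext (funext fun _ => funext fun _ => map_mul _ _ _)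
  map_zero' := Subtype.ext (funext fun _ => funext fun _ => map_zero _)
  map_add' _ _ := Subtype.ext (funext fun _ => funext fun _ => map_add _ _ _)

/-- The predicate that holds for all affine thickenings. -/
abbrev allData (_ : PDDatum.{u} p) : Prop := True

theorem toFam_chart {U : Scheme.{u}} (s : ocris p U) (c : CrisObj p U) (W : c.T.affineOpens) :
    (toFam allData U s).1 ⟨c.chart W, trivial⟩ (c.chartV W ≫ c.str) =
      (c.T.presheaf.map (homOfLE le_top).op).hom (s.1 c) := by
  have h := s.2 _ _ (c.chartHom W)
  have hW : IsAffineOpen W.1 := W.2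
  rw [← appTop_fromSpec hW]
  exact congrArg (Scheme.ΓSpecIso _).hom.hom h.symm

theorem toFam_injective (U : Scheme.{u}) : Function.Injective (toFam (p := p) allData U) := by
  intro s t h
  refine Subtype.ext (funext fun c => section_ext fun x _ => ?_)
  obtain ⟨W, hW, hx⟩ := exists_affineOpens_le (⊤ : c.T.Opens) (t := x) trivial
  refine ⟨W, hW, hx, ?_⟩
  exact (toFam_chart s c W).symm.trans ((congrArg (fun k : fam allData U => k.1 ⟨c.chart W, trivial⟩
    (c.chartV W ≫ c.str)) h).trans
    (toFam_chart t c W))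

theorem fam_congr {𝒞 : PDDatum.{u} p → Prop} {U : Scheme.{u}} (t : fam 𝒞 U)
    (d : {d : PDDatum.{u} p // 𝒞 d}) {f g : Spec d.1.C ⟶ U} (h : f = g) : t.1 d f = t.1 d g :=
  h ▸ rfl

theorem fam_chart {U : Scheme.{u}} (t : fam (p := p) allData U) {c' c : CrisObj p U}
    (g : CrisHom c' c) (W : c.T.affineOpens) (W' : c'.T.affineOpens)
    (h : (W' : c'.T.Opens) ≤ g.gT ⁻¹ᵁ W) :
    (g.gT.appLE W W' h).hom (t.1 ⟨c.chart W, trivial⟩ (c.chartV W ≫ c.str)) =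
      t.1 ⟨c'.chart W', trivial⟩ (c'.chartV W' ≫ c'.str) :=
  (t.2 ⟨c.chart W, trivial⟩ ⟨c'.chart W', trivial⟩ (g.chart W W' h) _).trans
    (fam_congr t _ (g.chart_ψ W W' h))

/-- A compatible family defines a section on each affine open subset of `T` for an object `(V, T,
δ)` of the crystalline site; these sections glue. -/
theorem toFam_surjective (U : Scheme.{u}) : Function.Surjective (toFam (p := p) allData U) := by
  intro t
  have hex : ∀ c : CrisObj p U, ∃ y : Γ(c.T, ⊤), ∀ W : c.T.affineOpens,
      (c.T.presheaf.map (homOfLE le_top).op).hom y =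
        t.1 ⟨c.chart W, trivial⟩ (c.chartV W ≫ c.str) := fun c =>
    exists_section _ fun W W' h => by
      refine Eq.trans ?_ (fam_chart t (CrisHom.id c) W W' h)
      refine congrArg (fun k : Γ(c.T, W) ⟶ Γ(c.T, W') => k.hom _) ?_
      exact ((congrArg (· ≫ c.T.presheaf.map (homOfLE h).op) (Scheme.Hom.id_app (U := W.1))).trans
        (Category.id_comp _)).symm
  choose y hy using hex
  have hy' : ∀ (c' c : CrisObj p U) (g : CrisHom c' c), g.gT.appTop.hom (y c) = y c' := by
    intro c' c g
    refine section_ext fun x _ => ?_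
    obtain ⟨W, -, hx⟩ := exists_affineOpens_le (⊤ : c.T.Opens) (t := g.gT x) trivial
    obtain ⟨W', hW', hx'⟩ := exists_affineOpens_le (g.gT ⁻¹ᵁ W.1) (t := x) hx
    refine ⟨W', le_top, hx', ?_⟩
    rw [hy c' W', ← fam_chart t g W W' hW', ← hy c W]
    refine (congrArg (fun k : Γ(c.T, ⊤) ⟶ Γ(c'.T, W') => k.hom (y c)) ?_ :
      (g.gT.appTop ≫ c'.T.presheaf.map (homOfLE le_top).op).hom (y c) =
        (c.T.presheaf.map (homOfLE le_top).op ≫ g.gT.appLE W W' hW').hom (y c))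
    rw [Scheme.Hom.map_appLE]; rfl
  refine ⟨⟨y, hy'⟩, Subtype.ext (funext fun d => funext fun f => ?_)⟩
  let W : (d.1.obj f).T.affineOpens := ⟨⊤, isAffineOpen_top (Spec d.1.B)⟩
  let g : d.1.Hom ((d.1.obj f).chart W) :=
    { φ := (Scheme.ΓSpecIso d.1.B).inv
      ψ := (Scheme.ΓSpecIso d.1.C).inv
      comm := Scheme.ΓSpecIso_inv_naturality d.1.q
      isDP := IsDPMorphism_congr (by
        rw [specRes]
        exact (congrArg _ ((Spec d.1.B).presheaf.map_id _)).trans (Category.comp_id _))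
        (d.1.isDPMorphism_specRes W) }
  have h1 := t.2 d ⟨_, trivial⟩ g f
  have h2 : Spec.map g.ψ ≫ f = (d.1.obj f).chartV W ≫ (d.1.obj f).str := by
    refine congrArg (· ≫ f) ?_
    change Spec.map (Scheme.ΓSpecIso d.1.C).inv = (isAffineOpen_top (Spec d.1.C)).fromSpec
    rw [IsAffineOpen.fromSpec_top]; simp
  replace h1 := h1.trans ((fam_congr t ⟨(d.1.obj f).chart W, trivial⟩ h2).trans (hy _ W).symm)
  have h3 : (((d.1.obj f).T).presheaf.map (homOfLE (le_top : W.1 ≤ ⊤)).op).hom (y (d.1.obj f)) =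
    y (d.1.obj f) := congrArg (fun k : Γ(Spec d.1.B, ⊤) ⟶ Γ(Spec d.1.B, ⊤) => k.hom (y (d.1.obj f))) ((Spec d.1.B).presheaf.map_id _)
  rw [h3] at h1
  change (Scheme.ΓSpecIso d.1.B).hom.hom (y (d.1.obj f)) = _
  rw [← h1]
  exact congrArg (fun k : d.1.B ⟶ d.1.B => k.hom (t.1 d f)) (Scheme.ΓSpecIso d.1.B).inv_hom_id

end

/-! ### Extraction of `p`-th roots -/

section ExpandFlat
variable (p : ℕ) [hp : Fact p.Prime] (ι : Type u)

/-- The polynomial ring `ℤ[T_i]` as an algebra over `ℤ[S_i]` via `S_i ↦ T_i ^ p`. -/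
def RootPoly (_ : ℕ) (ι : Type u) : Type u := MvPolynomial ι ℤ

noncomputable instance : CommRing (RootPoly p ι) := inferInstanceAs (CommRing (MvPolynomial ι ℤ))

noncomputable instance : Algebra (MvPolynomial ι ℤ) (RootPoly p ι) :=
  (MvPolynomial.expand (R := ℤ) (σ := ι) p).toRingHom.toAlgebra

/-- The `ℤ[S_i]`-linear combinations of the monomials in the `T_i` with exponents less than `p`. -/
noncomputable def rootPolyMap :
    ({r : ι →₀ ℕ // ∀ i, r i < p} →₀ MvPolynomial ι ℤ) →ₗ[MvPolynomial ι ℤ] RootPoly p ι :=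
  Finsupp.linearCombination _ fun r => (MvPolynomial.monomial r.1 (1 : ℤ) : MvPolynomial ι ℤ)

theorem rootPolyMap_single (r : {r : ι →₀ ℕ // ∀ i, r i < p}) (f : MvPolynomial ι ℤ) :
    rootPolyMap p ι (Finsupp.single r f) =
      (MvPolynomial.expand p f * MvPolynomial.monomial r.1 (1 : ℤ) : MvPolynomial ι ℤ) :=
  Finsupp.linearCombination_single _ _ _

theorem rootPolyMap_surjective : Function.Surjective (rootPolyMap p ι) := by
  intro f
  induction f using MvPolynomial.induction_on' with
  | monomial m c =>
    refine ⟨Finsupp.single ⟨m.mapRange (· % p) (Nat.zero_mod p), fun i =>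
      Nat.mod_lt _ hp.out.pos⟩ (MvPolynomial.monomial (m.mapRange (· / p) (Nat.zero_div p)) c), ?_⟩
    refine (rootPolyMap_single p ι _ _).trans ?_
    refine (congrArg (fun z : MvPolynomial ι ℤ => z * MvPolynomial.monomial _ 1)
      (MvPolynomial.expand_monomial _ _ _)).trans ?_
    refine MvPolynomial.monomial_mul.trans ?_
    rw [mul_one]
    refine congrArg (fun n => MvPolynomial.monomial n c) ?_
    ext i
    exact Nat.div_add_mod _ _
  | add f g hf hg =>
    obtain ⟨a, rfl⟩ := hf
    obtain ⟨b, rfl⟩ := hg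
    exact ⟨a + b, map_add _ _ _⟩

/-- Each exponent can be written uniquely as `p m + r` with `r < p`; the coefficients of a linear
combination can therefore be read off from its value. -/
theorem coeff_rootPolyMap (v : {r : ι →₀ ℕ // ∀ i, r i < p} →₀ MvPolynomial ι ℤ)
    (r : {r : ι →₀ ℕ // ∀ i, r i < p}) (m : ι →₀ ℕ) :
    MvPolynomial.coeff (p • m + r.1) (rootPolyMap p ι v : MvPolynomial ι ℤ) = (v r).coeff m := by
  classical
  induction v using Finsupp.induction_linear with
  | zero => rw [map_zero]; simp; rfl
  | add v w hv hw =>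
    rw [map_add, Finsupp.add_apply, MvPolynomial.coeff_add, ← hv, ← hw]
    exact MvPolynomial.coeff_add _ _ _
  | single s f =>
    rw [rootPolyMap_single, MvPolynomial.coeff_mul_monomial', mul_one, Finsupp.single_apply]
    by_cases hrs : s = r
    · subst hrs
      rw [if_pos le_add_self, if_pos rfl, add_tsub_cancel_right,
        MvPolynomial.coeff_expand_smul _ hp.out.ne_zero]
    · rw [if_neg hrs, MvPolynomial.coeff_zero]
      split_ifs with hle
      · obtain ⟨i, hi⟩ : ∃ i, s.1 i ≠ r.1 i := by
          by_contra! h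
          exact hrs (Subtype.ext (Finsupp.ext h))
        refine MvPolynomial.coeff_expand_of_not_dvd (i := i) _ fun hd => hi ?_
        have hle' := hle i
        simp only [Finsupp.tsub_apply, Finsupp.add_apply, Finsupp.smul_apply, smul_eq_mul] at hd hle'
        obtain ⟨k, hk⟩ := hd
        have hs := s.2 i
        have hr := r.2 i
        have h1 : p * m i + r.1 i = p * k + s.1 i := by omega
        have h2 := congrArg (· % p) h1
        simp only [Nat.mul_add_mod, Nat.mod_eq_of_lt hs, Nat.mod_eq_of_lt hr] at h2
        exact h2.symm
      · rfl

theorem flat_rootPoly : Module.Flat (MvPolynomial ι ℤ) (RootPoly p ι) := by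
  refine Module.Flat.of_linearEquiv (LinearEquiv.ofBijective (rootPolyMap p ι)
    ⟨fun v w h => ?_, rootPolyMap_surjective p ι⟩).symm
  ext r m
  rw [← coeff_rootPolyMap, ← coeff_rootPolyMap, h]

/-- `A[(a_i ^ (1/p))] = A[T_i] / (T_i ^ p - a_i)`. -/
abbrev RootRing {A : Type u} [CommRing A] (a : ι → A) : Type u :=
  MvPolynomial ι A ⧸ Ideal.span (Set.range fun i : ι =>
      (MvPolynomial.X i ^ p - MvPolynomial.C (a i) : MvPolynomial ι A))

open scoped TensorProduct in
/-- An algebra with the universal property of `A[T_i]/(T_i ^ p - a_i)` is flat, being a retract of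
the base change of `ℤ[T_i]` along `ℤ[S_i] → A`, `S_i ↦ a_i`. -/
theorem flat_of_rootPresentation {A Q : Type u} [CommRing A] [CommRing Q] [Algebra A Q] (a : ι → A)
    (t : ι → Q) (ht : ∀ i, t i ^ p = algebraMap A Q (a i))
    (hlift : ∀ (P : Type u) [CommRing P] [Algebra A P] (x : ι → P),
      (∀ i, x i ^ p = algebraMap A P (a i)) → ∃ g : Q →ₐ[A] P, ∀ i, g (t i) = x i)
    (hext : ∀ g : Q →ₐ[A] Q, (∀ i, g (t i) = t i) → g = AlgHom.id A Q) : Module.Flat A Q := by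
  have := flat_rootPoly p ι
  let _ : Algebra (MvPolynomial ι ℤ) A := (MvPolynomial.aeval (R := ℤ) a).toRingHom.toAlgebra
  let y : ι → RootPoly p ι := fun i => (MvPolynomial.X i : MvPolynomial ι ℤ)
  have hx : ∀ i, ((1 : A) ⊗ₜ[MvPolynomial ι ℤ] y i) ^ p = algebraMap A _ (a i) := fun i => by
    have h1 : (algebraMap (MvPolynomial ι ℤ) (RootPoly p ι) (MvPolynomial.X i)) =
        (MvPolynomial.X i ^ p : MvPolynomial ι ℤ) := MvPolynomial.expand_X _ _
    have h2 : (algebraMap (MvPolynomial ι ℤ) A (MvPolynomial.X i)) = a i :=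
      MvPolynomial.aeval_X _ _
    rw [Algebra.TensorProduct.tmul_pow, one_pow, Algebra.TensorProduct.algebraMap_apply, ← h2]
    refine (congrArg (fun z => (1 : A) ⊗ₜ[MvPolynomial ι ℤ] z) h1.symm).trans ?_
    rw [Algebra.algebraMap_eq_smul_one, TensorProduct.tmul_smul, TensorProduct.smul_tmul',
      Algebra.smul_def, mul_one]
    rfl
  obtain ⟨g, hg⟩ := hlift _ _ hx
  let _ : Algebra (MvPolynomial ι ℤ) Q :=
    ((algebraMap A Q).comp (algebraMap (MvPolynomial ι ℤ) A)).toAlgebra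
  have : IsScalarTower (MvPolynomial ι ℤ) A Q := IsScalarTower.of_algebraMap_eq fun _ => rfl
  let k : RootPoly p ι →ₐ[MvPolynomial ι ℤ] Q :=
    { (MvPolynomial.aeval (R := ℤ) t).toRingHom with
      commutes' := fun r => by
        have h : ((MvPolynomial.aeval (R := ℤ) t).toRingHom.comp
            (MvPolynomial.expand p).toRingHom) =
            (algebraMap A Q).comp (MvPolynomial.aeval (R := ℤ) a).toRingHom :=
          MvPolynomial.ringHom_ext (fun n => by simp) fun i => by simp [ht]
        exact congrArg (fun k => k r) h }
  let h : A ⊗[MvPolynomial ι ℤ] RootPoly p ι →ₐ[A] Q :=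
    Algebra.TensorProduct.lift (Algebra.ofId A Q) k fun _ _ => Commute.all _ _
  refine Module.Flat.of_retract g.toLinearMap h.toLinearMap ?_
  have hgh : h.comp g = AlgHom.id A Q := by
    refine hext _ fun i => ?_
    rw [AlgHom.comp_apply, hg, Algebra.TensorProduct.lift_tmul, map_one, one_mul]
    exact MvPolynomial.aeval_X _ _
  exact congrArg AlgHom.toLinearMap hgh

theorem rootRing_pow {A : Type u} [CommRing A] (a : ι → A) (i : ι) :
    (Ideal.Quotient.mk _ (MvPolynomial.X i) : RootRing p ι a) ^ p = algebraMap A _ (a i) := by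
  refine (map_pow (Ideal.Quotient.mk _) _ _).symm.trans ?_
  exact Ideal.Quotient.eq.2 (Ideal.subset_span ⟨i, rfl⟩)

theorem exists_rootRing_lift {A P : Type u} [CommRing A] (a : ι → A) [CommRing P] [Algebra A P]
    (x : ι → P) (hx : ∀ i, x i ^ p = algebraMap A P (a i)) :
    ∃ g : RootRing p ι a →ₐ[A] P, ∀ i, g (Ideal.Quotient.mk _ (MvPolynomial.X i)) = x i := by
  refine ⟨Ideal.Quotient.liftₐ _ (MvPolynomial.aeval x) fun z hz => ?_, fun i =>
    MvPolynomial.aeval_X _ _⟩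
  refine (Ideal.span_le (I := RingHom.ker (MvPolynomial.aeval x))).2 ?_ hz
  rintro _ ⟨i, rfl⟩
  simp [hx]

theorem flat_rootRing {A : Type u} [CommRing A] (a : ι → A) : Module.Flat A (RootRing p ι a) :=
  flat_of_rootPresentation p ι a _ (rootRing_pow p ι a)
    (fun _ _ _ x hx => exists_rootRing_lift p ι a x hx)
    fun _ hg => Ideal.Quotient.algHom_ext _ (MvPolynomial.algHom_ext fun i => hg i)

end ExpandFlat

/-! ### Extensions of rings by `p`-th roots -/

section RootExtension

/-- A homomorphism is flat if every linear relation over it comes from a relation over a flat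
`A`-algebra. -/
theorem flat_of_factorization {A P : Type u} [CommRing A] [CommRing P] (f : A →+* P)
    (h : ∀ (l : ℕ) (a : Fin l → A) (x : Fin l → P), ∑ i, f (a i) * x i = 0 →
      ∃ (Q : CommRingCat.{u}) (g : A →+* Q) (k : Q →+* P) (y : Fin l → Q), g.Flat ∧ k.comp g = f ∧
        (∀ i, k (y i) = x i) ∧ ∑ i, g (a i) * y i = 0) : f.Flat := by
  algebraize [f]
  refine Module.Flat.of_forall_isTrivialRelation fun {l a x} hx => ?_
  obtain ⟨Q, g, k, y, hg, hk, hy, h0⟩ := h l a x (by simpa [Algebra.smul_def] using! hx)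
  algebraize [g]
  obtain ⟨n, b, z, hz, hb⟩ := Module.Flat.isTrivialRelation_of_sum_smul_eq_zero (R := A) (M := Q)
    (f := a) (x := y) (by simpa [Algebra.smul_def] using! h0)
  refine ⟨n, b, fun j => k (z j), fun i => ?_, hb⟩
  rw [← hy, hz, map_sum]
  refine Finset.sum_congr rfl fun j _ => ?_
  rw [Algebra.smul_def, Algebra.smul_def, map_mul]
  exact congrArg (· * k (z j)) (RingHom.congr_fun hk (b i j))

instance preservesColimit_forget_nat (F : ℕ ⥤ CommRingCat.{u}) :
    Limits.PreservesColimit F (forget CommRingCat.{u}) := by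
  have : Limits.PreservesFilteredColimitsOfSize.{0, 0} (forget CommRingCat.{u}) :=
    Limits.preservesFilteredColimitsOfSize_shrink.{0, u, 0, u} _
  have : Limits.PreservesColimitsOfShape ℕ (forget CommRingCat.{u}) :=
    Limits.PreservesFilteredColimitsOfSize.preserves_filtered_colimits _
  infer_instance

open Limits in
/-- A sequential colimit of flat algebras is flat. -/
theorem flat_of_isColimit_nat {F : ℕ ⥤ CommRingCat.{u}} {c : Cocone F} (hc : IsColimit c)
    (hF : ∀ n, (F.map (homOfLE (Nat.zero_le n))).hom.Flat) : (c.ι.app 0).hom.Flat := by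
  refine flat_of_factorization _ fun l a x hx => ?_
  -- A linear relation over the colimit already holds at a finite stage.
  choose n y hy using fun i => Concrete.isColimit_exists_rep F hc (x i)
  let N := Finset.univ.sup n
  have hN : ∀ i, n i ≤ N := fun i => Finset.le_sup (Finset.mem_univ i)
  let z : Fin l → F.obj N := fun i => (F.map (homOfLE (hN i))).hom (y i)
  have hz : ∀ i, (c.ι.app N).hom (z i) = x i := fun i =>
    (congrArg (fun k : F.obj (n i) ⟶ c.pt => k.hom (y i)) (c.w (homOfLE (hN i)))).trans (hy i)
  have h0 : ∀ (m : ℕ) (b : F.obj 0), (c.ι.app m).hom ((F.map (homOfLE (Nat.zero_le m))).hom b) =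
      (c.ι.app 0).hom b := fun m b =>
    congrArg (fun k : F.obj 0 ⟶ c.pt => k.hom b) (c.w (homOfLE (Nat.zero_le m)))
  obtain ⟨M, g, g', hg⟩ := Concrete.isColimit_exists_of_rep_eq (i := N) (j := N) F hc
    (∑ i, (F.map (homOfLE (Nat.zero_le N))).hom (a i) * z i) (0 : F.obj N) (by
      refine Eq.trans ?_ (map_zero (c.ι.app N).hom).symm
      refine Eq.trans ?_ hx
      refine (map_sum (c.ι.app N).hom _ _).trans (Finset.sum_congr rfl fun i _ => ?_)
      rw [map_mul, hz, h0])
  refine ⟨F.obj M, (F.map (homOfLE (Nat.zero_le M))).hom, (c.ι.app M).hom,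
    fun i => (F.map g).hom (z i), hF M, RingHom.ext (h0 M), fun i => ?_, ?_⟩
  · exact (congrArg (fun k : F.obj N ⟶ c.pt => k.hom (z i)) (c.w g)).trans (hz i)
  · refine Eq.trans ?_ (hg.trans (map_zero (F.map g').hom))
    refine Eq.trans ?_ (map_sum (F.map g).hom _ _).symm
    refine Finset.sum_congr rfl fun i _ => ?_
    rw [map_mul]
    exact congrArg (· * _) (congrArg (fun k : F.obj 0 ⟶ F.obj M => k.hom (a i))
      (F.map_comp (homOfLE (Nat.zero_le N)) g))

variable (p : ℕ)

theorem rootExtraction_flat [Fact p.Prime] {A B : CommRingCat.{u}} {f : A ⟶ B}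
    (h : rootExtraction p f) : f.hom.Flat := by
  obtain ⟨ι, a, e, he⟩ := h
  have h1 : f.hom = (e : RootRing p ι a →+* B).comp (algebraMap A (RootRing p ι a)) :=
    RingHom.ext fun r => (he r).symm
  rw [h1]
  exact RingHom.Flat.comp ((RingHom.flat_algebraMap_iff).2 (flat_rootRing p ι a))
    (RingHom.Flat.of_bijective e.bijective)

/-- Every element is a `p`-th power. -/
def HasRoots (B : Type*) [CommRing B] : Prop := ∀ b : B, ∃ c, c ^ p = b

theorem rootExtraction_lift [Fact p.Prime] {A B C : CommRingCat.{u}} {f : A ⟶ B} (h : rootExtraction p f)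
    (hC : HasRoots p C) (g : A ⟶ C) : ∃ k : B ⟶ C, f ≫ k = g := by
  obtain ⟨ι, a, e, he⟩ := h
  choose x hx using fun i => hC (g.hom (a i))
  algebraize [g.hom]
  obtain ⟨k, -⟩ := exists_rootRing_lift p ι a x hx
  refine ⟨CommRingCat.ofHom ((k : RootRing p ι a →+* C).comp e.symm), ?_⟩
  ext r
  change k (e.symm (f.hom r)) = g.hom r
  rw [← he, e.symm_apply_apply]
  exact k.commutes r

/-- A `p`-root extension `A → B` has the lifting property for homomorphisms from `A` to a ring in
which all elements have `p`-th roots. -/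
theorem rootExtension_lift [Fact p.Prime] {A B C : CommRingCat.{u}} {f : A ⟶ B} (h : rootExtension p f)
    (hC : HasRoots p C) (g : A ⟶ C) : ∃ k : B ⟶ C, f ≫ k = g := by
  have h1 := MorphismProperty.transfiniteCompositionsOfShape_le_llp_rlp _ _ _ h
  let t : C ⟶ CommRingCat.of PUnit.{u + 1} := CommRingCat.punitIsTerminal.from C
  have ht : (rootExtraction p).rlp t := fun A' B' f' hf' => ⟨fun {a b} sq => by
    obtain ⟨k, hk⟩ := rootExtraction_lift p hf' hC a
    exact ⟨⟨⟨k, hk, CommRingCat.punitIsTerminal.hom_ext _ _⟩⟩⟩⟩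
  have := h1 t ht
  have sq : CommSq g f t (CommRingCat.punitIsTerminal.from B) :=
    ⟨CommRingCat.punitIsTerminal.hom_ext _ _⟩
  exact ⟨sq.lift, sq.fac_left⟩

/-- The ring obtained by adjoining a `p`-th root of every element. -/
noncomputable def rootStep (B : CommRingCat.{u}) : CommRingCat.{u} :=
  CommRingCat.of (RootRing p B (id : B → B))

/-- The homomorphism from `B` to the ring obtained by adjoining a `p`-th root of every element. -/
noncomputable def toRootStep (B : CommRingCat.{u}) : B ⟶ rootStep p B :=
  CommRingCat.ofHom (algebraMap B (RootRing p B (id : B → B)))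

theorem rootExtraction_toRootStep [Fact p.Prime] (B : CommRingCat.{u}) : rootExtraction p (toRootStep p B) :=
  ⟨B, id, RingEquiv.refl _, fun _ => rfl⟩

theorem exists_pow_toRootStep [Fact p.Prime] (B : CommRingCat.{u}) (b : B) :
    ∃ c : rootStep p B, c ^ p = (toRootStep p B).hom b := ⟨_, rootRing_pow p B id b⟩

/-- The sequence of rings obtained by iterated adjunction of all `p`-th roots. -/
noncomputable def rootSeq (B : CommRingCat.{u}) : ℕ → CommRingCat.{u}
  | 0 => B
  | n + 1 => rootStep p (rootSeq B n)

/-- The sequence `rootSeq` as a functor on `ℕ`. -/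
noncomputable def rootFunctor (B : CommRingCat.{u}) : ℕ ⥤ CommRingCat.{u} :=
  Functor.ofSequence (X := rootSeq p B) fun n => toRootStep p (rootSeq p B n)

theorem rootFunctor_map_succ (B : CommRingCat.{u}) (n : ℕ) :
    (rootFunctor p B).map (homOfLE (Nat.le_add_right n 1)) = toRootStep p (rootSeq p B n) :=
  Functor.ofSequence_map_homOfLE_succ _ _

/-- The `p`-root extension obtained by adjoining all iterated `p`-th roots. -/
noncomputable def rootClosure (B : CommRingCat.{u}) : CommRingCat.{u} :=
  Limits.colimit (rootFunctor p B)

/-- The homomorphism from `B` to the ring obtained by adjoining all iterated `p`-th roots. -/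
noncomputable def toRootClosure (B : CommRingCat.{u}) : B ⟶ rootClosure p B :=
  Limits.colimit.ι (rootFunctor p B) 0

theorem rootExtension_toRootClosure [Fact p.Prime] (B : CommRingCat.{u}) :
    rootExtension p (toRootClosure p B) := by
  refine ⟨⟨{ F := rootFunctor p B, isoBot := Iso.refl _, incl := (Limits.colimit.cocone _).ι
             isColimit := Limits.colimit.isColimit _, fac := Category.id_comp _ }, fun n _ => ?_⟩⟩
  have := rootExtraction_toRootStep p (rootSeq p B n)
  rw [← rootFunctor_map_succ] at this
  exact this

theorem hasRoots_rootClosure [Fact p.Prime] (B : CommRingCat.{u}) : HasRoots p (rootClosure p B) := by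
  intro x
  obtain ⟨n, y, rfl⟩ := Limits.Concrete.isColimit_exists_rep _
    (Limits.colimit.isColimit (rootFunctor p B)) x
  obtain ⟨c, hc⟩ := exists_pow_toRootStep p (rootSeq p B n) y
  refine ⟨(Limits.colimit.ι (rootFunctor p B) (n + 1)).hom c,
    (map_pow (Limits.colimit.ι (rootFunctor p B) (n + 1)).hom c p).symm.trans ?_⟩
  refine (congrArg (Limits.colimit.ι (rootFunctor p B) (n + 1)).hom (hc.trans
    (congrArg (fun k : rootSeq p B n ⟶ rootSeq p B (n + 1) => k.hom y)
      (rootFunctor_map_succ p B n).symm))).trans ?_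
  exact congrArg (fun k : (rootFunctor p B).obj n ⟶ rootClosure p B => k.hom y)
    (Limits.colimit.w (rootFunctor p B) (homOfLE (Nat.le_add_right n 1)))

theorem flat_toRootClosure [Fact p.Prime] (B : CommRingCat.{u}) :
    (toRootClosure p B).hom.Flat := by
  refine flat_of_isColimit_nat (Limits.colimit.isColimit (rootFunctor p B)) fun n => ?_
  induction n with
  | zero =>
    rw [show homOfLE (Nat.zero_le 0) = 𝟙 0 from rfl, CategoryTheory.Functor.map_id]
    exact RingHom.Flat.id _
  | succ n ih =>
    rw [show homOfLE (Nat.zero_le (n + 1)) = homOfLE (Nat.zero_le n) ≫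
      homOfLE (Nat.le_add_right n 1) from rfl, Functor.map_comp, rootFunctor_map_succ]
    exact RingHom.Flat.comp ih (rootExtraction_flat p (rootExtraction_toRootStep p _))

/-- A point with residue field `k` lifts, because `B → k̄` extends to the ring with all iterated
`p`-th roots adjoined. -/
theorem surjective_toRootClosure [hp : Fact p.Prime] (B : CommRingCat.{u}) :
    Function.Surjective (PrimeSpectrum.comap (toRootClosure p B).hom) := by
  intro P
  let K := CommRingCat.of (AlgebraicClosure P.asIdeal.ResidueField)
  let g : B ⟶ K := CommRingCat.ofHom (algebraMap B (AlgebraicClosure P.asIdeal.ResidueField))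
  obtain ⟨k, hk⟩ := rootExtension_lift p (rootExtension_toRootClosure p B) (C := K)
    (fun b => IsAlgClosed.exists_pow_nat_eq (k := AlgebraicClosure P.asIdeal.ResidueField) b
      hp.out.pos) g
  refine ⟨PrimeSpectrum.comap k.hom (⊥ : PrimeSpectrum (AlgebraicClosure P.asIdeal.ResidueField)), ?_⟩
  ext b
  have h1 : k.hom ((toRootClosure p B).hom b) = g.hom b :=
    congrArg (fun k : B ⟶ K => k.hom b) hk
  change k.hom ((toRootClosure p B).hom b) = 0 ↔ b ∈ P.asIdeal
  rw [h1]
  change algebraMap B (AlgebraicClosure P.asIdeal.ResidueField) b = 0 ↔ _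
  rw [IsScalarTower.algebraMap_apply B P.asIdeal.ResidueField, map_eq_zero_iff _
    (algebraMap P.asIdeal.ResidueField (AlgebraicClosure P.asIdeal.ResidueField)).injective,
    Ideal.algebraMap_residueField_eq_zero]

end RootExtension

/-! ### Faithfully flat descent for finite families -/

section Descent
open scoped TensorProduct
variable {B : Type u} [CommRing B] {κ : Type u} [Finite κ] (S : κ → Type u)
  [∀ j, CommRing (S j)] [∀ j, Algebra B (S j)]

theorem faithfullyFlat_pi (hf : ∀ j, Module.Flat B (S j))
    (hs : ∀ P : PrimeSpectrum B, ∃ j, ∃ Q, PrimeSpectrum.comap (algebraMap B (S j)) Q = P) :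
    Module.FaithfullyFlat B (∀ j, S j) := by
  classical
  cases nonempty_fintype κ
  have : Module.Flat B (∀ j, S j) :=
    Module.Flat.of_linearEquiv (DirectSum.linearEquivFunOnFintype B κ S).symm
  refine Module.FaithfullyFlat.of_comap_surjective fun P => ?_
  obtain ⟨j, Q, hQ⟩ := hs P
  refine ⟨PrimeSpectrum.comap (Pi.evalRingHom S j) Q, ?_⟩
  rw [← hQ]
  rfl

theorem tmul_pi_eq_zero {M : Type u} [AddCommGroup M] [Module B M] (z : M ⊗[B] (∀ j, S j))
    (h : ∀ j, LinearMap.lTensor M (LinearMap.proj j) z = 0) : z = 0 := by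
  classical
  cases nonempty_fintype κ
  have h1 : (∑ j, (LinearMap.single B S j).comp (LinearMap.proj j)) = LinearMap.id := by
    ext x j
    simp [Finset.sum_apply]
  have h2 : LinearMap.lTensorHom M (∑ j, (LinearMap.single B S j).comp (LinearMap.proj j)) z = z :=
    (congrArg (fun f => LinearMap.lTensorHom M f z) h1).trans
      (LinearMap.congr_fun (LinearMap.lTensor_id M _) z)
  rw [← h2, map_sum, LinearMap.sum_apply]
  refine Finset.sum_eq_zero fun j _ => ?_
  change LinearMap.lTensor M _ z = 0
  rw [LinearMap.lTensor_comp, LinearMap.comp_apply, h j, map_zero]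

theorem eq_zero_of_tmul_one_eq_zero (hf : ∀ j, Module.Flat B (S j))
    (hs : ∀ P : PrimeSpectrum B, ∃ j, ∃ Q, PrimeSpectrum.comap (algebraMap B (S j)) Q = P)
    {M : Type u} [AddCommGroup M] [Module B M] (z : M)
    (h : ∀ j, z ⊗ₜ[B] (1 : S j) = 0) : z = 0 := by
  have := faithfullyFlat_pi S hf hs
  refine Module.FaithfullyFlat.tensorProduct_mk_injective (A := B) (B := ∀ j, S j) M ?_
  rw [map_zero]
  refine (TensorProduct.comm B _ _).injective ?_
  rw [map_zero]
  exact tmul_pi_eq_zero S _ h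

/-- Faithfully flat descent of elements for a finite family of algebras. -/
theorem exists_of_tmul_eq (hf : ∀ j, Module.Flat B (S j))
    (hs : ∀ P : PrimeSpectrum B, ∃ j, ∃ Q, PrimeSpectrum.comap (algebraMap B (S j)) Q = P)
    (x : ∀ j, S j) (hx : ∀ j k, x j ⊗ₜ[B] (1 : S k) = (1 : S j) ⊗ₜ[B] x k) :
    ∃ b : B, ∀ j, algebraMap B (S j) b = x j := by
  have := faithfullyFlat_pi S hf hs
  obtain ⟨b, hb⟩ := (Algebra.IsEffective.of_faithfullyFlat (R := B) (S := ∀ j, S j) x).1 (by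
    rw [Algebra.TensorProduct.includeLeftSubRight_apply]
    refine tmul_pi_eq_zero S _ fun k => ?_
    refine (TensorProduct.comm B _ _).injective ?_
    rw [map_zero]
    refine tmul_pi_eq_zero S _ fun j => ?_
    refine (TensorProduct.comm B _ _).injective ?_
    rw [map_zero]
    rw [map_sub, map_sub, map_sub, map_sub]
    exact sub_eq_zero.2 (hx j k))
  exact ⟨b, fun j => congrFun hb j⟩

end Descent

/-! ### Flat base change of affine thickenings -/

namespace PDDatum
variable {p : ℕ} [hp : Fact p.Prime] (d : PDDatum.{u} p)

theorem exists_dp_baseChange {B' : CommRingCat.{u}} (f : d.B ⟶ B') (hf : f.hom.Flat) :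
    ∃ h : DividedPowers (RingHom.ker (Ideal.Quotient.mk ((RingHom.ker d.q.hom).map f.hom))),
      d.dp.IsDPMorphism h f.hom ∧ GammaCompat (f.hom.comp (padicMap d.nilp)) h :=
  exists_dividedPowers_flat_hom d.dp _ d.gammaCompat f hf Ideal.mk_ker

/-- The base change of an affine divided power thickening along a flat homomorphism. -/
noncomputable def baseChange {B' : CommRingCat.{u}} (f : d.B ⟶ B') (hf : f.hom.Flat) :
    PDDatum.{u} p where
  B := B'
  C := CommRingCat.of (B' ⧸ (RingHom.ker d.q.hom).map f.hom)
  q := CommRingCat.ofHom (Ideal.Quotient.mk _)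
  surj := Ideal.Quotient.mk_surjective
  nilp := by simpa using d.nilp.map f.hom
  dp := (d.exists_dp_baseChange f hf).choose
  compat := (gammaCompat_iff _ _).1 (d.exists_dp_baseChange f hf).choose_spec.2

theorem exists_desc {d d' : PDDatum.{u} p} (φ : d.B ⟶ d'.B)
    (h : RingHom.ker d.q.hom ≤ RingHom.ker (φ ≫ d'.q).hom) :
    ∃ ψ : d.C ⟶ d'.C, d.q ≫ ψ = φ ≫ d'.q := by
  refine ⟨CommRingCat.ofHom ((Ideal.Quotient.lift _ (φ ≫ d'.q).hom fun a ha => h ha).comp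
    (RingHom.quotientKerEquivOfSurjective d.surj).symm.toRingHom), ?_⟩
  ext b
  change Ideal.Quotient.lift _ (φ ≫ d'.q).hom (fun a ha => h ha)
    ((RingHom.quotientKerEquivOfSurjective d.surj).symm (d.q.hom b)) = _
  have : (RingHom.quotientKerEquivOfSurjective d.surj).symm (d.q.hom b) =
      Ideal.Quotient.mk _ b := by
    rw [RingEquiv.symm_apply_eq]; rfl
  rw [this]
  rfl

/-- A homomorphism of affine thickenings is determined by the homomorphism `B → B'`. -/
noncomputable def Hom.mk' {d d' : PDDatum.{u} p} (φ : d.B ⟶ d'.B)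
    (h : d.dp.IsDPMorphism d'.dp φ.hom) : d.Hom d' :=
  have h' : RingHom.ker d.q.hom ≤ RingHom.ker (φ ≫ d'.q).hom := fun _ ha =>
    Ideal.map_le_iff_le_comap.1 h.1 ha
  { φ := φ
    ψ := (exists_desc φ h').choose
    comm := (exists_desc φ h').choose_spec
    isDP := h }

theorem Hom.ψ_eq_of_comp {d d' d'' : PDDatum.{u} p} (g : d.Hom d') (g' : d'.Hom d'')
    (g'' : d.Hom d'') (h : g.φ ≫ g'.φ = g''.φ) : g.ψ ≫ g'.ψ = g''.ψ := by
  have he : Epi d.q := ConcreteCategory.epi_of_surjective _ d.surj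
  rw [← cancel_epi d.q, g''.comm, ← Category.assoc, g.comm, Category.assoc, g'.comm, ← h,
    Category.assoc]

/-- The homomorphism from an affine thickening to its base change. -/
noncomputable def toBaseChange {B' : CommRingCat.{u}} (f : d.B ⟶ B') (hf : f.hom.Flat) :
    d.Hom (d.baseChange f hf) :=
  .mk' (d' := d.baseChange f hf) f (d.exists_dp_baseChange f hf).choose_spec.1

/-- The universal property of the base change. -/
noncomputable def baseChangeLift {B' : CommRingCat.{u}} (f : d.B ⟶ B') (hf : f.hom.Flat)
    {d' : PDDatum.{u} p} (g : d.Hom d') (k : B' ⟶ d'.B) (hk : f ≫ k = g.φ) :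
    (d.baseChange f hf).Hom d' :=
  .mk' (d := d.baseChange f hf) k (by
    refine DividedPowers.IsDPMorphism.of_comp _ _ _ f.hom k.hom
      (Ideal.mk_ker : RingHom.ker (Ideal.Quotient.mk ((RingHom.ker d.q.hom).map f.hom)) = _)
      (d.toBaseChange f hf).isDP ?_
    have := g.isDP
    rw [← hk] at this
    exact this)

theorem toBaseChange_ψ_comp {B' : CommRingCat.{u}} (f : d.B ⟶ B') (hf : f.hom.Flat)
    {d' : PDDatum.{u} p} (g : d.Hom d') (k : B' ⟶ d'.B) (hk : f ≫ k = g.φ) :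
    (d.toBaseChange f hf).ψ ≫ (d.baseChangeLift f hf g k hk).ψ = g.ψ :=
  Hom.ψ_eq_of_comp _ _ _ hk

/-- A finite flat covering of an affine thickening by members of a sieve. -/
structure FlatCover (d : PDDatum.{u} p) {U : Scheme.{u}} (S : Sieve U) (f : Spec d.C ⟶ U) where
  κ : Type u
  finite : Finite κ
  B' : κ → CommRingCat.{u}
  φ : ∀ j, d.B ⟶ B' j
  flat : ∀ j, (φ j).hom.Flat
  surj : ∀ P : PrimeSpectrum d.B, ∃ j, ∃ Q, PrimeSpectrum.comap (φ j).hom Q = P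
  mem : ∀ j, S (Spec.map (d.toBaseChange (φ j) (flat j)).ψ ≫ f)

theorem FlatCover.eq_of_forall {d : PDDatum.{u} p} {U : Scheme.{u}} {S : Sieve U}
    {f : Spec d.C ⟶ U} (c : d.FlatCover S f) {b b' : d.B}
    (h : ∀ j, (c.φ j).hom b = (c.φ j).hom b') : b = b' := by
  have := c.finite
  let _ := fun j => (c.φ j).hom.toAlgebra
  refine sub_eq_zero.1 (eq_zero_of_tmul_one_eq_zero (B := d.B) (fun j => c.B' j) c.flat c.surj _
    fun j => ?_)
  have h1 : algebraMap d.B (c.B' j) (b - b') = 0 := by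
    rw [map_sub]; exact sub_eq_zero.2 (h j)
  rw [← mul_one (b - b'), ← smul_eq_mul, TensorProduct.smul_tmul, Algebra.smul_def, h1, zero_mul, TensorProduct.tmul_zero]

end PDDatum

/-! ### The sheaf property of compatible families -/

section Glue
variable {p : ℕ} [hp : Fact p.Prime]

namespace PDDatum.FlatCover
variable {d : PDDatum.{u} p} {U : Scheme.{u}} {S : Sieve U} {f : Spec d.C ⟶ U}
  (c : d.FlatCover S f)

open scoped TensorProduct in
theorem exists_of_agree (x : ∀ j, c.B' j)
    (hx : ∀ (j k : c.κ) (P : CommRingCat.{u}) (a : c.B' j ⟶ P) (b : c.B' k ⟶ P),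
      c.φ j ≫ a = c.φ k ≫ b → (c.φ j ≫ a).hom.Flat → a.hom (x j) = b.hom (x k)) :
    ∃ b : d.B, ∀ j, (c.φ j).hom b = x j := by
  have := c.finite
  let _ := fun j => (c.φ j).hom.toAlgebra
  have hfl : ∀ j, Module.Flat d.B (c.B' j) := c.flat
  refine exists_of_tmul_eq (B := d.B) (fun j => c.B' j) hfl c.surj x fun j k => ?_
  refine hx j k (CommRingCat.of (c.B' j ⊗[d.B] c.B' k))
    (CommRingCat.ofHom Algebra.TensorProduct.includeLeftRingHom)
    (CommRingCat.ofHom Algebra.TensorProduct.includeRight.toRingHom) ?_ ?_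
  · ext b
    exact (Algebra.TensorProduct.tmul_one_eq_one_tmul (R := d.B) (A := c.B' j) (B := c.B' k) b)
  · exact RingHom.Flat.comp (c.flat j)
      ((RingHom.flat_algebraMap_iff (R := c.B' j) (S := c.B' j ⊗[d.B] c.B' k)).2 inferInstance)

open scoped TensorProduct in
theorem eq_of_forall_pushout {A : CommRingCat.{u}} (g : d.B ⟶ A) (z z' : A)
    (h : ∀ (j : c.κ) (P : CommRingCat.{u}) (a : A ⟶ P) (b : c.B' j ⟶ P),
      g ≫ a = c.φ j ≫ b → a.hom.Flat → a.hom z = a.hom z') : z = z' := by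
  have := c.finite
  let _ := fun j => (c.φ j).hom.toAlgebra
  let _ := g.hom.toAlgebra
  have hfl : ∀ j, Module.Flat d.B (c.B' j) := c.flat
  refine sub_eq_zero.1 (eq_zero_of_tmul_one_eq_zero (B := d.B) (fun j => c.B' j) hfl c.surj _
    fun j => ?_)
  rw [TensorProduct.sub_tmul]
  refine sub_eq_zero.2 (h j (CommRingCat.of (A ⊗[d.B] c.B' j))
    (CommRingCat.ofHom Algebra.TensorProduct.includeLeftRingHom)
    (CommRingCat.ofHom Algebra.TensorProduct.includeRight.toRingHom) ?_ ?_)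
  · ext b
    exact (Algebra.TensorProduct.tmul_one_eq_one_tmul (R := d.B) (A := A) (B := c.B' j) b)
  · exact (RingHom.flat_algebraMap_iff (R := A) (S := A ⊗[d.B] c.B' j)).2 inferInstance

end PDDatum.FlatCover

variable (𝒞 : PDDatum.{u} p → Prop)

/-- Restriction of compatible families along a morphism. -/
noncomputable def famMap {U' U : Scheme.{u}} (h : U' ⟶ U) : fam 𝒞 U →+* fam 𝒞 U' where
  toFun s := ⟨fun d f => s.1 d (f ≫ h), fun d d' g f =>
    (s.2 d d' g (f ≫ h)).trans (congrArg (s.1 d') (Category.assoc _ _ _).symm)⟩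
  map_one' := rfl
  map_mul' _ _ := rfl
  map_zero' := rfl
  map_add' _ _ := rfl

/-- The presheaf of rings of compatible families on affine thickenings that satisfy `𝒞`. -/
noncomputable def famPre : Scheme.{u}ᵒᵖ ⥤ CommRingCat.{u + 1} where
  obj U := CommRingCat.of (fam 𝒞 U.unop)
  map h := CommRingCat.ofHom (famMap 𝒞 h.unop)
  map_id U := by
    ext s d f
    exact (congrArg (s.1 d) (Category.comp_id f) : s.1 d (f ≫ 𝟙 _) = s.1 d f)
  map_comp g h := by
    ext s d f
    exact (congrArg (s.1 d) (Category.assoc f h.unop g.unop).symm :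
      s.1 d (f ≫ h.unop ≫ g.unop) = s.1 d ((f ≫ h.unop) ≫ g.unop))

/-- The class `𝒞` is stable under flat base change. -/
def StableFlat : Prop := ∀ (d : PDDatum.{u} p) {B' : CommRingCat.{u}} (f : d.B ⟶ B')
  (hf : f.hom.Flat), 𝒞 d → 𝒞 (d.baseChange f hf)

variable {𝒞}

section
variable {U : Scheme.{u}} {S : Sieve U}

/-- The value on an affine thickening over a member of the sieve `S` that is prescribed by a family
of elements on `S`. -/
noncomputable def glueValue (x : Presieve.FamilyOfElements (famPre 𝒞 ⋙ forget _) S.arrows) (d : PDDatum.{u} p)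
    (hd : 𝒞 d) (h : Spec d.C ⟶ U) (hS : S h) : d.B :=
  ((x h hS : fam 𝒞 (Spec d.C))).1 ⟨d, hd⟩ (𝟙 _)

theorem glueValue_comp {x : Presieve.FamilyOfElements (famPre 𝒞 ⋙ forget _) S.arrows}
    (hx : x.SieveCompatible) {d : PDDatum.{u} p} (hd : 𝒞 d) {Y : Scheme.{u}} (k : Spec d.C ⟶ Y)
    (h : Y ⟶ U) (hS : S h) (h' : Spec d.C ⟶ U) (hS' : S h') (e : h' = k ≫ h) :
    glueValue x d hd h' hS' = ((x h hS : fam 𝒞 Y)).1 ⟨d, hd⟩ k := by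
  subst e
  have h1 : (x (k ≫ h) hS' : fam 𝒞 (Spec d.C)) = famMap 𝒞 k (x h hS) := hx h k hS
  refine (congrArg (fun z : fam 𝒞 (Spec d.C) => z.1 ⟨d, hd⟩ (𝟙 _)) h1).trans ?_
  exact congrArg ((x h hS : fam 𝒞 Y).1 ⟨d, hd⟩) (Category.id_comp _)

theorem glueValue_hom {x : Presieve.FamilyOfElements (famPre 𝒞 ⋙ forget _) S.arrows}
    (hx : x.SieveCompatible) {d d' : PDDatum.{u} p} (hd : 𝒞 d) (hd' : 𝒞 d') (g : d.Hom d')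
    (h : Spec d.C ⟶ U) (hS : S h) (h' : Spec d'.C ⟶ U) (hS' : S h') (e : h' = Spec.map g.ψ ≫ h) :
    g.φ.hom (glueValue x d hd h hS) = glueValue x d' hd' h' hS' := by
  rw [glueValue_comp hx hd' (Spec.map g.ψ) h hS h' hS' e, glueValue]
  refine ((x h hS : fam 𝒞 (Spec d.C)).2 ⟨d, hd⟩ ⟨d', hd'⟩ g (𝟙 _)).trans ?_
  exact congrArg ((x h hS : fam 𝒞 _).1 ⟨d', hd'⟩) (Category.comp_id _)

theorem specMap_baseChangeLift (d : PDDatum.{u} p) {B' : CommRingCat.{u}} (f : d.B ⟶ B')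
    (hf : f.hom.Flat) {d' : PDDatum.{u} p} (g : d.Hom d') (k : B' ⟶ d'.B) (hk : f ≫ k = g.φ)
    (u : Spec d.C ⟶ U) :
    Spec.map g.ψ ≫ u =
      Spec.map (d.baseChangeLift f hf g k hk).ψ ≫ Spec.map (d.toBaseChange f hf).ψ ≫ u := by
  rw [← Category.assoc, ← Spec.map_comp]
  exact congrArg (fun z => Spec.map z ≫ u) (d.toBaseChange_ψ_comp f hf g k hk).symm

/-- The prescribed values are compatible with homomorphisms from a flat base change. -/
theorem glueValue_lift (h𝒞 : StableFlat 𝒞)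
    {x : Presieve.FamilyOfElements (famPre 𝒞 ⋙ forget _) S.arrows}
    (hx : x.SieveCompatible) {d d' : PDDatum.{u} p} (hd : 𝒞 d) (hd' : 𝒞 d') {f : Spec d.C ⟶ U}
    {B' : CommRingCat.{u}} (φ : d.B ⟶ B') (hφ : φ.hom.Flat) (g : d.Hom d') (k : B' ⟶ d'.B)
    (hk : φ ≫ k = g.φ) (hS : S (Spec.map (d.toBaseChange φ hφ).ψ ≫ f))
    (hS' : S (Spec.map g.ψ ≫ f)) :
    k.hom (glueValue x _ (h𝒞 d φ hφ hd) _ hS) = glueValue x _ hd' _ hS' :=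
  glueValue_hom hx (h𝒞 d φ hφ hd) hd' (d.baseChangeLift φ hφ g k hk) _ hS _ hS'
    (specMap_baseChangeLift d φ hφ g k hk f)

/-- The prescribed values on the members of a flat covering agree on the pushouts, hence they
descend to an element of `B`. -/
theorem exists_glue (h𝒞 : StableFlat 𝒞)
    {x : Presieve.FamilyOfElements (famPre 𝒞 ⋙ forget _) S.arrows}
    (hx : x.SieveCompatible) {d : PDDatum.{u} p} (hd : 𝒞 d) {f : Spec d.C ⟶ U}
    (c : d.FlatCover S f) : ∃ b : d.B, ∀ (B' : CommRingCat.{u}) (φ : d.B ⟶ B')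
      (hφ : φ.hom.Flat) (hS : S (Spec.map (d.toBaseChange φ hφ).ψ ≫ f)),
      φ.hom b = glueValue x _ (h𝒞 d φ hφ hd) _ hS := by
  obtain ⟨b, hb⟩ : ∃ b : d.B, ∀ j,
      (c.φ j).hom b = glueValue x _ (h𝒞 d (c.φ j) (c.flat j) hd) _ (c.mem j) := by
    refine c.exists_of_agree _ fun j k P a b hab hfl => ?_
    let g := d.toBaseChange (c.φ j ≫ a) hfl
    have hS : S (Spec.map g.ψ ≫ f) := by
      rw [specMap_baseChangeLift d (c.φ j) (c.flat j) g a rfl]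
      exact S.downward_closed (c.mem j) _
    exact (glueValue_lift h𝒞 hx hd (h𝒞 d _ hfl hd) (c.φ j) (c.flat j) g a rfl (c.mem j) hS).trans
      (glueValue_lift h𝒞 hx hd (h𝒞 d _ hfl hd) (c.φ k) (c.flat k) g b hab.symm (c.mem k) hS).symm
  refine ⟨b, fun B' φ hφ hS => c.eq_of_forall_pushout φ _ _ fun j P a b' hab hfl => ?_⟩
  have hfl' : (φ ≫ a).hom.Flat := RingHom.Flat.comp hφ hfl
  let g := d.toBaseChange (φ ≫ a) hfl'
  have hS' : S (Spec.map g.ψ ≫ f) := by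
    rw [specMap_baseChangeLift d φ hφ g a rfl]
    exact S.downward_closed hS _
  refine Eq.trans ?_ (glueValue_lift h𝒞 hx hd (h𝒞 d _ hfl' hd) φ hφ g a rfl hS hS').symm
  refine (congrArg (fun k : d.B ⟶ P => k.hom b) hab).trans ((congrArg b'.hom (hb j)).trans ?_)
  exact glueValue_lift h𝒞 hx hd (h𝒞 d _ hfl' hd) (c.φ j) (c.flat j) g b' hab.symm (c.mem j) hS'

theorem glueValue_congr {x : Presieve.FamilyOfElements (famPre 𝒞 ⋙ forget _) S.arrows}
    {d : PDDatum.{u} p} (hd : 𝒞 d) {h h' : Spec d.C ⟶ U} (e : h = h') (hS : S h) (hS' : S h') :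
    glueValue x d hd h hS = glueValue x d hd h' hS' := by
  subst e; rfl

/-- `b` is the value on `d` prescribed by a compatible family of elements. -/
def IsGlued (h𝒞 : StableFlat 𝒞) (x : Presieve.FamilyOfElements (famPre 𝒞 ⋙ forget _) S.arrows)
    (d : PDDatum.{u} p) (hd : 𝒞 d) (f : Spec d.C ⟶ U) (b : d.B) : Prop :=
  ∀ (B' : CommRingCat.{u}) (φ : d.B ⟶ B') (hφ : φ.hom.Flat)
    (hS : S (Spec.map (d.toBaseChange φ hφ).ψ ≫ f)),
      φ.hom b = glueValue x _ (h𝒞 d φ hφ hd) _ hS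

theorem IsGlued.unique {h𝒞 : StableFlat 𝒞}
    {x : Presieve.FamilyOfElements (famPre 𝒞 ⋙ forget _) S.arrows} {d : PDDatum.{u} p} {hd : 𝒞 d}
    {f : Spec d.C ⟶ U} (c : d.FlatCover S f) {b b' : d.B} (h : IsGlued h𝒞 x d hd f b)
    (h' : IsGlued h𝒞 x d hd f b') : b = b' :=
  c.eq_of_forall fun j => (h _ _ (c.flat j) (c.mem j)).trans (h' _ _ (c.flat j) (c.mem j)).symm

theorem IsGlued.map {h𝒞 : StableFlat 𝒞}
    {x : Presieve.FamilyOfElements (famPre 𝒞 ⋙ forget _) S.arrows} (hx : x.SieveCompatible)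
    {d d' : PDDatum.{u} p} {hd : 𝒞 d} {hd' : 𝒞 d'} (g : d.Hom d') {f : Spec d.C ⟶ U}
    (c : d.FlatCover S f) {b : d.B} {b' : d'.B} (h : IsGlued h𝒞 x d hd f b)
    (h' : IsGlued h𝒞 x d' hd' (Spec.map g.ψ ≫ f) b') : g.φ.hom b = b' := by
  -- Compare after base change along the pushout of the covering of the source.
  refine c.eq_of_forall_pushout g.φ _ _ fun j P a k hak hfl => ?_
  let g₁ := d'.toBaseChange a hfl
  have h₁ : 𝒞 (d'.baseChange a hfl) := h𝒞 d' a hfl hd'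
  let g₂ : d.Hom (d'.baseChange a hfl) := .mk' (g.φ ≫ a) (.comp _ g₁.isDP g.isDP)
  have e₂ : Spec.map g₁.ψ ≫ Spec.map g.ψ ≫ f = Spec.map g₂.ψ ≫ f := by
    rw [← Category.assoc, ← Spec.map_comp]
    exact congrArg (fun z => Spec.map z ≫ f) (PDDatum.Hom.ψ_eq_of_comp g g₁ g₂ rfl)
  have hS₂ : S (Spec.map g₂.ψ ≫ f) := by
    rw [specMap_baseChangeLift d _ (c.flat j) g₂ k hak.symm]
    exact S.downward_closed (c.mem j) _
  have hS₁ : S (Spec.map g₁.ψ ≫ Spec.map g.ψ ≫ f) := e₂ ▸ hS₂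
  have v₁ : k.hom ((c.φ j).hom b) = glueValue x _ h₁ _ hS₂ :=
    (congrArg k.hom (h _ _ _ (c.mem j))).trans
      (glueValue_lift h𝒞 hx hd h₁ _ (c.flat j) g₂ k hak.symm _ hS₂)
  have v₂ : a.hom b' = glueValue x _ h₁ _ hS₁ := h' P a hfl hS₁
  refine (congrArg (fun k : d.B ⟶ P => k.hom b) hak).trans (v₁.trans (Eq.trans ?_ v₂.symm))
  exact glueValue_congr h₁ e₂.symm _ _

theorem isGlued_of_isAmalgamation (h𝒞 : StableFlat 𝒞)
    (x : Presieve.FamilyOfElements (famPre 𝒞 ⋙ forget _) S.arrows) (s : fam 𝒞 U)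
    (hs : x.IsAmalgamation s) (d : PDDatum.{u} p) (hd : 𝒞 d) (f : Spec d.C ⟶ U) :
    IsGlued h𝒞 x d hd f (s.1 ⟨d, hd⟩ f) := by
  intro B' φ hφ hS
  refine (s.2 ⟨d, hd⟩ ⟨_, h𝒞 d φ hφ hd⟩ (d.toBaseChange φ hφ) f).trans ?_
  have h1 : famMap 𝒞 (Spec.map (d.toBaseChange φ hφ).ψ ≫ f) s = (x _ hS : fam 𝒞 _) := hs _ hS
  refine Eq.trans ?_ (congrArg (fun z : fam 𝒞 _ => z.1 ⟨_, h𝒞 d φ hφ hd⟩ (𝟙 _)) h1)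
  exact congrArg (s.1 _) (Category.id_comp _).symm

theorem isGlued_of_mem (h𝒞 : StableFlat 𝒞)
    {x : Presieve.FamilyOfElements (famPre 𝒞 ⋙ forget _) S.arrows} (hx : x.SieveCompatible)
    {Y : Scheme.{u}} (h : Y ⟶ U) (hh : S h) (d : PDDatum.{u} p) (hd : 𝒞 d) (f : Spec d.C ⟶ Y) :
    IsGlued h𝒞 x d hd (f ≫ h) ((x h hh : fam 𝒞 Y).1 ⟨d, hd⟩ f) := by
  intro B' φ hφ hS
  refine ((x h hh : fam 𝒞 Y).2 ⟨d, hd⟩ ⟨_, h𝒞 d φ hφ hd⟩ (d.toBaseChange φ hφ) f).trans ?_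
  exact (glueValue_comp hx _ _ h hh _ hS (Category.assoc _ _ _).symm).symm

/-- Compatible families glue along a sieve by which every affine thickening has a finite flat
covering. -/
theorem isSheafFor_famPre (h𝒞 : StableFlat 𝒞)
    (hS : ∀ (d : PDDatum.{u} p) (f : Spec d.C ⟶ U), Nonempty (d.FlatCover S f)) :
    Presieve.IsSheafFor (famPre 𝒞 ⋙ forget _) S.arrows := by
  intro x hx
  rw [Presieve.compatible_iff_sieveCompatible] at hx
  have key : ∀ (d : {d : PDDatum.{u} p // 𝒞 d}) (f : Spec d.1.C ⟶ U),
      ∃ b, IsGlued h𝒞 x d.1 d.2 f b := fun d f => (hS d.1 f).elim fun c => exists_glue h𝒞 hx d.2 c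
  choose t ht using key
  refine ⟨(⟨t, fun d d' g f => ?_⟩ : fam 𝒞 U), fun Y h hh => ?_, fun (s : fam 𝒞 U) hs => ?_⟩
  · obtain ⟨c⟩ := hS d.1 f
    exact (ht d f).map hx g c (ht d' _)
  · refine Subtype.ext (funext₂ fun d f => ?_)
    obtain ⟨c⟩ := hS d.1 (f ≫ h)
    exact (ht d (f ≫ h)).unique c (isGlued_of_mem h𝒞 hx h hh d.1 d.2 f)
  · refine Subtype.ext (funext₂ fun d f => ?_)
    obtain ⟨c⟩ := hS d.1 f
    exact (isGlued_of_isAmalgamation h𝒞 x s hs d.1 d.2 f).unique c (ht d f)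

end

/-! ### Coverings of affine thickenings induced by `pr`-coverings -/

theorem PDDatum.isNilpotent_of_mem (d : PDDatum.{u} p) {b : d.B} (hb : d.q.hom b = 0) :
    IsNilpotent b := by
  obtain ⟨n, hn⟩ := d.nilp
  refine ⟨p ^ n, ?_⟩
  rw [← d.dp.factorial_mul_dpow_eq_pow hb]
  obtain ⟨k, hk⟩ := Nat.dvd_factorial (pow_pos hp.out.pos n) le_rfl
  rw [hk]
  push_cast
  rw [hn, zero_mul, zero_mul]

theorem PDDatum.exists_comap_eq (d : PDDatum.{u} p) (P : PrimeSpectrum d.B) :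
    ∃ y : PrimeSpectrum d.C, PrimeSpectrum.comap d.q.hom y = P := by
  have h : P ∈ Set.range (PrimeSpectrum.comap d.q.hom) := by
    rw [range_comap_of_surjective _ _ d.surj]
    intro b hb
    exact nilpotent_iff_mem_prime.1 (d.isNilpotent_of_mem hb) _ P.2
  exact h

theorem HasRoots.of_surjective {R R' : Type*} [CommRing R] [CommRing R'] (h : HasRoots p R)
    (f : R →+* R') (hf : Function.Surjective f) : HasRoots p R' := fun b => by
  obtain ⟨a, rfl⟩ := hf b
  obtain ⟨c, rfl⟩ := h a
  exact ⟨f c, (map_pow f c p).symm⟩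

/-- Near a point of `Spec C`, a `pr`-morphism `Y → U` can be lifted along a flat base change of the
affine thickening `Spec C → Spec B`. -/
theorem exists_flat_nhd (d : PDDatum.{u} p) {U Y : Scheme.{u}} (f : Spec d.C ⟶ U) (g : Y ⟶ U)
    (hg : prMorphism p g) (y : Spec d.C) (y' : Y) (hy : g y' = f y) :
    ∃ (b : d.B) (B' : CommRingCat.{u}) (φ : d.B ⟶ B') (hφ : φ.hom.Flat), d.q.hom b ∉ y.asIdeal ∧
      (∀ Q : PrimeSpectrum d.B, b ∉ Q.asIdeal → ∃ Q', PrimeSpectrum.comap φ.hom Q' = Q) ∧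
      ∃ k : Spec (d.baseChange φ hφ).C ⟶ Y,
        k ≫ g = Spec.map (d.toBaseChange φ hφ).ψ ≫ f := by
  obtain ⟨U', W, h, hyU', hroot⟩ := hg y'
  have hfy : y ∈ f ⁻¹ᵁ W.1 := by
    change f y ∈ W.1
    rw [← hy]
    exact h hyU'
  obtain ⟨_, ⟨c, rfl⟩, hyc, hc⟩ :=
    (PrimeSpectrum.isTopologicalBasis_basic_opens (R := d.C)).exists_subset_of_mem_open
      (a := y) (u := (f ⁻¹ᵁ W.1 : Set (Spec d.C))) hfy (f ⁻¹ᵁ W.1).2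
  obtain ⟨b, rfl⟩ := d.surj c
  -- Localize such that `Spec C` maps to an affine open subset of `U` over which `g` is a `p`-root
  -- extension, and then adjoin all `p`-th roots.
  let L : CommRingCat.{u} := CommRingCat.of (Localization.Away b)
  let l : d.B ⟶ L := CommRingCat.ofHom (algebraMap d.B (Localization.Away b))
  have hl : l.hom.Flat := (RingHom.flat_algebraMap_iff (R := d.B) (S := Localization.Away b)).2
    (IsLocalization.flat _ (Submonoid.powers b))
  let φ : d.B ⟶ rootClosure p L := l ≫ toRootClosure p L
  have hφ : φ.hom.Flat := RingHom.Flat.comp hl (flat_toRootClosure p L)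
  have hu : IsUnit (φ.hom b) :=
    (IsLocalization.Away.algebraMap_isUnit (S := Localization.Away b) b).map (toRootClosure p L).hom
  refine ⟨b, rootClosure p L, φ, hφ, hyc, fun Q hQ => ?_, ?_⟩
  · have hQ' : Q ∈ Set.range (PrimeSpectrum.comap (algebraMap d.B (Localization.Away b))) := by
      rw [PrimeSpectrum.localization_away_comap_range _ b]
      exact hQ
    obtain ⟨Q₁, rfl⟩ := hQ'
    obtain ⟨Q₂, rfl⟩ := surjective_toRootClosure p L Q₁
    exact ⟨Q₂, rfl⟩
  · set ψ := (d.toBaseChange φ hφ).ψ with hψ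
    have hroots : HasRoots p (d.baseChange φ hφ).C :=
      (hasRoots_rootClosure p L).of_surjective _ (d.baseChange φ hφ).surj
    have hunit : IsUnit (ψ.hom (d.q.hom b)) := by
      have h1 : ψ.hom (d.q.hom b) = (d.baseChange φ hφ).q.hom (φ.hom b) :=
        congrArg (fun k : d.B ⟶ (d.baseChange φ hφ).C => k.hom b) (d.toBaseChange φ hφ).comm
      rw [h1]
      exact hu.map _
    have hrange : Set.range (Spec.map ψ ≫ f) ⊆ Set.range W.2.fromSpec := by
      rw [W.2.range_fromSpec]
      rintro _ ⟨z, rfl⟩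
      refine hc (a := Spec.map ψ z) ?_
      exact fun hz => z.2.ne_top (Ideal.eq_top_of_isUnit_mem _ hz hunit)
    have := W.2.isOpenImmersion_fromSpec
    let α' := IsOpenImmersion.lift W.2.fromSpec (Spec.map ψ ≫ f) hrange
    obtain ⟨β, hβ⟩ := rootExtension_lift p hroot hroots (Spec.preimage α')
    refine ⟨Spec.map β ≫ U'.2.fromSpec, ?_⟩
    rw [Category.assoc, ← IsAffineOpen.SpecMap_appLE_fromSpec g W.2 U'.2 h, ← Category.assoc,
      ← Spec.map_comp, hβ, Spec.map_preimage]
    exact IsOpenImmersion.lift_fac _ _ _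

/-- A `pr`-covering of `U` induces a finite flat covering of every affine thickening `Spec C → Spec
B` with a morphism `Spec C → U`, by the quasi-compactness of `Spec B`. -/
theorem nonempty_flatCover {U : Scheme.{u}} {S : Sieve U}
    (hS : ∀ x : U, ∃ (Y : Scheme.{u}) (g : Y ⟶ U) (y : Y), S g ∧ prMorphism p g ∧ g y = x)
    (d : PDDatum.{u} p) (f : Spec d.C ⟶ U) : Nonempty (d.FlatCover S f) := by
  have key : ∀ P : PrimeSpectrum d.B, ∃ (b : d.B) (B' : CommRingCat.{u}) (φ : d.B ⟶ B')
      (hφ : φ.hom.Flat), P ∈ PrimeSpectrum.basicOpen b ∧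
      (∀ Q : PrimeSpectrum d.B, Q ∈ PrimeSpectrum.basicOpen b →
        ∃ Q', PrimeSpectrum.comap φ.hom Q' = Q) ∧
      S (Spec.map (d.toBaseChange φ hφ).ψ ≫ f) := fun P => by
    obtain ⟨y, rfl⟩ := d.exists_comap_eq P
    obtain ⟨Y, g, y', hg, hpr, hy⟩ := hS (f y)
    obtain ⟨b, B', φ, hφ, h1, h2, k, hk⟩ := exists_flat_nhd d f g hpr y y' hy
    exact ⟨b, B', φ, hφ, h1, h2, hk ▸ S.downward_closed hg k⟩
  choose b B' φ hφ h1 h2 h3 using key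
  obtain ⟨t, ht⟩ := isCompact_univ.elim_finite_subcover
    (fun P => (PrimeSpectrum.basicOpen (b P) : Set (PrimeSpectrum d.B)))
    (fun P => (PrimeSpectrum.basicOpen (b P)).2) (fun P _ => Set.mem_iUnion.2 ⟨P, h1 P⟩)
  refine ⟨{ κ := t, finite := inferInstance, B' := fun P => B' P.1, φ := fun P => φ P.1
            flat := fun P => hφ P.1, surj := fun Q => ?_, mem := fun P => h3 P.1 }⟩
  obtain ⟨P, hP, hQ⟩ := Set.mem_iUnion₂.1 (ht (Set.mem_univ Q))
  exact ⟨⟨P, hP⟩, h2 P Q hQ⟩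

/-- Compatible families form a sheaf for the `pr`-topology. -/
theorem isSheaf_famPre (h𝒞 : StableFlat 𝒞) :
    Presheaf.IsSheaf (Scheme.grothendieckTopology (prMorphism.{u} p)) (famPre 𝒞) := by
  rw [Presheaf.isSheaf_iff_isSheaf_forget _ _ (forget CommRingCat.{u + 1}),
    isSheaf_iff_isSheaf_of_type]
  refine (Precoverage.isSheaf_toGrothendieck_iff _).2 fun {U V f} R hR => ?_
  obtain ⟨ι, Y, g, rfl⟩ := R.exists_eq_ofArrows
  rw [Scheme.ofArrows_mem_precoverage_iff] at hR
  refine isSheafFor_famPre h𝒞 fun d k => ?_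
  obtain ⟨c⟩ := nonempty_flatCover (S := Sieve.generate (Presieve.ofArrows Y g)) (fun x => by
    obtain ⟨i, y, hy⟩ := hR.1 x
    exact ⟨Y i, g i, y, ⟨_, 𝟙 _, g i, Presieve.ofArrows.mk i, Category.id_comp _⟩, hR.2 i, hy⟩) d (k ≫ f)
  refine ⟨⟨c.κ, c.finite, c.B', c.φ, c.flat, c.surj, fun j => ?_⟩⟩
  have := c.mem j
  rw [← Category.assoc] at this
  exact this

end Glue

/-! ### Trivial thickenings and the structure sheaf -/

theorem isDPMorphism_of_eq_bot {A B : Type*} [CommRing A] [CommRing B] {I : Ideal A} {J : Ideal B}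
    (hI : DividedPowers I) (hJ : DividedPowers J) (f : A →+* B) (h : ∀ a ∈ I, f a = 0) :
    hI.IsDPMorphism hJ f := by
  refine ⟨Ideal.map_le_iff_le_comap.2 fun a ha => ?_, fun {n} a ha => ?_⟩
  · rw [Ideal.mem_comap, h a ha]; exact J.zero_mem
  · rw [h a ha]
    rcases eq_or_ne n 0 with rfl | hn
    · rw [hI.dpow_zero ha, hJ.dpow_zero J.zero_mem, map_one]
    · rw [hJ.dpow_eval_zero hn, h _ (hI.dpow_mem hn ha)]

section
variable {p : ℕ} [hp : Fact p.Prime]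

namespace PDDatum

theorem ker_id_hom (C : CommRingCat.{u}) : RingHom.ker (CommRingCat.Hom.hom (𝟙 C)) = ⊥ :=
  (RingHom.injective_iff_ker_eq_bot _).1 fun _ _ h => h

/-- The trivial thickening of `Spec C`. -/
noncomputable def triv (C : CommRingCat.{u}) (h : IsNilpotent (p : C)) : PDDatum.{u} p where
  B := C
  C := C
  q := 𝟙 C
  surj := Function.surjective_id
  nilp := h
  dp := dpOfEqBot (ker_id_hom C)
  compat n a ha := by
    have ha : (p : C) * a = 0 := ha
    rw [ha, dpOfEqBot_zero]
    split_ifs with hn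
    · subst hn; simp
    · have hlt := padicValNat_factorial_lt_of_ne_zero p hn
      obtain ⟨k, hk⟩ := Nat.exists_eq_add_of_lt hlt
      obtain ⟨m, rfl⟩ := Nat.exists_eq_succ_of_ne_zero hn
      rw [show m.succ - padicValNat p m.succ.factorial = k + 1 by omega, pow_succ, pow_succ,
        mul_zero, show (p : C) ^ k * p * (a ^ m * a) = p ^ k * a ^ m * (p * a) by ring, ha,
        mul_zero]

theorem nilp_C (d : PDDatum.{u} p) : IsNilpotent (p : d.C) := by
  simpa using d.nilp.map d.q.hom

/-- The homomorphism from an affine thickening `Spec C → Spec B` to the trivial thickening of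
`Spec C`. -/
noncomputable def toTriv (d : PDDatum.{u} p) : d.Hom (triv d.C d.nilp_C) where
  φ := d.q
  ψ := 𝟙 _
  comm := rfl
  isDP := isDPMorphism_of_eq_bot _ _ _ fun _ h => h

/-- Functoriality of the trivial thickening. -/
noncomputable def trivMap {C C' : CommRingCat.{u}} (f : C ⟶ C') (h : IsNilpotent (p : C))
    (h' : IsNilpotent (p : C')) : (triv C h).Hom (triv C' h') where
  φ := f
  ψ := f
  comm := (Category.id_comp f).trans (Category.comp_id f).symm
  isDP := isDPMorphism_of_eq_bot _ _ _ fun a (ha : a = 0) => by rw [ha, map_zero]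

end PDDatum

theorem fam_triv {U : Scheme.{u}} (t : fam (p := p) allData U) (d : PDDatum.{u} p)
    (f : Spec d.C ⟶ U) :
    d.q.hom (t.1 ⟨d, trivial⟩ f) = t.1 ⟨.triv d.C d.nilp_C, trivial⟩ f :=
  (t.2 ⟨d, trivial⟩ ⟨.triv d.C d.nilp_C, trivial⟩ d.toTriv f).trans (fam_congr t _ (by
    change Spec.map (𝟙 _) ≫ f = f
    rw [Spec.map_id, Category.id_comp]))

/-- The morphism from the trivial thickening of `Spec C` to the trivial thickening of `U`. -/
noncomputable def trivToTriv {U : Scheme.{u}} (hU : PLocNilp p U) (C : CommRingCat.{u})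
    (h : IsNilpotent (p : C)) (f : Spec C ⟶ U) :
    CrisHom ((PDDatum.triv C h).obj f) (CrisObj.triv hU) where
  gV := f
  gT := f
  comm := by
    change Spec.map (𝟙 C) ≫ f = f ≫ 𝟙 U
    rw [Spec.map_id, Category.id_comp, Category.comp_id]
  comm_str := Category.comp_id _
  isDP W W' _ := isDPMorphism_of_eq_bot _ _ _ fun a ha => by
    have ha : a = 0 := by
      have h1 : RingHom.ker ((CrisObj.triv hU).i.app W).hom = ⊥ := ker_id_app U W.1
      rw [h1] at ha
      exact ha
    rw [ha, map_zero]

theorem toFam_triv {U : Scheme.{u}} (hU : PLocNilp p U) (s : ocris p U) (C : CommRingCat.{u})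
    (h : IsNilpotent (p : C)) (f : Spec C ⟶ U) :
    (toFam allData U s).1 ⟨.triv C h, trivial⟩ f =
      (Scheme.ΓSpecIso C).hom.hom (f.appTop.hom (ocrisToO hU s)) :=
  congrArg (Scheme.ΓSpecIso C).hom.hom (s.2 _ _ (trivToTriv hU C h f)).symm

/-- Two global functions on `U` are equal if they have the same pullback to all affine schemes on
which `p` is nilpotent. -/
theorem section_ext_of_spec {U : Scheme.{u}} (hU : PLocNilp p U) {a b : Γ(U, ⊤)}
    (h : ∀ (C : CommRingCat.{u}), IsNilpotent (p : C) → ∀ f : Spec C ⟶ U,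
      (Scheme.ΓSpecIso C).hom.hom (f.appTop.hom a) = (Scheme.ΓSpecIso C).hom.hom (f.appTop.hom b)) :
    a = b := by
  refine section_ext fun x _ => ?_
  obtain ⟨W, hW, hx⟩ := exists_affineOpens_le (⊤ : U.Opens) (t := x) trivial
  refine ⟨W, hW, hx, ?_⟩
  have hW' : IsAffineOpen W.1 := W.2
  have h1 := h Γ(U, W) (isNilpotent_of_pLocNilp hU W.2) hW'.fromSpec
  have h2 : ∀ c, (Scheme.ΓSpecIso Γ(U, W)).hom.hom (hW'.fromSpec.appTop.hom c) =
      (U.presheaf.map (homOfLE le_top).op).hom c := fun c =>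
    congrArg (fun k : Γ(U, ⊤) ⟶ Γ(U, W) => k.hom c) (appTop_fromSpec hW')
  rw [h2, h2] at h1
  exact h1

/-- The class of affine thickenings with zero ideal. -/
def trivData (d : PDDatum.{u} p) : Prop := RingHom.ker d.q.hom = ⊥

theorem stableFlat_trivData : StableFlat (p := p) trivData.{u} := fun d B' f hf h => by
  unfold trivData at h
  have h1 : RingHom.ker (Ideal.Quotient.mk ((RingHom.ker d.q.hom).map f.hom)) = ⊥ := by
    rw [Ideal.mk_ker, h, Ideal.map_bot]
  exact h1

theorem stableFlat_allData : StableFlat (p := p) allData.{u} := fun _ _ _ _ _ => trivial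

end

/-! ### A criterion for `p`-adic sheaves of rings -/

section PAdicSheaf
variable {C : Type v} [Category.{u} C] (J : GrothendieckTopology C)
  [HasWeakSheafify J CommRingCat.{w}] [J.WEqualsLocallyBijective CommRingCat.{w}]
  [J.HasSheafCompose (forget CommRingCat.{w})]

/-- The map from the presheaf quotient `A / p ^ r` to a presheaf of rings in which `p ^ r = 0`. -/
noncomputable def pQuotDesc (p r : ℕ) {A B : Cᵒᵖ ⥤ CommRingCat.{w}} (q : A ⟶ B)
    (hB : ∀ U, (p : B.obj U) ^ r = 0) : pQuot p r A ⟶ B where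
  app U := CommRingCat.ofHom (Ideal.Quotient.lift _ (q.app U).hom fun a ha => by
    obtain ⟨b, rfl⟩ := Ideal.mem_span_singleton.1 ha
    rw [map_mul, map_pow, map_natCast, hB, zero_mul])
  naturality U V f := by
    ext x
    obtain ⟨x, rfl⟩ := Ideal.Quotient.mk_surjective x
    exact congrArg (fun k : A.obj U ⟶ B.obj V => k.hom x) (q.naturality f)

theorem pQuotMk_desc (p r : ℕ) {A B : Cᵒᵖ ⥤ CommRingCat.{w}} (q : A ⟶ B)
    (hB : ∀ U, (p : B.obj U) ^ r = 0) : pQuotMk p r A ≫ pQuotDesc p r q hB = q := by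
  ext U x
  rfl

/-- The elements of `A` that vanish in `B` are locally multiples of `p ^ r`. -/
def LocallyDvd (p r : ℕ) {A B : Cᵒᵖ ⥤ CommRingCat.{w}} (q : A ⟶ B) : Prop :=
  ∀ (U : Cᵒᵖ) (a : A.obj U), (q.app U).hom a = 0 → ∃ S ∈ J U.unop, ∀ ⦃V : C⦄ (f : V ⟶ U.unop),
    S f → (p : A.obj (op V)) ^ r ∣ (A.map f.op).hom a

theorem injective_sheafifyLift_pQuotDesc {p r : ℕ} {A B : Cᵒᵖ ⥤ CommRingCat.{w}} (q : A ⟶ B)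
    (hB : ∀ U, (p : B.obj U) ^ r = 0) (h : LocallyDvd J p r q) (hs : Presheaf.IsSheaf J B)
    (U : Cᵒᵖ) : Function.Injective ((sheafifyLift J (pQuotDesc p r q hB) hs).app U).hom := by
  have h1 : Presheaf.IsLocallyInjective J (pQuotDesc p r q hB) := ⟨fun {U} x y hxy => by
    obtain ⟨x, rfl⟩ := Ideal.Quotient.mk_surjective (I := Ideal.span {(p : A.obj U) ^ r}) x
    obtain ⟨y, rfl⟩ := Ideal.Quotient.mk_surjective (I := Ideal.span {(p : A.obj U) ^ r}) y
    obtain ⟨S, hS, hSf⟩ := h U (x - y) (by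
      rw [map_sub]; exact sub_eq_zero.2 hxy)
    refine J.superset_covering (fun V f hf => ?_) hS
    refine Ideal.Quotient.eq.2 (Ideal.mem_span_singleton.2 ?_)
    have := hSf f hf
    rw [map_sub] at this
    exact this⟩
  have h2 : Presheaf.IsLocallyInjective J (sheafifyLift J (pQuotDesc p r q hB) hs) :=
    Presheaf.isLocallyInjective_of_isLocallyInjective_of_isLocallySurjective_fac J _
      (toSheafify_sheafifyLift J (pQuotDesc p r q hB) hs)
  have h3 := GrothendieckTopology.HasSheafCompose.isSheaf (F := forget CommRingCat.{w}) _
    ((presheafToSheaf J CommRingCat.{w}).obj (pQuot p r A)).property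
  exact (Presheaf.isLocallyInjective_iff_injective_of_separated J _
    ((isSheaf_iff_isSheaf_of_type _ _).1 h3).isSeparated).1 h2 U

/-- A sheaf `A` is `p`-adically complete if it is the limit of sheaves `B_r` with `p ^ r = 0` such
that the kernel of `A → B_r` consists of elements that are locally divisible by `p ^ r`. The sheaf
`A / p ^ r` is then a subsheaf of `B_r`. -/
theorem isPAdicSheaf_of_factors (p : ℕ) (A : Cᵒᵖ ⥤ CommRingCat.{w}) (hA : Presheaf.IsSheaf J A)
    (B : ℕ → Cᵒᵖ ⥤ CommRingCat.{w}) (hB : ∀ r, Presheaf.IsSheaf J (B r))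
    (hpB : ∀ r U, (p : (B r).obj U) ^ r = 0) (q : ∀ r, A ⟶ B r) (t : ∀ r, B (r + 1) ⟶ B r)
    (hqt : ∀ r, q (r + 1) ≫ t r = q r) (hdvd : ∀ r, LocallyDvd J p r (q r))
    (hsep : ∀ (U : Cᵒᵖ) (a : A.obj U), (∀ r, ((q r).app U).hom a = 0) → a = 0)
    (hcomp : ∀ (U : Cᵒᵖ) (s : ∀ r, (B r).obj U), (∀ r, ((t r).app U).hom (s (r + 1)) = s r) →
      ∃ a : A.obj U, ∀ r, ((q r).app U).hom a = s r) : IsPAdicSheaf J p A := by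
  let k := fun r => sheafifyLift J (pQuotDesc p r (q r) (hpB r)) (hB r)
  have hk : ∀ r, toPQuotSheaf J p r A ≫ k r = q r := fun r => by
    rw [toPQuotSheaf, Category.assoc, toSheafify_sheafifyLift, pQuotMk_desc]
  have hk' : ∀ r U a, ((k r).app U).hom (((toPQuotSheaf J p r A).app U).hom a) =
      ((q r).app U).hom a := fun r U a =>
    congrArg (fun f : A ⟶ B r => (f.app U).hom a) (hk r)
  have hstep : ∀ r, sheafifyMap J (pQuotStep p r A) ≫ k r = k (r + 1) ≫ t r := fun r => by
    refine sheafify_hom_ext J _ _ (hB r) ?_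
    rw [← Category.assoc, ← toSheafify_naturality, Category.assoc, toSheafify_sheafifyLift,
      ← Category.assoc, toSheafify_sheafifyLift]
    ext U x
    obtain ⟨x, rfl⟩ := Ideal.Quotient.mk_surjective (I := Ideal.span {(p : A.obj U) ^ (r + 1)}) x
    exact congrArg (fun f : A ⟶ B r => (f.app U).hom x) (hqt r).symm
  refine ⟨hA, fun U a ha => hsep U a fun r => ?_, fun U s hs => ?_⟩
  · rw [← hk', ha, map_zero]
  · obtain ⟨a, ha⟩ := hcomp U (fun r => ((k r).app U).hom (s r)) fun r => by
      have h1 := congrArg (fun f : sheafify J (pQuot p (r + 1) A) ⟶ B r => (f.app U).hom (s (r + 1)))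
        (hstep r)
      refine Eq.trans h1.symm ?_
      exact congrArg ((k r).app U).hom (hs r)
    refine ⟨a, fun r => injective_sheafifyLift_pQuotDesc J (q r) (hpB r) (hdvd r) (hB r) U ?_⟩
    exact (hk' r U a).trans (ha r)

theorem toPQuotSheaf_eq_of_sub_eq (p : ℕ) {A : Cᵒᵖ ⥤ CommRingCat.{w}} (U : Cᵒᵖ) (a b c : A.obj U)
    (h : a = b ^ p + p * c) : ((toPQuotSheaf J p 1 A).app U).hom a =
      ((toPQuotSheaf J p 1 A).app U).hom b ^ p := by
  rw [← map_pow]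
  have : (Ideal.Quotient.mk (Ideal.span {(p : A.obj U) ^ 1}) a) = Ideal.Quotient.mk _ (b ^ p) :=
    Ideal.Quotient.eq.2 (Ideal.mem_span_singleton.2 ⟨c, by rw [h, pow_one]; ring⟩)
  exact congrArg ((toSheafify J (pQuot p 1 A)).app U).hom this

end PAdicSheaf

/-! ### The sheaves on the category of `X`-schemes -/

section
variable {p : ℕ} [hp : Fact p.Prime]

theorem appLE_specMap_fromSpec {X : Scheme.{u}} {W : X.Opens} (hW : IsAffineOpen W)
    {R : CommRingCat.{u}} (t : Γ(X, W) ⟶ R) (h : ⊤ ≤ (Spec.map t ≫ hW.fromSpec) ⁻¹ᵁ W) :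
    (Spec.map t ≫ hW.fromSpec).appLE W ⊤ h = t ≫ (Scheme.ΓSpecIso R).inv := by
  rw [Scheme.Hom.comp_appLE, hW.fromSpec_app_self, Category.assoc]
  refine (congrArg (_ ≫ ·) (Scheme.Hom.map_appLE _ _ _)).trans ?_
  rw [Scheme.ΓSpecIso_inv_naturality]
  exact congrArg (_ ≫ ·) (Scheme.Hom.appLE_eq_app _)

/-- A sieve on an `X`-scheme `U` is a covering for the `pr`-topology if it contains all morphisms
`Spec R → U`, where `p` is nilpotent in `R` and all elements of `R` have `p`-th roots. -/
theorem mem_prTopology_of_roots {X : Scheme.{u}} (hX : PLocNilp p X) (U : Over X) (S : Sieve U)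
    (h : ∀ (R : CommRingCat.{u}) (_ : HasRoots p R) (_ : IsNilpotent (p : R))
      (g : Spec R ⟶ U.left), S (Over.homMk g : Over.mk (g ≫ U.hom) ⟶ U)) :
    S ∈ prTopology p X U := by
  have hU : PLocNilp p U.left := hX.of_hom U.hom
  rw [prTopology, GrothendieckTopology.mem_over_iff]
  let Y : U.left.affineOpens → Scheme.{u} := fun W => Spec (rootClosure p Γ(U.left, W))
  let g : ∀ W, Y W ⟶ U.left := fun W =>
    Spec.map (toRootClosure p Γ(U.left, W)) ≫ IsAffineOpen.fromSpec (U := W.1) W.2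
  have hg : Presieve.ofArrows Y g ∈ Scheme.precoverage (prMorphism p) U.left := by
    rw [Scheme.ofArrows_mem_precoverage_iff]
    refine ⟨fun x => ?_, fun W y => ?_⟩
    · obtain ⟨W, -, hx⟩ := exists_affineOpens_le (⊤ : U.left.Opens) (t := x) trivial
      have hW : IsAffineOpen W.1 := W.2
      have h1 : x ∈ Set.range hW.fromSpec := by rw [hW.range_fromSpec]; exact hx
      obtain ⟨z, rfl⟩ := h1
      obtain ⟨z', hz'⟩ := surjective_toRootClosure p Γ(U.left, W) z
      refine ⟨W, z', ?_⟩
      exact congrArg hW.fromSpec hz'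
    · have hW : IsAffineOpen W.1 := W.2
      have hle : (⊤ : (Y W).Opens) ≤ g W ⁻¹ᵁ W.1 := by
        rw [Scheme.Hom.comp_preimage, hW.fromSpec_preimage_self]
        exact le_rfl
      refine ⟨⟨⊤, isAffineOpen_top _⟩, W, hle, trivial, ?_⟩
      have e : (g W).appLE W.1 ⊤ hle =
          toRootClosure p Γ(U.left, W) ≫ (Scheme.ΓSpecIso _).inv :=
        appLE_specMap_fromSpec hW _ hle
      change rootExtension p ((g W).appLE W.1 ⊤ hle)
      rw [e]
      have : (rootExtension.{u} p).RespectsIso := by unfold rootExtension; infer_instance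
      exact MorphismProperty.RespectsIso.postcomp (rootExtension.{u} p) _ _
        (rootExtension_toRootClosure p _)
  refine GrothendieckTopology.superset_covering _ ?_
    (Precoverage.generate_mem_toGrothendieck hg)
  rw [Sieve.generate_le_iff]
  rintro _ _ ⟨W⟩
  rw [Sieve.overEquiv_iff]
  refine h _ (hasRoots_rootClosure p _) ?_ (g W)
  have h1 := (isNilpotent_of_pLocNilp hU W.2).map (toRootClosure p Γ(U.left, W)).hom
  simpa using h1

/-- The presheaf of compatible families on the category of `X`-schemes. -/
noncomputable def famOver (𝒞 : PDDatum.{u} p → Prop) (X : Scheme.{u}) :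
    (Over X)ᵒᵖ ⥤ CommRingCat.{u + 1} := (Over.forget X).op ⋙ famPre 𝒞

theorem isSheaf_famOver {𝒞 : PDDatum.{u} p → Prop} (h𝒞 : StableFlat 𝒞) (X : Scheme.{u}) :
    Presheaf.IsSheaf (prTopology p X) (famOver 𝒞 X) :=
  (Sheaf.over ⟨famPre 𝒞, isSheaf_famPre h𝒞⟩ X).2

/-- Restriction of families to a smaller class of affine thickenings. -/
noncomputable def famRestrict {𝒞 𝒟 : PDDatum.{u} p → Prop} (h : ∀ d, 𝒟 d → 𝒞 d) (U : Scheme.{u}) :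
    fam 𝒞 U →+* fam 𝒟 U where
  toFun s := ⟨fun d f => s.1 ⟨d.1, h d.1 d.2⟩ f, fun d d' g f =>
    s.2 ⟨d.1, h d.1 d.2⟩ ⟨d'.1, h d'.1 d'.2⟩ g f⟩
  map_one' := rfl
  map_mul' _ _ := rfl
  map_zero' := rfl
  map_add' _ _ := rfl

/-- The restriction of families to a smaller class of affine thickenings, as a morphism of
presheaves. -/
noncomputable def famOverRestrict {𝒞 𝒟 : PDDatum.{u} p → Prop} (h : ∀ d, 𝒟 d → 𝒞 d)
    (X : Scheme.{u}) : famOver 𝒞 X ⟶ famOver 𝒟 X where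
  app U := CommRingCat.ofHom (famRestrict h U.unop.left)

/-- The affine thickenings in `𝒞` with `p ^ r = 0`. -/
def modData (𝒞 : PDDatum.{u} p → Prop) (r : ℕ) (d : PDDatum.{u} p) : Prop :=
  𝒞 d ∧ (p : d.B) ^ r = 0

theorem stableFlat_modData {𝒞 : PDDatum.{u} p → Prop} (h𝒞 : StableFlat 𝒞) (r : ℕ) :
    StableFlat (modData 𝒞 r) := fun d B' f hf h =>
  ⟨h𝒞 d f hf h.1, by
    have := congrArg f.hom h.2
    rwa [map_pow, map_natCast, map_zero] at this⟩

theorem modData_mono {𝒞 : PDDatum.{u} p → Prop} {r r' : ℕ} (hr : r ≤ r') (d : PDDatum.{u} p)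
    (h : modData 𝒞 r d) : modData 𝒞 r' d := ⟨h.1, pow_eq_zero_of_le hr h.2⟩

/-- Since `p` is nilpotent on each thickening, a family is the same as a compatible system of
families on the thickenings with `p ^ r = 0`. -/
theorem exists_fam_of_modData {𝒞 : PDDatum.{u} p → Prop} {U : Scheme.{u}}
    (s : ∀ r, fam (modData 𝒞 r) U)
    (hs : ∀ r, famRestrict (modData_mono r.le_succ) U (s (r + 1)) = s r) :
    ∃ a : fam 𝒞 U, ∀ r, famRestrict (fun _ h => h.1) U a = s r := by
  have hle : ∀ r r' (d : PDDatum.{u} p) (h : modData 𝒞 r d) (h' : modData 𝒞 r' d)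
      (f : Spec d.C ⟶ U), r ≤ r' → (s r').1 ⟨d, h'⟩ f = (s r).1 ⟨d, h⟩ f := by
    intro r r' d h h' f hr
    induction r', hr using Nat.le_induction with
    | base => rfl
    | succ m hm ih =>
      exact (congrArg (fun z : fam (modData 𝒞 m) U => z.1 ⟨d, modData_mono hm d h⟩ f) (hs m)).trans
        (ih _)
  have heq : ∀ r r' (d : PDDatum.{u} p) (h : modData 𝒞 r d) (h' : modData 𝒞 r' d)
      (f : Spec d.C ⟶ U), (s r').1 ⟨d, h'⟩ f = (s r).1 ⟨d, h⟩ f := fun r r' d h h' f =>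
    (le_total r r').elim (hle r r' d h h' f) fun hr => (hle r' r d h' h f hr).symm
  have hN : ∀ d : {d : PDDatum.{u} p // 𝒞 d}, ∃ N, modData 𝒞 N d.1 := fun d =>
    ⟨d.1.nilp.choose, d.2, d.1.nilp.choose_spec⟩
  choose N hN using hN
  refine ⟨⟨fun d f => (s (N d)).1 ⟨d.1, hN d⟩ f, fun d d' g f => ?_⟩, fun r =>
    Subtype.ext (funext₂ fun d f => ?_)⟩
  · have h1 : modData 𝒞 (N d) d'.1 := ⟨d'.2, by
      have := congrArg g.φ.hom (hN d).2
      rwa [map_pow, map_natCast, map_zero] at this⟩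
    exact ((s (N d)).2 ⟨d.1, hN d⟩ ⟨d'.1, h1⟩ g f).trans (heq _ _ d'.1 (hN d') h1 _)
  · exact heq r _ d.1 d.2 _ f

/-- Elements of `fam 𝒞` that vanish on all thickenings with `p ^ r = 0` are divisible by `p ^ r`
over rings in which all elements have `p`-th roots. -/
def RootsDvd (𝒞 : PDDatum.{u} p → Prop) : Prop :=
  ∀ (R : CommRingCat.{u}) (_ : HasRoots p R) (_ : IsNilpotent (p : R)) (r : ℕ)
    (a : fam 𝒞 (Spec R)), famRestrict (𝒟 := modData 𝒞 r) (fun _ h => h.1) (Spec R) a = 0 →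
      (p : fam 𝒞 (Spec R)) ^ r ∣ a

/-- Every `X`-scheme has a `pr`-covering by spectra of rings in which all elements have `p`-th
roots; there `RootsDvd` applies. -/
theorem isPAdicSheaf_of_iso_famOver {𝒞 : PDDatum.{u} p → Prop} (h𝒞 : StableFlat 𝒞)
    (hdvd : RootsDvd 𝒞) {X : Scheme.{u}} (hX : PLocNilp p X)
    (A : (Over X)ᵒᵖ ⥤ CommRingCat.{u + 1}) (e : A ≅ famOver 𝒞 X) :
    IsPAdicSheaf (prTopology p X) p A := by
  let q : ∀ r, A ⟶ famOver (modData 𝒞 r) X := fun r =>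
    e.hom ≫ famOverRestrict (fun _ h => h.1) X
  have he : ∀ U, Function.Bijective (e.hom.app U).hom := fun U =>
    ConcreteCategory.bijective_of_isIso (e.hom.app U)
  refine isPAdicSheaf_of_factors (prTopology p X) p A
    ((Presheaf.isSheaf_of_iso_iff e).2 (isSheaf_famOver h𝒞 X)) (fun r => famOver (modData 𝒞 r) X)
    (fun r => isSheaf_famOver (stableFlat_modData h𝒞 r) X) (fun r U => ?_) q
    (fun r => famOverRestrict (modData_mono r.le_succ) X) (fun r => rfl) (fun r U a ha => ?_)
    (fun U a ha => ?_) (fun U s hs => ?_)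
  · refine Subtype.ext (funext₂ fun d f => ?_)
    exact d.2.2
  · refine ⟨_, mem_prTopology_of_roots hX U.unop
      { arrows := fun V f => (p : A.obj (op V)) ^ r ∣ (A.map f.op).hom a
        downward_closed := fun {V W f} hf g => ?_ } fun R hR hp g => ?_, fun V f hf => hf⟩
    · obtain ⟨c, hc⟩ := hf
      refine ⟨(A.map g.op).hom c, ?_⟩
      rw [op_comp, A.map_comp, CommRingCat.hom_comp, RingHom.comp_apply, hc, map_mul, map_pow,
        map_natCast]
    · let f : Over.mk (g ≫ U.unop.hom) ⟶ U.unop := Over.homMk g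
      let b : fam 𝒞 (Spec R) := (e.hom.app (op (Over.mk (g ≫ U.unop.hom)))).hom ((A.map f.op).hom a)
      have hb : b = famMap 𝒞 g ((e.hom.app U).hom a) :=
        congrArg (fun k : A.obj U ⟶ (famOver 𝒞 X).obj (op (Over.mk (g ≫ U.unop.hom))) => k.hom a)
          (e.hom.naturality f.op)
      obtain ⟨c, hc⟩ := hdvd R hR hp r b (by
        rw [hb]
        have ha' : famRestrict (𝒟 := modData 𝒞 r) (fun _ h => h.1) U.unop.left
          ((e.hom.app U).hom a) = 0 := ha
        exact congrArg (famMap (modData 𝒞 r) g) ha')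
      obtain ⟨c', hc'⟩ := (he (op (Over.mk (g ≫ U.unop.hom)))).2 c
      refine ⟨c', (he _).1 ?_⟩
      rw [map_mul, map_pow, map_natCast, hc']
      exact hc
  · refine (he U).1 (Eq.trans ?_ (map_zero (e.hom.app U).hom).symm)
    refine Subtype.ext (funext₂ fun d f => ?_)
    obtain ⟨N, hN⟩ := d.1.nilp
    exact congrArg (fun z : fam (modData 𝒞 N) U.unop.left => z.1 ⟨d.1, d.2, hN⟩ f) (ha N)
  · obtain ⟨b, hb⟩ := exists_fam_of_modData (U := U.unop.left) s hs
    obtain ⟨a, rfl⟩ := (he U).2 b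
    exact ⟨a, hb⟩

end

section
variable {p : ℕ} [hp : Fact p.Prime]

/-! ### Adding `p` to the ideal of a thickening -/

/-- Divided powers on `J + p B` that extend divided powers on `J` and those of `p` are preserved by
homomorphisms that preserve the divided powers on `J`. -/
theorem isDPMorphism_sup_p {B B' : Type*} [CommRing B] [CommRing B'] {J K : Ideal B}
    {J' K' : Ideal B'} (ι : ℤ_[p] →+* B) (ι' : ℤ_[p] →+* B') {hJ : DividedPowers J}
    {hJ' : DividedPowers J'} {hK : DividedPowers K} {hK' : DividedPowers K'}
    (eK : K = J ⊔ Ideal.span {(p : B)}) (eK' : K' = J' ⊔ Ideal.span {(p : B')})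
    (h : hJ.IsDPMorphism hK (RingHom.id B)) (h' : hJ'.IsDPMorphism hK' (RingHom.id B'))
    (hc : GammaCompat ι hK) (hc' : GammaCompat ι' hK') (f : B →+* B') (hf : hJ.IsDPMorphism hJ' f)
    (hι : f.comp ι = ι') : hK.IsDPMorphism hK' f := by
  have hpK : (p : B) ∈ K := eK ▸ Ideal.mem_sup_right (Ideal.mem_span_singleton_self _)
  have hpK' : (p : B') ∈ K' := eK' ▸ Ideal.mem_sup_right (Ideal.mem_span_singleton_self _)
  have hJJ' : ∀ x ∈ J, f x ∈ J' := fun x hx => hf.1 (Ideal.mem_map_of_mem f hx)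
  have hJK' : ∀ x ∈ J', x ∈ K' := fun x hx => h'.1 (Ideal.mem_map_of_mem _ hx)
  refine DividedPowers.IsDPMorphism.on_span _ _ (S := (J : Set B) ∪ {(p : B)})
    (by rw [Ideal.span_union, Ideal.span_eq, eK]) ?_ ?_
  · rintro s (hs | rfl)
    · exact hJK' _ (hJJ' s hs)
    · rwa [map_natCast]
  · rintro n s (hs | rfl)
    · have h1 := h.2 (n := n) s hs
      have h2 := h'.2 (n := n) (f s) (hJJ' s hs)
      simp only [RingHom.id_apply] at h1 h2
      rw [h1, h2, hf.2 s hs]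
    · have h1 := hc n 1 (by rwa [mul_one])
      have h2 := hc' n 1 (by rwa [mul_one])
      rw [mul_one, one_pow, mul_one] at h1 h2
      rw [map_natCast, h1, h2, ← hι]; rfl

namespace PDDatum
variable (d : PDDatum.{u} p)

/-- The ideal generated by the ideal of a thickening and `p`. -/
abbrev idealP : Ideal d.B := RingHom.ker d.q.hom ⊔ Ideal.span {(p : d.B)}

theorem exists_dp_modP : ∃ h : DividedPowers (RingHom.ker (Ideal.Quotient.mk d.idealP)),
    d.dp.IsDPMorphism h (RingHom.id d.B) ∧ GammaCompat (padicMap d.nilp) h := by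
  rw [Ideal.mk_ker]
  exact exists_dividedPowers_sup_p _ d.dp d.gammaCompat

/-- The thickening `Spec C/p → Spec B` given by a thickening `Spec C → Spec B`. -/
noncomputable def modP : PDDatum.{u} p where
  B := d.B
  C := CommRingCat.of (d.B ⧸ d.idealP)
  q := CommRingCat.ofHom (Ideal.Quotient.mk _)
  surj := Ideal.Quotient.mk_surjective
  nilp := d.nilp
  dp := d.exists_dp_modP.choose
  compat := (gammaCompat_iff _ _).1 d.exists_dp_modP.choose_spec.2

theorem ker_modP : RingHom.ker d.modP.q.hom = d.idealP :=
  (Ideal.mk_ker : RingHom.ker (Ideal.Quotient.mk d.idealP) = _)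

/-- The homomorphism `(B → C) → (B → C/p)`. -/
noncomputable def toModP : d.Hom d.modP :=
  .mk' (d' := d.modP) (𝟙 d.B) d.exists_dp_modP.choose_spec.1

theorem p_modP : (p : d.modP.C) = 0 := by
  have : d.modP.q.hom (p : d.modP.B) = 0 := by
    have h : (p : d.modP.B) ∈ RingHom.ker d.modP.q.hom :=
      d.ker_modP ▸ Ideal.mem_sup_right (Ideal.mem_span_singleton_self _)
    exact h
  rwa [map_natCast] at this

theorem fam_modP {U : Scheme.{u}} (s : fam (p := p) allData U) (f : Spec d.C ⟶ U) :
    s.1 ⟨d.modP, trivial⟩ (Spec.map d.toModP.ψ ≫ f) = s.1 ⟨d, trivial⟩ f :=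
  (s.2 ⟨d, trivial⟩ ⟨d.modP, trivial⟩ d.toModP f).symm

variable {d}

/-- Passage to `C / p` is functorial. -/
noncomputable def Hom.modP {d' : PDDatum.{u} p} (g : d.Hom d') : d.modP.Hom d'.modP :=
  .mk' (d := d.modP) (d' := d'.modP) g.φ
    (isDPMorphism_sup_p (padicMap d.nilp) (padicMap d'.nilp) d.ker_modP d'.ker_modP
      d.exists_dp_modP.choose_spec.1 d'.exists_dp_modP.choose_spec.1
      d.exists_dp_modP.choose_spec.2 d'.exists_dp_modP.choose_spec.2 g.φ.hom g.isDP
      (padicInt_ringHom_ext d'.nilp _ _))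

theorem toModP_comp_modP {d' : PDDatum.{u} p} (g : d.Hom d') :
    d.toModP.ψ ≫ g.modP.ψ = g.ψ ≫ d'.toModP.ψ := by
  have he : Epi d.q := ConcreteCategory.epi_of_surjective _ d.surj
  rw [← cancel_epi d.q, ← Category.assoc, d.toModP.comm, Category.assoc, g.modP.comm]
  refine Eq.trans ?_ (Category.assoc _ _ _)
  rw [g.comm, Category.assoc, d'.toModP.comm]
  rfl

theorem pow_mem_span_p {x : d.B} (hx : d.q.hom x = 0) : (p : d.B) ∣ x ^ p := by
  rw [← d.dp.factorial_mul_dpow_eq_pow hx, ← Nat.mul_factorial_pred hp.out.ne_zero]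
  push_cast
  exact (Dvd.intro _ rfl : (p : d.B) ∣ p * _).mul_right _

theorem pow_sub_pow_dvd {x y : d.B} (h : d.q.hom x = d.q.hom y) : (p : d.B) ∣ x ^ p - y ^ p := by
  obtain ⟨z, rfl⟩ : ∃ z, x = y + z := ⟨x - y, by ring⟩
  have hz : d.q.hom z = 0 := by simpa using h
  rw [add_pow_eq_powDefect, show y ^ p + z ^ p + p * powDefect p y z - y ^ p =
    z ^ p + p * powDefect p y z by ring]
  exact dvd_add (pow_mem_span_p hz) (Dvd.intro _ rfl)

variable (d) in
/-- Sufficiently high powers of the elements of `B` only depend on their images in `C`. -/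
theorem exists_pow_eq : ∃ N, ∀ x y : d.B, d.q.hom x = d.q.hom y → x ^ p ^ N = y ^ p ^ N := by
  obtain ⟨N, hN⟩ := d.nilp
  refine ⟨1 + N, fun x y h => ?_⟩
  obtain ⟨t, ht⟩ := dvd_sub_pow_of_dvd_sub (pow_sub_pow_dvd h) N
  rw [pow_succ, hN, zero_mul, zero_mul, sub_eq_zero] at ht
  rw [pow_add, pow_mul, pow_mul, pow_one, ht]

theorem bijective_pow_pow {M : Type*} [CommMonoid M]
    (hM : Function.Bijective fun x : M => x ^ p) (N : ℕ) :
    Function.Bijective fun x : M => x ^ p ^ N := by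
  induction N with
  | zero => simp only [pow_zero, pow_one]; exact Function.bijective_id
  | succ N ih =>
    have h : (fun x : M => x ^ p ^ (N + 1)) = (fun x : M => x ^ p) ∘ fun x : M => x ^ p ^ N := by
      funext x; rw [pow_succ, pow_mul]; rfl
    exact h ▸ hM.comp ih

variable (d) in
/-- A homomorphism from a monoid with unique `p`-th roots to `C` lifts to `B`: the image of `m` is
the `p ^ N`-th power of any lift of the image of the `p ^ N`-th root of `m`, which is independent of
the lift. -/
theorem exists_monoidHom_lift {M : Type u} [CommMonoid M]
    (hM : Function.Bijective fun x : M => x ^ p) (θ : M →* d.C) :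
    ∃ μ : M →* d.B, ∀ m, d.q.hom (μ m) = θ m := by
  obtain ⟨N, hN⟩ := d.exists_pow_eq
  choose s hs using d.surj
  choose r hr using (bijective_pow_pow hM N).2
  have hr' : ∀ {m m' : M}, m ^ p ^ N = m' ^ p ^ N → m = m' := fun h => (bijective_pow_pow hM N).1 h
  refine ⟨⟨⟨fun m => s (θ (r m)) ^ p ^ N, ?_⟩, fun m m' => ?_⟩, fun m => ?_⟩
  · have : r 1 = 1 := hr' ((hr 1).trans (one_pow _).symm)
    exact (hN _ 1 (by rw [hs, this, map_one, map_one])).trans (one_pow _)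
  · have : r (m * m') = r m * r m' := hr' ((hr _).trans (by rw [mul_pow]; exact (congrArg₂ _ (hr m) (hr m')).symm))
    exact (hN _ (s (θ (r m)) * s (θ (r m'))) (by rw [hs, this, map_mul, map_mul, hs, hs])).trans
      (mul_pow _ _ _)
  · change d.q.hom (s (θ (r m)) ^ p ^ N) = _
    rw [map_pow, hs, ← map_pow]
    exact congrArg θ (hr m)

theorem monoidHom_ext {M : Type u} [CommMonoid M]
    (hM : Function.Bijective fun x : M => x ^ p) {μ μ' : M →* d.B}
    (h : ∀ m, d.q.hom (μ m) = d.q.hom (μ' m)) (m : M) : μ m = μ' m := by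
  obtain ⟨N, hN⟩ := d.exists_pow_eq
  obtain ⟨r, rfl⟩ := (bijective_pow_pow hM N).2 m
  change μ (r ^ p ^ N) = μ' (r ^ p ^ N)
  rw [map_pow, map_pow]
  exact hN _ _ (h r)

end PDDatum
end

/-! ### Sections over rings presented by perfect monoids -/

/-- A presentation of a ring `R`, in which `p` is nilpotent, as a quotient of the monoid algebra
over `ℤ_p` of a commutative monoid on which `x ↦ x ^ p` is bijective. -/
structure PerfectChart (p : ℕ) [Fact p.Prime] (R : CommRingCat.{u}) where
  M : Type u
  [commMonoid : CommMonoid M]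
  bij : Function.Bijective fun x : M => x ^ p
  nilp : IsNilpotent (p : R)
  θ : M →* R
  surj : Function.Surjective
    (MonoidAlgebra.liftNCRingHom (padicMap nilp) θ fun _ _ => Commute.all _ _)

attribute [instance] PerfectChart.commMonoid

namespace PerfectChart
variable {p : ℕ} [hp : Fact p.Prime] {R : CommRingCat.{u}} (c : PerfectChart p R)

/-- The monoid algebra. -/
abbrev A : Type u := MonoidAlgebra ℤ_[p] c.M

/-- The projection from the monoid algebra. -/
noncomputable def π : c.A →+* R :=
  MonoidAlgebra.liftNCRingHom (padicMap c.nilp) c.θ fun _ _ => Commute.all _ _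

theorem π_single (m : c.M) : c.π (MonoidAlgebra.single m 1) = c.θ m := by
  rw [π, MonoidAlgebra.liftNCRingHom_single, map_one, one_mul]

/-- The ideal of the presentation. -/
noncomputable abbrev I : Ideal c.A := RingHom.ker c.π

/-- The divided power envelope of the presentation. -/
abbrev D : Type u := PDEnv p c.I

/-- The divided power homomorphism from the envelope to the thickening `B → C/p` that is compatible
with the structure map of `C` as an `R`-algebra. -/
structure IsEval (d : PDDatum.{u} p) (f : Spec d.C ⟶ Spec R) (e : c.D →+* d.B) : Prop where
  isDP : (PDEnv.dividedPowers c.I).IsDPMorphism d.modP.dp e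
  comm : ∀ a, d.q.hom (e (algebraMap c.A c.D a)) = (Spec.preimage f).hom (c.π a)

variable {c}

theorem IsEval.unique {d : PDDatum.{u} p} {f : Spec d.C ⟶ Spec R} {e e' : c.D →+* d.B}
    (h : c.IsEval d f e) (h' : c.IsEval d f e') : e = e' := by
  refine PDEnv.hom_ext_of_isDPMorphism h.isDP h'.isDP fun a => ?_
  refine congrArg (fun k : c.A →+* d.B => k a) (?_ : e.comp (algebraMap c.A c.D) =
    e'.comp (algebraMap c.A c.D))
  refine MonoidAlgebra.ringHom_ext (fun r => ?_) fun m => ?_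
  · exact congrArg (fun k : ℤ_[p] →+* d.B => k r) (padicInt_ringHom_ext d.nilp
      ((e.comp (algebraMap c.A c.D)).comp MonoidAlgebra.singleOneRingHom)
      ((e'.comp (algebraMap c.A c.D)).comp MonoidAlgebra.singleOneRingHom))
  · exact PDDatum.monoidHom_ext c.bij
      (μ := ((e.comp (algebraMap c.A c.D)) : c.A →* d.B).comp (MonoidAlgebra.of ℤ_[p] c.M))
      (μ' := ((e'.comp (algebraMap c.A c.D)) : c.A →* d.B).comp (MonoidAlgebra.of ℤ_[p] c.M))
      (fun m => (h.comm _).trans (h'.comm _).symm) m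

theorem IsEval.comp {d d' : PDDatum.{u} p} {f : Spec d.C ⟶ Spec R} {e : c.D →+* d.B}
    (h : c.IsEval d f e) (g : d.Hom d') : c.IsEval d' (Spec.map g.ψ ≫ f) (g.φ.hom.comp e) where
  isDP := g.modP.isDP.comp _ h.isDP
  comm a := by
    have h1 : Spec.preimage (Spec.map g.ψ ≫ f) = Spec.preimage f ≫ g.ψ :=
      Spec.map_injective (by rw [Spec.map_preimage, Spec.map_comp, Spec.map_preimage])
    rw [h1]
    refine Eq.trans ?_ (congrArg g.ψ.hom (h.comm a))
    exact (congrArg (fun k : d.B ⟶ d'.C => k.hom (e (algebraMap c.A c.D a))) g.comm).symm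

variable (c)

/-- The homomorphism from the monoid to `C` lifts uniquely to `B`, and the resulting homomorphism
from the monoid algebra extends to the divided power envelope by its universal property. -/
theorem exists_isEval (d : PDDatum.{u} p) (f : Spec d.C ⟶ Spec R) : ∃ e, c.IsEval d f e := by
  obtain ⟨μ, hμ⟩ := d.exists_monoidHom_lift c.bij (((Spec.preimage f).hom : R →* d.C).comp c.θ)
  let φ : c.A →+* d.B :=
    MonoidAlgebra.liftNCRingHom (padicMap d.nilp) μ fun _ _ => Commute.all _ _
  have hφ : d.q.hom.comp φ = (Spec.preimage f).hom.comp c.π := by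
    refine MonoidAlgebra.ringHom_ext (fun r => ?_) fun m => ?_
    · exact congrArg (fun k : ℤ_[p] →+* d.C => k r) (padicInt_ringHom_ext d.nilp_C
        ((d.q.hom.comp φ).comp MonoidAlgebra.singleOneRingHom)
        (((Spec.preimage f).hom.comp c.π).comp MonoidAlgebra.singleOneRingHom))
    · change d.q.hom (φ _) = (Spec.preimage f).hom (c.π _)
      rw [π_single, MonoidAlgebra.liftNCRingHom_single, map_one, one_mul]
      exact hμ m
  have hφ' : ∀ x ∈ c.I ⊔ Ideal.span {(p : c.A)}, φ x ∈ RingHom.ker d.modP.q.hom := by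
    rw [d.ker_modP]
    refine (sup_le (fun x hx => ?_) ?_ : c.I ⊔ Ideal.span {(p : c.A)} ≤ d.idealP.comap φ)
    · refine Ideal.mem_sup_left ?_
      rw [RingHom.mem_ker] at hx ⊢
      refine (congrArg (fun k : c.A →+* d.C => k x) hφ).trans ?_
      change (Spec.preimage f).hom (c.π x) = 0
      rw [hx, map_zero]
    · rw [Ideal.span_singleton_le_iff_mem, Ideal.mem_comap, map_natCast]
      exact Ideal.mem_sup_right (Ideal.mem_span_singleton_self _)
  have hc : GammaCompat (φ.comp (algebraMap ℤ_[p] c.A)) d.modP.dp := by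
    rw [padicInt_ringHom_ext d.nilp (φ.comp (algebraMap ℤ_[p] c.A)) (padicMap d.modP.nilp)]
    exact d.modP.gammaCompat
  refine ⟨PDEnv.liftDP φ d.modP.dp hφ' hc, PDEnv.isDPMorphism_liftDP φ _ hφ' hc, fun a => ?_⟩
  refine (congrArg d.q.hom (PDEnv.liftDP_algebraMap φ d.modP.dp hφ' hc a)).trans ?_
  exact congrArg (fun k : c.A →+* d.C => k a) hφ

/-- The evaluation homomorphism. -/
noncomputable def eval (d : PDDatum.{u} p) (f : Spec d.C ⟶ Spec R) : c.D →+* d.B :=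
  (c.exists_isEval d f).choose

theorem isEval_eval (d : PDDatum.{u} p) (f : Spec d.C ⟶ Spec R) : c.IsEval d f (c.eval d f) :=
  (c.exists_isEval d f).choose_spec

/-- The homomorphism from the completed divided power envelope to the ring of compatible
families. -/
noncomputable def toFam : PCompl p c.D →+* fam (p := p) allData (Spec R) where
  toFun y := ⟨fun d f => pComplLift p (c.eval d.1 f) d.1.nilp y, fun d d' g f => by
    obtain ⟨N, hN⟩ := d.1.nilp
    have hN' : (p : d'.1.B) ^ N = 0 := by
      have := congrArg g.φ.hom hN
      rwa [map_pow, map_natCast, map_zero] at this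
    obtain ⟨z, hz⟩ := PCompl.exists_mod N y
    beta_reduce
    rw [hz.lift _ _ hN, hz.lift _ _ hN',
      (c.isEval_eval d'.1 _).unique ((c.isEval_eval d.1 f).comp g)]
    rfl⟩
  map_one' := Subtype.ext (funext₂ fun d f => map_one _)
  map_mul' _ _ := Subtype.ext (funext₂ fun d f => map_mul _ _ _)
  map_zero' := Subtype.ext (funext₂ fun d f => map_zero _)
  map_add' _ _ := Subtype.ext (funext₂ fun d f => map_add _ _ _)

theorem toFam_of_mod {N : ℕ} {y : PCompl p c.D} {z : c.D} (h : PCompl.Mod N y z)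
    (d : PDDatum.{u} p) (f : Spec d.C ⟶ Spec R) (hN : (p : d.B) ^ N = 0) :
    (c.toFam y).1 ⟨d, trivial⟩ f = c.eval d f z := h.lift _ _ hN

theorem toFam_of (z : c.D) (d : PDDatum.{u} p) (f : Spec d.C ⟶ Spec R) :
    (c.toFam (PCompl.of p c.D z)).1 ⟨d, trivial⟩ f = c.eval d f z := by
  obtain ⟨N, hN⟩ := d.nilp
  exact c.toFam_of_mod (PCompl.mod_of N z) d f hN

/-! ### The universal thickenings -/

theorem exists_dp_univ (n : ℕ) : ∃ h : DividedPowers (RingHom.ker (Ideal.Quotient.mk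
    ((PDEnv.ideal c.I).map (Ideal.Quotient.mk (Ideal.span {(p : c.D) ^ n}))))),
    (PDEnv.dividedPowers c.I).IsDPMorphism h (Ideal.Quotient.mk (Ideal.span {(p : c.D) ^ n})) := by
  refine exists_dividedPowers_of_surjective _ Ideal.Quotient.mk_surjective
    (PDEnv.dividedPowers c.I) (fun z hz hz0 k hk => ?_) Ideal.mk_ker
  obtain ⟨t, rfl⟩ := Ideal.mem_span_singleton.1 (Ideal.Quotient.eq_zero_iff_mem.1 hz0)
  refine Ideal.Quotient.eq_zero_iff_mem.2 (Ideal.mem_span_singleton.2 ?_)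
  rcases n with _ | n
  · rw [pow_zero]; exact one_dvd _
  · obtain ⟨k, rfl⟩ := Nat.exists_eq_succ_of_ne_zero hk
    rw [pow_succ', mul_assoc] at hz ⊢
    rw [PDEnv.gammaCompat c.I _ _ hz, p_mul_gammaDiv_mem _ hk, mul_pow, mul_assoc]
    refine mul_dvd_mul_left _ (Dvd.dvd.mul_left (Dvd.dvd.mul_right ?_ _) _)
    rw [← pow_mul]
    exact pow_dvd_pow _ (Nat.le_mul_of_pos_right n (Nat.succ_pos k))

/-- The reduction modulo `p ^ n` of the divided power envelope, as a thickening. -/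
noncomputable def univ (n : ℕ) : PDDatum.{u} p where
  B := CommRingCat.of (c.D ⧸ Ideal.span {(p : c.D) ^ n})
  C := CommRingCat.of ((c.D ⧸ Ideal.span {(p : c.D) ^ n}) ⧸
    (PDEnv.ideal c.I).map (Ideal.Quotient.mk (Ideal.span {(p : c.D) ^ n})))
  q := CommRingCat.ofHom (Ideal.Quotient.mk _)
  surj := Ideal.Quotient.mk_surjective
  nilp := ⟨n, by
    have : Ideal.Quotient.mk (Ideal.span {(p : c.D) ^ n}) (p ^ n) = 0 :=
      Ideal.Quotient.eq_zero_iff_mem.2 (Ideal.mem_span_singleton_self _)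
    rwa [map_pow, map_natCast] at this⟩
  dp := (c.exists_dp_univ n).choose
  compat := by
    refine (gammaCompat_iff ((Ideal.Quotient.mk (Ideal.span {(p : c.D) ^ n})).comp
      (PDEnv.padicInt c.I)) _).1 fun k b _ => ?_
    obtain ⟨t, rfl⟩ := Ideal.Quotient.mk_surjective b
    have ht : (p : c.D) * t ∈ PDEnv.ideal c.I := Ideal.mul_mem_right _ _ (PDEnv.p_mem_ideal c.I)
    have h := (c.exists_dp_univ n).choose_spec.2 (n := k) _ ht
    rw [map_mul, map_natCast] at h
    refine h.trans ?_
    rw [PDEnv.gammaCompat c.I k t ht, map_mul, map_pow]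
    rfl

/-- The projection from the envelope to its reduction modulo `p ^ n`. -/
noncomputable def toUniv (n : ℕ) : c.D →+* (c.univ n).B := Ideal.Quotient.mk _

theorem toUniv_surjective (n : ℕ) : Function.Surjective (c.toUniv n) := Ideal.Quotient.mk_surjective

theorem isDPMorphism_toUniv (n : ℕ) :
    (PDEnv.dividedPowers c.I).IsDPMorphism (c.univ n).dp (c.toUniv n) :=
  (c.exists_dp_univ n).choose_spec

theorem ker_univ (n : ℕ) :
    RingHom.ker (c.univ n).q.hom = (PDEnv.ideal c.I).map (c.toUniv n) :=
  (Ideal.mk_ker : RingHom.ker (Ideal.Quotient.mk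
    ((PDEnv.ideal c.I).map (Ideal.Quotient.mk (Ideal.span {(p : c.D) ^ n})))) = _)

theorem univ_pow (n : ℕ) : (p : (c.univ n).B) ^ n = 0 := by
  have : c.toUniv n (p ^ n) = 0 :=
    Ideal.Quotient.eq_zero_iff_mem.2 (Ideal.mem_span_singleton_self _)
  rwa [map_pow, map_natCast] at this

theorem toUniv_eq_zero {n : ℕ} {z : c.D} (h : c.toUniv n z = 0) : ∃ t, z = p ^ n * t :=
  Ideal.mem_span_singleton.1 (Ideal.Quotient.eq_zero_iff_mem.1 h)

theorem exists_univStr (n : ℕ) : ∃ ρ : R ⟶ (c.univ n).C,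
    ∀ a, ρ.hom (c.π a) = (c.univ n).q.hom (c.toUniv n (algebraMap c.A c.D a)) := by
  let g : c.A →+* (c.univ n).C := ((c.univ n).q.hom.comp (c.toUniv n)).comp (algebraMap c.A c.D)
  have hg : RingHom.ker c.π ≤ RingHom.ker g := fun a ha => by
    have h1 : c.toUniv n (algebraMap c.A c.D a) ∈ RingHom.ker (c.univ n).q.hom :=
      c.ker_univ n ▸ Ideal.mem_map_of_mem _
        (PDEnv.algebraMap_mem_ideal ⟨a, Ideal.mem_sup_left ha⟩)
    exact h1
  exact ⟨CommRingCat.ofHom (RingHom.liftOfSurjective c.π c.surj ⟨g, hg⟩), fun a =>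
    RingHom.liftOfSurjective_comp_apply c.π c.surj ⟨g, hg⟩ a⟩

/-- The structure map of the universal thickening. -/
noncomputable def univStr (n : ℕ) : Spec (c.univ n).C ⟶ Spec R := Spec.map (c.exists_univStr n).choose

theorem preimage_univStr (n : ℕ) (a : c.A) : (Spec.preimage (c.univStr n)).hom (c.π a) =
    (c.univ n).q.hom (c.toUniv n (algebraMap c.A c.D a)) := by
  rw [univStr, Spec.preimage_map]
  exact (c.exists_univStr n).choose_spec a

theorem isEval_toUniv (n : ℕ) : c.IsEval (c.univ n) (c.univStr n) (c.toUniv n) where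
  isDP := (c.univ n).toModP.isDP.comp _ (c.isDPMorphism_toUniv n)
  comm a := (c.preimage_univStr n a).symm

theorem eval_univ (n : ℕ) : c.eval (c.univ n) (c.univStr n) = c.toUniv n :=
  (c.isEval_eval _ _).unique (c.isEval_toUniv n)

variable {c}

theorem exists_factor {n : ℕ} {B : CommRingCat.{u}} (e : c.D →+* B) (h : (p : B) ^ n = 0) :
    ∃ φ : (c.univ n).B ⟶ B, φ.hom.comp (c.toUniv n) = e :=
  ⟨CommRingCat.ofHom (Ideal.Quotient.lift _ e fun a ha => by
    obtain ⟨t, rfl⟩ := Ideal.mem_span_singleton.1 ha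
    rw [map_mul, map_pow, map_natCast, h, zero_mul]), rfl⟩

/-- A divided power homomorphism from the envelope to a thickening factors over a universal
thickening. -/
noncomputable def univHom {n : ℕ} {d : PDDatum.{u} p} (e : c.D →+* d.B)
    (he : (PDEnv.dividedPowers c.I).IsDPMorphism d.dp e) (h : (p : d.B) ^ n = 0) :
    (c.univ n).Hom d :=
  .mk' (exists_factor e h).choose (by
    refine DividedPowers.IsDPMorphism.of_comp _ _ _ (c.toUniv n) _ (c.ker_univ n)
      (c.isDPMorphism_toUniv n) ?_
    rw [(exists_factor e h).choose_spec]
    exact he)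

theorem univHom_toUniv {n : ℕ} {d : PDDatum.{u} p} (e : c.D →+* d.B)
    (he : (PDEnv.dividedPowers c.I).IsDPMorphism d.dp e) (h : (p : d.B) ^ n = 0) (z : c.D) :
    (univHom e he h).φ.hom (c.toUniv n z) = e z :=
  congrArg (fun k : c.D →+* d.B => k z) (exists_factor e h).choose_spec

theorem univHom_str {n : ℕ} {d : PDDatum.{u} p} {f : Spec d.C ⟶ Spec R} (e : c.D →+* d.B)
    (he : (PDEnv.dividedPowers c.I).IsDPMorphism d.dp e) (h : (p : d.B) ^ n = 0)
    (hf : ∀ a, d.q.hom (e (algebraMap c.A c.D a)) = (Spec.preimage f).hom (c.π a)) :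
    Spec.map (univHom e he h).ψ ≫ c.univStr n = f := by
  have key : Spec.preimage (c.univStr n) ≫ (univHom e he h).ψ = Spec.preimage f := by
    ext r
    obtain ⟨a, rfl⟩ := c.surj r
    refine Eq.trans ?_ (hf a)
    refine (congrArg (univHom e he h).ψ.hom (c.preimage_univStr n a)).trans ?_
    refine (congrArg (fun k : (c.univ n).B ⟶ d.C => k.hom (c.toUniv n (algebraMap c.A c.D a)))
      (univHom e he h).comm).trans ?_
    exact congrArg d.q.hom (univHom_toUniv e he h _)
  rw [← Spec.map_preimage f, ← key, Spec.map_comp, Spec.map_preimage]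

variable (c)

/-- The values on the universal thickenings determine an element of the completed envelope modulo
all powers of `p`. -/
theorem toFam_injective : Function.Injective c.toFam := by
  refine (injective_iff_map_eq_zero _).2 fun y hy => PCompl.ext fun n => ?_
  obtain ⟨z, hz⟩ := PCompl.exists_mod n y
  have h := c.toFam_of_mod hz (c.univ n) (c.univStr n) (c.univ_pow n)
  rw [hy, eval_univ] at h
  obtain ⟨t, rfl⟩ := c.toUniv_eq_zero h.symm
  exact ⟨_, hz, by simpa using! (PCompl.mod_natCast n 0).of_eq t (by simp)⟩

/-- The values of a family on the universal thickenings form an element of the completed envelope.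
-/
theorem exists_mod_of_fam (s : fam (p := p) allData (Spec R)) :
    ∃ (y : PCompl p c.D) (z : ℕ → c.D), ∀ n, PCompl.Mod n y (z n) ∧
      c.toUniv n (z n) = s.1 ⟨c.univ n, trivial⟩ (c.univStr n) := by
  choose z hz using fun n => c.toUniv_surjective n (s.1 ⟨c.univ n, trivial⟩ (c.univStr n))
  obtain ⟨y, hy⟩ := PCompl.exists_of_seq z fun n => by
    have hp : (p : (c.univ n).B) ^ (n + 1) = 0 := by rw [pow_succ, c.univ_pow, zero_mul]
    have h := s.2 ⟨c.univ (n + 1), trivial⟩ ⟨c.univ n, trivial⟩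
      (univHom (c.toUniv n) (c.isDPMorphism_toUniv n) hp) (c.univStr (n + 1))
    rw [fam_congr s ⟨c.univ n, trivial⟩ (univHom_str (f := c.univStr n) (c.toUniv n)
      (c.isDPMorphism_toUniv n) hp fun a => (c.preimage_univStr n a).symm), ← hz, ← hz] at h
    rw [univHom_toUniv] at h
    obtain ⟨t, ht⟩ := c.toUniv_eq_zero (n := n) (z := z n - z (n + 1))
      (by rw [map_sub, h, sub_self])
    exact ⟨t, by rw [← ht]; ring⟩
  exact ⟨y, z, fun n => ⟨hy n, hz n⟩⟩

/-- Every section is determined by its values on the universal thickenings, and hence comes from the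
completed envelope. -/
theorem toFam_surjective : Function.Surjective c.toFam := by
  intro s
  obtain ⟨y, z, h⟩ := c.exists_mod_of_fam s
  refine ⟨y, Subtype.ext (funext₂ fun d f => ?_)⟩
  obtain ⟨d, _⟩ := d
  obtain ⟨n, hn⟩ := d.nilp
  have he := c.isEval_eval d f
  refine (c.toFam_of_mod (h n).1 d f hn).trans ?_
  refine Eq.trans ?_ (d.fam_modP s f)
  -- The thickening `Spec C/p → Spec B` receives a homomorphism from a universal thickening.
  have h1 := s.2 ⟨c.univ n, trivial⟩ ⟨d.modP, trivial⟩
    (univHom (d := d.modP) (c.eval d f) he.isDP hn) (c.univStr n)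
  rw [← (h n).2] at h1
  refine (univHom_toUniv (d := d.modP) (c.eval d f) he.isDP hn (z n)).symm.trans (h1.trans
    (fam_congr s ⟨d.modP, trivial⟩ (univHom_str (d := d.modP) _ he.isDP hn fun a => ?_)))
  have h2 : Spec.preimage (Spec.map d.toModP.ψ ≫ f) = Spec.preimage f ≫ d.toModP.ψ :=
    Spec.map_injective (by rw [Spec.map_preimage, Spec.map_comp, Spec.map_preimage])
  rw [h2]
  refine Eq.trans ?_ (congrArg d.toModP.ψ.hom (he.comm a))
  exact (congrArg (fun k : d.B ⟶ d.modP.C => k.hom (c.eval d f (algebraMap c.A c.D a)))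
    d.toModP.comm).symm

/-- A section that vanishes on the thickenings with `p ^ r = 0` is divisible by `p ^ r`. -/
theorem pow_dvd_of_famRestrict (c : PerfectChart p R) (r : ℕ) (a : fam (p := p) allData (Spec R))
    (h : famRestrict (𝒟 := modData allData r) (fun _ h => h.1) (Spec R) a = 0) :
    (p : fam (p := p) allData (Spec R)) ^ r ∣ a := by
  obtain ⟨y, rfl⟩ := c.toFam_surjective a
  obtain ⟨z, hz⟩ := PCompl.exists_mod r y
  have h1 := congrArg (fun t : fam (p := p) (modData allData r) (Spec R) =>
    t.1 ⟨c.univ r, trivial, c.univ_pow r⟩ (c.univStr r)) h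
  have h2 := (c.toFam_of_mod hz (c.univ r) (c.univStr r) (c.univ_pow r)).symm.trans h1
  rw [eval_univ] at h2
  obtain ⟨t, rfl⟩ := c.toUniv_eq_zero h2
  obtain ⟨y', rfl⟩ := PCompl.mod_zero_iff.1 (hz.of_eq (d' := 0) (-t) (by ring))
  exact ⟨c.toFam y', by rw [map_mul, map_pow, map_natCast]⟩

/-- The chart of a ring with `p`-th roots given by its sequences of successive `p`-th roots. -/
noncomputable def ofHasRoots (h : HasRoots p R) (hR : IsNilpotent (p : R)) : PerfectChart p R where
  M := Perfection R p
  bij := by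
    refine ⟨fun f g hfg => ?_, fun f => ⟨Perfection.pthRootMonoidHom R p f, ?_⟩⟩
    · ext n
      have := congrArg (Perfection.coeffMonoidHom R p (n + 1)) hfg
      simp only [map_pow] at this
      exact (f.2 n).symm.trans (this.trans (g.2 n))
    · ext n
      exact f.2 n
  nilp := hR
  θ := Perfection.coeffMonoidHom R p 0
  surj r := by
    choose s hs using h
    let m : Perfection R p := ⟨fun n => s^[n] r, fun n => by
      beta_reduce
      rw [Function.iterate_succ_apply', hs]⟩
    refine ⟨MonoidAlgebra.single m 1, (MonoidAlgebra.liftNCRingHom_single _ _ _ _ _).trans ?_⟩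
    rw [map_one, one_mul]
    rfl

end PerfectChart

theorem rootsDvd_allData {p : ℕ} [Fact p.Prime] : RootsDvd (p := p) allData.{u} :=
  fun _ hR hn r a h => (PerfectChart.ofHasRoots hR hn).pow_dvd_of_famRestrict r a h

section
variable {p : ℕ} [hp : Fact p.Prime]

/-! ### The sheaves `𝒪^cris` and `𝒪` as sheaves of compatible families -/

/-- The isomorphism between `𝒪_X^cris` and the sheaf of compatible families. -/
noncomputable def ocrisIso (p : ℕ) [Fact p.Prime] (X : Scheme.{u}) :
    ocrisSheaf p X ≅ famOver (p := p) allData X :=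
  NatIso.ofComponents (fun U => (RingEquiv.ofBijective (toFam (p := p) allData U.unop.left)
    ⟨toFam_injective _, toFam_surjective _⟩).toCommRingCatIso) fun _ => rfl

theorem isPAdicSheaf_ocris {X : Scheme.{u}} (hX : PLocNilp p X) :
    IsPAdicSheaf (prTopology p X) p (ocrisSheaf p X) :=
  isPAdicSheaf_of_iso_famOver stableFlat_allData rootsDvd_allData hX _ (ocrisIso p X)

/-- For a thickening with zero ideal, the isomorphism from `B` to `C`. -/
noncomputable def PDDatum.trivEquiv {d : PDDatum.{u} p} (h : trivData d) : d.B ≃+* d.C :=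
  RingEquiv.ofBijective d.q.hom ⟨(RingHom.injective_iff_ker_eq_bot _).2 h, d.surj⟩

/-- The compatible family on trivial thickenings given by a global function. -/
noncomputable def toTrivFam (p : ℕ) [Fact p.Prime] (U : Scheme.{u}) :
    Γ(U, ⊤) →+* fam (p := p) trivData U where
  toFun a := ⟨fun d f => (PDDatum.trivEquiv d.2).symm
      ((Scheme.ΓSpecIso d.1.C).hom.hom (f.appTop.hom a)), fun d d' g f => by
    refine (PDDatum.trivEquiv d'.2).injective ?_
    beta_reduce
    rw [RingEquiv.apply_symm_apply]
    refine (congrArg (fun k : d.1.B ⟶ d'.1.C => k.hom _) g.comm).symm.trans ?_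
    change g.ψ.hom ((PDDatum.trivEquiv d.2) _) = _
    rw [RingEquiv.apply_symm_apply, Scheme.Hom.comp_appTop]
    exact congrArg (fun k : Γ(Spec d.1.C, ⊤) ⟶ d'.1.C => k.hom (f.appTop.hom a))
      (Scheme.ΓSpecIso_naturality g.ψ).symm⟩
  map_one' := Subtype.ext (funext₂ fun d f => by simp)
  map_mul' _ _ := Subtype.ext (funext₂ fun d f => by simp)
  map_zero' := Subtype.ext (funext₂ fun d f => by simp)
  map_add' _ _ := Subtype.ext (funext₂ fun d f => by simp)

theorem q_toTrivFam {U : Scheme.{u}} (a : Γ(U, ⊤)) (d : PDDatum.{u} p) (h : trivData d)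
    (f : Spec d.C ⟶ U) : d.q.hom ((toTrivFam p U a).1 ⟨d, h⟩ f) =
      (Scheme.ΓSpecIso d.C).hom.hom (f.appTop.hom a) :=
  (PDDatum.trivEquiv h).apply_symm_apply _

theorem trivData_triv (C : CommRingCat.{u}) (h : IsNilpotent (p : C)) :
    trivData (PDDatum.triv C h) := PDDatum.ker_id_hom C

theorem toTrivFam_injective {U : Scheme.{u}} (hU : PLocNilp p U) :
    Function.Injective (toTrivFam p U) := fun a b h =>
  section_ext_of_spec hU fun C hC f => by
    have h1 := congrArg (fun t : fam (p := p) trivData U => t.1 ⟨.triv C hC, trivData_triv C hC⟩ f) h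
    exact (q_toTrivFam a _ (trivData_triv C hC) f).symm.trans
      ((congrArg _ h1).trans (q_toTrivFam b _ (trivData_triv C hC) f))

theorem q_fam_trivData {U : Scheme.{u}} (t : fam (p := p) trivData U) (d : PDDatum.{u} p)
    (h : trivData d) (f : Spec d.C ⟶ U) :
    d.q.hom (t.1 ⟨d, h⟩ f) = t.1 ⟨.triv d.C d.nilp_C, trivData_triv _ _⟩ f :=
  (t.2 ⟨d, h⟩ ⟨.triv d.C d.nilp_C, trivData_triv _ _⟩ d.toTriv f).trans (fam_congr t _ (by
    change Spec.map (𝟙 _) ≫ f = f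
    rw [Spec.map_id, Category.id_comp]))

theorem fam_trivData_map {U : Scheme.{u}} (t : fam (p := p) trivData U) {C C' : CommRingCat.{u}}
    (g : C ⟶ C') (h : IsNilpotent (p : C)) (h' : IsNilpotent (p : C')) (f : Spec C ⟶ U)
    (f' : Spec C' ⟶ U) (hf : f' = Spec.map g ≫ f) :
    g.hom (t.1 ⟨.triv C h, trivData_triv _ _⟩ f) = t.1 ⟨.triv C' h', trivData_triv _ _⟩ f' := by
  subst hf
  exact t.2 ⟨.triv C h, trivData_triv _ _⟩ ⟨.triv C' h', trivData_triv _ _⟩ (PDDatum.trivMap g h h') f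

theorem SpecMap_specRes (B : CommRingCat.{u}) (W : (Spec B).affineOpens) :
    Spec.map (specRes B W) = IsAffineOpen.fromSpec (U := W.1) W.2 := by
  rw [specRes, Spec.map_comp, ← IsAffineOpen.map_fromSpec (isAffineOpen_top (Spec B)) W.2
      (homOfLE le_top).op, IsAffineOpen.fromSpec_top]
  simp

/-- The values on the trivial thickenings of the affine open subsets of `U` glue to a global
function. -/
theorem toTrivFam_surjective {U : Scheme.{u}} (hU : PLocNilp p U) :
    Function.Surjective (toTrivFam p U) := by
  intro t
  have hn : ∀ W : U.affineOpens, IsNilpotent (p : Γ(U, W)) := fun W =>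
    isNilpotent_of_pLocNilp hU W.2
  let x : ∀ W : U.affineOpens, Γ(U, W) := fun W =>
    t.1 ⟨.triv Γ(U, W) (hn W), trivData_triv _ _⟩ (IsAffineOpen.fromSpec (U := W.1) W.2)
  obtain ⟨y, hy⟩ := exists_section x fun W W' h =>
    fam_trivData_map t (U.presheaf.map (homOfLE h).op) (hn W) (hn W') _ _
      (IsAffineOpen.map_fromSpec W.2 W'.2 (homOfLE h).op).symm
  refine ⟨y, Subtype.ext (funext₂ fun d f => ?_)⟩
  obtain ⟨d, hd⟩ := d
  refine (PDDatum.trivEquiv hd).injective ?_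
  refine (q_toTrivFam y d hd f).trans (Eq.trans ?_ (q_fam_trivData t d hd f).symm)
  refine (Scheme.ΓSpecIso d.C).commRingCatIsoToRingEquiv.symm.injective ?_
  refine section_ext fun z _ => ?_
  obtain ⟨W, -, hW⟩ := exists_affineOpens_le (⊤ : U.Opens) (t := f z) trivial
  obtain ⟨V, hV, hzV⟩ := exists_affineOpens_le (f ⁻¹ᵁ W.1) (t := z) hW
  refine ⟨V, le_top, hzV, ?_⟩
  have h1 := fam_trivData_map t (f.appLE W V hV) (hn W)
    (isNilpotent_of_pLocNilp (PDDatum.pLocNilp_Spec d.nilp_C) V.2) _ _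
    (IsAffineOpen.SpecMap_appLE_fromSpec f W.2 V.2 hV).symm
  have h2 := fam_trivData_map t (specRes d.C V) d.nilp_C
    (isNilpotent_of_pLocNilp (PDDatum.pLocNilp_Spec d.nilp_C) V.2) f
    (IsAffineOpen.fromSpec (U := V.1) V.2 ≫ f) (by rw [SpecMap_specRes])
  refine Eq.trans ?_ (h1.trans h2.symm)
  refine Eq.trans ?_ (congrArg (f.appLE W V hV).hom (hy W))
  refine (congrArg ((Spec d.C).presheaf.map (homOfLE le_top).op).hom
    ((Scheme.ΓSpecIso d.C).commRingCatIsoToRingEquiv.symm_apply_apply _)).trans ?_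
  have h3 : U.presheaf.map (homOfLE le_top).op ≫ f.appLE W V hV =
      f.appTop ≫ (Spec d.C).presheaf.map (homOfLE le_top).op := by
    rw [Scheme.Hom.map_appLE, Scheme.Hom.appLE]; rfl
  exact (congrArg (fun k : Γ(U, ⊤) ⟶ Γ(Spec d.C, V) => k.hom y) h3).symm

/-- The isomorphism between `𝒪_X` and the sheaf of compatible families on trivial thickenings. -/
noncomputable def oIso {X : Scheme.{u}} (hX : PLocNilp p X) :
    oSheaf X ≅ famOver (p := p) trivData X :=
  NatIso.ofComponents (fun U => (ULift.ringEquiv.trans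
    (RingEquiv.ofBijective (toTrivFam p U.unop.left)
      ⟨toTrivFam_injective (hX.of_hom U.unop.hom),
        toTrivFam_surjective (hX.of_hom U.unop.hom)⟩)).toCommRingCatIso) fun {U V} f => by
    ext a
    refine Subtype.ext (funext₂ fun d g => (PDDatum.trivEquiv d.2).injective ?_)
    refine (q_toTrivFam _ d.1 d.2 g).trans
      (Eq.trans ?_ (q_toTrivFam a.down d.1 d.2 (g ≫ f.unop.left)).symm)
    exact (congrArg (fun k => (Scheme.ΓSpecIso d.1.C).hom.hom (k.hom a.down))
      (Scheme.Hom.comp_appTop (g : Spec d.1.C ⟶ V.unop.left) f.unop.left)).symm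

/-- A function that vanishes modulo `p ^ r` is divisible by `p ^ r` on an affine scheme; roots are
not needed. -/
theorem rootsDvd_trivData : RootsDvd (p := p) trivData.{u} := by
  intro R _ hR r s h
  obtain ⟨a, rfl⟩ := toTrivFam_surjective (PDDatum.pLocNilp_Spec hR) s
  let C : CommRingCat.{u} := CommRingCat.of (R ⧸ Ideal.span {(p : R) ^ r})
  let g : R ⟶ C := CommRingCat.ofHom (Ideal.Quotient.mk _)
  have hC : (p : C) ^ r = 0 := by
    have : g.hom (p ^ r) = 0 := Ideal.Quotient.eq_zero_iff_mem.2 (Ideal.mem_span_singleton_self _)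
    rwa [map_pow, map_natCast] at this
  have hC' : IsNilpotent (p : C) := ⟨r, hC⟩
  have h1 := congrArg (fun t : fam (p := p) (modData trivData r) (Spec R) =>
    t.1 ⟨.triv C hC', trivData_triv _ _, hC⟩ (Spec.map g)) h
  have h2 := (q_toTrivFam a _ (trivData_triv C hC') (Spec.map g)).symm.trans h1
  have h3 : g.hom ((Scheme.ΓSpecIso R).hom.hom a) = 0 :=
    (congrArg (fun k : Γ(Spec R, ⊤) ⟶ C => k.hom a) (Scheme.ΓSpecIso_naturality g)).symm.trans h2
  obtain ⟨b, hb⟩ := Ideal.mem_span_singleton.1 (Ideal.Quotient.eq_zero_iff_mem.1 h3)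
  refine ⟨toTrivFam p _ ((Scheme.ΓSpecIso R).inv.hom b), ?_⟩
  rw [← map_natCast (toTrivFam p (Spec R)), ← map_pow, ← map_mul]
  congr 1
  refine (Scheme.ΓSpecIso R).commRingCatIsoToRingEquiv.injective ?_
  rw [map_mul, map_pow, map_natCast]
  refine Eq.trans hb (congrArg _ ?_)
  exact ((Scheme.ΓSpecIso R).commRingCatIsoToRingEquiv.apply_symm_apply b).symm

theorem isPAdicSheaf_o {X : Scheme.{u}} (hX : PLocNilp p X) :
    IsPAdicSheaf (prTopology p X) p (oSheaf X) :=
  isPAdicSheaf_of_iso_famOver stableFlat_trivData rootsDvd_trivData hX _ (oIso hX)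

/-- Over a ring with `p`-th roots, every function lifts to a section of `𝒪^cris`. -/
theorem exists_ocrisToO_eq {R : CommRingCat.{u}} (h : HasRoots p R) (hR : IsNilpotent (p : R))
    (hR' : PLocNilp p (Spec R)) (b : Γ(Spec R, ⊤)) : ∃ s, ocrisToO hR' s = b := by
  let c := PerfectChart.ofHasRoots h hR
  obtain ⟨a, ha⟩ := c.surj ((Scheme.ΓSpecIso R).hom.hom b)
  obtain ⟨s, hs⟩ := toFam_surjective (Spec R)
    (c.toFam (PCompl.of p c.D (algebraMap c.A c.D a)))
  refine ⟨s, (Scheme.ΓSpecIso R).commRingCatIsoToRingEquiv.injective ?_⟩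
  have h1 := toFam_triv hR' s R hR (𝟙 _)
  rw [hs, Scheme.Hom.id_appTop] at h1
  refine h1.symm.trans ((c.toFam_of _ (.triv R hR) (𝟙 _)).trans ?_)
  refine ((c.isEval_eval (.triv R hR) (𝟙 _)).comm a).trans ?_
  have h2 : Spec.preimage (𝟙 (Spec R)) = 𝟙 R :=
    Spec.map_injective (by rw [Spec.map_preimage, Spec.map_id])
  exact (congrArg (fun k : R ⟶ R => k.hom (c.π a)) h2).trans ha

theorem isLocallySurjective_ocrisToO {X : Scheme.{u}} (hX : PLocNilp p X) :
    Presheaf.IsLocallySurjective (prTopology p X) (ocrisToOSheaf p hX) where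
  imageSieve_mem {U} s := mem_prTopology_of_roots hX U _ fun R h hR g => by
    obtain ⟨t, ht⟩ := exists_ocrisToO_eq h hR
      (hX.of_hom (Over.mk (g ≫ U.hom)).hom) (g.appTop.hom s.down)
    exact ⟨t, congrArg ULift.up ht⟩

end

section
variable {p : ℕ} [hp : Fact p.Prime]

/-! ### The Witt vector thickenings -/

namespace PDDatum
variable (d : PDDatum.{u} p)

theorem p_mem_ker_modP : (p : d.B) ∈ RingHom.ker d.modP.q.hom :=
  d.ker_modP ▸ Ideal.mem_sup_right (Ideal.mem_span_singleton_self _)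

/-- The thickening `Spec C/p → Spec W₂(B)` given by a thickening `Spec C → Spec B`. -/
noncomputable def witt : PDDatum.{u} p where
  B := CommRingCat.of (W2 p d.B)
  C := d.modP.C
  q := CommRingCat.ofHom (W2.fst p d.B) ≫ d.modP.q
  surj := d.modP.surj.comp fun b => ⟨W2.teich p b, rfl⟩
  nilp := W2.isNilpotent_p d.nilp
  dp := W2.dividedPowers (padicMap d.nilp) d.modP.dp
  compat := (gammaCompat_iff _ _).1 (W2.gammaCompat d.modP.gammaCompat d.p_mem_ker_modP)

theorem modP_frob (x y : d.modP.B) :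
    d.modP.q.hom (x ^ p + p * y) = d.modP.q.hom x ^ p := by
  rw [map_add, map_pow, map_mul, map_natCast, p_modP, zero_mul, add_zero]

theorem isDPMorphism_fst : d.witt.dp.IsDPMorphism d.modP.dp (W2.fst p d.B) :=
  W2.isDPMorphism_fst (padicMap d.nilp) d.modP.dp

theorem isDPMorphism_ghostHom : d.witt.dp.IsDPMorphism d.modP.dp (W2.ghostHom p d.B) :=
  W2.isDPMorphism_ghostHom d.modP.gammaCompat d.p_mem_ker_modP

/-- The first component as a homomorphism of thickenings. -/
noncomputable def fstHom : d.witt.Hom d.modP where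
  φ := CommRingCat.ofHom (W2.fst p d.B)
  ψ := 𝟙 _
  comm := Category.comp_id _
  isDP := d.isDPMorphism_fst

/-- The second ghost component as a homomorphism of thickenings; it induces the Frobenius
on `C / p`. -/
noncomputable def ghostHom : d.witt.Hom d.modP where
  φ := CommRingCat.ofHom (W2.ghostHom p d.B)
  ψ := CommRingCat.ofHom (frobHom p d.modP.C d.p_modP)
  comm := by
    ext x
    exact (d.modP_frob x.c0 x.c1).symm
  isDP := d.isDPMorphism_ghostHom

variable {d}

/-- The functoriality of the Witt vector thickening. -/
noncomputable def Hom.witt {d' : PDDatum.{u} p} (g : d.Hom d') : d.witt.Hom d'.witt where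
  φ := CommRingCat.ofHom (W2.map g.φ.hom)
  ψ := g.modP.ψ
  comm := by
    ext x
    exact congrArg (fun k : d.B ⟶ d'.modP.C => k.hom x.c0) g.modP.comm
  isDP := W2.isDPMorphism_map g.modP.isDP (padicInt_ringHom_ext d'.nilp _ _)

end PDDatum

variable {U : Scheme.{u}}

/-- The value of a section at a Witt vector thickening. -/
noncomputable def wittVal (d : PDDatum.{u} p) (f : Spec d.C ⟶ U) :
    fam (p := p) allData U →+* W2 p d.B where
  toFun t := t.1 ⟨d.witt, trivial⟩ (Spec.map d.toModP.ψ ≫ f)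
  map_one' := rfl
  map_mul' _ _ := rfl
  map_zero' := rfl
  map_add' _ _ := rfl

theorem wittVal_c0 (t : fam (p := p) allData U) (d : PDDatum.{u} p) (f : Spec d.C ⟶ U) :
    (wittVal d f t).c0 = t.1 ⟨d, trivial⟩ f := by
  refine Eq.trans ?_ (d.fam_modP t f)
  refine (t.2 ⟨d.witt, trivial⟩ ⟨d.modP, trivial⟩ d.fstHom (Spec.map d.toModP.ψ ≫ f)).trans
    (fam_congr t ⟨d.modP, trivial⟩ ?_)
  change Spec.map (𝟙 _) ≫ _ = _
  rw [Spec.map_id]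
  exact Category.id_comp _

theorem map_wittVal (t : fam (p := p) allData U) {d d' : PDDatum.{u} p} (g : d.Hom d')
    (f : Spec d.C ⟶ U) :
    W2.map g.φ.hom (wittVal d f t) = wittVal d' (Spec.map g.ψ ≫ f) t := by
  refine (t.2 ⟨d.witt, trivial⟩ ⟨d'.witt, trivial⟩ g.witt (Spec.map d.toModP.ψ ≫ f)).trans
    (fam_congr t ⟨d'.witt, trivial⟩ ?_)
  change Spec.map g.modP.ψ ≫ Spec.map d.toModP.ψ ≫ f = Spec.map d'.toModP.ψ ≫ Spec.map g.ψ ≫ f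
  rw [← Category.assoc, ← Spec.map_comp, ← Category.assoc, ← Spec.map_comp,
    PDDatum.toModP_comp_modP]

/-- The Frobenius lift on compatible families. -/
noncomputable def famSigma (U : Scheme.{u}) : fam (p := p) allData U →+* fam (p := p) allData U where
  toFun t := ⟨fun d f => W2.ghostHom p d.1.B (wittVal d.1 f t), fun d d' g f => by
    beta_reduce
    rw [← map_wittVal]
    exact W2.map_ghostHom g.φ.hom (wittVal d.1 f t)⟩
  map_one' := Subtype.ext (funext₂ fun d f => by simp)
  map_mul' _ _ := Subtype.ext (funext₂ fun d f => by simp)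
  map_zero' := Subtype.ext (funext₂ fun d f => by simp)
  map_add' _ _ := Subtype.ext (funext₂ fun d f => by simp)

/-- The second Witt components of a section. -/
noncomputable def famDelta (t : fam (p := p) allData U) : fam (p := p) allData U :=
  ⟨fun d f => (wittVal d.1 f t).c1, fun d d' g f => by
    beta_reduce
    rw [← map_wittVal]
    rfl⟩

theorem famSigma_eq (t : fam (p := p) allData U) : famSigma U t = t ^ p + p * famDelta t := by
  refine Subtype.ext (funext₂ fun d f => ?_)
  refine (W2.ghostHom_apply _).trans ?_
  rw [wittVal_c0]
  have h : ((p : fam (p := p) allData U) : ∀ d : {d : PDDatum.{u} p // allData d},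
      (Spec d.1.C ⟶ U) → d.1.B) d f = p := by simp
  change _ = t.1 d f ^ p + ((p : fam (p := p) allData U) : ∀ d : {d : PDDatum.{u} p // allData d},
      (Spec d.1.C ⟶ U) → d.1.B) d f * _
  rw [h]; rfl

/-- A section with values in the ideals of the thickenings. -/
def FamKer (t : fam (p := p) allData U) : Prop :=
  ∀ (d : PDDatum.{u} p) (f : Spec d.C ⟶ U), d.q.hom (t.1 ⟨d, trivial⟩ f) = 0

theorem FamKer.wittVal_mem {t : fam (p := p) allData U} (ht : FamKer t) (d : PDDatum.{u} p)
    (f : Spec d.C ⟶ U) : (wittVal d f t).c0 ∈ RingHom.ker d.modP.q.hom := by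
  rw [wittVal_c0, d.ker_modP]
  exact Ideal.mem_sup_left (ht d f)

/-- The divided Frobenius on compatible families. -/
noncomputable def famDiv (t : fam (p := p) allData U) (ht : FamKer t) : fam (p := p) allData U :=
  ⟨fun d f => W2.frobDiv d.1.modP.dp (wittVal d.1 f t), fun d d' g f => by
    beta_reduce
    rw [← map_wittVal]
    exact W2.map_frobDiv g.modP.isDP (ht.wittVal_mem d.1 f)⟩

theorem famDiv_add {t t' : fam (p := p) allData U} (ht : FamKer t) (ht' : FamKer t')
    (h : FamKer (t + t')) : famDiv (t + t') h = famDiv t ht + famDiv t' ht' := by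
  refine Subtype.ext (funext₂ fun d f => ?_)
  change W2.frobDiv d.1.modP.dp (wittVal d.1 f (t + t')) = _
  rw [map_add]
  exact W2.frobDiv_add _ (ht.wittVal_mem d.1 f) (ht'.wittVal_mem d.1 f)

theorem famDiv_mul (a : fam (p := p) allData U) {t : fam (p := p) allData U} (ht : FamKer t)
    (h : FamKer (a * t)) : famDiv (a * t) h = famSigma U a * famDiv t ht := by
  refine Subtype.ext (funext₂ fun d f => ?_)
  change W2.frobDiv d.1.modP.dp (wittVal d.1 f (a * t)) = _
  rw [map_mul]
  exact W2.frobDiv_mul _ _ (ht.wittVal_mem d.1 f)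

theorem p_mul_famDiv {t : fam (p := p) allData U} (ht : FamKer t) :
    (p : fam (p := p) allData U) * famDiv t ht = famSigma U t := by
  refine Subtype.ext (funext₂ fun d f => ?_)
  refine Eq.trans ?_ (W2.p_mul_frobDiv d.1.modP.dp (ht.wittVal_mem d.1 f))
  have h : ((p : fam (p := p) allData U) : ∀ d : {d : PDDatum.{u} p // allData d},
      (Spec d.1.C ⟶ U) → d.1.B) d f = p := by simp
  change ((p : fam (p := p) allData U) : ∀ d : {d : PDDatum.{u} p // allData d},
      (Spec d.1.C ⟶ U) → d.1.B) d f * _ = _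
  rw [h]; rfl

theorem famDiv_p (h : FamKer (p : fam (p := p) allData U)) : famDiv _ h = 1 := by
  refine Subtype.ext (funext₂ fun d f => ?_)
  change W2.frobDiv d.1.modP.dp (wittVal d.1 f _) = 1
  rw [map_natCast]
  exact W2.frobDiv_natCast_p d.1.modP.gammaCompat d.1.p_mem_ker_modP

theorem famMap_famSigma {U' : Scheme.{u}} (h : U' ⟶ U) (t : fam (p := p) allData U) :
    famMap allData h (famSigma U t) = famSigma U' (famMap allData h t) :=
  Subtype.ext (funext₂ fun d f => congrArg (W2.ghostHom p d.1.B)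
    (fam_congr t ⟨d.1.witt, trivial⟩ (Category.assoc _ _ _).symm))

theorem famMap_famDiv {U' : Scheme.{u}} (h : U' ⟶ U) (t : fam (p := p) allData U) (ht : FamKer t)
    (ht' : FamKer (famMap allData h t)) :
    famMap allData h (famDiv t ht) = famDiv (famMap allData h t) ht' :=
  Subtype.ext (funext₂ fun d f => congrArg (W2.frobDiv d.1.modP.dp)
    (fam_congr t ⟨d.1.witt, trivial⟩ (Category.assoc _ _ _).symm))

theorem famKer_toFam (hU : PLocNilp p U) {s : ocris p U} (hs : ocrisToO hU s = 0) :
    FamKer (toFam allData U s) := fun d f => by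
  rw [fam_triv, toFam_triv hU, hs, map_zero, map_zero]

/-! ### The Frobenius lift of `𝒪^cris` -/

/-- The isomorphism between `𝒪^cris(U)` and the ring of compatible families. -/
noncomputable def famEquiv (p : ℕ) [Fact p.Prime] (U : Scheme.{u}) :
    ocris p U ≃+* fam (p := p) allData U :=
  RingEquiv.ofBijective (toFam allData U) ⟨toFam_injective _, toFam_surjective _⟩

theorem famEquiv_ocrisMap {U' : Scheme.{u}} (h : U' ⟶ U) (s : ocris p U) :
    famEquiv p U' (ocrisMap p h s) = famMap allData h (famEquiv p U s) := rfl

/-- The Frobenius lift of `𝒪^cris(U)`. -/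
noncomputable def crisSigma (p : ℕ) [Fact p.Prime] (U : Scheme.{u}) : ocris p U →+* ocris p U :=
  (famEquiv p U).symm.toRingHom.comp ((famSigma U).comp (toFam allData U))

theorem famEquiv_crisSigma (s : ocris p U) :
    famEquiv p U (crisSigma p U s) = famSigma U (famEquiv p U s) :=
  (famEquiv p U).apply_symm_apply (famSigma U (famEquiv p U s))

theorem ocrisMap_crisSigma {U' : Scheme.{u}} (h : U' ⟶ U) (s : ocris p U) :
    crisSigma p U' (ocrisMap p h s) = ocrisMap p h (crisSigma p U s) := by
  refine (famEquiv p _).injective ?_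
  rw [famEquiv_crisSigma, famEquiv_ocrisMap, famEquiv_ocrisMap, famEquiv_crisSigma,
    famMap_famSigma]

/-- The Frobenius lift of the sheaf `𝒪_X^cris`. -/
noncomputable def crisSigmaSheaf (p : ℕ) [Fact p.Prime] (X : Scheme.{u}) :
    ocrisSheaf p X ⟶ ocrisSheaf p X where
  app U := CommRingCat.ofHom (crisSigma p U.unop.left)
  naturality U V f := by
    ext s
    exact ocrisMap_crisSigma f.unop.left s

theorem absFrob_comp {Y W : Scheme.{u}} (hY : (p : Γ(Y, ⊤)) = 0) (hW : (p : Γ(W, ⊤)) = 0)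
    (h : Y ⟶ W) : absFrob p Y hY ≫ h = h ≫ absFrob p W hW := by
  refine Scheme.Hom.ext rfl fun V => ?_
  refine (congrArg ((absFrob p Y hY ≫ h).app V ≫ ·) (Y.presheaf.map_id _)).trans ?_
  ext x
  exact (map_pow (h.app V).hom x p).symm

theorem absFrob_Spec {C : CommRingCat.{u}} (hC : (p : C) = 0) (hC' : (p : Γ(Spec C, ⊤)) = 0) :
    absFrob p (Spec C) hC' = Spec.map (CommRingCat.ofHom (frobHom p C hC)) := by
  refine ext_of_isAffine ?_
  rw [← cancel_mono (Scheme.ΓSpecIso C).hom, Scheme.ΓSpecIso_naturality]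
  ext x
  exact (map_pow (Scheme.ΓSpecIso C).hom.hom x p)

theorem SpecMap_frobHom_comp {C : CommRingCat.{u}} (hC : (p : C) = 0) {W : Scheme.{u}}
    (hW : (p : Γ(W, ⊤)) = 0) (h : Spec C ⟶ W) :
    Spec.map (CommRingCat.ofHom (frobHom p C hC)) ≫ h = h ≫ absFrob p W hW := by
  have hC' : (p : Γ(Spec C, ⊤)) = 0 := by
    rw [← map_natCast h.appTop.hom, hW, map_zero]
  rw [← absFrob_Spec hC hC']
  exact absFrob_comp hC' hW h

/-- Over a scheme of characteristic `p` the map `famSigma` is the pullback along the Frobenius,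
because the second ghost component is a homomorphism of thickenings that induces the Frobenius on `C
/ p`. -/
theorem famSigma_eq_of_comp (t : fam (p := p) allData U) {W : Scheme.{u}}
    (hW : (p : Γ(W, ⊤)) = 0) (h : W ⟶ U) (d : PDDatum.{u} p) (f : Spec d.C ⟶ W) :
    (famSigma U t).1 ⟨d, trivial⟩ (f ≫ h) = t.1 ⟨d, trivial⟩ ((f ≫ absFrob p W hW) ≫ h) := by
  refine Eq.trans ?_ (d.fam_modP t _)
  refine (t.2 ⟨d.witt, trivial⟩ ⟨d.modP, trivial⟩ d.ghostHom
    (Spec.map d.toModP.ψ ≫ f ≫ h)).trans (fam_congr t ⟨d.modP, trivial⟩ ?_)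
  have h1 := SpecMap_frobHom_comp d.p_modP hW (Spec.map d.toModP.ψ ≫ f)
  have h2 := congrArg (· ≫ h) h1
  simp only [Category.assoc] at h2 ⊢
  exact h2

theorem isCrisFrobenius_crisSigma (X : Scheme.{u}) : IsCrisFrobenius p X (crisSigmaSheaf p X) := by
  intro U W hW f s
  refine (famEquiv p W).injective (Subtype.ext (funext₂ fun d g => ?_))
  have h := congrArg (fun t : fam (p := p) allData U.left => t.1 d (g ≫ f)) (famEquiv_crisSigma s)
  exact h.trans (famSigma_eq_of_comp _ hW f d.1 g)

/-- The value of a section on a thickening `Spec C → Spec B` is its value on `Spec C/p → Spec B`,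
where the endomorphism is determined by the Frobenius. -/
theorem IsCrisFrobenius.unique {X : Scheme.{u}} {τ τ' : ocrisSheaf p X ⟶ ocrisSheaf p X}
    (h : IsCrisFrobenius p X τ) (h' : IsCrisFrobenius p X τ') : τ = τ' := by
  ext U s
  refine (famEquiv p U.unop.left).injective (Subtype.ext (funext₂ fun d f => ?_))
  obtain ⟨d, -⟩ := d
  have hp0 : (p : Γ(Spec d.modP.C, ⊤)) = 0 := by
    have := congrArg (Scheme.ΓSpecIso d.modP.C).inv.hom d.p_modP
    rwa [map_natCast, map_zero] at this
  have h1 := (h U.unop (Spec d.modP.C) hp0 (Spec.map d.toModP.ψ ≫ f) s).trans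
    (h' U.unop (Spec d.modP.C) hp0 (Spec.map d.toModP.ψ ≫ f) s).symm
  have h2 := congrArg (fun t : ocris p (Spec d.modP.C) =>
    (toFam allData _ t).1 ⟨d.modP, trivial⟩ (𝟙 _)) h1
  have h3 : ∀ t : fam (p := p) allData U.unop.left,
      t.1 ⟨d.modP, trivial⟩ (𝟙 _ ≫ Spec.map d.toModP.ψ ≫ f) = t.1 ⟨d, trivial⟩ f := fun t =>
    (fam_congr t ⟨d.modP, trivial⟩ (Category.id_comp _)).trans (d.fam_modP t f)
  exact (h3 (famEquiv p _ ((τ.app U).hom s))).symm.trans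
    (h2.trans (h3 (famEquiv p _ ((τ'.app U).hom s))))

/-! ### The divided Frobenius of `𝒪^cris` -/

/-- The divided Frobenius on the kernel of `𝒪^cris(U) → 𝒪(U)`. -/
noncomputable def crisDiv (hU : PLocNilp p U) (s : ocris p U) (hs : ocrisToO hU s = 0) :
    ocris p U := (famEquiv p U).symm (famDiv _ (famKer_toFam hU hs))

theorem famEquiv_crisDiv (hU : PLocNilp p U) (s : ocris p U) (hs : ocrisToO hU s = 0) :
    famEquiv p U (crisDiv hU s hs) = famDiv _ (famKer_toFam hU hs) :=
  (famEquiv p U).apply_symm_apply _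

theorem famDiv_congr {t t' : fam (p := p) allData U} (h : t = t') (ht : FamKer t)
    (ht' : FamKer t') : famDiv t ht = famDiv t' ht' := by
  subst h; rfl

theorem crisDiv_add (hU : PLocNilp p U) {s s' : ocris p U} (hs : ocrisToO hU s = 0)
    (hs' : ocrisToO hU s' = 0) (h : ocrisToO hU (s + s') = 0) :
    crisDiv hU (s + s') h = crisDiv hU s hs + crisDiv hU s' hs' := by
  refine (famEquiv p U).injective ?_
  rw [map_add, famEquiv_crisDiv, famEquiv_crisDiv, famEquiv_crisDiv]
  refine (famDiv_congr (map_add _ _ _) _ ?_).trans (famDiv_add _ _ ?_)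
  all_goals rw [← map_add]; exact famKer_toFam hU h

theorem crisDiv_mul (hU : PLocNilp p U) (a : ocris p U) {s : ocris p U} (hs : ocrisToO hU s = 0)
    (h : ocrisToO hU (a * s) = 0) : crisDiv hU (a * s) h = crisSigma p U a * crisDiv hU s hs := by
  refine (famEquiv p U).injective ?_
  rw [map_mul, famEquiv_crisDiv, famEquiv_crisDiv, famEquiv_crisSigma]
  refine (famDiv_congr (map_mul _ _ _) _ ?_).trans (famDiv_mul _ _ ?_)
  all_goals rw [← map_mul]; exact famKer_toFam hU h

theorem p_mul_crisDiv (hU : PLocNilp p U) {s : ocris p U} (hs : ocrisToO hU s = 0) :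
    (p : ocris p U) * crisDiv hU s hs = crisSigma p U s := by
  refine (famEquiv p U).injective ?_
  rw [map_mul, map_natCast, famEquiv_crisDiv, p_mul_famDiv, famEquiv_crisSigma]
  rfl

theorem crisDiv_p (hU : PLocNilp p U) (h : ocrisToO hU (p : ocris p U) = 0) :
    crisDiv hU p h = 1 := by
  refine (famEquiv p U).injective ?_
  rw [map_one, famEquiv_crisDiv]
  refine (famDiv_congr (map_natCast _ _) _ ?_).trans (famDiv_p ?_)
  all_goals rw [← map_natCast (toFam allData U)]; exact famKer_toFam hU h

theorem ocrisMap_crisDiv {U' : Scheme.{u}} (g : U' ⟶ U) (hU : PLocNilp p U) (hU' : PLocNilp p U')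
    (s : ocris p U) (hs : ocrisToO hU s = 0) (h : ocrisToO hU' (ocrisMap p g s) = 0) :
    crisDiv hU' (ocrisMap p g s) h = ocrisMap p g (crisDiv hU s hs) := by
  refine (famEquiv p U').injective ?_
  rw [famEquiv_ocrisMap, famEquiv_crisDiv, famEquiv_crisDiv]
  exact (famMap_famDiv g _ (famKer_toFam hU hs) (famKer_toFam hU' h)).symm

theorem crisSigma_eq (s : ocris p U) :
    crisSigma p U s = s ^ p + p * (famEquiv p U).symm (famDelta (famEquiv p U s)) := by
  refine (famEquiv p U).injective ?_
  rw [famEquiv_crisSigma, famSigma_eq, map_add, map_pow, map_mul, map_natCast,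
    RingEquiv.apply_symm_apply]

theorem ocrisToO_of_mem_ker {X : Scheme.{u}} (hX : PLocNilp p X) {U : (Over X)ᵒᵖ}
    (x : RingHom.ker ((ocrisToOSheaf p hX).app U).hom) :
    ocrisToO (hX.of_hom U.unop.hom) x.1 = 0 := congrArg ULift.down x.2

/-- The divided Frobenius of the sheaves `𝒪_X^cris`. -/
noncomputable def crisSigmaOne (p : ℕ) [Fact p.Prime] :
    SigmaOneFamily.{u} p (fun X _ => crisSigmaSheaf p X) := fun X hX U =>
  { toFun := fun x => crisDiv (hX.of_hom U.unop.hom) x.1 (ocrisToO_of_mem_ker hX x)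
    map_add' := fun x y => crisDiv_add _ (ocrisToO_of_mem_ker hX x) (ocrisToO_of_mem_ker hX y) _
    map_smul' := fun a x => crisDiv_mul _ a (ocrisToO_of_mem_ker hX x) _ }

theorem isFunctorialSigmaOne_crisSigmaOne :
    IsFunctorialSigmaOne.{u} p (fun X _ => crisSigmaSheaf p X) (crisSigmaOne p) where
  natural X hX U V f x y h := by
    obtain ⟨y, hy⟩ := y
    obtain rfl : y = _ := h
    exact ocrisMap_crisDiv f.unop.left (hX.of_hom U.unop.hom) (hX.of_hom V.unop.hom) x.1
      (ocrisToO_of_mem_ker hX x) (congrArg ULift.down hy)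
  p_mul X hX U x := p_mul_crisDiv (hX.of_hom U.unop.hom) (ocrisToO_of_mem_ker hX x)
  functorial X' X hX' hX f U x := rfl

theorem isSheafFrame_cris {X : Scheme.{u}} (hX : PLocNilp p X) :
    IsSheafFrame (prTopology p X) p (ocrisToOSheaf p hX) (crisSigmaSheaf p X)
      (crisSigmaOne p X hX) where
  pAdic_A := isPAdicSheaf_ocris hX
  pAdic_R := isPAdicSheaf_o hX
  surjective := isLocallySurjective_ocrisToO hX
  frobenius U a := toPQuotSheaf_eq_of_sub_eq _ p U _ a _ (crisSigma_eq (U := U.unop.left) a)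
  natural _ _ f x y h := isFunctorialSigmaOne_crisSigmaOne.natural X hX f x y h
  p_mul U x := isFunctorialSigmaOne_crisSigmaOne.p_mul X hX U x

theorem crisSigmaOne_p {X : Scheme.{u}} (hX : PLocNilp p X) (h0 : (p : Γ(X, ⊤)) = 0)
    (U : (Over X)ᵒᵖ) : ∃ h : (p : (ocrisSheaf p X).obj U) ∈
      RingHom.ker ((ocrisToOSheaf p hX).app U).hom, crisSigmaOne p X hX U ⟨p, h⟩ = 1 := by
  have h1 : (p : (oSheaf X).obj U) = 0 := by
    refine ULift.down_injective ?_
    have := congrArg U.unop.hom.appTop.hom h0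
    rwa [map_natCast, map_zero] at this
  have h2 : (p : (ocrisSheaf p X).obj U) ∈ RingHom.ker ((ocrisToOSheaf p hX).app U).hom :=
    (map_natCast ((ocrisToOSheaf p hX).app U).hom p).trans h1
  exact ⟨h2, crisDiv_p (hX.of_hom U.unop.hom) (ocrisToO_of_mem_ker hX ⟨_, h2⟩)⟩

end

/-! ### The free commutative monoid with `p`-power roots -/

section RootMonoid
variable (p : ℕ) [hp : Fact p.Prime] (S : Type u)

/-- The additive monoid of finitely supported families of non-negative elements of `ℤ[1/p]`. -/
def rootLattice : AddSubmonoid (S →₀ ℚ) where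
  carrier := {f | ∃ (k : ℕ) (n : S →₀ ℕ), ∀ s, (p : ℚ) ^ k * f s = n s}
  zero_mem' := ⟨0, 0, fun s => by simp⟩
  add_mem' := by
    rintro f f' ⟨k, n, h⟩ ⟨k', n', h'⟩
    refine ⟨k + k', p ^ k' • n + p ^ k • n', fun s => ?_⟩
    simp only [Finsupp.add_apply, Finsupp.smul_apply, smul_eq_mul, Nat.cast_add, Nat.cast_mul,
      Nat.cast_pow, ← h, ← h']
    ring

/-- The free commutative monoid on `S` in which all elements have unique `p`-power roots. -/
abbrev RootMonoid : Type u := Multiplicative (rootLattice p S)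

variable {S}

/-- The generator given by `s`. -/
noncomputable def RootMonoid.X (s : S) : RootMonoid p S :=
  Multiplicative.ofAdd ⟨Finsupp.single s 1, 0, Finsupp.single s 1, fun t => by
    classical
    simp only [pow_zero, one_mul, Finsupp.single_apply]
    split_ifs <;> simp⟩

instance : TwoUniqueSums (rootLattice p S) :=
  TwoUniqueSums.of_injective_addHom (rootLattice p S).subtype.toAddHom Subtype.val_injective
    inferInstance

namespace RootMonoid

theorem bijective_pow : Function.Bijective fun x : RootMonoid p S => x ^ p := by
  have hp0 : (p : ℚ) ≠ 0 := Nat.cast_ne_zero.2 hp.out.ne_zero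
  refine ⟨fun x y h => ?_, fun x => ?_⟩
  · have h1 : ∀ s, (p : ℚ) * x.toAdd.1 s = p * y.toAdd.1 s := fun s => by
      have := congrArg (fun z : RootMonoid p S => z.toAdd.1 s) h
      simpa using this
    exact Multiplicative.toAdd.injective (Subtype.ext (Finsupp.ext fun s =>
      mul_left_cancel₀ hp0 (h1 s)))
  · obtain ⟨k, n, h⟩ := x.toAdd.2
    refine ⟨Multiplicative.ofAdd ⟨(p : ℚ)⁻¹ • x.toAdd.1, k + 1, n, fun s => ?_⟩,
      Multiplicative.toAdd.injective (Subtype.ext (Finsupp.ext fun s => ?_))⟩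
    · rw [← h, Finsupp.smul_apply, smul_eq_mul, pow_succ, mul_assoc, mul_inv_cancel_left₀ hp0]
    · change (p • ((p : ℚ)⁻¹ • x.toAdd.1)) s = _
      rw [Finsupp.smul_apply, Finsupp.smul_apply, nsmul_eq_mul, smul_eq_mul,
        mul_inv_cancel_left₀ hp0]

variable {p} {M : Type v} [CommMonoid M]

/-- The element `r` of `M` is the image of `f` under the homomorphism given by `v`. -/
def Rel (v : S → M) (f : S →₀ ℚ) (r : M) : Prop :=
  ∃ (k : ℕ) (n : S →₀ ℕ), (∀ s, (p : ℚ) ^ k * f s = n s) ∧ r ^ p ^ k = n.prod fun s j => v s ^ j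

theorem prod_smul (v : S → M) (c : ℕ) (n : S →₀ ℕ) :
    (c • n).prod (fun s j => v s ^ j) = (n.prod fun s j => v s ^ j) ^ c := by
  induction c with
  | zero => rw [zero_smul, Finsupp.prod_zero_index, pow_zero]
  | succ c ih =>
    rw [succ_nsmul, Finsupp.prod_add_index' (fun s => pow_zero _) (fun s i j => pow_add _ _ _), ih,
      pow_succ]

theorem Rel.mul {v : S → M} {f f' : S →₀ ℚ} {r r' : M} (h : Rel (p := p) v f r)
    (h' : Rel (p := p) v f' r') : Rel (p := p) v (f + f') (r * r') := by
  obtain ⟨k, n, h1, h2⟩ := h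
  obtain ⟨k', n', h1', h2'⟩ := h'
  refine ⟨k + k', p ^ k' • n + p ^ k • n', fun s => ?_, ?_⟩
  · simp only [Finsupp.add_apply, Finsupp.smul_apply, smul_eq_mul, Nat.cast_add, Nat.cast_mul,
      Nat.cast_pow, ← h1, ← h1']
    ring
  · rw [Finsupp.prod_add_index' (fun s => pow_zero _) (fun s i j => pow_add _ _ _), prod_smul,
      prod_smul, ← h2, ← h2', mul_pow, ← pow_mul, ← pow_mul, ← pow_add, ← pow_add, add_comm k' k]

theorem Rel.unique (hM : Function.Bijective fun x : M => x ^ p) {v : S → M} {f : S →₀ ℚ} {r r' : M}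
    (h : Rel (p := p) v f r) (h' : Rel (p := p) v f r') : r = r' := by
  obtain ⟨k, n, h1, h2⟩ := h
  obtain ⟨k', n', h1', h2'⟩ := h'
  have h3 : p ^ k' • n = p ^ k • n' := by
    refine Finsupp.ext fun s => Nat.cast_injective (R := ℚ) ?_
    simp only [Finsupp.smul_apply, smul_eq_mul, Nat.cast_mul, Nat.cast_pow, ← h1, ← h1']
    ring
  refine (PDDatum.bijective_pow_pow hM (k + k')).1 ?_
  change r ^ p ^ (k + k') = r' ^ p ^ (k + k')
  rw [pow_add, pow_mul, h2, ← prod_smul, h3, prod_smul, ← h2', ← pow_mul, mul_comm]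

/-- The homomorphism from the free monoid with `p`-power roots given by a family of elements. -/
theorem exists_lift (hM : Function.Bijective fun x : M => x ^ p) (v : S → M) :
    ∃ φ : RootMonoid p S →* M, ∀ s, φ (X p s) = v s := by
  have hex : ∀ x : RootMonoid p S, ∃ r, Rel (p := p) v x.toAdd.1 r := fun x => by
    obtain ⟨k, n, h⟩ := x.toAdd.2
    obtain ⟨r, hr⟩ := (PDDatum.bijective_pow_pow hM k).2 (n.prod fun s j => v s ^ j)
    exact ⟨r, k, n, h, hr⟩
  choose φ hφ using hex
  refine ⟨⟨⟨φ, ?_⟩, fun x y => ?_⟩, fun s => ?_⟩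
  · exact (hφ 1).unique hM ⟨0, 0, fun s => by simp, by simp⟩
  · exact (hφ (x * y)).unique hM ((hφ x).mul (hφ y))
  · refine (hφ (X p s)).unique hM ⟨0, Finsupp.single s 1, fun t => ?_, by simp⟩
    classical
    change _ * (Finsupp.single s (1 : ℚ)) t = _
    simp only [pow_zero, one_mul, Finsupp.single_apply]
    split_ifs <;> simp

end RootMonoid

/-! ### Monoid algebras over `ℤ_p` -/

theorem monoidAlgebra_natTorsionFree (M : Type u) [CommMonoid M] :
    NatTorsionFree (MonoidAlgebra ℤ_[p] M) :=
  NatTorsionFree.of_basis NatTorsionFree.of_charZero_domain (MonoidAlgebra.basis M ℤ_[p])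

variable {p}

theorem exists_eq_p_mul_of_mapRingHom {M : Type u} [CommMonoid M] {x : MonoidAlgebra ℤ_[p] M}
    (h : MonoidAlgebra.mapRingHom M (PadicInt.toZMod (p := p)) x = 0) : ∃ b, x = p * b := by
  have h1 : ∀ m, ∃ b, x.coeff m = p * b := fun m => by
    have : PadicInt.toZMod (x.coeff m) = 0 := by
      rw [← MonoidAlgebra.coeff_mapRingHom, h]; rfl
    rw [← RingHom.mem_ker, PadicInt.ker_toZMod, PadicInt.maximalIdeal_eq_span_p] at this
    exact Ideal.mem_span_singleton.1 this
  choose b hb using h1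
  refine ⟨∑ m ∈ x.coeff.support, MonoidAlgebra.single m (b m), ?_⟩
  have h2 : ∀ m, (p : MonoidAlgebra ℤ_[p] M) * MonoidAlgebra.single m (b m) =
      MonoidAlgebra.single m (x.coeff m) := fun m => by
    rw [hb, ← nsmul_eq_mul, ← nsmul_eq_mul, MonoidAlgebra.smul_single]
  rw [Finset.mul_sum, Finset.sum_congr rfl fun m _ => h2 m]
  exact (MonoidAlgebra.sum_coeff_single x).symm

/-- The monoid algebra over `𝔽_p` of a monoid with two unique products is a domain. -/
theorem exists_eq_p_mul_of_mul {M : Type u} [CommMonoid M] [TwoUniqueProds M]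
    {x a : MonoidAlgebra ℤ_[p] M} (hx : ¬ ∃ b, x = p * b) (h : ∃ b, x * a = p * b) :
    ∃ b, a = p * b := by
  obtain ⟨b, hb⟩ := h
  have h1 := congrArg (MonoidAlgebra.mapRingHom M (PadicInt.toZMod (p := p))) hb
  have h2 : (p : MonoidAlgebra (ZMod p) M) = 0 := by
    rw [← map_natCast (algebraMap (ZMod p) (MonoidAlgebra (ZMod p) M)), CharP.cast_eq_zero, map_zero]
  rw [map_mul, map_mul, map_natCast, h2, zero_mul] at h1
  rcases mul_eq_zero.1 h1 with h3 | h3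
  · exact (hx (exists_eq_p_mul_of_mapRingHom h3)).elim
  · exact exists_eq_p_mul_of_mapRingHom h3

end RootMonoid

/-! ### Uniqueness of the divided Frobenius of `𝒪^cris` -/

section
variable {p : ℕ} [hp : Fact p.Prime]

theorem mem_ker_iff {X : Scheme.{u}} (hX : PLocNilp p X) {U : (Over X)ᵒᵖ} {s : ocris p U.unop.left} :
    s ∈ RingHom.ker ((ocrisToOSheaf p hX).app U).hom ↔ ocrisToO (hX.of_hom U.unop.hom) s = 0 :=
  ⟨congrArg ULift.down, congrArg ULift.up⟩

/-- An element of the kernel of `𝒪^cris(Y) → 𝒪(Y)`, over the terminal `Y`-scheme. -/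
def toKer {Y : Scheme.{u}} (hY : PLocNilp p Y) (s : ocris p Y) (hs : ocrisToO hY s = 0) :
    RingHom.ker ((ocrisToOSheaf p hY).app (op (Over.mk (𝟙 Y)))).hom :=
  ⟨(s : (ocrisSheaf p Y).obj (op (Over.mk (𝟙 Y)))),
    (mem_ker_iff (U := op (Over.mk (𝟙 Y))) hY).2 hs⟩

section Agree
variable {σ : ∀ X : Scheme.{u}, PLocNilp p X → (ocrisSheaf p X ⟶ ocrisSheaf p X)}
  {τ τ' : SigmaOneFamily p σ}

/-- A functorial family is determined by its components at the terminal objects. -/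
theorem IsFunctorialSigmaOne.restrict (h : IsFunctorialSigmaOne p σ τ) {X Y : Scheme.{u}}
    (hX : PLocNilp p X) (hY : PLocNilp p Y) (U : Over X) (g : Y ⟶ U.left)
    (x : RingHom.ker ((ocrisToOSheaf p hX).app (op U)).hom)
    (y : RingHom.ker ((ocrisToOSheaf p hY).app (op (Over.mk (𝟙 Y)))).hom)
    (hy : y.1 = ocrisMap p g x.1) :
    τ Y hY (op (Over.mk (𝟙 Y))) y = ocrisMap p g (τ X hX (op U) x) := by
  let f : (Over.map (g ≫ U.hom)).obj (Over.mk (𝟙 Y)) ⟶ U :=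
    Over.homMk g (Category.id_comp (g ≫ U.hom)).symm
  exact (h.functorial Y X hY hX (g ≫ U.hom) (Over.mk (𝟙 Y)) y).trans
    (h.natural X hX f.op x ⟨y.1, y.2⟩ hy)

variable (τ τ') in
/-- The ideal of the sections in the kernel of `𝒪^cris(Y) → 𝒪(Y)` on which two families of divided
Frobenius maps agree. -/
noncomputable def agree (Y : Scheme.{u}) (hY : PLocNilp p Y) : Ideal (ocris p Y) :=
  let K : Ideal ((ocrisSheaf p Y).obj (op (Over.mk (𝟙 Y)))) :=
    (LinearMap.eqLocus (τ Y hY (op (Over.mk (𝟙 Y)))) (τ' Y hY (op (Over.mk (𝟙 Y))))).map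
      (RingHom.ker ((ocrisToOSheaf p hY).app (op (Over.mk (𝟙 Y)))).hom).subtype
  K

theorem mem_agree {Y : Scheme.{u}} {hY : PLocNilp p Y}
    (x : RingHom.ker ((ocrisToOSheaf p hY).app (op (Over.mk (𝟙 Y)))).hom) :
    x.1 ∈ agree τ τ' Y hY ↔
      τ Y hY (op (Over.mk (𝟙 Y))) x = τ' Y hY (op (Over.mk (𝟙 Y))) x := by
  refine ⟨fun h => ?_, fun h => Submodule.mem_map.2 ⟨x, h, rfl⟩⟩
  obtain ⟨y, hy, hyx⟩ := Submodule.mem_map.1 h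
  obtain rfl : y = x := Subtype.ext hyx
  exact hy

theorem ocrisMap_mem_agree (h : IsFunctorialSigmaOne p σ τ) (h' : IsFunctorialSigmaOne p σ τ')
    {Y Y' : Scheme.{u}} {hY : PLocNilp p Y} {hY' : PLocNilp p Y'} (g : Y' ⟶ Y) {s : ocris p Y}
    (hs : s ∈ agree τ τ' Y hY) (hs' : ocrisToO hY' (ocrisMap p g s) = 0) :
    ocrisMap p g s ∈ agree τ τ' Y' hY' := by
  have h0 : ∃ x : RingHom.ker ((ocrisToOSheaf p hY).app (op (Over.mk (𝟙 Y)))).hom,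
      τ Y hY (op (Over.mk (𝟙 Y))) x = τ' Y hY (op (Over.mk (𝟙 Y))) x ∧ x.1 = s := hs
  obtain ⟨x, hx, rfl⟩ := h0
  refine (mem_agree (toKer hY' _ hs')).2 ?_
  rw [h.restrict hY hY' (Over.mk (𝟙 Y)) g x (toKer hY' _ hs') rfl,
    h'.restrict hY hY' (Over.mk (𝟙 Y)) g x (toKer hY' _ hs') rfl]
  exact congrArg (ocrisMap p g) hx

/-- Without `p`-torsion, `p σ₁ = σ` determines `σ₁`. -/
theorem mem_agree_of_torsionFree (h : IsFunctorialSigmaOne p σ τ) (h' : IsFunctorialSigmaOne p σ τ')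
    {Y : Scheme.{u}} {hY : PLocNilp p Y} (tf : ∀ s : ocris p Y, (p : ocris p Y) * s = 0 → s = 0)
    {s : ocris p Y} (hs : ocrisToO hY s = 0) : s ∈ agree τ τ' Y hY := by
  refine (mem_agree (toKer hY s hs)).2 (sub_eq_zero.1 (tf _ ?_))
  have h1 := (h.p_mul Y hY _ (toKer hY s hs)).trans (h'.p_mul Y hY _ (toKer hY s hs)).symm
  exact (mul_sub _ _ _).trans (sub_eq_zero.2 h1)

end Agree

namespace PerfectChart
variable {R R' : CommRingCat.{u}} (c : PerfectChart p R)

/-- The homomorphism from the divided power envelope of a chart to the ring of sections. -/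
noncomputable def sec : c.D →+* ocris p (Spec R) :=
  (famEquiv p (Spec R)).symm.toRingHom.comp (c.toFam.comp (algebraMap c.D (PCompl p c.D)))

theorem famEquiv_sec (z : c.D) : famEquiv p (Spec R) (c.sec z) = c.toFam (PCompl.of p c.D z) :=
  (famEquiv p (Spec R)).apply_symm_apply _

theorem ocrisMap_sec (c' : PerfectChart p R') (g : R' ⟶ R) (α : c'.A →ₐ[ℤ_[p]] c.A)
    (h : c'.I ⊔ Ideal.span {(p : c'.A)} ≤ (c.I ⊔ Ideal.span {(p : c.A)}).comap α)
    (hα : ∀ a, c.π (α a) = g.hom (c'.π a)) (z : c'.D) :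
    ocrisMap p (Spec.map g) (c'.sec z) = c.sec (PDEnv.map α h z) := by
  refine (famEquiv p _).injective (Subtype.ext (funext₂ fun d f => ?_))
  obtain ⟨d, -⟩ := d
  rw [famEquiv_ocrisMap, famEquiv_sec, famEquiv_sec]
  refine (c'.toFam_of z d (f ≫ Spec.map g)).trans (Eq.trans ?_ (c.toFam_of _ d f).symm)
  have he : c'.IsEval d (f ≫ Spec.map g) ((c.eval d f).comp (PDEnv.map α h)) :=
    { isDP := (c.isEval_eval d f).isDP.comp _ (PDEnv.isDPMorphism_map α h)
      comm := fun a => by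
        have h1 : Spec.preimage (f ≫ Spec.map g) = g ≫ Spec.preimage f :=
          Spec.map_injective (by rw [Spec.map_preimage, Spec.map_comp, Spec.map_preimage])
        rw [h1, RingHom.comp_apply, PDEnv.map_algebraMap, (c.isEval_eval d f).comm, hα]
        rfl }
  rw [(c'.isEval_eval d _).unique he]
  rfl

theorem ocrisToO_eq_zero_iff (hR : IsNilpotent (p : R)) (s : ocris p (Spec R)) :
    ocrisToO (PDDatum.pLocNilp_Spec hR) s = 0 ↔
      (famEquiv p (Spec R) s).1 ⟨.triv R hR, trivial⟩ (𝟙 _) = 0 := by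
  have h := toFam_triv (PDDatum.pLocNilp_Spec hR) s R hR (𝟙 _)
  refine ⟨fun h0 => h.trans ?_, fun h0 => ?_⟩
  · rw [h0, map_zero, map_zero]; rfl
  · have h1 := h.symm.trans h0
    have h2 : (Scheme.ΓSpecIso R).hom.hom (ocrisToO (PDDatum.pLocNilp_Spec hR) s) = 0 := h1
    have h3 := congrArg (Scheme.ΓSpecIso R).inv.hom h2
    rw [map_zero] at h3
    refine Eq.trans ?_ h3
    exact (congrArg (fun k : Γ(Spec R, ⊤) ⟶ Γ(Spec R, ⊤) => k.hom (ocrisToO (PDDatum.pLocNilp_Spec hR) s))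
      (Scheme.ΓSpecIso R).hom_inv_id).symm

/-- In characteristic `p`, the divided power ideal of the envelope maps to the kernel of
`𝒪^cris → 𝒪`. -/
theorem ocrisToO_sec (h0 : (p : R) = 0) {z : c.D} (hz : z ∈ PDEnv.ideal c.I) :
    ocrisToO (PDDatum.pLocNilp_Spec c.nilp) (c.sec z) = 0 := by
  rw [ocrisToO_eq_zero_iff, famEquiv_sec]
  refine (c.toFam_of z (.triv R c.nilp) (𝟙 _)).trans ?_
  have h1 := (c.isEval_eval (.triv R c.nilp) (𝟙 _)).isDP.1 (Ideal.mem_map_of_mem _ hz)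
  rw [PDDatum.ker_modP] at h1
  have h2 : ∀ x : R, x ∈ RingHom.ker (CommRingCat.Hom.hom (𝟙 R)) ⊔ Ideal.span {(p : R)} → x = 0 := by
    rw [PDDatum.ker_id_hom, h0, Ideal.span_singleton_eq_bot.2 rfl, bot_sup_eq]
    exact fun x hx => hx
  exact h2 _ h1

theorem ocrisToO_sec_algebraMap (a : c.A)
    (h : ocrisToO (PDDatum.pLocNilp_Spec c.nilp) (c.sec (algebraMap c.A c.D a)) = 0) : a ∈ c.I := by
  rw [ocrisToO_eq_zero_iff, famEquiv_sec] at h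
  have h1 := (c.toFam_of _ (.triv R c.nilp) (𝟙 _)).symm.trans h
  have h2 := (c.isEval_eval (.triv R c.nilp) (𝟙 _)).comm a
  rw [h1] at h2
  have h3 : (Spec.preimage (𝟙 (Spec R))).hom (c.π a) = c.π a := by
    rw [show Spec.preimage (𝟙 (Spec R)) = 𝟙 R from
      Spec.map_injective (by rw [Spec.map_preimage, Spec.map_id])]
    rfl
  exact h3.symm.trans (h2.symm.trans (map_zero _))

theorem ocris_torsionFree (tf : NatTorsionFree c.D) (s : ocris p (Spec R))
    (hs : (p : ocris p (Spec R)) * s = 0) : s = 0 := by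
  obtain ⟨y, hy⟩ := c.toFam_surjective (famEquiv p _ s)
  have h1 : y = 0 := by
    refine PCompl.natTorsionFree_p (fun x hx => tf p hp.out.ne_zero x hx) y
      (c.toFam_injective ?_)
    rw [map_mul, map_natCast, hy, map_zero, ← map_natCast (famEquiv p (Spec R)), ← map_mul, hs,
      map_zero]
  refine (famEquiv p _).injective ?_
  rw [← hy, h1, map_zero, map_zero]

end PerfectChart

/-! ### Charts with torsion free envelope -/

section TestChart
variable {M : Type u} [CommMonoid M] (hM : Function.Bijective fun x : M => x ^ p)

/-- The quotient of the monoid algebra of `M` by `p` and an element. -/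
noncomputable abbrev PrincipalQuot (e : MonoidAlgebra ℤ_[p] M) : CommRingCat.{u} :=
  CommRingCat.of (MonoidAlgebra ℤ_[p] M ⧸ Ideal.span {(p : MonoidAlgebra ℤ_[p] M), e})

theorem p_principalQuot (e : MonoidAlgebra ℤ_[p] M) : (p : PrincipalQuot e) = 0 := by
  have : Ideal.Quotient.mk (Ideal.span {(p : MonoidAlgebra ℤ_[p] M), e}) p = 0 :=
    Ideal.Quotient.eq_zero_iff_mem.2 (Ideal.subset_span (Set.mem_insert _ _))
  rwa [map_natCast] at this

theorem isNilpotent_principalQuot (e : MonoidAlgebra ℤ_[p] M) :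
    IsNilpotent (p : PrincipalQuot e) := by
  rw [p_principalQuot]; exact IsNilpotent.zero

theorem lift_principalQuot (e : MonoidAlgebra ℤ_[p] M) (h : IsNilpotent (p : PrincipalQuot e)) :
    MonoidAlgebra.liftNCRingHom (padicMap h)
      (((Ideal.Quotient.mk (Ideal.span {(p : MonoidAlgebra ℤ_[p] M), e})) :
        MonoidAlgebra ℤ_[p] M →* PrincipalQuot e).comp (MonoidAlgebra.of ℤ_[p] M))
      (fun _ _ => Commute.all _ _) = Ideal.Quotient.mk _ := by
  refine MonoidAlgebra.ringHom_ext (fun r => ?_) fun m => ?_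
  · exact congrArg (fun k : ℤ_[p] →+* PrincipalQuot e => k r) (padicInt_ringHom_ext h
      (RingHom.comp (MonoidAlgebra.liftNCRingHom (padicMap h)
        (((Ideal.Quotient.mk (Ideal.span {(p : MonoidAlgebra ℤ_[p] M), e})) :
          MonoidAlgebra ℤ_[p] M →* PrincipalQuot e).comp (MonoidAlgebra.of ℤ_[p] M))
        (fun _ _ => Commute.all _ _)) MonoidAlgebra.singleOneRingHom)
      ((Ideal.Quotient.mk (Ideal.span {(p : MonoidAlgebra ℤ_[p] M), e})).comp
        MonoidAlgebra.singleOneRingHom))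
  · rw [MonoidAlgebra.liftNCRingHom_single, map_one, one_mul]
    rfl

/-- The tautological chart of the quotient of a monoid algebra by `p` and an element. -/
noncomputable def principalChart (e : MonoidAlgebra ℤ_[p] M) :
    PerfectChart p (PrincipalQuot e) where
  M := M
  bij := hM
  nilp := isNilpotent_principalQuot e
  θ := ((Ideal.Quotient.mk (Ideal.span {(p : MonoidAlgebra ℤ_[p] M), e})) :
    MonoidAlgebra ℤ_[p] M →* PrincipalQuot e).comp (MonoidAlgebra.of ℤ_[p] M)
  surj := by
    rw [lift_principalQuot e (isNilpotent_principalQuot e)]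
    exact Ideal.Quotient.mk_surjective

theorem principalChart_π (e : MonoidAlgebra ℤ_[p] M) :
    (principalChart hM e).π = Ideal.Quotient.mk (Ideal.span {(p : MonoidAlgebra ℤ_[p] M), e}) :=
  lift_principalQuot e _

theorem principalChart_I (e : MonoidAlgebra ℤ_[p] M) :
    (principalChart hM e).I = Ideal.span {(p : MonoidAlgebra ℤ_[p] M), e} :=
  (congrArg RingHom.ker (principalChart_π hM e)).trans
    (Ideal.mk_ker : RingHom.ker (Ideal.Quotient.mk
      (Ideal.span {(p : MonoidAlgebra ℤ_[p] M), e})) = _)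

/-- If `e` is not divisible by `p` and the monoid algebra modulo `p` is a domain, then `p, e` is a
regular sequence, and the divided power envelope is torsion free. -/
theorem principalChart_torsionFree [TwoUniqueProds M] {e : MonoidAlgebra ℤ_[p] M}
    (he : ¬ ∃ b, e = p * b) : NatTorsionFree (principalChart hM e).D := by
  refine PDEnv.natTorsionFree_of_regular (p := p) (A := MonoidAlgebra ℤ_[p] M) (y := e)
    (monoidAlgebra_natTorsionFree p M) ?_ fun a ha => exists_eq_p_mul_of_mul he ha
  rw [principalChart_I, Ideal.span_insert, sup_comm, ← sup_assoc, sup_idem, sup_comm]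

end TestChart

end

/-! ### Comparison with the test charts -/

section
variable {p : ℕ} [hp : Fact p.Prime] {R : CommRingCat.{u}}

/-- Every element `i` of the ideal of a chart that is not divisible by `p` is the image of an element
of the ideal of a chart with torsion free envelope. The latter is the quotient of the monoid algebra
of the free monoid with `p`-power roots on the monoid of the given chart by `p` and the tautological
lift of `i`. -/
theorem PerfectChart.exists_torsionFree_chart (c : PerfectChart p R) (h0 : (p : R) = 0) {i : c.A}
    (hi : i ∈ c.I) (hip : ¬ ∃ b, i = p * b) :
    ∃ (R' : CommRingCat.{u}) (c' : PerfectChart p R') (g : R' ⟶ R) (α : c'.A →ₐ[ℤ_[p]] c.A)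
      (e : c'.A), NatTorsionFree c'.D ∧ (p : R') = 0 ∧ (∀ a, c.π (α a) = g.hom (c'.π a)) ∧
        e ∈ c'.I ∧ α e = i := by
  obtain ⟨φ, hφ⟩ := RootMonoid.exists_lift (p := p) (S := c.M) c.bij id
  let α : MonoidAlgebra ℤ_[p] (RootMonoid p c.M) →ₐ[ℤ_[p]] c.A :=
    MonoidAlgebra.mapDomainAlgHom ℤ_[p] ℤ_[p] φ
  let e : MonoidAlgebra ℤ_[p] (RootMonoid p c.M) :=
    ∑ m ∈ i.coeff.support, MonoidAlgebra.single (RootMonoid.X p m) (i.coeff m)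
  have hαe : α e = i := by
    refine Eq.trans ?_ (MonoidAlgebra.sum_coeff_single i)
    rw [map_sum, Finsupp.sum]
    refine Finset.sum_congr rfl fun m _ => ?_
    refine (MonoidAlgebra.mapDomain_single ..).trans ?_
    rw [hφ]; rfl
  have hg : ∀ a ∈ Ideal.span {(p : MonoidAlgebra ℤ_[p] (RootMonoid p c.M)), e},
      (c.π.comp α.toRingHom) a = 0 := by
    change Ideal.span _ ≤ RingHom.ker _
    rw [Ideal.span_le, Set.insert_subset_iff, Set.singleton_subset_iff]
    refine ⟨?_, ?_⟩
    · rw [SetLike.mem_coe, RingHom.mem_ker, map_natCast, h0]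
    · exact (congrArg c.π hαe).trans hi
  refine ⟨_, principalChart (RootMonoid.bijective_pow p) e,
    CommRingCat.ofHom (Ideal.Quotient.lift _ (c.π.comp α.toRingHom) hg), α, e,
    principalChart_torsionFree _ fun ⟨b, hb⟩ => hip ⟨α b, ?_⟩, p_principalQuot e, fun a => ?_, ?_,
    hαe⟩
  · rw [← hαe, hb, map_mul, map_natCast]
  · rw [principalChart_π (RootMonoid.bijective_pow p) e]
    rfl
  · rw [principalChart_I]
    exact Ideal.subset_span (Set.mem_insert_of_mem _ rfl)

variable {σ : ∀ X : Scheme.{u}, PLocNilp p X → (ocrisSheaf p X ⟶ ocrisSheaf p X)}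
  {τ τ' : SigmaOneFamily p σ}

/-- The element `i` comes from a chart with torsion-free envelope, where `σ₁` is unique; so do its
divided powers and `p`. -/
theorem sec_dpI_mem_agree_of_not_dvd (h : IsFunctorialSigmaOne p σ τ)
    (h' : IsFunctorialSigmaOne p σ τ') (c : PerfectChart p R) (h0 : (p : R) = 0) (i : c.I)
    (hip : ¬ ∃ b, i.1 = p * b) :
    (∀ k ≠ 0, c.sec (PDEnv.dpI k i) ∈ agree τ τ' (Spec R) (PDDatum.pLocNilp_Spec c.nilp)) ∧
      (p : ocris p (Spec R)) ∈ agree τ τ' (Spec R) (PDDatum.pLocNilp_Spec c.nilp) := by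
  obtain ⟨R', c', g, α, e, tf, h0', hα, he, hei⟩ := c.exists_torsionFree_chart h0 i.2 hip
  have hI : c'.I ⊔ Ideal.span {(p : c'.A)} ≤ (c.I ⊔ Ideal.span {(p : c.A)}).comap α := by
    refine sup_le (fun x hx => Ideal.mem_sup_left ?_) ?_
    · rw [RingHom.mem_ker]
      exact (hα x).trans ((congrArg g.hom hx).trans (map_zero _))
    · rw [Ideal.span_singleton_le_iff_mem, Ideal.mem_comap, map_natCast]
      exact Ideal.mem_sup_right (Ideal.mem_span_singleton_self _)
  have key : ∀ z ∈ PDEnv.ideal c'.I,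
      c.sec (PDEnv.map α hI z) ∈ agree τ τ' (Spec R) (PDDatum.pLocNilp_Spec c.nilp) := fun z hz => by
    have h1 := mem_agree_of_torsionFree h h' (c'.ocris_torsionFree tf) (c'.ocrisToO_sec h0' hz)
    rw [← c.ocrisMap_sec c' g α hI hα]
    refine ocrisMap_mem_agree h h' _ h1 ?_
    rw [c.ocrisMap_sec c' g α hI hα]
    exact c.ocrisToO_sec h0 ((PDEnv.isDPMorphism_map α hI).1 (Ideal.mem_map_of_mem _ hz))
  refine ⟨fun k hk => ?_, ?_⟩
  · have h1 := key (PDEnv.dpI k ⟨e, he⟩) (PDEnv.dp_mem_ideal hk _)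
    have h2 : PDEnv.map α hI (PDEnv.dpI k ⟨e, he⟩) = PDEnv.dpI k i :=
      (PDEnv.map_dp α hI k _).trans (congrArg _ (Subtype.ext hei))
    rwa [h2] at h1
  · have h1 := key p (PDEnv.p_mem_ideal _)
    rwa [map_natCast, map_natCast] at h1

/-- The divided powers of a multiple of `p` are multiples of `p`, so that they need no chart with
torsion-free envelope. -/
theorem sec_mem_agree (h : IsFunctorialSigmaOne p σ τ) (h' : IsFunctorialSigmaOne p σ τ')
    (c : PerfectChart p R) (h0 : (p : R) = 0)
    (hp' : (p : ocris p (Spec R)) ∈ agree τ τ' (Spec R) (PDDatum.pLocNilp_Spec c.nilp)) {z : c.D}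
    (hz : z ∈ PDEnv.dpSpan p c.I) :
    c.sec z ∈ agree τ τ' (Spec R) (PDDatum.pLocNilp_Spec c.nilp) := by
  revert z
  change PDEnv.dpSpan p c.I ≤ (agree τ τ' (Spec R) (PDDatum.pLocNilp_Spec c.nilp)).comap c.sec
  rw [PDEnv.dpSpan, Ideal.span_le]
  rintro _ ⟨k, i, hk, rfl⟩
  by_cases hip : ∃ b, i.1 = p * b
  · obtain ⟨b, hb⟩ := hip
    rw [SetLike.mem_coe, Ideal.mem_comap, PDEnv.dpI, PDEnv.dp_p_mul k b _ (hb.trans (mul_comm _ _)),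
      p_mul_gammaDiv_mem _ hk, map_mul, map_mul, map_mul, map_mul, map_natCast, map_natCast]
    exact Ideal.mul_mem_left _ _ (Ideal.mul_mem_right _ _ hp')
  · exact (sec_dpI_mem_agree_of_not_dvd h h' c h0 i hip).1 k hk

theorem not_p_dvd_single {M : Type u} [CommMonoid M] (m : M) :
    ¬ ∃ b, (MonoidAlgebra.single m 1 : MonoidAlgebra ℤ_[p] M) = p * b := by
  rintro ⟨b, hb⟩
  rw [← nsmul_eq_mul] at hb
  have h1 := congrArg (fun x : MonoidAlgebra ℤ_[p] M => x.coeff m) hb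
  rw [MonoidAlgebra.coeff_smul_apply, MonoidAlgebra.coeff_single, Finsupp.single_eq_same,
    nsmul_eq_mul] at h1
  exact PadicInt.prime_p.not_isUnit (IsUnit.of_mul_eq_one _ h1.symm)

/-- Two families of divided Frobenius maps agree over rings of characteristic `p` with `p`-th
roots. -/
theorem mem_agree_of_hasRoots (h : IsFunctorialSigmaOne p σ τ) (h' : IsFunctorialSigmaOne p σ τ')
    (hR : HasRoots p R) (h0 : (p : R) = 0) (hn : IsNilpotent (p : R)) {s : ocris p (Spec R)}
    (hs : ocrisToO (PDDatum.pLocNilp_Spec hn) s = 0) : s ∈ agree τ τ' (Spec R) (PDDatum.pLocNilp_Spec hn) := by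
  let c := PerfectChart.ofHasRoots hR hn
  -- The monomial of the zero element is in the ideal of the chart, and it is not divisible by `p`.
  let m : Perfection R p := ⟨fun _ => 0, fun _ => zero_pow hp.out.ne_zero⟩
  have hm : (MonoidAlgebra.single m 1 : c.A) ∈ c.I := c.π_single m
  have hp' : (p : ocris p (Spec R)) ∈ agree τ τ' (Spec R) (PDDatum.pLocNilp_Spec hn) :=
    (sec_dpI_mem_agree_of_not_dvd h h' c h0 ⟨_, hm⟩ (not_p_dvd_single m)).2
  -- Modulo `p`, the section `s` comes from an element `d` of the envelope.
  obtain ⟨y, hy⟩ := c.toFam_surjective (famEquiv p _ s)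
  obtain ⟨d, hd⟩ := PCompl.exists_mod 1 y
  obtain ⟨y', rfl⟩ := hd.exists_eq
  have hsd : s = c.sec d + p * (famEquiv p _).symm (c.toFam y') := by
    refine (famEquiv p _).injective ?_
    rw [← hy, map_add, map_add, map_mul, map_mul, c.famEquiv_sec, RingEquiv.apply_symm_apply,
      pow_one, map_natCast, map_natCast]
  have hpO : ocrisToO (PDDatum.pLocNilp_Spec hn) (p : ocris p (Spec R)) = 0 := by
    have := c.ocrisToO_sec h0 (PDEnv.p_mem_ideal c.I)
    rwa [map_natCast] at this
  have hd0 : ocrisToO (PDDatum.pLocNilp_Spec hn) (c.sec d) = 0 := by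
    rw [hsd, map_add, map_mul, hpO, zero_mul, add_zero] at hs
    exact hs
  obtain ⟨a, ha⟩ := PDEnv.exists_sub_mem_dpSpan d
  have hdp : ∀ z ∈ PDEnv.dpSpan p c.I, z ∈ PDEnv.ideal c.I := by
    change PDEnv.dpSpan p c.I ≤ PDEnv.ideal c.I
    rw [PDEnv.dpSpan, Ideal.span_le]
    rintro _ ⟨k, i, hk, rfl⟩
    exact PDEnv.dp_mem_ideal hk _
  have haI : a ∈ c.I := by
    refine c.ocrisToO_sec_algebraMap a ?_
    have h1 := c.ocrisToO_sec h0 (hdp _ ha)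
    rw [map_sub, map_sub, hd0, zero_sub, neg_eq_zero] at h1
    exact h1
  have ha' : algebraMap c.A c.D a ∈ PDEnv.dpSpan p c.I :=
    Ideal.subset_span ⟨1, ⟨a, haI⟩, one_ne_zero, (PDEnv.dp_one p
      (⟨a, Ideal.mem_sup_left haI⟩ : ↥(c.I ⊔ Ideal.span {(p : c.A)}))).symm⟩
  have hdS : d ∈ PDEnv.dpSpan p c.I := by simpa using add_mem ha ha'
  rw [hsd]
  exact add_mem (sec_mem_agree h h' c h0 hp' hdS) (Ideal.mul_mem_right _ _ hp')

/-- Sections of `𝒪^cris` are determined by their pullbacks to the spectra of rings of characteristic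
`p` with `p`-th roots. -/
theorem ocris_ext_of_hasRoots {U : Scheme.{u}} {z z' : ocris p U}
    (h : ∀ (R : CommRingCat.{u}) (_ : HasRoots p R) (_ : (p : R) = 0) (g : Spec R ⟶ U),
      ocrisMap p g z = ocrisMap p g z') : z = z' := by
  refine (famEquiv p U).injective (Subtype.ext (funext₂ fun d f => ?_))
  obtain ⟨d, -⟩ := d
  -- Passing from `C` to `C/p` does not change the value; over `Spec C/p` rings with `p`-th roots
  -- form a covering.
  let f' : Spec d.modP.C ⟶ U := Spec.map d.toModP.ψ ≫ f
  have hn : IsNilpotent (p : d.modP.C) := d.modP.nilp_C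
  have hX := PDDatum.pLocNilp_Spec hn
  have h1 : ocrisMap p f' z = ocrisMap p f' z' := by
    let X := Spec d.modP.C
    let V : Over X := Over.mk (𝟙 X)
    have hsep := ((isSheaf_iff_isSheaf_of_type _ _).1
      (Presheaf.isSheaf_comp_of_isSheaf (prTopology p X) (ocrisSheaf p X) (forget CommRingCat)
        (isPAdicSheaf_ocris hX).isSheaf)).isSeparated
    let S : Sieve V :=
      { arrows := fun W k => ocrisMap p k.left (ocrisMap p f' z) =
          ocrisMap p k.left (ocrisMap p f' z')
        downward_closed := fun {W W' k} hk l => congrArg (ocrisMap p l.left) hk }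
    have hS : S ∈ prTopology p X V := mem_prTopology_of_roots hX V S fun R hR _ g =>
      h R hR (by
        have := congrArg (Spec.preimage g).hom d.p_modP
        rwa [map_natCast, map_zero] at this) (g ≫ f')
    exact (hsep S hS).ext fun W k hk => hk
  have h2 := congrArg (fun t : ocris p (Spec d.modP.C) =>
    (famEquiv p _ t).1 ⟨d.modP, trivial⟩ (𝟙 _)) h1
  have h3 : ∀ t : fam (p := p) allData U, t.1 ⟨d.modP, trivial⟩ (𝟙 _ ≫ f') = t.1 ⟨d, trivial⟩ f :=
    fun t => (fam_congr t ⟨d.modP, trivial⟩ (Category.id_comp _)).trans (d.fam_modP t f)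
  exact (h3 (famEquiv p U z)).symm.trans (h2.trans (h3 (famEquiv p U z')))

/-- There is at most one functorial family of divided Frobenius maps. -/
theorem IsFunctorialSigmaOne.unique (h : IsFunctorialSigmaOne p σ τ)
    (h' : IsFunctorialSigmaOne p σ τ') : τ = τ' := by
  funext X hX U
  refine LinearMap.ext fun x => ?_
  refine ocris_ext_of_hasRoots (U := U.unop.left) fun R hR h0 g => ?_
  have hn : IsNilpotent (p : R) := h0 ▸ IsNilpotent.zero
  have h1 : ocrisToO (PDDatum.pLocNilp_Spec hn) (ocrisMap p g x.1) = 0 := by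
    let k : Over.mk (g ≫ U.unop.hom) ⟶ U.unop := Over.homMk g
    have h2 := congrArg (fun l : (ocrisSheaf p X).obj U ⟶ (oSheaf X).obj (op (Over.mk
      (g ≫ U.unop.hom))) => l.hom x.1) ((ocrisToOSheaf p hX).naturality k.op)
    exact congrArg ULift.down (h2.trans ((congrArg ((oSheaf X).map k.op).hom x.2).trans
      (map_zero _)))
  have h2 := (mem_agree (toKer (PDDatum.pLocNilp_Spec hn) _ h1)).1 (mem_agree_of_hasRoots h h' hR h0 hn h1)
  exact (h.restrict hX (PDDatum.pLocNilp_Spec hn) U.unop g x (toKer _ _ h1) rfl).symm.trans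
    (h2.trans (h'.restrict hX (PDDatum.pLocNilp_Spec hn) U.unop g x (toKer _ _ h1) rfl))

end

end DivDieud

theorem mainTheorem10 (p : ℕ) [Fact p.Prime] :
    (∃ σ : ∀ X : Scheme.{u}, PLocNilp p X →
        (ocrisSheaf p X ⟶ ocrisSheaf p X),
      (∀ X hX τ, IsCrisFrobenius p X τ ↔ τ = σ X hX) ∧
      ∃ σ₁ : SigmaOneFamily p σ,
        IsFunctorialSigmaOne p σ σ₁ ∧
        (∀ τ₁ : SigmaOneFamily p σ, IsFunctorialSigmaOne p σ τ₁ → τ₁ = σ₁) ∧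
        (∀ (X : Scheme.{u}) (hX : PLocNilp p X),
          IsSheafFrame (prTopology p X) p (ocrisToOSheaf p hX)
            (σ X hX) (σ₁ X hX)) ∧
        (∀ (X : Scheme.{u}) (hX : PLocNilp p X),
          (p : Γ(X, ⊤)) = 0 → ∀ U : (Over X)ᵒᵖ,
            ∃ h : (p : (ocrisSheaf p X).obj U) ∈
                RingHom.ker ((ocrisToOSheaf p hX).app U).hom,
              σ₁ X hX U ⟨p, h⟩ = 1)) ∧
    (∃ σ₁ : SigmaOneFamilyD.{v} p,
      IsFunctorialSigmaOneD σ₁ ∧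
      (∀ τ₁ : SigmaOneFamilyD.{v} p, IsFunctorialSigmaOneD τ₁ → τ₁ = σ₁) ∧
      (∀ P : FrobPresentation.{v} p, IsFrame p P.toR P.σD (σ₁ P)) ∧
      (∀ (P P' : FrobPresentation.{v} p) (f : FrobPresentation.Hom p P P'),
        IsFrameHom (σ₁ P) (σ₁ P') f.mapD f.mapR)) := by
  refine ⟨⟨fun X _ => crisSigmaSheaf p X, fun X hX τ => ⟨fun h => h.unique (isCrisFrobenius_crisSigma X),
    fun h => h ▸ isCrisFrobenius_crisSigma X⟩, crisSigmaOne p, isFunctorialSigmaOne_crisSigmaOne,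
    fun τ h => h.unique isFunctorialSigmaOne_crisSigmaOne, fun X hX => isSheafFrame_cris hX,
    fun X hX h0 U => crisSigmaOne_p hX h0 U⟩, ?_⟩
  exact ⟨fun P => P.sigma1, FrobPresentation.isFunctorialSigmaOneD_sigma1,
    fun τ h => FrobPresentation.eq_of_isFunctorialSigmaOneD h FrobPresentation.isFunctorialSigmaOneD_sigma1,
    fun P => P.isFrame, fun P P' f => FrobPresentation.isFrameHom f⟩
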